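/- Let $k$ be a field and $G$ a finite group with $\operatorname{char} k\nmid |G|$; let $\mathcal K(G)$ be the set of conjugacy classes of $G$ and $Z_g$ the centralizer of $g$. **Ramification systems.** An $\mathrm{RSR}$ $S=(G,r,\overrightarrow\rho,u)$ consists of a map $u:\mathcal K(G)\to G$ with $u(C)\in C$, of (possibly empty or infinite) index sets $I_C$ for $C\in\mathcal K(G)$, and of irreducible right representations $\rho_C^{(i)}$ of $Z_{u(C)}$ over $k$ for $i\in I_C$, with basis $x_C^{(i,j)}$, $1\le j\le d_C^{(i)}:=\deg\rho_C^{(i)}$; the ramification is $r_C=\sum_{i\in I_C} d_C^{(i)}$. An isomorphism $S\cong S'$ of $\mathrm{RSR}$'s over $G$ and $G'$ is a group isomorphism $\phi:G\to G'$ together with, for every $C\in\mathcal K(G)$, an element $h_C\in G$ with $\phi(h_C^{-1}u(C)h_C)=u'(\phi(C))$ and a bijection $\phi_C:I_C\to I'_{\phi(C)}$ such that $\rho_C^{(i)}$ is isomorphic to the pull-back of $\rho'^{(\phi_C(i))}_{\phi(C)}$ along $Z_{u(C)}\to Z_{u'(\phi(C))}$, $x\mapsto\phi(h_C^{-1}xh_C)$,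 for all $i\in I_C$. **Objects built from $S$.** Let $Q$ be the quiver with vertex set $G$ and arrows $a_{y,x}^{(i,j)}$ from $x$ to $y$, where $x^{-1}y\in C$, $i\in I_C$, $1\le j\le d_C^{(i)}$. For each $C$ choose representatives $g_\theta$ of the right cosets of $Z_{u(C)}$ in $G$, with $1$ representing $Z_{u(C)}$, and write $g_\theta h=\zeta_\theta(h)g_{\theta'}$ with $\zeta_\theta(h)\in Z_{u(C)}$. * $(kQ_1^c,S)$ is the $kG$-Hopf bimodule with basis the arrows, coactions $\delta^-(a_{y,x}^{(i,j)})=y\otimes a_{y,x}^{(i,j)}$, $\delta^+(a_{y,x}^{(i,j)})=a_{y,x}^{(i,j)}\otimes x$, and actions $h\cdot a_{y,x}^{(i,j)}=a_{hy,hx}^{(i,j)}$ and $a_{y,x}^{(i,j)}\cdot h=\sum_s k^{(i,j,s)}a_{yh,xh}^{(i,s)}$, where $x^{-1}y=g_\theta^{-1}u(C)g_\theta$ and $x_C^{(i,j)}\cdot\zeta_\theta(h)=\sum_s k^{(i,j,s)}x_C^{(i,s)}$. * $(kQ_1^1,\mathrm{ad}\,S)$ is the Yetter–Drinfeld $kG$-module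 spanned by the arrows with source $1$, with action $g\rhd x=g\cdot x\cdot g^{-1}$ and coaction $\delta^-$. * $\mathcal B(V)$, for a Yetter–Drinfeld $kG$-module $V$, is the Nichols algebra of $V$: a graded braided Hopf algebra $R=\bigoplus_{n\ge0}R(n)$ in ${}^{kG}_{kG}\mathcal{YD}$ with $R(0)=k1$, $R(1)\cong V$ as Yetter–Drinfeld modules, $R(1)$ the space of all primitive elements, and $R$ generated by $R(1)$ as an algebra. * For a Hopf algebra $H$ and an $H$-Hopf bimodule $M$, $T_H(M)$ and $T_H^c(M)$ are the tensor and the cotensor Hopf algebra, graded by $\otimes_H^nM$ and $\Box_H^nM$, and $H[M]$ (a Hopf algebra of type one) is the subalgebra of $T^c_H(M)$ generated by $H$ and $M$. Put $kQ^c(S)=T^c_{kG}(kQ_1^c,S)$, $kQ^s(S)=T_{kG}(kQ_1^c,S)$, $kG[kQ_1^c,S]$ and, when $Q$ is finite (that is, all $I_C$ are finite), with $(kQ_1^a,S)$ the $(kG)^*$-Hopf bimodule dual to $(kQ_1^c,S)$: $kQ^a(S)=T_{(kG)^*}(kQ_1^a,S)$, $kQ^{sc}(S)=T^c_{(kG)^*}(kQ_1^a,S)$,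 $(kG)^*[kQ_1^a,S]$. A *Hopf quiver* on $G$ is a quiver with vertex set $G$ in which the number of arrows from $x$ to $y$ depends only on the conjugacy class of $x^{-1}y$. The *quiver Hopf algebras over $G$* are the graded Hopf algebras $T^c_{kG}(M)$, $T_{kG}(M)$, $kG[M]$, where $M$ is the span of the arrows of a Hopf quiver with any $kG$-Hopf bimodule structure whose coactions are $a\mapsto t(a)\otimes a$ and $a\mapsto a\otimes s(a)$ ($s$, $t$ the source and target), and $T_{(kG)^*}(M)$, $T^c_{(kG)^*}(M)$, $(kG)^*[M]$, where $M$ is the span of the arrows of a finite Hopf quiver with any $(kG)^*$-Hopf bimodule structure whose actions are $p\cdot a=p(t(a))a$ and $a\cdot p=p(s(a))a$. **Theorem. Existence.** In each of the following there is an $\mathrm{RSR}$ $S$ over $G$ such that the stated isomorphism holds for every choice of coset representatives. 1. Every Yetter–Drinfeld $kG$-module is isomorphic, as a Yetter–Drinfeld $kG$-module, to some $(kQ_1^1,\mathrm{ad}\,S)$. 2. Every $kG$-Hopf bimodule is isomorphic, as a $kG$-Hopf bimodule, to some $(kQ_1^c,S)$. 3. Every $(kQ_1^1,\mathrm{ad}\,S)$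 has a Nichols algebra, and every Nichols algebra in ${}^{kG}_{kG}\mathcal{YD}$ is isomorphic, as a graded braided Hopf algebra in ${}^{kG}_{kG}\mathcal{YD}$, to some $\mathcal B(kQ_1^1,\mathrm{ad}\,S)$. 4. Every pointed Hopf algebra of type one with coradical $kG$, that is every $kG[M]$ with $M$ a $kG$-Hopf bimodule, is isomorphic, as a graded Hopf algebra, to some $kG[kQ_1^c,S]$. 5. Every quiver Hopf algebra over $G$ of one of the six kinds is isomorphic, as a graded Hopf algebra, to the one of the same kind among $kQ^c(S)$, $kQ^s(S)$, $kG[kQ_1^c,S]$, $kQ^a(S)$, $kQ^{sc}(S)$, $(kG)^*[kQ_1^a,S]$ for some $S$ (with finite quiver in the last three kinds). **Uniqueness.** Let $G'$ be another finite group with $\operatorname{char}k\nmid|G'|$, and let $S$, $S'$ be $\mathrm{RSR}$'s over $G$, $G'$. Then $S\cong S'$ is equivalent to each of the following: for some Hopf algebra isomorphism $\phi:kG\to kG'$ there is a bijective linear map $\psi$ that is a pull-push isomorphism along $\phi$ (it intertwines the actions when $kG$ acts on the target through $\phi$, and the coactions when those of the source are pushed forward along $\phi$) from $(kQ_1^1,\mathrm{ad}\,S)$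 to $(kQ_1'^1,\mathrm{ad}\,S')$; the same from $(kQ_1^c,S)$ to $(kQ_1'^c,S')$; the same from $\mathcal B(kQ_1^1,\mathrm{ad}\,S)$ to $\mathcal B(kQ_1'^1,\mathrm{ad}\,S')$, with $\psi$ moreover an isomorphism of graded algebras and coalgebras; $kQ^c(S)\cong kQ'^c(S')$; $kQ^s(S)\cong kQ'^s(S')$; $kG[kQ_1^c,S]\cong kG'[kQ_1'^c,S']$; and, when both quivers are finite, $kQ^a(S)\cong kQ'^a(S')$; $kQ^{sc}(S)\cong kQ'^{sc}(S')$; $(kG)^*[kQ_1^a,S]\cong (kG')^*[kQ_1'^a,S']$; the last six isomorphisms being isomorphisms of graded Hopf algebras. -/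

import Mathlib

open scoped TensorProduct
noncomputable section
namespace RSRQuiver

section Shortcuts
variable {k A B : Type*} [CommSemiring k] [AddCommMonoid A] [AddCommMonoid B] [Module k A]
  [Module k B]

instance : ZeroHomClass (A →ₗ[k] B) A B := inferInstance
instance : AddHomClass (A →ₗ[k] B) A B := inferInstance
instance : ZeroHomClass (A ≃ₗ[k] B) A B := inferInstance
instance : AddHomClass (A ≃ₗ[k] B) A B := inferInstance

end Shortcuts

section Naturality
variable {k A A' B B' C C' : Type*} [CommRing k] [AddCommGroup A] [Module k A]
  [AddCommGroup A'] [Module k A'] [AddCommGroup B] [Module k B] [AddCommGroup B'] [Module k B']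
  [AddCommGroup C] [Module k C] [AddCommGroup C'] [Module k C']

theorem nat1 (f : A →ₗ[k] A') (t : A ⊗[k] B ⊗[k] C) :
    TensorProduct.assoc k A' B C ((f.rTensor B).rTensor C t) =
      f.rTensor (B ⊗[k] C) (TensorProduct.assoc k A B C t) :=
  LinearMap.congr_fun (f := (TensorProduct.assoc k A' B C).toLinearMap ∘ₗ (f.rTensor B).rTensor C)
    (g := f.rTensor (B ⊗[k] C) ∘ₗ (TensorProduct.assoc k A B C).toLinearMap)
    (TensorProduct.ext_threefold fun _ _ _ => by simp) t

theorem nat2 (f : B →ₗ[k] B') (t : A ⊗[k] B ⊗[k] C) :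
    TensorProduct.assoc k A B' C ((f.lTensor A).rTensor C t) =
      (f.rTensor C).lTensor A (TensorProduct.assoc k A B C t) :=
  LinearMap.congr_fun (f := (TensorProduct.assoc k A B' C).toLinearMap ∘ₗ (f.lTensor A).rTensor C)
    (g := (f.rTensor C).lTensor A ∘ₗ (TensorProduct.assoc k A B C).toLinearMap)
    (TensorProduct.ext_threefold fun _ _ _ => by simp) t

theorem nat3 (f : C →ₗ[k] C') (t : A ⊗[k] B ⊗[k] C) :
    TensorProduct.assoc k A B C' (f.lTensor (A ⊗[k] B) t) =
      (f.lTensor B).lTensor A (TensorProduct.assoc k A B C t) :=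
  LinearMap.congr_fun (f := (TensorProduct.assoc k A B C').toLinearMap ∘ₗ f.lTensor (A ⊗[k] B))
    (g := (f.lTensor B).lTensor A ∘ₗ (TensorProduct.assoc k A B C).toLinearMap)
    (TensorProduct.ext_threefold fun _ _ _ => by simp) t

theorem nat1' (f : A →ₗ[k] A') (t : A ⊗[k] (B ⊗[k] C)) :
    (TensorProduct.assoc k A' B C).symm (f.rTensor (B ⊗[k] C) t) =
      (f.rTensor B).rTensor C ((TensorProduct.assoc k A B C).symm t) := by
  rw [LinearEquiv.symm_apply_eq, nat1, LinearEquiv.apply_symm_apply]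

theorem nat2' (f : B →ₗ[k] B') (t : A ⊗[k] (B ⊗[k] C)) :
    (TensorProduct.assoc k A B' C).symm ((f.rTensor C).lTensor A t) =
      (f.lTensor A).rTensor C ((TensorProduct.assoc k A B C).symm t) := by
  rw [LinearEquiv.symm_apply_eq, nat2, LinearEquiv.apply_symm_apply]

theorem nat3' (f : C →ₗ[k] C') (t : A ⊗[k] (B ⊗[k] C)) :
    (TensorProduct.assoc k A B C').symm ((f.lTensor B).lTensor A t) =
      f.lTensor (A ⊗[k] B) ((TensorProduct.assoc k A B C).symm t) := by
  rw [LinearEquiv.symm_apply_eq, nat3, LinearEquiv.apply_symm_apply]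

theorem lr_comm (f : A →ₗ[k] A') (g : B →ₗ[k] B') (t : A ⊗[k] B) :
    f.rTensor B' (g.lTensor A t) = g.lTensor A' (f.rTensor B t) := by
  rw [← LinearMap.comp_apply, ← LinearMap.comp_apply, LinearMap.rTensor_comp_lTensor,
    LinearMap.lTensor_comp_rTensor]

theorem penta (t : A ⊗[k] (B ⊗[k] C) ⊗[k] C') :
    (TensorProduct.assoc k A B (C ⊗[k] C')) (TensorProduct.assoc k (A ⊗[k] B) C C'
      ((TensorProduct.assoc k A B C).symm.toLinearMap.rTensor C' t)) =
    (TensorProduct.assoc k B C C').toLinearMap.lTensor A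
      (TensorProduct.assoc k A (B ⊗[k] C) C' t) := by
  induction t using TensorProduct.induction_on with
  | zero => simp
  | tmul s d =>
    induction s using TensorProduct.induction_on with
    | zero => simp
    | tmul a s =>
      induction s using TensorProduct.induction_on with
      | zero => simp
      | tmul => simp
      | add x y hx hy => simp only [map_add, TensorProduct.add_tmul, TensorProduct.tmul_add, hx, hy]
    | add x y hx hy => simp only [map_add, TensorProduct.add_tmul, hx, hy]
  | add x y hx hy => simp only [map_add, hx, hy]

end Naturality

section Range
variable {k V W X Y : Type*} [CommRing k] [AddCommGroup V] [Module k V]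
  [AddCommGroup W] [Module k W] [AddCommGroup X] [Module k X] [AddCommGroup Y] [Module k Y]

/-- The image of `S ⊗ T` in `V ⊗ W`. -/
def tens (S : Submodule k V) (T : Submodule k W) : Submodule k (V ⊗[k] W) :=
  LinearMap.range (TensorProduct.map S.subtype T.subtype)

theorem tmul_mem_tens {S : Submodule k V} {T : Submodule k W} {v : V} {w : W} (hv : v ∈ S)
    (hw : w ∈ T) : v ⊗ₜ[k] w ∈ tens S T :=
  ⟨(⟨v, hv⟩ : S) ⊗ₜ (⟨w, hw⟩ : T), by simp⟩

theorem tens_induction {S : Submodule k V} {T : Submodule k W} {P : V ⊗[k] W → Prop}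
    (h0 : P 0) (hadd : ∀ x y, P x → P y → P (x + y))
    (ht : ∀ v ∈ S, ∀ w ∈ T, P (v ⊗ₜ w)) {t : V ⊗[k] W} (h : t ∈ tens S T) : P t := by
  obtain ⟨s, rfl⟩ := h
  induction s using TensorProduct.induction_on with
  | zero => simpa using h0
  | tmul v w => simpa using ht v v.2 w w.2
  | add x y hx hy => rw [map_add]; exact hadd _ _ hx hy

theorem tens_mono {S S' : Submodule k V} {T T' : Submodule k W} (hS : S ≤ S') (hT : T ≤ T') :
    tens S T ≤ tens S' T' := fun _ ht =>
  tens_induction (P := fun t => t ∈ tens S' T') (zero_mem _) (fun _ _ => add_mem)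
    (fun _ hv _ hw => tmul_mem_tens (hS hv) (hT hw)) ht

theorem map_mem_tens {S : Submodule k V} {T : Submodule k W} {S' : Submodule k X}
    {T' : Submodule k Y} (f : V →ₗ[k] X) (g : W →ₗ[k] Y) (hf : ∀ v ∈ S, f v ∈ S')
    (hg : ∀ w ∈ T, g w ∈ T') {t : V ⊗[k] W} (h : t ∈ tens S T) :
    TensorProduct.map f g t ∈ tens S' T' :=
  tens_induction (P := fun t => TensorProduct.map f g t ∈ tens S' T') (by simp)
    (fun x y hx hy => by rw [map_add]; exact add_mem hx hy)
    (fun v hv w hw => by simpa using tmul_mem_tens (hf v hv) (hg w hw)) h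

theorem mem_tens_top (t : V ⊗[k] W) : t ∈ tens (⊤ : Submodule k V) (⊤ : Submodule k W) := by
  induction t using TensorProduct.induction_on with
  | zero => exact zero_mem _
  | tmul v w => exact tmul_mem_tens trivial trivial
  | add x y hx hy => exact add_mem hx hy

end Range



/-- `H`-Hopf bimodules: `H`-bimodules that are `H`-bicomodules such that both coactions are
`H`-bimodule maps. Here `actL h m = h · m`, `actR h m = m · h`, and the last four fields say
`δ⁻(h · m) = Δ(h) δ⁻(m)`, `δ⁻(m · h) = δ⁻(m) Δ(h)` and the same for `δ⁺`. -/
structure HopfBimodule (k H M : Type*) [Field k] [Ring H] [Bialgebra k H]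
    [AddCommGroup M] [Module k M] where
  actL : H →ₗ[k] M →ₗ[k] M
  actR : H →ₗ[k] M →ₗ[k] M
  coactL : M →ₗ[k] H ⊗[k] M
  coactR : M →ₗ[k] M ⊗[k] H
  actL_one : ∀ m, actL 1 m = m
  actL_mul : ∀ a b m, actL (a * b) m = actL a (actL b m)
  actR_one : ∀ m, actR 1 m = m
  actR_mul : ∀ a b m, actR (a * b) m = actR b (actR a m)
  act_comm : ∀ a b m, actL a (actR b m) = actR b (actL a m)
  coactL_counit : ∀ m,
    TensorProduct.lid k M ((Coalgebra.counit (R := k) (A := H)).rTensor M (coactL m)) = m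
  coactL_coassoc : ∀ m,
    TensorProduct.assoc k H H M ((Coalgebra.comul (R := k) (A := H)).rTensor M (coactL m)) =
      coactL.lTensor H (coactL m)
  coactR_counit : ∀ m,
    TensorProduct.rid k M ((Coalgebra.counit (R := k) (A := H)).lTensor M (coactR m)) = m
  coactR_coassoc : ∀ m,
    TensorProduct.assoc k M H H (coactR.rTensor H (coactR m)) =
      (Coalgebra.comul (R := k) (A := H)).lTensor M (coactR m)
  coact_comm : ∀ m,
    TensorProduct.assoc k H M H (coactL.rTensor H (coactR m)) = coactR.lTensor H (coactL m)
  coactL_actL : ∀ h m, coactL (actL h m) =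
    TensorProduct.map₂ (LinearMap.mul k H) actL (Coalgebra.comul (R := k) h) (coactL m)
  coactL_actR : ∀ h m, coactL (actR h m) =
    TensorProduct.map₂ (LinearMap.mul k H).flip actR (Coalgebra.comul (R := k) h) (coactL m)
  coactR_actL : ∀ h m, coactR (actL h m) =
    TensorProduct.map₂ actL (LinearMap.mul k H) (Coalgebra.comul (R := k) h) (coactR m)
  coactR_actR : ∀ h m, coactR (actR h m) =
    TensorProduct.map₂ actR (LinearMap.mul k H).flip (Coalgebra.comul (R := k) h) (coactR m)

section Bilinear
variable {k : Type*} [CommRing k]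
  {A₁ A₂ A₃ B₁ B₂ B₃ C₁ C₂ C₃ D₁ D₂ D₃ : Type*}
  [AddCommGroup A₁] [Module k A₁] [AddCommGroup A₂] [Module k A₂] [AddCommGroup A₃] [Module k A₃]
  [AddCommGroup B₁] [Module k B₁] [AddCommGroup B₂] [Module k B₂] [AddCommGroup B₃] [Module k B₃]
  [AddCommGroup C₁] [Module k C₁] [AddCommGroup C₂] [Module k C₂] [AddCommGroup C₃] [Module k C₃]
  [AddCommGroup D₁] [Module k D₁] [AddCommGroup D₂] [Module k D₂] [AddCommGroup D₃] [Module k D₃]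

theorem tens_induction₂ {S₁ : Submodule k A₁} {S₂ : Submodule k A₂} {T₁ : Submodule k B₁}
    {T₂ : Submodule k B₂} {P : A₁ ⊗[k] A₂ → B₁ ⊗[k] B₂ → Prop}
    (z₁ : ∀ t, P 0 t) (z₂ : ∀ s, P s 0) (a₁ : ∀ s s' t, P s t → P s' t → P (s + s') t)
    (a₂ : ∀ s t t', P s t → P s t' → P s (t + t'))
    (h : ∀ a ∈ S₁, ∀ a' ∈ S₂, ∀ b ∈ T₁, ∀ b' ∈ T₂, P (a ⊗ₜ a') (b ⊗ₜ b'))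
    {s : A₁ ⊗[k] A₂} {t : B₁ ⊗[k] B₂} (hs : s ∈ tens S₁ S₂) (ht : t ∈ tens T₁ T₂) : P s t :=
  tens_induction (P := fun s => P s t) (z₁ t) (fun x y => a₁ x y t)
    (fun a ha a' ha' => tens_induction (P := fun t => P (a ⊗ₜ a') t) (z₂ _) (a₂ _)
      (h a ha a' ha') ht) hs

theorem tensor_induction₂ {P : A₁ ⊗[k] A₂ → B₁ ⊗[k] B₂ → Prop}
    (z₁ : ∀ t, P 0 t) (z₂ : ∀ s, P s 0) (a₁ : ∀ s s' t, P s t → P s' t → P (s + s') t)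
    (a₂ : ∀ s t t', P s t → P s t' → P s (t + t'))
    (h : ∀ a a' b b', P (a ⊗ₜ a') (b ⊗ₜ b')) (s : A₁ ⊗[k] A₂) (t : B₁ ⊗[k] B₂) : P s t :=
  tens_induction₂ z₁ z₂ a₁ a₂ (fun a _ a' _ b _ b' _ => h a a' b b') (mem_tens_top s)
    (mem_tens_top t)

theorem map₂_assoc (f : A₁ →ₗ[k] B₁ →ₗ[k] C₁) (g : A₂ →ₗ[k] B₂ →ₗ[k] C₂)
    (h : A₃ →ₗ[k] B₃ →ₗ[k] C₃) (s : A₁ ⊗[k] A₂ ⊗[k] A₃) (t : B₁ ⊗[k] B₂ ⊗[k] B₃) :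
    TensorProduct.assoc k C₁ C₂ C₃ (TensorProduct.map₂ (TensorProduct.map₂ f g) h s t) =
      TensorProduct.map₂ f (TensorProduct.map₂ g h) (TensorProduct.assoc k A₁ A₂ A₃ s)
        (TensorProduct.assoc k B₁ B₂ B₃ t) := by
  refine tensor_induction₂ (P := fun s t => TensorProduct.assoc k C₁ C₂ C₃
    (TensorProduct.map₂ (TensorProduct.map₂ f g) h s t) =
      TensorProduct.map₂ f (TensorProduct.map₂ g h) (TensorProduct.assoc k A₁ A₂ A₃ s)
        (TensorProduct.assoc k B₁ B₂ B₃ t)) (by simp) (by simp)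
    (fun s s' t h h' => by simp only [map_add, LinearMap.add_apply, h, h'])
    (fun s t t' h h' => by simp only [map_add, h, h']) (fun u a v b => ?_) s t
  refine tensor_induction₂ (P := fun u v => TensorProduct.assoc k C₁ C₂ C₃
    (TensorProduct.map₂ (TensorProduct.map₂ f g) h (u ⊗ₜ a) (v ⊗ₜ b)) =
      TensorProduct.map₂ f (TensorProduct.map₂ g h) (TensorProduct.assoc k A₁ A₂ A₃ (u ⊗ₜ a))
        (TensorProduct.assoc k B₁ B₂ B₃ (v ⊗ₜ b))) (by simp) (by simp)
    (fun s s' t h h' => by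
      simp only [map_add, LinearMap.add_apply, TensorProduct.add_tmul, h, h'])
    (fun s t t' h h' => by simp only [map_add, TensorProduct.add_tmul, h, h'])
    (fun _ _ _ _ => by simp) u v

theorem map₂_assoc_symm (f : A₁ →ₗ[k] B₁ →ₗ[k] C₁) (g : A₂ →ₗ[k] B₂ →ₗ[k] C₂)
    (h : A₃ →ₗ[k] B₃ →ₗ[k] C₃) (s : A₁ ⊗[k] (A₂ ⊗[k] A₃)) (t : B₁ ⊗[k] (B₂ ⊗[k] B₃)) :
    (TensorProduct.assoc k C₁ C₂ C₃).symm (TensorProduct.map₂ f (TensorProduct.map₂ g h) s t) =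
    TensorProduct.map₂ (TensorProduct.map₂ f g) h ((TensorProduct.assoc k A₁ A₂ A₃).symm s)
        ((TensorProduct.assoc k B₁ B₂ B₃).symm t) := by
  rw [LinearEquiv.symm_apply_eq, map₂_assoc, LinearEquiv.apply_symm_apply,
    LinearEquiv.apply_symm_apply]

/-- Compatibility of linear maps with bilinear maps passes to tensor products. -/
theorem map_map₂ {f : A₁ →ₗ[k] B₁ →ₗ[k] C₁} {g : A₂ →ₗ[k] B₂ →ₗ[k] C₂}
    {f' : D₁ →ₗ[k] D₂ →ₗ[k] D₃} {g' : A₃ →ₗ[k] B₃ →ₗ[k] C₃}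
    {α : A₁ →ₗ[k] D₁} {β : B₁ →ₗ[k] D₂} {γ : C₁ →ₗ[k] D₃}
    {α' : A₂ →ₗ[k] A₃} {β' : B₂ →ₗ[k] B₃} {γ' : C₂ →ₗ[k] C₃}
    (h : ∀ a b, γ (f a b) = f' (α a) (β b)) {S : Submodule k A₂} {T : Submodule k B₂}
    (h' : ∀ a ∈ S, ∀ b ∈ T, γ' (g a b) = g' (α' a) (β' b))
    {s : A₁ ⊗[k] A₂} {t : B₁ ⊗[k] B₂} (hs : s ∈ tens (⊤ : Submodule k A₁) S)
    (ht : t ∈ tens (⊤ : Submodule k B₁) T) :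
    TensorProduct.map γ γ' (TensorProduct.map₂ f g s t) =
      TensorProduct.map₂ f' g' (TensorProduct.map α α' s) (TensorProduct.map β β' t) :=
  tens_induction₂ (P := fun s t => TensorProduct.map γ γ' (TensorProduct.map₂ f g s t) =
      TensorProduct.map₂ f' g' (TensorProduct.map α α' s) (TensorProduct.map β β' t))
    (by simp) (by simp)
    (fun s s' t h h' => by simp only [map_add, LinearMap.add_apply, h, h'])
    (fun s t t' h h' => by simp only [map_add, h, h'])
    (fun a _ a' ha' b _ b' hb' => by simp [h, h' a' ha' b' hb']) hs ht

theorem map₂_flip (f : A₁ →ₗ[k] B₁ →ₗ[k] C₁) (g : A₂ →ₗ[k] B₂ →ₗ[k] C₂)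
    (s : A₁ ⊗[k] A₂) (t : B₁ ⊗[k] B₂) :
    TensorProduct.map₂ f.flip g.flip t s = TensorProduct.map₂ f g s t :=
  tensor_induction₂ (P := fun s t => TensorProduct.map₂ f.flip g.flip t s =
    TensorProduct.map₂ f g s t) (by simp) (by simp)
    (fun s s' t h h' => by simp only [map_add, LinearMap.add_apply, h, h'])
    (fun s t t' h h' => by simp only [map_add, LinearMap.add_apply, h, h'])
    (fun _ _ _ _ => by simp) s t

theorem map₂_mul {A B : Type*} [Ring A] [Algebra k A] [Ring B] [Algebra k B] (s t : A ⊗[k] B) :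
    TensorProduct.map₂ (LinearMap.mul k A) (LinearMap.mul k B) s t = s * t :=
  tensor_induction₂ (P := fun s t => TensorProduct.map₂ (LinearMap.mul k A) (LinearMap.mul k B) s t
    = s * t) (by simp) (by simp)
    (fun s s' t h h' => by simp only [map_add, LinearMap.add_apply, add_mul, h, h'])
    (fun s t t' h h' => by simp only [map_add, mul_add, h, h'])
    (fun _ _ _ _ => by simp) s t

end Bilinear


section Flat
variable {k V X Y : Type*} [Field k] [AddCommGroup V] [Module k V]
  [AddCommGroup X] [Module k X] [AddCommGroup Y] [Module k Y]

theorem tens_ker_right (f : X →ₗ[k] Y) {S : Submodule k X} {T : Submodule k V} {t : X ⊗[k] V}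
    (ht : t ∈ tens S T) (h0 : f.rTensor V t = 0) : t ∈ tens (S ⊓ LinearMap.ker f) T := by
  obtain ⟨s, rfl⟩ := ht
  have h1 : (f ∘ₗ S.subtype).rTensor T s = 0 := by
    apply Module.Flat.lTensor_preserves_injective_linearMap (M := Y) T.subtype T.injective_subtype
    rw [map_zero, ← h0, ← lr_comm, LinearMap.rTensor_comp_apply, ← LinearMap.rTensor_comp_lTensor,
      LinearMap.comp_apply]
  obtain ⟨r, rfl⟩ := (Module.Flat.rTensor_exact T
    (LinearMap.exact_subtype_ker_map (f ∘ₗ S.subtype)) s).1 h1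
  induction r using TensorProduct.induction_on with
  | zero => simp
  | tmul a b =>
    simp only [LinearMap.rTensor_tmul, TensorProduct.map_tmul]
    exact tmul_mem_tens ⟨a.1.2, a.2⟩ b.2
  | add x y hx hy =>
    rw [map_add, map_add]
    have e : ∀ z, f.rTensor V (TensorProduct.map S.subtype T.subtype
        ((LinearMap.ker (f ∘ₗ S.subtype)).subtype.rTensor T z)) = 0 := by
      intro z
      induction z using TensorProduct.induction_on with
      | zero => simp
      | tmul a b =>
        have := a.2
        rw [LinearMap.mem_ker, LinearMap.comp_apply] at this
        simp only [Submodule.subtype_apply] at this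
        simp [this]
      | add x y hx hy => simp only [map_add, hx, hy, add_zero]
    have e' : ∀ z, (f ∘ₗ S.subtype).rTensor T
        ((LinearMap.ker (f ∘ₗ S.subtype)).subtype.rTensor T z) = 0 := fun z =>
      (Module.Flat.rTensor_exact T (LinearMap.exact_subtype_ker_map (f ∘ₗ S.subtype)) _).2 ⟨z, rfl⟩
    exact add_mem (hx (e _) (e' _)) (hy (e _) (e' _))

theorem tens_comm {S : Submodule k X} {T : Submodule k V} {t : X ⊗[k] V} (ht : t ∈ tens S T) :
    TensorProduct.comm k X V t ∈ tens T S :=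
  tens_induction (P := fun t => TensorProduct.comm k X V t ∈ tens T S) (by simp)
    (fun x y hx hy => by rw [map_add]; exact add_mem hx hy)
    (fun v hv w hw => by simpa using tmul_mem_tens hw hv) ht

theorem tens_ker_left (f : X →ₗ[k] Y) {S : Submodule k X} {T : Submodule k V} {t : V ⊗[k] X}
    (ht : t ∈ tens T S) (h0 : f.lTensor V t = 0) : t ∈ tens T (S ⊓ LinearMap.ker f) := by
  have h := tens_ker_right f (tens_comm ht) (by
    have e : f.rTensor V (TensorProduct.comm k V X t) =
        TensorProduct.comm k V Y (f.lTensor V t) := by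
      induction t using TensorProduct.induction_on with
      | zero => simp
      | tmul => simp
      | add x y hx hy => rw [LinearMap.rTensor_comm]
    rw [e, h0, map_zero])
  have := tens_comm h
  rwa [← TensorProduct.comm_symm, LinearEquiv.symm_apply_apply] at this

end Flat

section SubBialgebra
variable {k A : Type*} [Field k] [Ring A] [Bialgebra k A]

/-- `S` is closed under the comultiplication: `Δ(S)` is contained in the image of `S ⊗ S`. -/
def IsSubcoalgebra (S : Submodule k A) : Prop :=
  ∀ a ∈ S, Coalgebra.comul (R := k) a ∈ tens S S

theorem incl₂_injective (S : Submodule k A) :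
    Function.Injective (TensorProduct.map S.subtype S.subtype) := by
  rw [← LinearMap.rTensor_comp_lTensor, LinearMap.coe_comp]
  exact (Module.Flat.rTensor_preserves_injective_linearMap (M := A) S.subtype
    S.injective_subtype).comp
    (Module.Flat.lTensor_preserves_injective_linearMap (M := S) S.subtype S.injective_subtype)

/-- The restriction of the comultiplication to a subcoalgebra. -/
def subComul (S : Submodule k A) (h : IsSubcoalgebra S) : S →ₗ[k] S ⊗[k] S :=
  (LinearEquiv.ofInjective _ (incl₂_injective S)).symm.toLinearMap ∘ₗ
    LinearMap.codRestrict _ (Coalgebra.comul ∘ₗ S.subtype) (fun a => h a a.2)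

theorem incl₂_subComul (S : Submodule k A) (h : IsSubcoalgebra S) (a : S) :
    TensorProduct.map S.subtype S.subtype (subComul S h a) = Coalgebra.comul (R := k) (a : A) := by
  have := congrArg Subtype.val ((LinearEquiv.ofInjective _ (incl₂_injective S)).apply_symm_apply
    (LinearMap.codRestrict _ (Coalgebra.comul ∘ₗ S.subtype) (fun a => h a a.2) a))
  exact this

/-- A subspace closed under the comultiplication is a coalgebra. -/
@[reducible] def subCoalgebra (S : Submodule k A) (h : IsSubcoalgebra S) : Coalgebra k S where
  comul := subComul S h
  counit := Coalgebra.counit ∘ₗ S.subtype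
  coassoc := by
    ext a
    have inj : Function.Injective (TensorProduct.map S.subtype
        (TensorProduct.map S.subtype S.subtype)) := by
      rw [← LinearMap.rTensor_comp_lTensor, LinearMap.coe_comp]
      exact (Module.Flat.rTensor_preserves_injective_linearMap (M := A ⊗[k] A) S.subtype
        S.injective_subtype).comp
        (Module.Flat.lTensor_preserves_injective_linearMap (M := S) _ (incl₂_injective S))
    apply inj
    have e : TensorProduct.map S.subtype S.subtype ∘ₗ subComul S h =
      Coalgebra.comul ∘ₗ S.subtype := LinearMap.ext (incl₂_subComul S h)
    have e1 : ∀ t : S ⊗[k] S, TensorProduct.map S.subtype (TensorProduct.map S.subtype S.subtype)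
        ((subComul S h).lTensor S t) = (Coalgebra.comul (R := k)).lTensor A
          (TensorProduct.map S.subtype S.subtype t) := by
      intro t
      induction t using TensorProduct.induction_on with
      | zero => simp
      | tmul a b => simp [incl₂_subComul]
      | add x y hx hy => simp only [map_add, hx, hy]
    have e2 : ∀ t : S ⊗[k] S, TensorProduct.map S.subtype (TensorProduct.map S.subtype S.subtype)
        (TensorProduct.assoc k S S S ((subComul S h).rTensor S t)) =
        TensorProduct.assoc k A A A ((Coalgebra.comul (R := k)).rTensor A
          (TensorProduct.map S.subtype S.subtype t)) := by
      intro t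
      rw [TensorProduct.map_map_assoc]
      congr 1
      induction t using TensorProduct.induction_on with
      | zero => simp
      | tmul a b => simp [incl₂_subComul]
      | add x y hx hy => simp only [map_add, hx, hy]
    simp only [LinearMap.comp_apply, LinearEquiv.coe_coe]
    rw [e2, e1, incl₂_subComul, Coalgebra.coassoc_apply]
  rTensor_counit_comp_comul := by
    apply LinearMap.ext
    intro a
    apply Module.Flat.lTensor_preserves_injective_linearMap (M := k) S.subtype S.injective_subtype
    simp only [LinearMap.comp_apply, LinearMap.rTensor_comp_apply]
    rw [← lr_comm, ← LinearMap.comp_apply (LinearMap.lTensor A S.subtype),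
      LinearMap.lTensor_comp_rTensor, incl₂_subComul, Coalgebra.rTensor_counit_comul]
    simp
  lTensor_counit_comp_comul := by
    apply LinearMap.ext
    intro a
    apply Module.Flat.rTensor_preserves_injective_linearMap (M := k) S.subtype S.injective_subtype
    simp only [LinearMap.comp_apply, LinearMap.lTensor_comp_apply]
    rw [lr_comm, ← LinearMap.comp_apply (LinearMap.rTensor A S.subtype),
      LinearMap.rTensor_comp_lTensor, incl₂_subComul, Coalgebra.lTensor_counit_comul]
    simp

/-- A subalgebra closed under the comultiplication is a bialgebra. -/
@[reducible] def subBialgebra (S : Subalgebra k A) (h : IsSubcoalgebra (Subalgebra.toSubmodule S)) :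
    Bialgebra k S :=
  letI : Coalgebra k S := subCoalgebra (Subalgebra.toSubmodule S) h
  Bialgebra.mk' k S (Bialgebra.counit_one (R := k) (A := A))
    (fun {a b} => Bialgebra.counit_mul (R := k) (a : A) (b : A))
    (by
      apply incl₂_injective (Subalgebra.toSubmodule S)
      refine (incl₂_subComul (Subalgebra.toSubmodule S) h ⟨1, S.one_mem⟩).trans ?_
      exact (Bialgebra.comul_one (R := k) (A := A)))
    (fun {a b} => by
      apply incl₂_injective (Subalgebra.toSubmodule S)
      refine (incl₂_subComul (Subalgebra.toSubmodule S) h ⟨a * b, S.mul_mem a.2 b.2⟩).trans ?_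
      have e := map_mul (Algebra.TensorProduct.map S.val S.val)
        (show S ⊗[k] S from subComul (Subalgebra.toSubmodule S) h a)
        (show S ⊗[k] S from subComul (Subalgebra.toSubmodule S) h b)
      refine Eq.trans ?_ e.symm
      refine (Bialgebra.comul_mul (R := k) (a : A) (b : A)).trans ?_
      exact congrArg₂ (· * ·) (incl₂_subComul (Subalgebra.toSubmodule S) h a).symm
        (incl₂_subComul (Subalgebra.toSubmodule S) h b).symm)

end SubBialgebra


section Ambient
variable {k H M : Type*} [Field k] [Ring H] [Bialgebra k H] [AddCommGroup M] [Module k M]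

section Raw
variable {X : Type*} [AddCommGroup X] [Module k X]

theorem raw_fold_cons (φ : H →ₗ[k] X) (α : M →ₗ[k] X →ₗ[k] X) (m : M)
    (x : TensorAlgebra k M ⊗[k] H) :
    TensorProduct.lift
      (LinearMap.compl₂ (TensorAlgebra.lift k (A := Module.End k X) α).toLinearMap φ)
      ((LinearMap.mulLeft k (TensorAlgebra.ι k m)).rTensor H x) =
    α m (TensorProduct.lift
      (LinearMap.compl₂ (TensorAlgebra.lift k (A := Module.End k X) α).toLinearMap φ) x) := by
  induction x using TensorProduct.induction_on with
  | zero => simp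
  | tmul a h => simp
  | add x y hx hy => rw [map_add, map_add, hx, hy, map_add, map_add]

theorem raw_induct {P : TensorAlgebra k M ⊗[k] H → Prop}
    (hadd : ∀ x y, P x → P y → P (x + y))
    (hinc : ∀ h : H, P ((1 : TensorAlgebra k M) ⊗ₜ[k] h))
    (hcons : ∀ m x, P x → P ((LinearMap.mulLeft k (TensorAlgebra.ι k m)).rTensor H x))
    (x : TensorAlgebra k M ⊗[k] H) : P x := by
  have key : ∀ a w : TensorAlgebra k M, (∀ h : H, P (w ⊗ₜ[k] h)) →
      ∀ h : H, P ((a * w) ⊗ₜ[k] h) := by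
    intro a
    induction a using TensorAlgebra.induction with
    | algebraMap r =>
      intro w hw h
      rw [← Algebra.smul_def, TensorProduct.smul_tmul]
      exact hw _
    | ι m => exact fun w hw h => by simpa using hcons m _ (hw h)
    | mul a b ha hb => exact fun w hw h => by rw [mul_assoc]; exact ha _ (hb w hw) h
    | add a b ha hb =>
      exact fun w hw h => by
        rw [add_mul, TensorProduct.add_tmul]; exact hadd _ _ (ha w hw h) (hb w hw h)
  induction x using TensorProduct.induction_on with
  | zero => simpa using hinc 0
  | tmul a h => simpa using key a 1 hinc h
  | add x y hx hy => exact hadd x y hx hy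

end Raw

/-- The space `⨁ₙ M^{⊗n} ⊗ H`, in which the cotensor coalgebra lives. -/
def Amb (_B : HopfBimodule k H M) : Type _ := TensorAlgebra k M ⊗[k] H

namespace Amb
variable (B : HopfBimodule k H M)

instance : AddCommGroup (Amb B) := inferInstanceAs (AddCommGroup (TensorAlgebra k M ⊗[k] H))
instance : Module k (Amb B) := inferInstanceAs (Module k (TensorAlgebra k M ⊗[k] H))

/-- The inclusion of `H` as the summand of degree `0`. -/
def inc : H →ₗ[k] Amb B := TensorProduct.mk k (TensorAlgebra k M) H 1

/-- `cons m` sends `M^{⊗n} ⊗ H` to `M^{⊗(n+1)} ⊗ H`, putting `m` in front. -/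
def cons : M →ₗ[k] Amb B →ₗ[k] Amb B :=
  (LinearMap.rTensorHom H ∘ₗ LinearMap.mul k (TensorAlgebra k M)) ∘ₗ TensorAlgebra.ι k

variable {X : Type*} [AddCommGroup X] [Module k X]

/-- Linear maps out of `Amb B` by recursion. -/
def fold (φ : H →ₗ[k] X) (α : M →ₗ[k] X →ₗ[k] X) : Amb B →ₗ[k] X :=
  TensorProduct.lift
    (LinearMap.compl₂ (TensorAlgebra.lift k (A := Module.End k X) α).toLinearMap φ)

variable {B}

theorem fold_inc (φ : H →ₗ[k] X) (α : M →ₗ[k] X →ₗ[k] X) (h : H) :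
    fold B φ α (inc B h) = φ h := by
  have : TensorProduct.lift
    (LinearMap.compl₂ (TensorAlgebra.lift k (A := Module.End k X) α).toLinearMap φ)
    ((1 : TensorAlgebra k M) ⊗ₜ[k] h) = φ h := by simp
  exact this

theorem fold_cons (φ : H →ₗ[k] X) (α : M →ₗ[k] X →ₗ[k] X) (m : M) (x : Amb B) :
    fold B φ α (cons B m x) = α m (fold B φ α x) :=
  raw_fold_cons φ α m x

theorem induct {P : Amb B → Prop} (hadd : ∀ x y, P x → P y → P (x + y))
    (hinc : ∀ h, P (inc B h)) (hcons : ∀ m x, P x → P (cons B m x)) (x : Amb B) : P x :=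
  raw_induct (P := P) hadd hinc hcons x

theorem hom_ext {f g : Amb B →ₗ[k] X} (hinc : ∀ h, f (inc B h) = g (inc B h))
    (hcons : ∀ m x, f x = g x → f (cons B m x) = g (cons B m x)) (x : Amb B) : f x = g x :=
  induct (P := fun x => f x = g x) (fun x y hx hy => by rw [map_add, map_add, hx, hy])
    hinc hcons x

variable (B)

/-- Linear maps out of `Amb B` by recursion, the step having access to the tail. -/
def para (φ : H →ₗ[k] X) (α : M →ₗ[k] Amb B × X →ₗ[k] X) : Amb B →ₗ[k] X :=
  LinearMap.snd k (Amb B) X ∘ₗ fold B ((inc B).prod φ)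
    (LinearMap.mk₂ k (fun m y => (cons B m y.1, α m y))
      (fun m m' y => by simp) (fun c m y => by simp) (fun m y y' => by simp)
      (fun c m y => by simp))

variable {B}

theorem para_fst (φ : H →ₗ[k] X) (α : M →ₗ[k] Amb B × X →ₗ[k] X) (x : Amb B) :
    (fold B ((inc B).prod φ)
    (LinearMap.mk₂ k (fun m y => (cons B m y.1, α m y))
      (fun m m' y => by simp) (fun c m y => by simp) (fun m y y' => by simp)
      (fun c m y => by simp)) x).1 = x := by
  induction x using induct with
  | hadd x y hx hy => rw [map_add, Prod.fst_add, hx, hy]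
  | hinc h => rw [fold_inc]; rfl
  | hcons m x hx => rw [fold_cons, LinearMap.mk₂_apply, hx]

theorem para_inc (φ : H →ₗ[k] X) (α : M →ₗ[k] Amb B × X →ₗ[k] X) (h : H) :
    para B φ α (inc B h) = φ h := by
  rw [para, LinearMap.comp_apply, fold_inc]; rfl

theorem para_cons (φ : H →ₗ[k] X) (α : M →ₗ[k] Amb B × X →ₗ[k] X) (m : M) (x : Amb B) :
    para B φ α (cons B m x) = α m (x, para B φ α x) := by
  conv_lhs => rw [para, LinearMap.comp_apply, fold_cons, LinearMap.mk₂_apply]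
  change α m _ = _
  congr 1
  exact Prod.ext (para_fst φ α x) rfl

variable (B)

/-- The projection onto the summand of degree `0`. -/
def pr0 : Amb B →ₗ[k] H := para B LinearMap.id 0

/-- `cons` as a map on the tensor product. -/
def join : M ⊗[k] Amb B →ₗ[k] Amb B := TensorProduct.lift (cons B)

/-- The inverse of `join` on positive degrees, zero in degree `0`. -/
def tail : Amb B →ₗ[k] M ⊗[k] Amb B :=
  para B 0 ((LinearMap.lcomp k _ (LinearMap.fst k (Amb B) (M ⊗[k] Amb B))) ∘ₗ
    TensorProduct.mk k M (Amb B))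

variable {B}

@[simp] theorem join_tmul (m : M) (x : Amb B) : join B (m ⊗ₜ x) = cons B m x := rfl
@[simp] theorem pr0_inc (h : H) : pr0 B (inc B h) = h := para_inc _ _ h
@[simp] theorem pr0_cons (m : M) (x : Amb B) : pr0 B (cons B m x) = 0 := para_cons _ _ m x
@[simp] theorem tail_inc (h : H) : tail B (inc B h) = 0 := para_inc _ _ h
@[simp] theorem tail_cons (m : M) (x : Amb B) : tail B (cons B m x) = m ⊗ₜ x := para_cons _ _ m x

@[simp] theorem pr0_join (z : M ⊗[k] Amb B) : pr0 B (join B z) = 0 := by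
  induction z using TensorProduct.induction_on with
  | zero => simp
  | tmul m x => simp
  | add x y hx hy => simp [hx, hy]

@[simp] theorem tail_join (z : M ⊗[k] Amb B) : tail B (join B z) = z := by
  induction z using TensorProduct.induction_on with
  | zero => simp
  | tmul m x => simp
  | add x y hx hy => simp [hx, hy]

theorem decomp (x : Amb B) : inc B (pr0 B x) + join B (tail B x) = x := by
  induction x using induct with
  | hadd x y hx hy => 
    conv_rhs => rw [← hx, ← hy]
    simp only [map_add]; abel
  | hinc h => simp
  | hcons m x hx => simp

theorem eq_of {x y : Amb B} (h0 : pr0 B x = pr0 B y) (h1 : tail B x = tail B y) : x = y := by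
  rw [← decomp x, ← decomp y, h0, h1]

theorem eq_of_lTensor {V : Type*} [AddCommGroup V] [Module k V] {x y : V ⊗[k] Amb B}
    (h0 : (pr0 B).lTensor V x = (pr0 B).lTensor V y)
    (h1 : (tail B).lTensor V x = (tail B).lTensor V y) : x = y := by
  have key : ∀ z : V ⊗[k] Amb B,
      (inc B).lTensor V ((pr0 B).lTensor V z) + (join B).lTensor V ((tail B).lTensor V z) = z := by
    intro z
    induction z using TensorProduct.induction_on with
    | zero => simp
    | tmul m x => simp [← TensorProduct.tmul_add, decomp]
    | add x y hx hy =>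
      conv_rhs => rw [← hx, ← hy]
      simp only [map_add]; abel
  rw [← key x, ← key y, h0, h1]

theorem eq_of_rTensor {V : Type*} [AddCommGroup V] [Module k V] {x y : Amb B ⊗[k] V}
    (h0 : (pr0 B).rTensor V x = (pr0 B).rTensor V y)
    (h1 : (tail B).rTensor V x = (tail B).rTensor V y) : x = y := by
  have key : ∀ z : Amb B ⊗[k] V,
      (inc B).rTensor V ((pr0 B).rTensor V z) + (join B).rTensor V ((tail B).rTensor V z) = z := by
    intro z
    induction z using TensorProduct.induction_on with
    | zero => simp
    | tmul m x => simp [← TensorProduct.add_tmul, decomp]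
    | add x y hx hy =>
      conv_rhs => rw [← hx, ← hy]
      simp only [map_add]; abel
  rw [← key x, ← key y, h0, h1]


variable (B)

/-- The left coaction of `H`: the comultiplication in degree `0`, the coaction on the first
factor `M` in positive degrees. -/
def lco : Amb B →ₗ[k] H ⊗[k] Amb B :=
  (inc B).lTensor H ∘ₗ Coalgebra.comul ∘ₗ pr0 B +
    (join B).lTensor H ∘ₗ (TensorProduct.assoc k H M (Amb B)).toLinearMap ∘ₗ
      B.coactL.rTensor (Amb B) ∘ₗ tail B

/-- The comultiplication
`m₁ ⋯ mₙ h ↦ ∑ᵢ m₁ ⋯ mᵢ (m_{i+1})₍₋₁₎ ⊗ (m_{i+1})₍₀₎ m_{i+2} ⋯ mₙ h + m₁ ⋯ mₙ h₍₁₎ ⊗ h₍₂₎`. -/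
def comul : Amb B →ₗ[k] Amb B ⊗[k] Amb B :=
  para B (TensorProduct.map (inc B) (inc B) ∘ₗ Coalgebra.comul)
    (LinearMap.mk₂ k
      (fun m y => (inc B).rTensor (Amb B) (lco B (cons B m y.1)) + (cons B m).rTensor (Amb B) y.2)
      (fun m m' y => by simp [LinearMap.rTensor_add]; abel)
      (fun c m y => by simp [LinearMap.rTensor_smul])
      (fun m y y' => by simp; abel) (fun c m y => by simp))

def counit : Amb B →ₗ[k] k := Coalgebra.counit ∘ₗ pr0 B

variable {B}

theorem lco_inc (h : H) : lco B (inc B h) = (inc B).lTensor H (Coalgebra.comul h) := by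
  simp [lco]

theorem lco_join (z : M ⊗[k] Amb B) : lco B (join B z) =
    (join B).lTensor H (TensorProduct.assoc k H M (Amb B) (B.coactL.rTensor (Amb B) z)) := by
  simp [lco]

theorem pr0_lco (x : Amb B) : (pr0 B).lTensor H (lco B x) = Coalgebra.comul (pr0 B x) := by
  have h1 : (pr0 B) ∘ₗ inc B = LinearMap.id := by ext; simp
  have h2 : (pr0 B) ∘ₗ join B = 0 := by ext; simp
  simp only [lco, LinearMap.add_apply, map_add, LinearMap.comp_apply,
    ← LinearMap.lTensor_comp_apply, h1, h2]
  simp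

theorem tail_lco (x : Amb B) : (tail B).lTensor H (lco B x) =
    TensorProduct.assoc k H M (Amb B) (B.coactL.rTensor (Amb B) (tail B x)) := by
  have h1 : (tail B) ∘ₗ inc B = 0 := by ext; simp
  have h2 : (tail B) ∘ₗ join B = LinearMap.id := by
    apply LinearMap.ext; intro z; simp
  simp only [lco, LinearMap.add_apply, map_add, LinearMap.comp_apply,
    ← LinearMap.lTensor_comp_apply, h1, h2]
  simp

theorem comul_inc (h : H) :
    comul B (inc B h) = TensorProduct.map (inc B) (inc B) (Coalgebra.comul h) :=
  para_inc _ _ h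

theorem comul_cons (m : M) (x : Amb B) : comul B (cons B m x) =
    (inc B).rTensor (Amb B) (lco B (cons B m x)) + (cons B m).rTensor (Amb B) (comul B x) :=
  para_cons _ _ m x

theorem comul_eq (x : Amb B) : comul B x = (inc B).rTensor (Amb B) (lco B x) +
    (join B).rTensor (Amb B) ((TensorProduct.assoc k M (Amb B) (Amb B)).symm
      ((comul B).lTensor M (tail B x))) := by
  have key : ∀ m (t : Amb B ⊗[k] Amb B), (cons B m).rTensor (Amb B) t =
      (join B).rTensor (Amb B) ((TensorProduct.assoc k M (Amb B) (Amb B)).symm (m ⊗ₜ t)) := by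
    intro m t
    induction t using TensorProduct.induction_on with
    | zero => simp
    | tmul => simp
    | add x y hx hy => simp only [map_add, TensorProduct.tmul_add, hx, hy]
  induction x using induct with
  | hadd x y hx hy => rw [map_add, hx, hy]; simp only [map_add]; abel
  | hinc h =>
    rw [comul_inc, lco_inc, tail_inc, map_zero, map_zero, map_zero, add_zero,
      ← LinearMap.rTensor_comp_lTensor, LinearMap.comp_apply]
  | hcons m x _ => rw [comul_cons, tail_cons, LinearMap.lTensor_tmul, key]

theorem pr0_comul (x : Amb B) : (pr0 B).rTensor (Amb B) (comul B x) = lco B x := by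
  have h1 : (pr0 B) ∘ₗ inc B = LinearMap.id := by ext; simp
  have h2 : (pr0 B) ∘ₗ join B = 0 := by ext; simp
  rw [comul_eq, map_add, ← LinearMap.rTensor_comp_apply, ← LinearMap.rTensor_comp_apply, h1, h2]
  simp

theorem tail_comul (x : Amb B) : (tail B).rTensor (Amb B) (comul B x) =
    (TensorProduct.assoc k M (Amb B) (Amb B)).symm ((comul B).lTensor M (tail B x)) := by
  have h1 : (tail B) ∘ₗ inc B = 0 := by ext; simp
  have h2 : (tail B) ∘ₗ join B = LinearMap.id := by
    apply LinearMap.ext; intro z; simp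
  rw [comul_eq, map_add, ← LinearMap.rTensor_comp_apply, ← LinearMap.rTensor_comp_apply, h1, h2]
  simp

theorem lco_cons (m : M) (x : Amb B) :
    lco B (cons B m x) = ((cons B).flip x).lTensor H (B.coactL m) := by
  rw [← join_tmul, lco_join, LinearMap.rTensor_tmul]
  generalize B.coactL m = t
  induction t using TensorProduct.induction_on with
  | zero => simp
  | tmul => simp
  | add x y hx hy => simp only [map_add, TensorProduct.add_tmul, hx, hy]

theorem lco_coassoc (x : Amb B) :
    TensorProduct.assoc k H H (Amb B) ((Coalgebra.comul (R := k)).rTensor (Amb B) (lco B x)) =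
      (lco B).lTensor H (lco B x) := by
  refine hom_ext (f := (TensorProduct.assoc k H H (Amb B)).toLinearMap ∘ₗ
    (Coalgebra.comul (R := k)).rTensor (Amb B) ∘ₗ lco B)
    (g := (lco B).lTensor H ∘ₗ lco B) (fun h => ?_) (fun m x _ => ?_) x
  · have e : lco B ∘ₗ inc B = (inc B).lTensor H ∘ₗ Coalgebra.comul := by
      ext h; exact lco_inc h
    simp only [LinearMap.comp_apply, LinearEquiv.coe_coe, lco_inc, lr_comm, nat3]
    rw [← LinearMap.lTensor_comp_apply, e, LinearMap.lTensor_comp_apply, Coalgebra.coassoc_apply]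
  · have e : lco B ∘ₗ (cons B).flip x = ((cons B).flip x).lTensor H ∘ₗ B.coactL := by
      ext h; exact lco_cons h x
    simp only [LinearMap.comp_apply, LinearEquiv.coe_coe, lco_cons, lr_comm, nat3]
    rw [← LinearMap.lTensor_comp_apply, e, LinearMap.lTensor_comp_apply, B.coactL_coassoc]

theorem coactL_assoc_symm (t : M ⊗[k] (Amb B ⊗[k] Amb B)) :
    TensorProduct.assoc k H (M ⊗[k] Amb B) (Amb B)
    ((TensorProduct.assoc k H M (Amb B)).toLinearMap.rTensor (Amb B)
      ((B.coactL.rTensor (Amb B)).rTensor (Amb B)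
        ((TensorProduct.assoc k M (Amb B) (Amb B)).symm t))) =
    (TensorProduct.assoc k M (Amb B) (Amb B)).symm.toLinearMap.lTensor H
      (TensorProduct.assoc k H M (Amb B ⊗[k] Amb B) (B.coactL.rTensor _ t)) := by
  rw [← nat1']
  generalize (LinearMap.rTensor (Amb B ⊗[k] Amb B) B.coactL) t = s
  induction s using TensorProduct.induction_on with
  | zero => simp
  | tmul s d =>
    induction s using TensorProduct.induction_on with
    | zero => simp
    | tmul a s =>
      induction d using TensorProduct.induction_on with
      | zero => simp
      | tmul => simp
      | add x y hx hy => simp only [map_add, TensorProduct.tmul_add, hx, hy]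
    | add x y hx hy => simp only [map_add, TensorProduct.add_tmul, hx, hy]
  | add x y hx hy => simp only [map_add, hx, hy]

theorem lco_comul (x : Amb B) :
    TensorProduct.assoc k H (Amb B) (Amb B) ((lco B).rTensor (Amb B) (comul B x)) =
      (comul B).lTensor H (lco B x) := by
  have e1 : lco B ∘ₗ inc B = (inc B).lTensor H ∘ₗ Coalgebra.comul := by
    ext h; exact lco_inc h
  have e2 : lco B ∘ₗ join B = (join B).lTensor H ∘ₗ
      (TensorProduct.assoc k H M (Amb B)).toLinearMap ∘ₗ B.coactL.rTensor (Amb B) := by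
    apply LinearMap.ext; intro z; exact lco_join z
  have e3 : comul B = (inc B).rTensor (Amb B) ∘ₗ lco B +
    (join B).rTensor (Amb B) ∘ₗ (TensorProduct.assoc k M (Amb B) (Amb B)).symm.toLinearMap ∘ₗ
      (comul B).lTensor M ∘ₗ tail B := by
    apply LinearMap.ext; intro z; exact comul_eq z
  conv_rhs => rw [e3]
  rw [comul_eq, map_add, ← LinearMap.rTensor_comp_apply, ← LinearMap.rTensor_comp_apply, e1, e2]
  simp only [LinearMap.rTensor_comp, LinearMap.lTensor_comp, LinearMap.lTensor_add,
    LinearMap.comp_apply, LinearMap.add_apply, map_add, nat2, lco_coassoc, tail_lco,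
    coactL_assoc_symm, lr_comm, nat3]

theorem comul_coassoc (x : Amb B) :
    TensorProduct.assoc k (Amb B) (Amb B) (Amb B) ((comul B).rTensor (Amb B) (comul B x)) =
      (comul B).lTensor (Amb B) (comul B x) := by
  have h0 : (pr0 B).rTensor (Amb B) ∘ₗ comul B = lco B := LinearMap.ext pr0_comul
  have h1 : (tail B).rTensor (Amb B) ∘ₗ comul B =
      (TensorProduct.assoc k M (Amb B) (Amb B)).symm.toLinearMap ∘ₗ
        (comul B).lTensor M ∘ₗ tail B := LinearMap.ext tail_comul
  have a0 : ∀ x, (pr0 B).rTensor _ (TensorProduct.assoc k (Amb B) (Amb B) (Amb B)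
      ((comul B).rTensor (Amb B) (comul B x))) =
      (pr0 B).rTensor _ ((comul B).lTensor (Amb B) (comul B x)) := by
    intro x
    rw [← nat1, lr_comm, ← LinearMap.rTensor_comp_apply, h0, pr0_comul, lco_comul]
  have a1 : ∀ x, (tail B).rTensor _ (TensorProduct.assoc k (Amb B) (Amb B) (Amb B)
      ((comul B).rTensor (Amb B) (comul B x))) = (TensorProduct.assoc k M (Amb B) _).symm
      (((TensorProduct.assoc k (Amb B) (Amb B) (Amb B)).toLinearMap ∘ₗ
        (comul B).rTensor (Amb B) ∘ₗ comul B).lTensor M (tail B x)) := by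
    intro x
    rw [← nat1, ← LinearMap.rTensor_comp_apply, h1, LinearMap.rTensor_comp_apply,
      LinearMap.rTensor_comp_apply, tail_comul, ← nat2', LinearEquiv.eq_symm_apply, penta,
      LinearEquiv.apply_symm_apply, LinearMap.lTensor_comp_apply, LinearMap.lTensor_comp_apply]
  have a2 : ∀ x, (tail B).rTensor _ ((comul B).lTensor (Amb B) (comul B x)) =
      (TensorProduct.assoc k M (Amb B) _).symm
      (((comul B).lTensor (Amb B) ∘ₗ comul B).lTensor M (tail B x)) := by
    intro x
    rw [lr_comm, tail_comul, LinearMap.lTensor_comp_apply, nat3']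
  induction x using induct with
  | hadd x y hx hy => simp only [map_add, hx, hy]
  | hinc h => exact eq_of_rTensor (a0 _) (by rw [a1, a2, tail_inc]; simp only [map_zero])
  | hcons m x ih =>
    refine eq_of_rTensor (a0 _) ?_
    rw [a1, a2, tail_cons, LinearMap.lTensor_tmul, LinearMap.lTensor_tmul]
    simp only [LinearMap.comp_apply, LinearEquiv.coe_coe, ih]

theorem counit_left (x : Amb B) : (counit B).rTensor (Amb B) (comul B x) = 1 ⊗ₜ[k] x := by
  have e : ∀ x : Amb B, TensorProduct.lid k _ ((Coalgebra.counit (R := k)).rTensor (Amb B)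
      (lco B x)) = x := by
    refine hom_ext (f := (TensorProduct.lid k _).toLinearMap ∘ₗ
      (Coalgebra.counit (R := k)).rTensor (Amb B) ∘ₗ lco B) (g := LinearMap.id)
      (fun h => ?_) (fun m x _ => ?_)
    · simp [lco_inc, lr_comm]
    · have := B.coactL_counit m
      simp only [LinearMap.comp_apply, LinearEquiv.coe_coe, lco_cons, lr_comm, LinearMap.id_apply]
      conv_rhs => rw [← this]
      generalize (LinearMap.rTensor M (Coalgebra.counit (R := k) (A := H))) (B.coactL m) = t
      induction t using TensorProduct.induction_on with
      | zero => simp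
      | tmul => simp
      | add x y hx hy => simp only [map_add, LinearMap.add_apply, hx, hy]
  rw [counit, LinearMap.rTensor_comp_apply, pr0_comul]
  apply (TensorProduct.lid k (Amb B)).injective
  rw [e]; simp

theorem counit_right (x : Amb B) : (counit B).lTensor (Amb B) (comul B x) = x ⊗ₜ[k] 1 := by
  refine hom_ext (f := (counit B).lTensor (Amb B) ∘ₗ comul B)
    (g := (TensorProduct.mk k (Amb B) k).flip 1) (fun h => ?_) (fun m x ih => ?_) x
  · have e : counit B ∘ₗ inc B = Coalgebra.counit := by ext; simp [counit]
    simp only [LinearMap.comp_apply, comul_inc]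
    rw [← LinearMap.rTensor_comp_lTensor, LinearMap.comp_apply, ← lr_comm,
      ← LinearMap.lTensor_comp_apply, e]
    simp
  · have e : counit B ∘ₗ (cons B).flip x = 0 := by ext; simp [counit]
    simp only [LinearMap.comp_apply] at ih ⊢
    rw [comul_cons, map_add, ← lr_comm, ← lr_comm, ih, lco_cons, ← LinearMap.lTensor_comp_apply, e]
    simp

instance : Coalgebra k (Amb B) where
  comul := comul B
  counit := counit B
  coassoc := LinearMap.ext comul_coassoc
  rTensor_counit_comp_comul := LinearMap.ext counit_left
  lTensor_counit_comp_comul := LinearMap.ext counit_right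


end Amb
end Ambient

section Ambient
variable {k H M : Type*} [Field k] [Ring H] [Bialgebra k H] [AddCommGroup M] [Module k M]
namespace Amb
variable {B : HopfBimodule k H M}

section Mul
variable (B)

/-- Approximations of the multiplication, exact in total degree `< n`. -/
def mulN : ℕ → (Amb B →ₗ[k] Amb B →ₗ[k] Amb B)
  | 0 => 0
  | n + 1 =>
    ((LinearMap.mul k H).compl₁₂ (pr0 B) (pr0 B)).compr₂ (inc B) +
    ((TensorProduct.map₂ B.actL (mulN n)).compl₁₂ (lco B) (tail B)).compr₂ (join B) +
    ((TensorProduct.map₂ B.actR.flip (mulN n)).compl₁₂ (tail B) (lco B)).compr₂ (join B)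

/-- The filtration by degree `< n`. -/
def fil : ℕ → Submodule k (Amb B)
  | 0 => ⊥
  | n + 1 => (tens ⊤ (fil n)).comap (tail B)

variable {B}

theorem mulN_succ (n : ℕ) (a b : Amb B) : mulN B (n + 1) a b = inc B (pr0 B a * pr0 B b) +
    join B (TensorProduct.map₂ B.actL (mulN B n) (lco B a) (tail B b)) +
    join B (TensorProduct.map₂ B.actR.flip (mulN B n) (tail B a) (lco B b)) := rfl

theorem fil_mono (n : ℕ) : fil B n ≤ fil B (n + 1) := by
  induction n with
  | zero => exact bot_le
  | succ n ih => exact Submodule.comap_mono (tens_mono le_rfl ih)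

theorem fil_le {m n : ℕ} (h : m ≤ n) : fil B m ≤ fil B n :=
  monotone_nat_of_le_succ (f := fil B) fil_mono h

theorem exists_fil (x : Amb B) : ∃ n, x ∈ fil B n := by
  induction x using induct with
  | hadd x y hx hy =>
    obtain ⟨i, hi⟩ := hx
    obtain ⟨j, hj⟩ := hy
    exact ⟨max i j, add_mem (fil_le (le_max_left _ _) hi) (fil_le (le_max_right _ _) hj)⟩
  | hinc h => exact ⟨1, by simp [fil]⟩
  | hcons m x hx =>
    obtain ⟨n, hn⟩ := hx
    exact ⟨n + 1, by
      rw [fil, Submodule.mem_comap, tail_cons]; exact tmul_mem_tens trivial hn⟩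

theorem lco_fil {n : ℕ} {x : Amb B} (hx : x ∈ fil B n) : lco B x ∈ tens (⊤ : Submodule k H) (fil B n) := by
  cases n with
  | zero =>
    have : x = 0 := hx
    rw [this, map_zero]; exact zero_mem _
  | succ n =>
    have hx' : tail B x ∈ tens (⊤ : Submodule k M) (fil B n) := hx
    rw [← decomp x, map_add, lco_inc, lco_join]
    refine add_mem (map_mem_tens (S' := ⊤) LinearMap.id (inc B) (fun _ _ => trivial)
      (fun h _ => by simp [fil]) (mem_tens_top _)) ?_
    refine tens_induction (P := fun t => (join B).lTensor H (TensorProduct.assoc k H M (Amb B)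
      (B.coactL.rTensor (Amb B) t)) ∈ tens (⊤ : Submodule k H) (fil B (n + 1))) (by simp)
      (fun x y hx hy => by simp only [map_add]; exact add_mem hx hy) (fun m _ y hy => ?_) hx'
    rw [← lco_join, join_tmul, lco_cons]
    refine map_mem_tens (S' := ⊤) LinearMap.id ((cons B).flip y) (fun _ _ => trivial) (fun m' _ => ?_)
      (mem_tens_top _)
    rw [fil, Submodule.mem_comap, LinearMap.flip_apply, tail_cons]
    exact tmul_mem_tens trivial hy

theorem map₂_congr_fil {V W X : Type*} [AddCommGroup V] [Module k V] [AddCommGroup W] [Module k W]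
    [AddCommGroup X] [Module k X] (f : V →ₗ[k] W →ₗ[k] X) {S T : Submodule k (Amb B)}
    {Y : Type*} [AddCommGroup Y] [Module k Y]
    {g g' : Amb B →ₗ[k] Amb B →ₗ[k] Y} (h : ∀ a ∈ S, ∀ b ∈ T, g a b = g' a b)
    {s : V ⊗[k] Amb B} {t : W ⊗[k] Amb B} (hs : s ∈ tens (⊤ : Submodule k V) S)
    (ht : t ∈ tens (⊤ : Submodule k W) T) :
    TensorProduct.map₂ f g s t = TensorProduct.map₂ f g' s t := by
  refine tens_induction (P := fun s => TensorProduct.map₂ f g s t = TensorProduct.map₂ f g' s t)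
    (by simp) (fun x y hx hy => by simp only [map_add, LinearMap.add_apply, hx, hy])
    (fun v _ a ha => ?_) hs
  refine tens_induction (P := fun t => TensorProduct.map₂ f g (v ⊗ₜ a) t =
    TensorProduct.map₂ f g' (v ⊗ₜ a) t)
    (by simp) (fun x y hx hy => by simp only [map_add, hx, hy]) (fun w _ b hb => ?_) ht
  simp [h a ha b hb]

theorem mulN_stable : ∀ (n i j : ℕ), i + j ≤ n → ∀ a ∈ fil B i, ∀ b ∈ fil B j, ∀ l, n ≤ l →
    mulN B l a b = mulN B n a b := by
  intro n
  induction n with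
  | zero =>
    intro i j hij a ha b hb l hl
    obtain rfl : i = 0 := by omega
    have : a = 0 := ha
    simp [this]
  | succ n ih =>
    intro i j hij a ha b hb l hl
    obtain ⟨l, rfl⟩ : ∃ l', l = l' + 1 := ⟨l - 1, by omega⟩
    cases i with
    | zero =>
      have : a = 0 := ha
      simp [this]
    | succ i =>
      cases j with
      | zero =>
        have : b = 0 := hb
        simp [this]
      | succ j =>
        rw [mulN_succ, mulN_succ]
        congr 1
        · congr 2
          exact map₂_congr_fil _ (fun a ha b hb => ih (i + 1) j (by omega) a ha b hb l (by omega))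
            (lco_fil ha) hb
        · congr 1
          exact map₂_congr_fil _ (fun a ha b hb => ih i (j + 1) (by omega) a ha b hb l (by omega))
            ha (lco_fil hb)

theorem mulN_eventually (a b : Amb B) : ∃ n, ∀ l, n ≤ l → mulN B l a b = mulN B n a b := by
  obtain ⟨i, hi⟩ := exists_fil a
  obtain ⟨j, hj⟩ := exists_fil b
  exact ⟨i + j, fun l hl => mulN_stable (i + j) i j le_rfl a hi b hj l hl⟩

variable (B)

/-- The multiplication: the unique bilinear map for which
`π₀ (a b) = π₀ a π₀ b` and the tail of `a b` is `a₍₋₁₎ · m ⊗ a₍₀₎ y + m' · b₍₋₁₎ ⊗ x b₍₀₎`,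
where `m ⊗ y` and `m' ⊗ x` are the tails of `b` and `a`. -/
def mul : Amb B →ₗ[k] Amb B →ₗ[k] Amb B :=
  LinearMap.mk₂ k (fun a b => mulN B (mulN_eventually a b).choose a b)
    (fun a a' b => by
      obtain ⟨n, hn⟩ : ∃ n, n = max (mulN_eventually (a + a') b).choose
        (max (mulN_eventually a b).choose (mulN_eventually a' b).choose) := ⟨_, rfl⟩
      rw [← (mulN_eventually (a + a') b).choose_spec n (by omega),
        ← (mulN_eventually a b).choose_spec n (by omega),
        ← (mulN_eventually a' b).choose_spec n (by omega), map_add, LinearMap.add_apply])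
    (fun c a b => by
      obtain ⟨n, hn⟩ : ∃ n, n = max (mulN_eventually (c • a) b).choose
        (mulN_eventually a b).choose := ⟨_, rfl⟩
      rw [← (mulN_eventually (c • a) b).choose_spec n (by omega),
        ← (mulN_eventually a b).choose_spec n (by omega), map_smul, LinearMap.smul_apply])
    (fun a b b' => by
      obtain ⟨n, hn⟩ : ∃ n, n = max (mulN_eventually a (b + b')).choose
        (max (mulN_eventually a b).choose (mulN_eventually a b').choose) := ⟨_, rfl⟩
      rw [← (mulN_eventually a (b + b')).choose_spec n (by omega),
        ← (mulN_eventually a b).choose_spec n (by omega),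
        ← (mulN_eventually a b').choose_spec n (by omega), map_add])
    (fun c a b => by
      obtain ⟨n, hn⟩ : ∃ n, n = max (mulN_eventually a (c • b)).choose
        (mulN_eventually a b).choose := ⟨_, rfl⟩
      rw [← (mulN_eventually a (c • b)).choose_spec n (by omega),
        ← (mulN_eventually a b).choose_spec n (by omega), map_smul])

variable {B}

theorem mul_eq_mulN {i j : ℕ} {a b : Amb B} (ha : a ∈ fil B i) (hb : b ∈ fil B j) {n : ℕ}
    (hn : i + j ≤ n) : mul B a b = mulN B n a b := by
  change mulN B (mulN_eventually a b).choose a b = _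
  rw [← (mulN_eventually a b).choose_spec (max n (mulN_eventually a b).choose) (by omega),
    ← mulN_stable n i j hn a ha b hb (max n (mulN_eventually a b).choose) (by omega)]

theorem mul_eq (a b : Amb B) : mul B a b = inc B (pr0 B a * pr0 B b) +
    join B (TensorProduct.map₂ B.actL (mul B) (lco B a) (tail B b)) +
    join B (TensorProduct.map₂ B.actR.flip (mul B) (tail B a) (lco B b)) := by
  obtain ⟨i, hi⟩ := exists_fil a
  obtain ⟨j, hj⟩ := exists_fil b
  rw [mul_eq_mulN (fil_mono _ hi) (fil_mono _ hj) (n := i + j + 2) (by omega), mulN_succ]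
  have hi' := fil_mono _ hi
  have hj' := fil_mono _ hj
  congr 1
  · congr 2
    exact map₂_congr_fil _ (fun a ha b hb => (mul_eq_mulN ha hb (by omega)).symm)
      (lco_fil hi) hj'
  · congr 1
    exact map₂_congr_fil _ (fun a ha b hb => (mul_eq_mulN ha hb (by omega)).symm)
      hi' (lco_fil hj)

theorem pr0_mul (a b : Amb B) : pr0 B (mul B a b) = pr0 B a * pr0 B b := by
  rw [mul_eq]; simp

theorem tail_mul (a b : Amb B) : tail B (mul B a b) =
    TensorProduct.map₂ B.actL (mul B) (lco B a) (tail B b) +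
    TensorProduct.map₂ B.actR.flip (mul B) (tail B a) (lco B b) := by
  rw [mul_eq]; simp

end Mul


end Amb
end Ambient

section Ambient
variable {k H M : Type*} [Field k] [Ring H] [Bialgebra k H] [AddCommGroup M] [Module k M]
namespace Amb
variable {B : HopfBimodule k H M}

section Ring

theorem lco_mul (a b : Amb B) : lco B (mul B a b) =
    TensorProduct.map₂ (LinearMap.mul k H) (mul B) (lco B a) (lco B b) := by
  apply eq_of_lTensor
  · rw [pr0_lco, pr0_mul, Bialgebra.comul_mul, ← map₂_mul, ← pr0_lco, ← pr0_lco]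
    exact (map_map₂ (α := LinearMap.id) (β := LinearMap.id) (fun _ _ => rfl)
      (fun _ _ _ _ => pr0_mul _ _) (mem_tens_top _) (mem_tens_top _)).symm
  · have N1 : ∀ (s : H ⊗[k] Amb B) (t : M ⊗[k] Amb B),
        B.coactL.rTensor (Amb B) (TensorProduct.map₂ B.actL (mul B) s t) =
        TensorProduct.map₂ (TensorProduct.map₂ (LinearMap.mul k H) B.actL) (mul B)
          ((Coalgebra.comul (R := k)).rTensor (Amb B) s) (B.coactL.rTensor (Amb B) t) :=
      fun s t => map_map₂ (fun h m => B.coactL_actL h m) (fun _ _ _ _ => rfl) (mem_tens_top _)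
        (mem_tens_top _)
    have N2 : ∀ (s : M ⊗[k] Amb B) (t : H ⊗[k] Amb B),
        B.coactL.rTensor (Amb B) (TensorProduct.map₂ B.actR.flip (mul B) s t) =
        TensorProduct.map₂ (TensorProduct.map₂ (LinearMap.mul k H) B.actR.flip) (mul B)
          (B.coactL.rTensor (Amb B) s) ((Coalgebra.comul (R := k)).rTensor (Amb B) t) :=
      fun s t => map_map₂ (fun m h => by
        rw [LinearMap.flip_apply, B.coactL_actR, ← map₂_flip]; rfl) (fun _ _ _ _ => rfl)
        (mem_tens_top _) (mem_tens_top _)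
    have N3 : ∀ s t : H ⊗[k] Amb B,
        (tail B).lTensor H (TensorProduct.map₂ (LinearMap.mul k H) (mul B) s t) =
        TensorProduct.map₂ (LinearMap.mul k H) (TensorProduct.map₂ B.actL (mul B))
          ((lco B).lTensor H s) ((tail B).lTensor H t) +
        TensorProduct.map₂ (LinearMap.mul k H) (TensorProduct.map₂ B.actR.flip (mul B))
          ((tail B).lTensor H s) ((lco B).lTensor H t) :=
      tensor_induction₂ (by simp) (by simp)
        (fun s s' t h h' => by
          simp only [map_add, LinearMap.add_apply, h, h']; abel)
        (fun s t t' h h' => by simp only [map_add, h, h']; abel)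
        (fun h a g b => by simp [tail_mul, TensorProduct.tmul_add])
    rw [tail_lco, tail_mul, map_add, map_add, N1, N2, N3, map₂_assoc, map₂_assoc,
      lco_coassoc, lco_coassoc, tail_lco, tail_lco]

theorem mul_assoc_aux : ∀ (n i j l : ℕ), i + j + l ≤ n → ∀ a ∈ fil B i, ∀ b ∈ fil B j,
    ∀ c ∈ fil B l, mul B (mul B a b) c = mul B a (mul B b c) := by
  intro n
  induction n with
  | zero =>
    intro i j l hn a ha b hb c hc
    obtain rfl : i = 0 := by omega
    have : a = 0 := ha
    simp [this]
  | succ n ih =>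
    intro i j l hn a ha b hb c hc
    rcases i with _ | i
    · have : a = 0 := ha
      simp [this]
    rcases j with _ | j
    · have : b = 0 := hb
      simp [this]
    rcases l with _ | l
    · have : c = 0 := hc
      simp [this]
    have T1 : TensorProduct.map₂ B.actL (mul B)
        (TensorProduct.map₂ (LinearMap.mul k H) (mul B) (lco B a) (lco B b)) (tail B c) =
        TensorProduct.map₂ B.actL (mul B) (lco B a)
          (TensorProduct.map₂ B.actL (mul B) (lco B b) (tail B c)) := by
      refine tens_induction (P := fun r => TensorProduct.map₂ B.actL (mul B)
        (TensorProduct.map₂ (LinearMap.mul k H) (mul B) (lco B a) (lco B b)) r =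
        TensorProduct.map₂ B.actL (mul B) (lco B a)
          (TensorProduct.map₂ B.actL (mul B) (lco B b) r)) (by simp)
        (fun x y hx hy => by simp only [map_add, hx, hy]) (fun m _ y hy => ?_) hc
      refine tens_induction₂ (P := fun s t => TensorProduct.map₂ B.actL (mul B)
        (TensorProduct.map₂ (LinearMap.mul k H) (mul B) s t) (m ⊗ₜ y) =
        TensorProduct.map₂ B.actL (mul B) s
          (TensorProduct.map₂ B.actL (mul B) t (m ⊗ₜ y))) (by simp) (by simp)
        (fun s s' t h h' => by simp only [map_add, LinearMap.add_apply, h, h'])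
        (fun s t t' h h' => by simp only [map_add, LinearMap.add_apply, h, h'])
        (fun h _ x hx g _ z hz => ?_) (lco_fil ha) (lco_fil hb)
      simp [B.actL_mul, ih (i + 1) (j + 1) l (by omega) x hx z hz y hy]
    have T2 : TensorProduct.map₂ B.actR.flip (mul B)
        (TensorProduct.map₂ B.actL (mul B) (lco B a) (tail B b)) (lco B c) =
        TensorProduct.map₂ B.actL (mul B) (lco B a)
          (TensorProduct.map₂ B.actR.flip (mul B) (tail B b) (lco B c)) := by
      refine tens_induction (P := fun r => TensorProduct.map₂ B.actR.flip (mul B)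
        (TensorProduct.map₂ B.actL (mul B) (lco B a) r) (lco B c) =
        TensorProduct.map₂ B.actL (mul B) (lco B a)
          (TensorProduct.map₂ B.actR.flip (mul B) r (lco B c))) (by simp)
        (fun x y hx hy => by simp only [map_add, LinearMap.add_apply, hx, hy])
        (fun m _ y hy => ?_) hb
      refine tens_induction₂ (P := fun s t => TensorProduct.map₂ B.actR.flip (mul B)
        (TensorProduct.map₂ B.actL (mul B) s (m ⊗ₜ y)) t =
        TensorProduct.map₂ B.actL (mul B) s
          (TensorProduct.map₂ B.actR.flip (mul B) (m ⊗ₜ y) t)) (by simp) (by simp)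
        (fun s s' t h h' => by simp only [map_add, LinearMap.add_apply, h, h'])
        (fun s t t' h h' => by simp only [map_add, h, h'])
        (fun h _ x hx g _ z hz => ?_) (lco_fil ha) (lco_fil hc)
      simp [B.act_comm, ih (i + 1) j (l + 1) (by omega) x hx y hy z hz]
    have T3 : TensorProduct.map₂ B.actR.flip (mul B)
        (TensorProduct.map₂ B.actR.flip (mul B) (tail B a) (lco B b)) (lco B c) =
        TensorProduct.map₂ B.actR.flip (mul B) (tail B a)
          (TensorProduct.map₂ (LinearMap.mul k H) (mul B) (lco B b) (lco B c)) := by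
      refine tens_induction (P := fun r => TensorProduct.map₂ B.actR.flip (mul B)
        (TensorProduct.map₂ B.actR.flip (mul B) r (lco B b)) (lco B c) =
        TensorProduct.map₂ B.actR.flip (mul B) r
          (TensorProduct.map₂ (LinearMap.mul k H) (mul B) (lco B b) (lco B c))) (by simp)
        (fun x y hx hy => by simp only [map_add, LinearMap.add_apply, hx, hy])
        (fun m _ y hy => ?_) ha
      refine tens_induction₂ (P := fun s t => TensorProduct.map₂ B.actR.flip (mul B)
        (TensorProduct.map₂ B.actR.flip (mul B) (m ⊗ₜ y) s) t =
        TensorProduct.map₂ B.actR.flip (mul B) (m ⊗ₜ y)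
          (TensorProduct.map₂ (LinearMap.mul k H) (mul B) s t)) (by simp) (by simp)
        (fun s s' t h h' => by simp only [map_add, LinearMap.add_apply, h, h'])
        (fun s t t' h h' => by simp only [map_add, h, h'])
        (fun h _ x hx g _ z hz => ?_) (lco_fil hb) (lco_fil hc)
      simp [B.actR_mul, ih i (j + 1) (l + 1) (by omega) y hy x hx z hz]
    apply eq_of
    · simp only [pr0_mul, mul_assoc]
    · rw [tail_mul, lco_mul, tail_mul, map_add, LinearMap.add_apply, T1, T2, T3, tail_mul,
        lco_mul, tail_mul, map_add, add_assoc]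

theorem one_mul' (b : Amb B) : mul B (inc B 1) b = b := by
  refine hom_ext (f := mul B (inc B 1)) (g := LinearMap.id) (fun h => ?_) (fun m x ih => ?_) b
  · apply eq_of
    · simp [pr0_mul]
    · simp [tail_mul]
  · apply eq_of
    · simp [pr0_mul]
    · simp only [LinearMap.id_apply] at ih ⊢
      rw [tail_mul, lco_inc, Bialgebra.comul_one, Algebra.TensorProduct.one_def,
        LinearMap.lTensor_tmul, tail_cons, tail_inc]
      simp [B.actL_one, ih]

theorem mul_one' (b : Amb B) : mul B b (inc B 1) = b := by
  refine hom_ext (f := (mul B).flip (inc B 1)) (g := LinearMap.id) (fun h => ?_)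
    (fun m x ih => ?_) b
  · apply eq_of
    · simp [pr0_mul]
    · simp [tail_mul]
  · apply eq_of
    · simp [pr0_mul]
    · simp only [LinearMap.id_apply, LinearMap.flip_apply] at ih ⊢
      rw [tail_mul, lco_inc, Bialgebra.comul_one, Algebra.TensorProduct.one_def,
        LinearMap.lTensor_tmul, tail_cons, tail_inc]
      simp [B.actR_one, ih]

instance : Ring (Amb B) :=
  { (inferInstance : AddCommGroup (Amb B)) with
    mul := fun a b => mul B a b
    one := inc B 1
    mul_assoc := fun a b c => by
      obtain ⟨i, hi⟩ := exists_fil a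
      obtain ⟨j, hj⟩ := exists_fil b
      obtain ⟨l, hl⟩ := exists_fil c
      exact mul_assoc_aux _ i j l le_rfl a hi b hj c hl
    one_mul := one_mul'
    mul_one := mul_one'
    left_distrib := fun a b c => map_add (mul B a) b c
    right_distrib := fun a b c => by
      change mul B (a + b) c = _
      rw [map_add]; rfl
    zero_mul := fun a => by
      change mul B 0 a = 0
      rw [map_zero]; rfl
    mul_zero := fun a => map_zero (mul B a) }

theorem mul_def (a b : Amb B) : a * b = mul B a b := rfl
theorem one_def : (1 : Amb B) = inc B 1 := rfl

instance : Algebra k (Amb B) := Algebra.ofModule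
  (fun r a b => by rw [mul_def, mul_def, map_smul, LinearMap.smul_apply])
  (fun r a b => by rw [mul_def, mul_def, map_smul])

theorem comul_mul_aux : ∀ (n i j : ℕ), i + j ≤ n → ∀ a ∈ fil B i, ∀ b ∈ fil B j,
    comul B (mul B a b) = TensorProduct.map₂ (mul B) (mul B) (comul B a) (comul B b) := by
  intro n
  induction n with
  | zero =>
    intro i j hn a ha b hb
    obtain rfl : i = 0 := by omega
    have : a = 0 := ha
    simp [this]
  | succ n ih =>
    intro i j hn a ha b hb
    rcases i with _ | i
    · have : a = 0 := ha
      simp [this]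
    rcases j with _ | j
    · have : b = 0 := hb
      simp [this]
    apply eq_of_rTensor
    · rw [pr0_comul, lco_mul, ← pr0_comul, ← pr0_comul]
      exact (map_map₂ (α' := LinearMap.id) (β' := LinearMap.id) (fun _ _ => pr0_mul _ _)
        (fun _ _ _ _ => rfl) (mem_tens_top _) (mem_tens_top _)).symm
    · have N1 : (comul B).lTensor M (TensorProduct.map₂ B.actL (mul B) (lco B a) (tail B b)) =
          TensorProduct.map₂ B.actL (TensorProduct.map₂ (mul B) (mul B))
            ((comul B).lTensor H (lco B a)) ((comul B).lTensor M (tail B b)) :=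
        map_map₂ (fun _ _ => rfl) (fun x hx y hy => ih (i + 1) j (by omega) x hx y hy)
          (lco_fil ha) hb
      have N2 : (comul B).lTensor M (TensorProduct.map₂ B.actR.flip (mul B) (tail B a) (lco B b)) =
          TensorProduct.map₂ B.actR.flip (TensorProduct.map₂ (mul B) (mul B))
            ((comul B).lTensor M (tail B a)) ((comul B).lTensor H (lco B b)) :=
        map_map₂ (fun _ _ => rfl) (fun x hx y hy => ih i (j + 1) (by omega) x hx y hy)
          ha (lco_fil hb)
      have N3 : ∀ s t : Amb B ⊗[k] Amb B,
          (tail B).rTensor (Amb B) (TensorProduct.map₂ (mul B) (mul B) s t) =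
          TensorProduct.map₂ (TensorProduct.map₂ B.actL (mul B)) (mul B)
            ((lco B).rTensor (Amb B) s) ((tail B).rTensor (Amb B) t) +
          TensorProduct.map₂ (TensorProduct.map₂ B.actR.flip (mul B)) (mul B)
            ((tail B).rTensor (Amb B) s) ((lco B).rTensor (Amb B) t) :=
        tensor_induction₂ (by simp) (by simp)
          (fun s s' t h h' => by
            simp only [map_add, LinearMap.add_apply, h, h']; abel)
          (fun s t t' h h' => by simp only [map_add, h, h']; abel)
          (fun h a g b => by simp [tail_mul, TensorProduct.add_tmul])
      have L : ∀ x, (lco B).rTensor (Amb B) (comul B x) =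
          (TensorProduct.assoc k H (Amb B) (Amb B)).symm ((comul B).lTensor H (lco B x)) := by
        intro x
        rw [LinearEquiv.eq_symm_apply, lco_comul]
      rw [tail_comul, tail_mul, map_add, map_add, N1, N2, N3, tail_comul, tail_comul, L, L,
        map₂_assoc_symm, map₂_assoc_symm]

instance : Bialgebra k (Amb B) :=
  Bialgebra.mk' k (Amb B)
    (by change counit B (inc B 1) = 1; simp [counit])
    (fun {a b} => by
      change counit B (mul B a b) = counit B a * counit B b
      simp [counit, pr0_mul])
    (by
      change comul B (inc B 1) = 1
      rw [comul_inc, Bialgebra.comul_one]; rfl)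
    (fun {a b} => by
      obtain ⟨i, hi⟩ := exists_fil a
      obtain ⟨j, hj⟩ := exists_fil b
      change comul B (mul B a b) = comul B a * comul B b
      rw [comul_mul_aux _ i j le_rfl a hi b hj, ← map₂_mul]; rfl)

end Ring

end Amb
end Ambient

section Ambient
variable {k H M : Type*} [Field k] [Ring H] [Bialgebra k H] [AddCommGroup M] [Module k M]
namespace Amb
variable {B : HopfBimodule k H M}

section Cotensor
variable (B)

/-- The difference of the two maps `M ⊗ N ⇉ M ⊗ H ⊗ N` whose equalizer is `M □_H N`. -/
def cotEq : M ⊗[k] Amb B →ₗ[k] M ⊗[k] (H ⊗[k] Amb B) :=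
  (TensorProduct.assoc k M H (Amb B)).toLinearMap ∘ₗ B.coactR.rTensor (Amb B) -
    (lco B).lTensor M

/-- The iterated cotensor product: `cot 0 = H` and `cot (n + 1) = M □_H cot n`, so that
`cot n = M □_H ⋯ □_H M □_H H`, which is `M □_H ⋯ □_H M` (`n` factors) when `0 < n`. -/
def cot : ℕ → Submodule k (Amb B)
  | 0 => LinearMap.range (inc B)
  | n + 1 => (tens ⊤ (cot n) ⊓ LinearMap.ker (cotEq B)).map (join B)

/-- The component of the comultiplication whose left factor has degree `i`. -/
def comulN : ℕ → (Amb B →ₗ[k] Amb B ⊗[k] Amb B)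
  | 0 => (inc B).rTensor (Amb B) ∘ₗ lco B
  | i + 1 => (join B).rTensor (Amb B) ∘ₗ (TensorProduct.assoc k M (Amb B) (Amb B)).symm.toLinearMap
      ∘ₗ (comulN i).lTensor M ∘ₗ tail B

variable {B}

theorem cotEq_eq_zero {z : M ⊗[k] Amb B} : cotEq B z = 0 ↔
    TensorProduct.assoc k M H (Amb B) (B.coactR.rTensor (Amb B) z) = (lco B).lTensor M z :=
  sub_eq_zero

theorem lco_comulN (i : ℕ) (x : Amb B) :
    TensorProduct.assoc k H (Amb B) (Amb B) ((lco B).rTensor (Amb B) (comulN B i x)) =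
      (comulN B i).lTensor H (lco B x) := by
  have e1 : lco B ∘ₗ inc B = (inc B).lTensor H ∘ₗ Coalgebra.comul := by
    ext h; exact lco_inc h
  have e2 : lco B ∘ₗ join B = (join B).lTensor H ∘ₗ
      (TensorProduct.assoc k H M (Amb B)).toLinearMap ∘ₗ B.coactL.rTensor (Amb B) := by
    apply LinearMap.ext; intro z; exact lco_join z
  cases i with
  | zero =>
    simp only [comulN, LinearMap.comp_apply]
    rw [← LinearMap.rTensor_comp_apply, e1]
    simp only [LinearMap.rTensor_comp, LinearMap.lTensor_comp, LinearMap.comp_apply, nat2,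
      lco_coassoc]
  | succ i =>
    simp only [comulN, LinearMap.comp_apply]
    rw [← LinearMap.rTensor_comp_apply, e2]
    simp only [LinearMap.rTensor_comp, LinearMap.lTensor_comp, LinearMap.comp_apply, nat2,
      tail_lco, coactL_assoc_symm, lr_comm, nat3, LinearEquiv.coe_coe]

theorem lco_cot : ∀ (n : ℕ) (x : Amb B), x ∈ cot B n → lco B x ∈ tens (⊤ : Submodule k H) (cot B n) := by
  intro n x hx
  cases n with
  | zero =>
    obtain ⟨h, rfl⟩ := hx
    rw [lco_inc]
    exact map_mem_tens (S' := ⊤) (T' := cot B 0) LinearMap.id (inc B) (fun _ _ => trivial) (fun h _ => ⟨h, rfl⟩)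
      (mem_tens_top _)
  | succ n =>
    obtain ⟨z, ⟨hz, hz0⟩, rfl⟩ := hx
    rw [lco_join]
    have hz0' := cotEq_eq_zero.1 hz0
    have h1 : TensorProduct.assoc k H M (Amb B) (B.coactL.rTensor (Amb B) z) ∈
        tens (⊤ : Submodule k H) (tens (⊤ : Submodule k M) (cot B n)) := by
      refine tens_induction (P := fun z => TensorProduct.assoc k H M (Amb B)
        (B.coactL.rTensor (Amb B) z) ∈ tens (⊤ : Submodule k H) (tens (⊤ : Submodule k M) (cot B n)))
        (by simp) (fun x y hx hy => by rw [map_add, map_add]; exact add_mem hx hy)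
        (fun m _ y hy => ?_) hz
      rw [LinearMap.rTensor_tmul]
      generalize B.coactL m = t
      induction t using TensorProduct.induction_on with
      | zero => simp
      | tmul a b => exact tmul_mem_tens trivial (tmul_mem_tens trivial hy)
      | add x y hx hy => rw [TensorProduct.add_tmul, map_add]; exact add_mem hx hy
    have e : B.coactR.lTensor H ∘ₗ B.coactL =
        (TensorProduct.assoc k H M H).toLinearMap ∘ₗ B.coactL.rTensor H ∘ₗ B.coactR :=
      LinearMap.ext fun m => (B.coact_comm m).symm
    have p := penta (k := k) ((TensorProduct.assoc k H M H).toLinearMap.rTensor (Amb B)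
      ((B.coactL.rTensor H).rTensor (Amb B) (B.coactR.rTensor (Amb B) z)))
    rw [← LinearMap.rTensor_comp_apply (Amb B) (TensorProduct.assoc k H M H).symm.toLinearMap,
      LinearEquiv.symm_comp, LinearMap.rTensor_id, LinearMap.id_apply, nat1] at p
    have h2 : (cotEq B).lTensor H
        (TensorProduct.assoc k H M (Amb B) (B.coactL.rTensor (Amb B) z)) = 0 := by
      rw [cotEq, LinearMap.lTensor_sub, LinearMap.sub_apply, sub_eq_zero,
        LinearMap.lTensor_comp_apply, ← nat2, ← LinearMap.rTensor_comp_apply, e,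
        LinearMap.rTensor_comp_apply, LinearMap.rTensor_comp_apply, ← p, hz0', ← nat3, lr_comm]
    exact map_mem_tens (T' := cot B (n + 1)) LinearMap.id (join B) (fun _ h => h) (fun z hz => ⟨z, hz, rfl⟩)
      (tens_ker_left (cotEq B) h1 h2)

theorem comulN_cot : ∀ (i j : ℕ) (x : Amb B), x ∈ cot B (i + j) →
    comulN B i x ∈ tens (cot B i) (cot B j) := by
  intro i
  induction i with
  | zero =>
    intro j x hx
    rw [zero_add] at hx
    exact map_mem_tens (S' := cot B 0) (inc B) LinearMap.id (fun h _ => ⟨h, rfl⟩) (fun _ h => h) (lco_cot j x hx)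
  | succ i ih =>
    intro j x hx
    rw [show i + 1 + j = (i + j) + 1 by omega] at hx
    obtain ⟨z, ⟨hz, hz0⟩, rfl⟩ := hx
    have hz0' := cotEq_eq_zero.1 hz0
    simp only [comulN, LinearMap.comp_apply, tail_join, LinearEquiv.coe_coe]
    set y := (TensorProduct.assoc k M (Amb B) (Amb B)).symm ((comulN B i).lTensor M z) with hy
    have h1 : y ∈ tens (tens (⊤ : Submodule k M) (cot B i)) (cot B j) := by
      refine tens_induction (P := fun z => (TensorProduct.assoc k M (Amb B) (Amb B)).symm
        ((comulN B i).lTensor M z) ∈ tens (tens (⊤ : Submodule k M) (cot B i)) (cot B j))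
        (by simp) (fun x y hx hy => by rw [map_add, map_add]; exact add_mem hx hy)
        (fun m _ x hx => ?_) hz
      rw [LinearMap.lTensor_tmul]
      refine tens_induction (P := fun t => (TensorProduct.assoc k M (Amb B) (Amb B)).symm (m ⊗ₜ t)
        ∈ tens (tens (⊤ : Submodule k M) (cot B i)) (cot B j)) (by simp)
        (fun x y hx hy => by rw [TensorProduct.tmul_add, map_add]; exact add_mem hx hy)
        (fun a ha b hb => ?_) (ih j x hx)
      exact tmul_mem_tens (tmul_mem_tens trivial ha) hb
    have p := penta (k := k) ((TensorProduct.assoc k M H (Amb B)).toLinearMap.rTensor (Amb B)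
      ((B.coactR.rTensor (Amb B)).rTensor (Amb B) y))
    rw [← LinearMap.rTensor_comp_apply (Amb B) (TensorProduct.assoc k M H (Amb B)).symm.toLinearMap,
      LinearEquiv.symm_comp, LinearMap.rTensor_id, LinearMap.id_apply, nat1, hy,
      LinearEquiv.apply_symm_apply, lr_comm, nat3, hz0'] at p
    have e : (TensorProduct.assoc k H (Amb B) (Amb B)).toLinearMap ∘ₗ (lco B).rTensor (Amb B) ∘ₗ
        comulN B i = (comulN B i).lTensor H ∘ₗ lco B := LinearMap.ext (lco_comulN i)
    have h2 : (cotEq B).rTensor (Amb B) y = 0 := by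
      rw [cotEq, LinearMap.rTensor_sub, LinearMap.sub_apply, sub_eq_zero,
        LinearMap.rTensor_comp_apply]
      apply (TensorProduct.assoc k M (H ⊗[k] Amb B) (Amb B)).injective
      apply ((TensorProduct.assoc k H (Amb B) (Amb B)).lTensor M).injective
      refine Eq.trans p.symm ?_
      rw [nat2, hy, LinearEquiv.apply_symm_apply]
      refine Eq.trans (LinearMap.lTensor_comp_apply M _ _ z).symm ?_
      rw [← e, LinearMap.lTensor_comp_apply, LinearMap.lTensor_comp_apply]
      rfl
    exact map_mem_tens (S' := cot B (i + 1)) (join B) LinearMap.id (fun z hz => ⟨z, hz, rfl⟩) (fun _ h => h)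
      (tens_ker_right (cotEq B) h1 h2)

theorem comul_eq_sum : ∀ (n : ℕ) (x : Amb B), x ∈ cot B n →
    comul B x = ∑ i ∈ Finset.range (n + 1), comulN B i x := by
  intro n
  induction n with
  | zero =>
    rintro x ⟨h, rfl⟩
    rw [comul_eq]
    simp [comulN]
  | succ n ih =>
    rintro x ⟨z, ⟨hz, -⟩, rfl⟩
    rw [comul_eq, Finset.sum_range_succ', add_comm]
    congr 1
    simp only [comulN, LinearMap.comp_apply, tail_join, LinearEquiv.coe_coe]
    rw [← map_sum, ← map_sum]
    refine congrArg _ (congrArg _ ?_)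
    refine tens_induction (P := fun z => (comul B).lTensor M z =
      ∑ i ∈ Finset.range (n + 1), (comulN B i).lTensor M z) (by simp)
      (fun x y hx hy => by simp only [map_add, Finset.sum_add_distrib, hx, hy])
      (fun m _ x hx => ?_) hz
    simp only [LinearMap.lTensor_tmul, ih x hx, TensorProduct.tmul_sum]

theorem tail_cot {n : ℕ} {x : Amb B} (hx : x ∈ cot B (n + 1)) :
    tail B x ∈ tens (⊤ : Submodule k M) (cot B n) ∧ cotEq B (tail B x) = 0 := by
  obtain ⟨z, ⟨hz, hz0⟩, rfl⟩ := hx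
  rw [tail_join]
  exact ⟨hz, hz0⟩

theorem cotEq_actL (x : Amb B) {t : M ⊗[k] Amb B} (ht : cotEq B t = 0) :
    cotEq B (TensorProduct.map₂ B.actL (mul B) (lco B x) t) = 0 := by
  rw [cotEq_eq_zero] at ht ⊢
  have N1 : B.coactR.rTensor (Amb B) (TensorProduct.map₂ B.actL (mul B) (lco B x) t) =
      TensorProduct.map₂ (TensorProduct.map₂ B.actL (LinearMap.mul k H)) (mul B)
        ((Coalgebra.comul (R := k)).rTensor (Amb B) (lco B x)) (B.coactR.rTensor (Amb B) t) :=
    map_map₂ (fun h m => B.coactR_actL h m) (fun _ _ _ _ => rfl) (mem_tens_top _) (mem_tens_top _)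
  have N2 : (lco B).lTensor M (TensorProduct.map₂ B.actL (mul B) (lco B x) t) =
      TensorProduct.map₂ B.actL (TensorProduct.map₂ (LinearMap.mul k H) (mul B))
        ((lco B).lTensor H (lco B x)) ((lco B).lTensor M t) :=
    map_map₂ (fun _ _ => rfl) (fun _ _ _ _ => lco_mul _ _) (mem_tens_top _) (mem_tens_top _)
  rw [N1, map₂_assoc, N2, lco_coassoc, ht]

theorem cotEq_actR (x : Amb B) {t : M ⊗[k] Amb B} (ht : cotEq B t = 0) :
    cotEq B (TensorProduct.map₂ B.actR.flip (mul B) t (lco B x)) = 0 := by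
  rw [cotEq_eq_zero] at ht ⊢
  have N1 : B.coactR.rTensor (Amb B) (TensorProduct.map₂ B.actR.flip (mul B) t (lco B x)) =
      TensorProduct.map₂ (TensorProduct.map₂ B.actR.flip (LinearMap.mul k H)) (mul B)
        (B.coactR.rTensor (Amb B) t) ((Coalgebra.comul (R := k)).rTensor (Amb B) (lco B x)) :=
    map_map₂ (fun m h => by
      rw [LinearMap.flip_apply, B.coactR_actR, ← map₂_flip]; rfl) (fun _ _ _ _ => rfl)
      (mem_tens_top _) (mem_tens_top _)
  have N2 : (lco B).lTensor M (TensorProduct.map₂ B.actR.flip (mul B) t (lco B x)) =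
      TensorProduct.map₂ B.actR.flip (TensorProduct.map₂ (LinearMap.mul k H) (mul B))
        ((lco B).lTensor M t) ((lco B).lTensor H (lco B x)) :=
    map_map₂ (fun _ _ => rfl) (fun _ _ _ _ => lco_mul _ _) (mem_tens_top _) (mem_tens_top _)
  rw [N1, map₂_assoc, N2, lco_coassoc, ht]

theorem map₂_mem_tens {V W X : Type*} [AddCommGroup V] [Module k V] [AddCommGroup W] [Module k W]
    [AddCommGroup X] [Module k X] (f : V →ₗ[k] W →ₗ[k] X) {S T U : Submodule k (Amb B)}
    (h : ∀ a ∈ S, ∀ b ∈ T, mul B a b ∈ U)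
    {s : V ⊗[k] Amb B} {t : W ⊗[k] Amb B} (hs : s ∈ tens (⊤ : Submodule k V) S)
    (ht : t ∈ tens (⊤ : Submodule k W) T) :
    TensorProduct.map₂ f (mul B) s t ∈ tens (⊤ : Submodule k X) U :=
  tens_induction₂ (P := fun s t => TensorProduct.map₂ f (mul B) s t ∈ tens (⊤ : Submodule k X) U)
    (by simp) (by simp)
    (fun s s' t h h' => by rw [map_add, LinearMap.add_apply]; exact add_mem h h')
    (fun s t t' h h' => by rw [map_add]; exact add_mem h h')
    (fun v _ a ha w _ b hb => by
      rw [TensorProduct.map₂_apply_tmul]; exact tmul_mem_tens trivial (h a ha b hb)) hs ht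

theorem mul_cot : ∀ (n i j : ℕ), i + j = n → ∀ a ∈ cot B i, ∀ b ∈ cot B j,
    mul B a b ∈ cot B n := by
  intro n
  induction n with
  | zero =>
    intro i j hn a ha b hb
    obtain rfl : i = 0 := by omega
    obtain rfl : j = 0 := by omega
    obtain ⟨h, rfl⟩ := ha
    obtain ⟨g, rfl⟩ := hb
    exact ⟨h * g, by rw [mul_eq]; simp⟩
  | succ n ih =>
    intro i j hn a ha b hb
    have hp : pr0 B a * pr0 B b = 0 := by
      rcases i with _ | i
      · rcases j with _ | j
        · omega
        · obtain ⟨z, -, rfl⟩ := hb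
          simp
      · obtain ⟨z, -, rfl⟩ := ha
        simp
    rw [mul_eq, hp, map_zero, zero_add]
    refine add_mem ?_ ?_
    · rcases j with _ | j
      · obtain ⟨g, rfl⟩ := hb
        simp
      · obtain ⟨h1, h2⟩ := tail_cot hb
        exact ⟨_, ⟨map₂_mem_tens _ (fun a ha b hb => ih i j (by omega) a ha b hb)
          (lco_cot _ _ ha) h1, cotEq_actL a h2⟩, rfl⟩
    · rcases i with _ | i
      · obtain ⟨g, rfl⟩ := ha
        simp
      · obtain ⟨h1, h2⟩ := tail_cot ha
        exact ⟨_, ⟨map₂_mem_tens _ (fun a ha b hb => ih i j (by omega) a ha b hb)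
          h1 (lco_cot _ _ hb), cotEq_actR b h2⟩, rfl⟩

variable (B)

/-- The cotensor algebra `⨁ₙ □ⁿ M` as a subalgebra of `Amb B`. -/
def cotensor : Subalgebra k (Amb B) where
  carrier := (⨆ n, cot B n : Submodule k (Amb B))
  mul_mem' := fun {a b} ha hb => by
    refine Submodule.iSup_induction (cot B) (motive := fun a => a * b ∈ ⨆ n, cot B n) ha
      (fun i a ha => ?_) (by simp) (fun x y hx hy => by rw [add_mul]; exact add_mem hx hy)
    refine Submodule.iSup_induction (cot B) (motive := fun b => a * b ∈ ⨆ n, cot B n) hb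
      (fun j b hb => ?_) (by simp) (fun x y hx hy => by rw [mul_add]; exact add_mem hx hy)
    exact Submodule.mem_iSup_of_mem (i + j) (mul_cot _ i j rfl a ha b hb)
  add_mem' := fun ha hb => add_mem ha hb
  algebraMap_mem' := fun r => Submodule.mem_iSup_of_mem 0 ⟨r • 1, by
    rw [Algebra.algebraMap_eq_smul_one, map_smul, one_def]⟩

theorem cotensor_isSubcoalgebra : IsSubcoalgebra (Subalgebra.toSubmodule (cotensor B)) := by
  intro a ha
  refine Submodule.iSup_induction (cot B) (motive := fun a => Coalgebra.comul (R := k) a ∈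
    tens (Subalgebra.toSubmodule (cotensor B)) (Subalgebra.toSubmodule (cotensor B))) ha
    (fun n a ha => ?_) (by simp) (fun x y hx hy => by rw [map_add]; exact add_mem hx hy)
  change comul B a ∈ _
  rw [comul_eq_sum n a ha]
  refine Submodule.sum_mem _ fun i hi => ?_
  have hi' : i ≤ n := by simpa [Nat.lt_succ_iff] using hi
  refine tens_mono (fun x hx => Submodule.mem_iSup_of_mem i hx)
    (fun x hx => Submodule.mem_iSup_of_mem (n - i) hx) (comulN_cot i (n - i) a ?_)
  rwa [Nat.add_sub_cancel' hi']

end Cotensor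


end Amb
end Ambient

section TypeOne
variable {k : Type*} [Field k]

theorem tens_mul_mem {A : Type*} [Ring A] [Algebra k A] (S : Subalgebra k A) {s t : A ⊗[k] A}
    (hs : s ∈ tens (Subalgebra.toSubmodule S) (Subalgebra.toSubmodule S))
    (ht : t ∈ tens (Subalgebra.toSubmodule S) (Subalgebra.toSubmodule S)) :
    s * t ∈ tens (Subalgebra.toSubmodule S) (Subalgebra.toSubmodule S) :=
  tens_induction₂ (P := fun s t => s * t ∈ tens (Subalgebra.toSubmodule S)
      (Subalgebra.toSubmodule S)) (fun t => by rw [zero_mul]; exact zero_mem _)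
    (fun t => by rw [mul_zero]; exact zero_mem _)
    (fun s s' t h h' => by rw [add_mul]; exact add_mem h h')
    (fun s t t' h h' => by rw [mul_add]; exact add_mem h h')
    (fun a ha a' ha' b hb b' hb' => by
      rw [Algebra.TensorProduct.tmul_mul_tmul]
      exact tmul_mem_tens (S.mul_mem ha hb) (S.mul_mem ha' hb')) hs ht

theorem adjoin_isSubcoalgebra {A : Type*} [Ring A] [Bialgebra k A] (X : Set A)
    (h : ∀ x ∈ X, Coalgebra.comul (R := k) x ∈ tens (Subalgebra.toSubmodule (Algebra.adjoin k X))
      (Subalgebra.toSubmodule (Algebra.adjoin k X))) :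
    IsSubcoalgebra (Subalgebra.toSubmodule (Algebra.adjoin k X)) := by
  intro a ha
  refine Algebra.adjoin_induction (p := fun a _ => Coalgebra.comul (R := k) a ∈
    tens (Subalgebra.toSubmodule (Algebra.adjoin k X))
      (Subalgebra.toSubmodule (Algebra.adjoin k X))) h (fun r => ?_) (fun x y _ _ hx hy => ?_)
    (fun x y _ _ hx hy => ?_) ha
  · rw [Bialgebra.comul_algebraMap, Algebra.algebraMap_eq_smul_one,
      Algebra.TensorProduct.one_def]
    exact Submodule.smul_mem _ _ (tmul_mem_tens (one_mem (Algebra.adjoin k X))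
      (one_mem (Algebra.adjoin k X)))
  · rw [map_add]
    exact add_mem hx hy
  · rw [Bialgebra.comul_mul]
    exact tens_mul_mem _ hx hy

variable {H M : Type*} [Ring H] [Bialgebra k H] [AddCommGroup M] [Module k M]

/-- The subalgebra of the cotensor algebra generated by its components of degree `0` (that is
`H`) and of degree `1` (that is `M □_H H ≅ M`). -/
def typeOne (B : HopfBimodule k H M) : Subalgebra k (Amb B) :=
  Algebra.adjoin k ((Amb.cot B 0 : Set (Amb B)) ∪ Amb.cot B 1)

theorem typeOne_isSubcoalgebra (B : HopfBimodule k H M) :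
    IsSubcoalgebra (Subalgebra.toSubmodule (typeOne B)) := by
  have h0 : Amb.cot B 0 ≤ Subalgebra.toSubmodule (typeOne B) :=
    fun x hx => Algebra.subset_adjoin (Or.inl hx)
  have h1 : Amb.cot B 1 ≤ Subalgebra.toSubmodule (typeOne B) :=
    fun x hx => Algebra.subset_adjoin (Or.inr hx)
  refine adjoin_isSubcoalgebra _ ?_
  rintro x (hx | hx)
  · change Amb.comul B x ∈ _
    rw [Amb.comul_eq_sum 0 x hx, Finset.sum_range_one]
    exact tens_mono h0 h0 (Amb.comulN_cot 0 0 x hx)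
  · change Amb.comul B x ∈ _
    rw [Amb.comul_eq_sum 1 x hx, Finset.sum_range_succ, Finset.sum_range_one]
    exact add_mem (tens_mono h0 h1 (Amb.comulN_cot 0 1 x hx))
      (tens_mono h1 h0 (Amb.comulN_cot 1 0 x hx))

/-- The cotensor bialgebra `T^c_H(M)`; it is a Hopf algebra when `H` is one. -/
def CotensorAlg (B : HopfBimodule k H M) : Type _ := Amb.cotensor B

namespace CotensorAlg
variable (B : HopfBimodule k H M)

instance : Ring (CotensorAlg B) := inferInstanceAs (Ring (Amb.cotensor B))
instance : Bialgebra k (CotensorAlg B) :=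
  subBialgebra (Amb.cotensor B) (Amb.cotensor_isSubcoalgebra B)

/-- The grading of `T^c_H(M)`, with component `M □_H ⋯ □_H M` in degree `n`. -/
def grade (n : ℕ) : Submodule k (CotensorAlg B) :=
  (Amb.cot B n).comap (Subalgebra.toSubmodule (Amb.cotensor B)).subtype

end CotensorAlg

/-- The bialgebra of type one `H[M]`, the subalgebra of `T^c_H(M)` generated by `H` and `M`; it is
a Hopf algebra when `H` is one. -/
def TypeOneAlg (B : HopfBimodule k H M) : Type _ := typeOne B

namespace TypeOneAlg
variable (B : HopfBimodule k H M)

instance : Ring (TypeOneAlg B) := inferInstanceAs (Ring (typeOne B))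
instance : Bialgebra k (TypeOneAlg B) := subBialgebra (typeOne B) (typeOne_isSubcoalgebra B)

/-- The grading of `H[M]`, induced from `T^c_H(M)`. -/
def grade (n : ℕ) : Submodule k (TypeOneAlg B) :=
  (Amb.cot B n).comap (Subalgebra.toSubmodule (typeOne B)).subtype

end TypeOneAlg

end TypeOne

section TensorAlg
variable {k H M : Type*} [Field k] [Ring H] [Bialgebra k H] [AddCommGroup M] [Module k M]

/-- The defining relations of `T_H(M)` in the free algebra on the vector space `H × M`. -/
inductive TensorAlgRel (B : HopfBimodule k H M) :
    TensorAlgebra k (H × M) → TensorAlgebra k (H × M) → Prop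
  | one : TensorAlgRel B (TensorAlgebra.ι k (1, 0)) 1
  | mul (a b : H) : TensorAlgRel B (TensorAlgebra.ι k (a * b, 0))
      (TensorAlgebra.ι k (a, 0) * TensorAlgebra.ι k (b, 0))
  | actL (a : H) (m : M) : TensorAlgRel B (TensorAlgebra.ι k (0, B.actL a m))
      (TensorAlgebra.ι k (a, 0) * TensorAlgebra.ι k (0, m))
  | actR (a : H) (m : M) : TensorAlgRel B (TensorAlgebra.ι k (0, B.actR a m))
      (TensorAlgebra.ι k (0, m) * TensorAlgebra.ι k (a, 0))

/-- The tensor algebra `T_H(M)` of the `H`-bimodule `M`, as the universal algebra with an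
algebra map from `H` and an `H`-bimodule map from `M`. -/
def TensorAlg (B : HopfBimodule k H M) : Type _ := RingQuot (TensorAlgRel B)

namespace TensorAlg
variable (B : HopfBimodule k H M)

instance : Ring (TensorAlg B) := inferInstanceAs (Ring (RingQuot (TensorAlgRel B)))
instance : Algebra k (TensorAlg B) := inferInstanceAs (Algebra k (RingQuot (TensorAlgRel B)))

/-- The quotient map. -/
def π : TensorAlgebra k (H × M) →ₐ[k] TensorAlg B := RingQuot.mkAlgHom k (TensorAlgRel B)

/-- The algebra map `H → T_H(M)`. -/
def ιH : H →ₐ[k] TensorAlg B :=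
  AlgHom.ofLinearMap ((π B).toLinearMap ∘ₗ TensorAlgebra.ι k ∘ₗ LinearMap.inl k H M)
    ((RingQuot.mkAlgHom_rel k (TensorAlgRel.one (B := B))).trans (map_one (π B)))
    (fun a b => (RingQuot.mkAlgHom_rel k (TensorAlgRel.mul (B := B) a b)).trans
      (map_mul (π B) _ _))

/-- The bimodule map `M → T_H(M)`. -/
def ιM : M →ₗ[k] TensorAlg B :=
  (π B).toLinearMap ∘ₗ TensorAlgebra.ι k ∘ₗ LinearMap.inr k H M

variable {B}

theorem ιM_actL (a : H) (m : M) : ιM B (B.actL a m) = ιH B a * ιM B m :=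
  (RingQuot.mkAlgHom_rel k (TensorAlgRel.actL (B := B) a m)).trans (map_mul (π B) _ _)

theorem ιM_actR (a : H) (m : M) : ιM B (B.actR a m) = ιM B m * ιH B a :=
  (RingQuot.mkAlgHom_rel k (TensorAlgRel.actR (B := B) a m)).trans (map_mul (π B) _ _)

variable (B) in
/-- The universal property of `T_H(M)`. -/
def lift {A : Type*} [Ring A] [Algebra k A] (f : H →ₐ[k] A) (g : M →ₗ[k] A)
    (hL : ∀ a m, g (B.actL a m) = f a * g m) (hR : ∀ a m, g (B.actR a m) = g m * f a) :
    TensorAlg B →ₐ[k] A :=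
  RingQuot.liftAlgHom k ⟨TensorAlgebra.lift k (f.toLinearMap.coprod g), fun x y h => by
    cases h <;> simp [hL, hR]⟩

section
variable {A : Type*} [Ring A] [Algebra k A] {f : H →ₐ[k] A} {g : M →ₗ[k] A}
    {hL : ∀ a m, g (B.actL a m) = f a * g m} {hR : ∀ a m, g (B.actR a m) = g m * f a}

@[simp] theorem lift_ιH (a : H) : lift B f g hL hR (ιH B a) = f a := by
  refine (RingQuot.liftAlgHom_mkAlgHom_apply k _ _ _).trans ?_
  simp

@[simp] theorem lift_ιM (m : M) : lift B f g hL hR (ιM B m) = g m := by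
  refine (RingQuot.liftAlgHom_mkAlgHom_apply k _ _ _).trans ?_
  simp

theorem hom_ext {f g : TensorAlg B →ₐ[k] A} (h : ∀ a, f (ιH B a) = g (ιH B a))
    (h' : ∀ m, f (ιM B m) = g (ιM B m)) : f = g := by
  refine RingQuot.ringQuot_ext' k _ _ (TensorAlgebra.hom_ext (LinearMap.prod_ext ?_ ?_))
  · exact LinearMap.ext h
  · exact LinearMap.ext h'
end

variable (B)

/-- The sum of the two coactions on `M`, in `T_H(M) ⊗ T_H(M)`. -/
def comulM : M →ₗ[k] TensorAlg B ⊗[k] TensorAlg B :=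
  TensorProduct.map (ιH B).toLinearMap (ιM B) ∘ₗ B.coactL +
    TensorProduct.map (ιM B) (ιH B).toLinearMap ∘ₗ B.coactR

/-- The comultiplication: the given one on `H`, the sum of both coactions on `M`. -/
def comul : TensorAlg B →ₐ[k] TensorAlg B ⊗[k] TensorAlg B :=
  lift B ((Algebra.TensorProduct.map (ιH B) (ιH B)).comp (Bialgebra.comulAlgHom k H)) (comulM B)
    (fun a m => by
      have h (s : H ⊗[k] H) : Algebra.TensorProduct.map (ιH B) (ιH B) s =
        TensorProduct.map (ιH B).toLinearMap (ιH B).toLinearMap s := rfl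
      simp only [comulM, LinearMap.add_apply, LinearMap.comp_apply, AlgHom.comp_apply,
        Bialgebra.comulAlgHom_apply, h, mul_add, B.coactL_actL, B.coactR_actL, ← map₂_mul]
      congr 1
      · exact map_map₂ (fun a b => map_mul (ιH B) a b) (fun _ _ _ _ => ιM_actL _ _)
          (mem_tens_top _) (mem_tens_top _)
      · exact map_map₂ (fun a b => ιM_actL _ _) (fun _ _ _ _ => map_mul (ιH B) _ _)
          (mem_tens_top _) (mem_tens_top _))
    (fun a m => by
      have h (s : H ⊗[k] H) : Algebra.TensorProduct.map (ιH B) (ιH B) s =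
        TensorProduct.map (ιH B).toLinearMap (ιH B).toLinearMap s := rfl
      simp only [comulM, LinearMap.add_apply, LinearMap.comp_apply, AlgHom.comp_apply,
        Bialgebra.comulAlgHom_apply, h, add_mul, B.coactL_actR, B.coactR_actR, ← map₂_mul]
      congr 1
      · rw [← map₂_flip (LinearMap.mul k (TensorAlg B))]
        exact map_map₂ (fun a b => map_mul (ιH B) _ _) (fun _ _ _ _ => ιM_actR _ _)
          (mem_tens_top _) (mem_tens_top _)
      · rw [← map₂_flip (LinearMap.mul k (TensorAlg B))]
        exact map_map₂ (fun a b => ιM_actR _ _) (fun _ _ _ _ => map_mul (ιH B) _ _)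
          (mem_tens_top _) (mem_tens_top _))

/-- The counit: the given one on `H`, zero on `M`. -/
def counit : TensorAlg B →ₐ[k] k :=
  lift B (Bialgebra.counitAlgHom k H) 0 (by simp) (by simp)

variable {B}

theorem comul_ιH (a : H) : comul B (ιH B a) =
    TensorProduct.map (ιH B).toLinearMap (ιH B).toLinearMap (Coalgebra.comul (R := k) a) :=
  lift_ιH a

theorem comul_ιM (m : M) : comul B (ιM B m) =
    TensorProduct.map (ιH B).toLinearMap (ιM B) (B.coactL m) +
      TensorProduct.map (ιM B) (ιH B).toLinearMap (B.coactR m) :=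
  lift_ιM m

theorem assoc_map_map {A₁ A₂ A₃ B₁ B₂ B₃ : Type*}
    [AddCommGroup A₁] [Module k A₁] [AddCommGroup A₂] [Module k A₂] [AddCommGroup A₃] [Module k A₃]
    [AddCommGroup B₁] [Module k B₁] [AddCommGroup B₂] [Module k B₂] [AddCommGroup B₃] [Module k B₃]
    (f : A₁ →ₗ[k] B₁) (g : A₂ →ₗ[k] B₂) (h : A₃ →ₗ[k] B₃) (t : A₁ ⊗[k] A₂ ⊗[k] A₃) :
    TensorProduct.assoc k B₁ B₂ B₃ (TensorProduct.map (TensorProduct.map f g) h t) =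
      TensorProduct.map f (TensorProduct.map g h) (TensorProduct.assoc k A₁ A₂ A₃ t) :=
  LinearMap.congr_fun (f := (TensorProduct.assoc k B₁ B₂ B₃).toLinearMap ∘ₗ
    TensorProduct.map (TensorProduct.map f g) h)
    (g := TensorProduct.map f (TensorProduct.map g h) ∘ₗ
      (TensorProduct.assoc k A₁ A₂ A₃).toLinearMap)
    (TensorProduct.ext_threefold fun _ _ _ => by simp) t

theorem rTensor_map' {A₁ A₂ B₁ B₂ C : Type*}
    [AddCommGroup A₁] [Module k A₁] [AddCommGroup A₂] [Module k A₂] [AddCommGroup C] [Module k C]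
    [AddCommGroup B₁] [Module k B₁] [AddCommGroup B₂] [Module k B₂]
    (p : B₁ →ₗ[k] C) (f : A₁ →ₗ[k] B₁) (g : A₂ →ₗ[k] B₂) (t : A₁ ⊗[k] A₂) :
    p.rTensor B₂ (TensorProduct.map f g t) = TensorProduct.map (p ∘ₗ f) g t := by
  rw [← LinearMap.rTensor_comp_map]; rfl

theorem lTensor_map' {A₁ A₂ B₁ B₂ C : Type*}
    [AddCommGroup A₁] [Module k A₁] [AddCommGroup A₂] [Module k A₂] [AddCommGroup C] [Module k C]
    [AddCommGroup B₁] [Module k B₁] [AddCommGroup B₂] [Module k B₂]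
    (p : B₂ →ₗ[k] C) (f : A₁ →ₗ[k] B₁) (g : A₂ →ₗ[k] B₂) (t : A₁ ⊗[k] A₂) :
    p.lTensor B₁ (TensorProduct.map f g t) = TensorProduct.map f (p ∘ₗ g) t := by
  rw [← LinearMap.lTensor_comp_map]; rfl

theorem map_rTensor' {A₁ A₂ B₁ B₂ C : Type*}
    [AddCommGroup A₁] [Module k A₁] [AddCommGroup A₂] [Module k A₂] [AddCommGroup C] [Module k C]
    [AddCommGroup B₁] [Module k B₁] [AddCommGroup B₂] [Module k B₂]
    (p : C →ₗ[k] A₁) (f : A₁ →ₗ[k] B₁) (g : A₂ →ₗ[k] B₂) (t : C ⊗[k] A₂) :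
    TensorProduct.map (f ∘ₗ p) g t = TensorProduct.map f g (p.rTensor A₂ t) := by
  rw [← LinearMap.map_comp_rTensor]; rfl

theorem map_lTensor' {A₁ A₂ B₁ B₂ C : Type*}
    [AddCommGroup A₁] [Module k A₁] [AddCommGroup A₂] [Module k A₂] [AddCommGroup C] [Module k C]
    [AddCommGroup B₁] [Module k B₁] [AddCommGroup B₂] [Module k B₂]
    (p : C →ₗ[k] A₂) (f : A₁ →ₗ[k] B₁) (g : A₂ →ₗ[k] B₂) (t : A₁ ⊗[k] C) :
    TensorProduct.map f (g ∘ₗ p) t = TensorProduct.map f g (p.lTensor A₁ t) := by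
  rw [← LinearMap.map_comp_lTensor]; rfl

theorem comul_coassoc : (Algebra.TensorProduct.assoc k k k (TensorAlg B) (TensorAlg B)
      (TensorAlg B)).toAlgHom.comp
      ((Algebra.TensorProduct.map (comul B) (.id k (TensorAlg B))).comp (comul B)) =
    (Algebra.TensorProduct.map (.id k (TensorAlg B)) (comul B)).comp (comul B) := by
  have E1 : (comul B).toLinearMap ∘ₗ (ιH B).toLinearMap =
      TensorProduct.map (ιH B).toLinearMap (ιH B).toLinearMap ∘ₗ Coalgebra.comul :=
    LinearMap.ext comul_ιH
  have E2 : (comul B).toLinearMap ∘ₗ ιM B =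
      TensorProduct.map (ιH B).toLinearMap (ιM B) ∘ₗ B.coactL +
        TensorProduct.map (ιM B) (ιH B).toLinearMap ∘ₗ B.coactR :=
    LinearMap.ext comul_ιM
  refine hom_ext (fun a => ?_) (fun m => ?_)
  · change TensorProduct.assoc k _ _ _
      ((comul B).toLinearMap.rTensor (TensorAlg B) (comul B (ιH B a))) =
      (comul B).toLinearMap.lTensor (TensorAlg B) (comul B (ιH B a))
    rw [comul_ιH, rTensor_map', lTensor_map', E1, map_rTensor', map_lTensor', assoc_map_map,
      Coalgebra.coassoc_apply]
  · change TensorProduct.assoc k _ _ _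
      ((comul B).toLinearMap.rTensor (TensorAlg B) (comul B (ιM B m))) =
      (comul B).toLinearMap.lTensor (TensorAlg B) (comul B (ιM B m))
    rw [comul_ιM]
    simp only [map_add]
    rw [rTensor_map', rTensor_map', lTensor_map', lTensor_map', E1, E2]
    simp only [TensorProduct.map_add_left, TensorProduct.map_add_right, LinearMap.add_apply,
      map_rTensor', map_lTensor', map_add, assoc_map_map, B.coactL_coassoc, B.coactR_coassoc,
      B.coact_comm]
    abel

theorem lid_map_counit {N : Type*} [AddCommGroup N] [Module k N] (f : N →ₗ[k] TensorAlg B) (t : H ⊗[k] N) :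
    TensorProduct.lid k (TensorAlg B) (TensorProduct.map (Coalgebra.counit (R := k)) f t) =
    f (TensorProduct.lid k N ((Coalgebra.counit (R := k)).rTensor N t)) := by
  induction t using TensorProduct.induction_on with
  | zero => simp
  | tmul => simp
  | add x y hx hy => simp only [map_add, hx, hy]

theorem rTensor_counit : (Algebra.TensorProduct.map (counit B) (.id k (TensorAlg B))).comp
    (comul B) = (Algebra.TensorProduct.lid k (TensorAlg B)).symm := by
  have E1 : (counit B).toLinearMap ∘ₗ (ιH B).toLinearMap = Coalgebra.counit :=
    LinearMap.ext fun a => lift_ιH a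
  have E2 : (counit B).toLinearMap ∘ₗ ιM B = 0 := LinearMap.ext fun a => lift_ιM a
  refine hom_ext (fun a => ?_) (fun m => ?_)
  · apply (TensorProduct.lid k (TensorAlg B)).injective
    refine Eq.trans ?_ ((TensorProduct.lid k (TensorAlg B)).apply_symm_apply (ιH B a)).symm
    change TensorProduct.lid k _
      ((counit B).toLinearMap.rTensor (TensorAlg B) (comul B (ιH B a))) = _
    rw [comul_ιH, rTensor_map', E1, lid_map_counit, Coalgebra.rTensor_counit_comul]
    simp
  · apply (TensorProduct.lid k (TensorAlg B)).injective
    refine Eq.trans ?_ ((TensorProduct.lid k (TensorAlg B)).apply_symm_apply (ιM B m)).symm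
    change TensorProduct.lid k _
      ((counit B).toLinearMap.rTensor (TensorAlg B) (comul B (ιM B m))) = _
    rw [comul_ιM, map_add, rTensor_map', rTensor_map', E1, E2, map_add, lid_map_counit, B.coactL_counit]
    simp

theorem rid_map_counit {N : Type*} [AddCommGroup N] [Module k N] (f : N →ₗ[k] TensorAlg B) (t : N ⊗[k] H) :
    TensorProduct.rid k (TensorAlg B) (TensorProduct.map f (Coalgebra.counit (R := k)) t) =
    f (TensorProduct.rid k N ((Coalgebra.counit (R := k)).lTensor N t)) := by
  induction t using TensorProduct.induction_on with
  | zero => simp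
  | tmul => simp
  | add x y hx hy => simp only [map_add, hx, hy]

theorem lTensor_counit : (Algebra.TensorProduct.map (.id k (TensorAlg B)) (counit B)).comp
    (comul B) = (Algebra.TensorProduct.rid k k (TensorAlg B)).symm := by
  have E1 : (counit B).toLinearMap ∘ₗ (ιH B).toLinearMap = Coalgebra.counit :=
    LinearMap.ext fun a => lift_ιH a
  have E2 : (counit B).toLinearMap ∘ₗ ιM B = 0 := LinearMap.ext fun a => lift_ιM a
  refine hom_ext (fun a => ?_) (fun m => ?_)
  · apply (TensorProduct.rid k (TensorAlg B)).injective
    refine Eq.trans ?_ ((TensorProduct.rid k (TensorAlg B)).apply_symm_apply (ιH B a)).symm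
    change TensorProduct.rid k _
      ((counit B).toLinearMap.lTensor (TensorAlg B) (comul B (ιH B a))) = _
    rw [comul_ιH, lTensor_map', E1, rid_map_counit, Coalgebra.lTensor_counit_comul]
    simp
  · apply (TensorProduct.rid k (TensorAlg B)).injective
    refine Eq.trans ?_ ((TensorProduct.rid k (TensorAlg B)).apply_symm_apply (ιM B m)).symm
    change TensorProduct.rid k _
      ((counit B).toLinearMap.lTensor (TensorAlg B) (comul B (ιM B m))) = _
    rw [comul_ιM, map_add, lTensor_map', lTensor_map', E1, E2, map_add, rid_map_counit, B.coactR_counit]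
    simp

instance : Bialgebra k (TensorAlg B) :=
  Bialgebra.ofAlgHom (comul B) (counit B) comul_coassoc rTensor_counit lTensor_counit

/-- The grading of `T_H(M)`, with component `M ⊗_H ⋯ ⊗_H M` in degree `n`, which is spanned by
the products of an element of `H` and `n` elements of `M`. -/
def grade (B : HopfBimodule k H M) (n : ℕ) : Submodule k (TensorAlg B) :=
  LinearMap.range (ιH B).toLinearMap * LinearMap.range (ιM B) ^ n

end TensorAlg
end TensorAlg

section GroupAlgebra
variable {k G : Type*} [Field k] [Group G]

/-- The group element `g` in the group algebra. -/
abbrev gr (k : Type*) {G : Type*} [Field k] [Group G] (g : G) : MonoidAlgebra k G :=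
  MonoidAlgebra.single g 1

/-- The linear extension of a map defined on the group. -/
def gl {N : Type*} [AddCommGroup N] [Module k N] (f : G → N) : MonoidAlgebra k G →ₗ[k] N :=
  Finsupp.linearCombination k f ∘ₗ (MonoidAlgebra.coeffLinearEquiv k).toLinearMap

@[simp] theorem gl_gr {N : Type*} [AddCommGroup N] [Module k N] (f : G → N) (g : G) :
    gl f (gr k g) = f g := by
  simp [gl]

theorem gr_induction {P : MonoidAlgebra k G → Prop} (h0 : P 0)
    (hadd : ∀ x y, P x → P y → P (x + y)) (hsmul : ∀ (c : k) x, P x → P (c • x))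
    (hg : ∀ g, P (gr k g)) (x : MonoidAlgebra k G) : P x := by
  induction x using MonoidAlgebra.induction_linear with
  | zero => exact h0
  | add x y hx hy => exact hadd x y hx hy
  | single g c =>
    have : MonoidAlgebra.single g c = c • gr k g := by simp
    rw [this]
    exact hsmul c _ (hg g)

theorem gr_mul (g h : G) : gr k (g * h) = gr k g * gr k h := by simp

theorem gr_one : gr k (1 : G) = 1 := rfl

theorem comul_gr (g : G) : Coalgebra.comul (R := k) (gr k g) = gr k g ⊗ₜ gr k g := by
  simp

theorem counit_gr (g : G) : Coalgebra.counit (R := k) (gr k g) = 1 := by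
  simp

theorem single_induction {X : Type*} {P : (X →₀ k) → Prop} (h0 : P 0)
    (hadd : ∀ x y, P x → P y → P (x + y)) (hsmul : ∀ (c : k) x, P x → P (c • x))
    (hg : ∀ a, P (Finsupp.single a 1)) (x : X →₀ k) : P x := by
  induction x using Finsupp.induction_linear with
  | zero => exact h0
  | add x y hx hy => exact hadd x y hx hy
  | single a c =>
    have : Finsupp.single a c = c • Finsupp.single a (1 : k) := by simp
    rw [this]
    exact hsmul c _ (hg a)

/-- The left `kG`-coaction `a ↦ t(a) ⊗ a` on the space with basis `X`. -/
def arrowCoactL (k : Type*) {G X : Type*} [Field k] [Group G] (t : X → G) :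
    (X →₀ k) →ₗ[k] MonoidAlgebra k G ⊗[k] (X →₀ k) :=
  Finsupp.linearCombination k fun a => gr k (t a) ⊗ₜ Finsupp.single a 1

/-- The right `kG`-coaction `a ↦ a ⊗ s(a)` on the space with basis `X`. -/
def arrowCoactR (k : Type*) {G X : Type*} [Field k] [Group G] (s : X → G) :
    (X →₀ k) →ₗ[k] (X →₀ k) ⊗[k] MonoidAlgebra k G :=
  Finsupp.linearCombination k fun a => Finsupp.single a 1 ⊗ₜ gr k (s a)

section
variable {X : Type*}

@[simp] theorem arrowCoactL_single (t : X → G) (a : X) :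
    arrowCoactL k t (Finsupp.single a 1) = gr k (t a) ⊗ₜ Finsupp.single a 1 := by
  simp [arrowCoactL]

@[simp] theorem arrowCoactR_single (s : X → G) (a : X) :
    arrowCoactR k s (Finsupp.single a 1) = Finsupp.single a 1 ⊗ₜ gr k (s a) := by
  simp [arrowCoactR]

theorem supported_induction {D : Set X} {P : (X →₀ k) → Prop} (h0 : P 0)
    (hadd : ∀ x y, P x → P y → P (x + y)) (hsmul : ∀ (c : k) x, P x → P (c • x))
    (hg : ∀ a ∈ D, P (Finsupp.single a 1)) {x : X →₀ k} (hx : x ∈ Finsupp.supported k k D) :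
    P x := by
  rw [Finsupp.supported_eq_span_single] at hx
  refine Submodule.span_induction ?_ h0 (fun x y _ _ => hadd x y) (fun c x _ => hsmul c x) hx
  rintro _ ⟨a, ha, rfl⟩
  exact hg a ha

theorem arrowCoactL_of_supported (t : X → G) {g : G} {D : Set X} (hD : ∀ a ∈ D, t a = g)
    {x : X →₀ k} (hx : x ∈ Finsupp.supported k k D) : arrowCoactL k t x = gr k g ⊗ₜ x := by
  refine supported_induction (P := fun x => arrowCoactL k t x = gr k g ⊗ₜ x) (by simp)
    (fun x y hx hy => ?_) (fun c x hx => ?_) (fun a ha => ?_) hx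
  · rw [map_add, hx, hy, TensorProduct.tmul_add]
  · rw [map_smul, hx, TensorProduct.tmul_smul]
  · rw [arrowCoactL_single, hD a ha]

theorem arrowCoactR_of_supported (s : X → G) {g : G} {D : Set X} (hD : ∀ a ∈ D, s a = g)
    {x : X →₀ k} (hx : x ∈ Finsupp.supported k k D) : arrowCoactR k s x = x ⊗ₜ gr k g := by
  refine supported_induction (P := fun x => arrowCoactR k s x = x ⊗ₜ gr k g) (by simp)
    (fun x y hx hy => ?_) (fun c x hx => ?_) (fun a ha => ?_) hx
  · rw [map_add, hx, hy, TensorProduct.add_tmul]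
  · rw [map_smul, hx, TensorProduct.smul_tmul']
  · rw [arrowCoactR_single, hD a ha]
end

theorem gl_mul {N : Type*} [AddCommGroup N] [Module k N] {F : G → N →ₗ[k] N}
    (hF : ∀ g h m, F (g * h) m = F g (F h m)) (a b : MonoidAlgebra k G) (m : N) :
    gl F (a * b) m = gl F a (gl F b m) := by
  refine gr_induction (P := fun a => gl F (a * b) m = gl F a (gl F b m)) (by simp)
    (fun x y hx hy => by simp only [add_mul, map_add, LinearMap.add_apply, hx, hy])
    (fun c x hx => by simp only [smul_mul_assoc, map_smul, LinearMap.smul_apply, hx])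
    (fun g => ?_) a
  refine gr_induction (P := fun b => gl F (gr k g * b) m = gl F (gr k g) (gl F b m))
    (by simp)
    (fun x y hx hy => by simp only [mul_add, map_add, LinearMap.add_apply, hx, hy])
    (fun c x hx => by simp only [mul_smul_comm, map_smul, LinearMap.smul_apply, hx])
    (fun h => ?_) b
  rw [← gr_mul, gl_gr, gl_gr, gl_gr, hF]

theorem gl_mul' {N : Type*} [AddCommGroup N] [Module k N] {F : G → N →ₗ[k] N}
    (hF : ∀ g h m, F (g * h) m = F h (F g m)) (a b : MonoidAlgebra k G) (m : N) :
    gl F (a * b) m = gl F b (gl F a m) := by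
  refine gr_induction (P := fun a => gl F (a * b) m = gl F b (gl F a m)) (by simp)
    (fun x y hx hy => by simp only [add_mul, map_add, LinearMap.add_apply, hx, hy])
    (fun c x hx => by simp only [smul_mul_assoc, map_smul, LinearMap.smul_apply, hx])
    (fun g => ?_) a
  refine gr_induction (P := fun b => gl F (gr k g * b) m = gl F b (gl F (gr k g) m))
    (by simp)
    (fun x y hx hy => by simp only [mul_add, map_add, LinearMap.add_apply, hx, hy])
    (fun c x hx => by simp only [mul_smul_comm, map_smul, LinearMap.smul_apply, hx])
    (fun h => ?_) b
  rw [← gr_mul, gl_gr, gl_gr, gl_gr, hF]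

theorem gl_comm {N : Type*} [AddCommGroup N] [Module k N] {F F' : G → N →ₗ[k] N}
    (hF : ∀ g h m, F g (F' h m) = F' h (F g m)) (a b : MonoidAlgebra k G) (m : N) :
    gl F a (gl F' b m) = gl F' b (gl F a m) := by
  refine gr_induction (P := fun a => gl F a (gl F' b m) = gl F' b (gl F a m)) (by simp)
    (fun x y hx hy => by simp only [map_add, LinearMap.add_apply, hx, hy])
    (fun c x hx => by simp only [map_smul, LinearMap.smul_apply, hx])
    (fun g => ?_) a
  refine gr_induction (P := fun b => gl F (gr k g) (gl F' b m) =
      gl F' b (gl F (gr k g) m)) (by simp)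
    (fun x y hx hy => by simp only [map_add, LinearMap.add_apply, hx, hy])
    (fun c x hx => by simp only [map_smul, LinearMap.smul_apply, hx])
    (fun h => ?_) b
  rw [gl_gr, gl_gr, hF]

section
variable {X : Type*}

theorem arrowCoactL_counit (t : X → G) (m : X →₀ k) : TensorProduct.lid k (X →₀ k)
    ((Coalgebra.counit (R := k) (A := MonoidAlgebra k G)).rTensor (X →₀ k) (arrowCoactL k t m)) =
      m := by
  refine single_induction (P := fun m => TensorProduct.lid k (X →₀ k)
    ((Coalgebra.counit (R := k) (A := MonoidAlgebra k G)).rTensor (X →₀ k) (arrowCoactL k t m)) = m) (by simp)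
    (fun x y hx hy => by simp only [map_add, hx, hy])
    (fun c x hx => by simp only [map_smul, hx]) (fun a => ?_) m
  rw [arrowCoactL_single, LinearMap.rTensor_tmul, counit_gr]
  simp

theorem arrowCoactL_coassoc (t : X → G) (m : X →₀ k) :
    TensorProduct.assoc k (MonoidAlgebra k G) (MonoidAlgebra k G) (X →₀ k)
      ((Coalgebra.comul (R := k)).rTensor (X →₀ k) (arrowCoactL k t m)) =
      (arrowCoactL k t).lTensor (MonoidAlgebra k G) (arrowCoactL k t m) := by
  refine single_induction (P := fun m => TensorProduct.assoc k (MonoidAlgebra k G) (MonoidAlgebra k G) (X →₀ k)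
    ((Coalgebra.comul (R := k)).rTensor (X →₀ k) (arrowCoactL k t m)) =
    (arrowCoactL k t).lTensor (MonoidAlgebra k G) (arrowCoactL k t m)) (by simp)
    (fun x y hx hy => by simp only [map_add, hx, hy])
    (fun c x hx => by simp only [map_smul, hx]) (fun a => ?_) m
  rw [arrowCoactL_single, LinearMap.rTensor_tmul, comul_gr, LinearMap.lTensor_tmul,
    arrowCoactL_single, TensorProduct.assoc_tmul]

theorem arrowCoactR_counit (s : X → G) (m : X →₀ k) : TensorProduct.rid k (X →₀ k)
    ((Coalgebra.counit (R := k) (A := MonoidAlgebra k G)).lTensor (X →₀ k) (arrowCoactR k s m)) =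
      m := by
  refine single_induction (P := fun m => TensorProduct.rid k (X →₀ k)
    ((Coalgebra.counit (R := k) (A := MonoidAlgebra k G)).lTensor (X →₀ k) (arrowCoactR k s m)) = m) (by simp)
    (fun x y hx hy => by simp only [map_add, hx, hy])
    (fun c x hx => by simp only [map_smul, hx]) (fun a => ?_) m
  rw [arrowCoactR_single, LinearMap.lTensor_tmul, counit_gr]
  simp

theorem arrowCoactR_coassoc (s : X → G) (m : X →₀ k) :
    TensorProduct.assoc k (X →₀ k) (MonoidAlgebra k G) (MonoidAlgebra k G)
      ((arrowCoactR k s).rTensor (MonoidAlgebra k G) (arrowCoactR k s m)) =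
      (Coalgebra.comul (R := k)).lTensor (X →₀ k) (arrowCoactR k s m) := by
  refine single_induction (P := fun m => TensorProduct.assoc k (X →₀ k) (MonoidAlgebra k G) (MonoidAlgebra k G)
    ((arrowCoactR k s).rTensor (MonoidAlgebra k G) (arrowCoactR k s m)) =
    (Coalgebra.comul (R := k)).lTensor (X →₀ k) (arrowCoactR k s m)) (by simp)
    (fun x y hx hy => by simp only [map_add, hx, hy])
    (fun c x hx => by simp only [map_smul, hx]) (fun a => ?_) m
  rw [arrowCoactR_single, LinearMap.rTensor_tmul, LinearMap.lTensor_tmul, comul_gr,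
    arrowCoactR_single, TensorProduct.assoc_tmul]

theorem arrowCoact_comm (s t : X → G) (m : X →₀ k) :
    TensorProduct.assoc k (MonoidAlgebra k G) (X →₀ k) (MonoidAlgebra k G)
      ((arrowCoactL k t).rTensor (MonoidAlgebra k G) (arrowCoactR k s m)) =
      (arrowCoactR k s).lTensor (MonoidAlgebra k G) (arrowCoactL k t m) := by
  refine single_induction (P := fun m => TensorProduct.assoc k (MonoidAlgebra k G) (X →₀ k) (MonoidAlgebra k G)
    ((arrowCoactL k t).rTensor (MonoidAlgebra k G) (arrowCoactR k s m)) =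
    (arrowCoactR k s).lTensor (MonoidAlgebra k G) (arrowCoactL k t m)) (by simp)
    (fun x y hx hy => by simp only [map_add, hx, hy])
    (fun c x hx => by simp only [map_smul, hx]) (fun a => ?_) m
  rw [arrowCoactR_single, arrowCoactL_single, LinearMap.rTensor_tmul, LinearMap.lTensor_tmul,
    arrowCoactR_single, arrowCoactL_single, TensorProduct.assoc_tmul]

end

/-- Two commuting actions of `G`, from the left and from the right, on the vector space whose
basis `X` is the set of arrows of a quiver with vertex set `G`, moving sources and targets. -/
structure ArrowActions (k : Type*) {G X : Type*} [Field k] [Group G] (s t : X → G) where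
  L : G → (X →₀ k) →ₗ[k] (X →₀ k)
  R : G → (X →₀ k) →ₗ[k] (X →₀ k)
  L_one : ∀ m, L 1 m = m
  L_mul : ∀ g h m, L (g * h) m = L g (L h m)
  R_one : ∀ m, R 1 m = m
  R_mul : ∀ g h m, R (g * h) m = R h (R g m)
  comm : ∀ g h m, L g (R h m) = R h (L g m)
  L_deg : ∀ g a, L g (Finsupp.single a 1) ∈
    Finsupp.supported k k {b | t b = g * t a ∧ s b = g * s a}
  R_deg : ∀ g a, R g (Finsupp.single a 1) ∈
    Finsupp.supported k k {b | t b = t a * g ∧ s b = s a * g}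

theorem ArrowActions.coactL_actL {X : Type*} {s t : X → G} (A : ArrowActions k s t)
    (h : MonoidAlgebra k G) (m : X →₀ k) : arrowCoactL k t (gl A.L h m) =
      TensorProduct.map₂ (LinearMap.mul k (MonoidAlgebra k G)) (gl A.L) (Coalgebra.comul (R := k) h) (arrowCoactL k t m) := by
  refine gr_induction (P := fun h => arrowCoactL k t (gl A.L h m) =
    TensorProduct.map₂ (LinearMap.mul k (MonoidAlgebra k G)) (gl A.L) (Coalgebra.comul (R := k) h)
      (arrowCoactL k t m)) (by simp)
    (fun x y hx hy => by simp only [map_add, LinearMap.add_apply, hx, hy])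
    (fun c x hx => by simp only [map_smul, LinearMap.smul_apply, hx])
    (fun g => ?_) h
  refine single_induction (P := fun m => arrowCoactL k t (gl A.L (gr k g) m) =
    TensorProduct.map₂ (LinearMap.mul k (MonoidAlgebra k G)) (gl A.L) (Coalgebra.comul (R := k) (gr k g))
      (arrowCoactL k t m)) (by simp)
    (fun x y hx hy => by simp only [map_add, hx, hy])
    (fun c x hx => by simp only [map_smul, hx]) (fun a => ?_) m
  rw [comul_gr, arrowCoactL_single, TensorProduct.map₂_apply_tmul, gl_gr,
    arrowCoactL_of_supported t (fun b hb => hb.1) (A.L_deg g a), gr_mul]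
  rfl

theorem ArrowActions.coactL_actR {X : Type*} {s t : X → G} (A : ArrowActions k s t)
    (h : MonoidAlgebra k G) (m : X →₀ k) : arrowCoactL k t (gl A.R h m) =
      TensorProduct.map₂ (LinearMap.mul k (MonoidAlgebra k G)).flip (gl A.R) (Coalgebra.comul (R := k) h) (arrowCoactL k t m) := by
  refine gr_induction (P := fun h => arrowCoactL k t (gl A.R h m) =
    TensorProduct.map₂ (LinearMap.mul k (MonoidAlgebra k G)).flip (gl A.R) (Coalgebra.comul (R := k) h)
      (arrowCoactL k t m)) (by simp)
    (fun x y hx hy => by simp only [map_add, LinearMap.add_apply, hx, hy])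
    (fun c x hx => by simp only [map_smul, LinearMap.smul_apply, hx])
    (fun g => ?_) h
  refine single_induction (P := fun m => arrowCoactL k t (gl A.R (gr k g) m) =
    TensorProduct.map₂ (LinearMap.mul k (MonoidAlgebra k G)).flip (gl A.R) (Coalgebra.comul (R := k) (gr k g))
      (arrowCoactL k t m)) (by simp)
    (fun x y hx hy => by simp only [map_add, hx, hy])
    (fun c x hx => by simp only [map_smul, hx]) (fun a => ?_) m
  rw [comul_gr, arrowCoactL_single, TensorProduct.map₂_apply_tmul, gl_gr,
    arrowCoactL_of_supported t (fun b hb => hb.1) (A.R_deg g a), gr_mul]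
  rfl

theorem ArrowActions.coactR_actL {X : Type*} {s t : X → G} (A : ArrowActions k s t)
    (h : MonoidAlgebra k G) (m : X →₀ k) : arrowCoactR k s (gl A.L h m) =
      TensorProduct.map₂ (gl A.L) (LinearMap.mul k (MonoidAlgebra k G)) (Coalgebra.comul (R := k) h) (arrowCoactR k s m) := by
  refine gr_induction (P := fun h => arrowCoactR k s (gl A.L h m) =
    TensorProduct.map₂ (gl A.L) (LinearMap.mul k (MonoidAlgebra k G)) (Coalgebra.comul (R := k) h)
      (arrowCoactR k s m)) (by simp)
    (fun x y hx hy => by simp only [map_add, LinearMap.add_apply, hx, hy])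
    (fun c x hx => by simp only [map_smul, LinearMap.smul_apply, hx])
    (fun g => ?_) h
  refine single_induction (P := fun m => arrowCoactR k s (gl A.L (gr k g) m) =
    TensorProduct.map₂ (gl A.L) (LinearMap.mul k (MonoidAlgebra k G)) (Coalgebra.comul (R := k) (gr k g))
      (arrowCoactR k s m)) (by simp)
    (fun x y hx hy => by simp only [map_add, hx, hy])
    (fun c x hx => by simp only [map_smul, hx]) (fun a => ?_) m
  rw [comul_gr, arrowCoactR_single, TensorProduct.map₂_apply_tmul, gl_gr,
    arrowCoactR_of_supported s (fun b hb => hb.2) (A.L_deg g a), gr_mul]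
  rfl

theorem ArrowActions.coactR_actR {X : Type*} {s t : X → G} (A : ArrowActions k s t)
    (h : MonoidAlgebra k G) (m : X →₀ k) : arrowCoactR k s (gl A.R h m) =
      TensorProduct.map₂ (gl A.R) (LinearMap.mul k (MonoidAlgebra k G)).flip (Coalgebra.comul (R := k) h) (arrowCoactR k s m) := by
  refine gr_induction (P := fun h => arrowCoactR k s (gl A.R h m) =
    TensorProduct.map₂ (gl A.R) (LinearMap.mul k (MonoidAlgebra k G)).flip (Coalgebra.comul (R := k) h)
      (arrowCoactR k s m)) (by simp)
    (fun x y hx hy => by simp only [map_add, LinearMap.add_apply, hx, hy])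
    (fun c x hx => by simp only [map_smul, LinearMap.smul_apply, hx])
    (fun g => ?_) h
  refine single_induction (P := fun m => arrowCoactR k s (gl A.R (gr k g) m) =
    TensorProduct.map₂ (gl A.R) (LinearMap.mul k (MonoidAlgebra k G)).flip (Coalgebra.comul (R := k) (gr k g))
      (arrowCoactR k s m)) (by simp)
    (fun x y hx hy => by simp only [map_add, hx, hy])
    (fun c x hx => by simp only [map_smul, hx]) (fun a => ?_) m
  rw [comul_gr, arrowCoactR_single, TensorProduct.map₂_apply_tmul, gl_gr,
    arrowCoactR_of_supported s (fun b hb => hb.2) (A.R_deg g a), gr_mul]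
  rfl

/-- The `kG`-Hopf bimodule with the arrow coactions and the linear extensions of the given
actions. -/
def ArrowActions.hopfBimodule {X : Type*} {s t : X → G} (A : ArrowActions k s t) :
    HopfBimodule k (MonoidAlgebra k G) (X →₀ k) where
  actL := gl A.L
  actR := gl A.R
  coactL := arrowCoactL k t
  coactR := arrowCoactR k s
  actL_one m := by rw [← gr_one, gl_gr, A.L_one]
  actL_mul := gl_mul A.L_mul
  actR_one m := by rw [← gr_one, gl_gr, A.R_one]
  actR_mul := gl_mul' A.R_mul
  act_comm := gl_comm A.comm
  coactL_counit := arrowCoactL_counit t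
  coactL_coassoc := arrowCoactL_coassoc t
  coactR_counit := arrowCoactR_counit s
  coactR_coassoc := arrowCoactR_coassoc s
  coact_comm := arrowCoact_comm s t
  coactL_actL := A.coactL_actL
  coactL_actR := A.coactL_actR
  coactR_actL := A.coactR_actL
  coactR_actR := A.coactR_actR

/-- Yetter-Drinfeld `kG`-modules: left modules that are left comodules, with
`δ(g · v) = g v₍₋₁₎ g⁻¹ ⊗ g · v₍₀₎`. -/
structure YDModule (k G V : Type*) [Field k] [Group G] [AddCommGroup V] [Module k V] where
  act : MonoidAlgebra k G →ₗ[k] V →ₗ[k] V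
  coact : V →ₗ[k] MonoidAlgebra k G ⊗[k] V
  act_one : ∀ v, act 1 v = v
  act_mul : ∀ a b v, act (a * b) v = act a (act b v)
  coact_counit : ∀ v, TensorProduct.lid k V
    ((Coalgebra.counit (R := k) (A := MonoidAlgebra k G)).rTensor V (coact v)) = v
  coact_coassoc : ∀ v, TensorProduct.assoc k _ _ V
    ((Coalgebra.comul (R := k) (A := MonoidAlgebra k G)).rTensor V (coact v)) =
      coact.lTensor (MonoidAlgebra k G) (coact v)
  coact_act : ∀ (g : G) v, coact (act (gr k g) v) =
    TensorProduct.map (LinearMap.mulLeft k (gr k g) ∘ₗ LinearMap.mulRight k (gr k g⁻¹))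
      (act (gr k g)) (coact v)

namespace ArrowActions
variable {X : Type*} {s t : X → G} (A : ArrowActions k s t)

theorem L_supported {g : G} {D E : Set X}
    (h : ∀ a ∈ D, ∀ b, t b = g * t a → s b = g * s a → b ∈ E) {x : X →₀ k}
    (hx : x ∈ Finsupp.supported k k D) : A.L g x ∈ Finsupp.supported k k E :=
  supported_induction (P := fun x => A.L g x ∈ Finsupp.supported k k E) (by simp)
    (fun x y hx hy => by rw [map_add]; exact add_mem hx hy)
    (fun c x hx => by rw [map_smul]; exact Submodule.smul_mem _ c hx)
    (fun a ha => Finsupp.supported_mono (fun b hb => h a ha b hb.1 hb.2) (A.L_deg g a)) hx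

theorem R_supported {g : G} {D E : Set X}
    (h : ∀ a ∈ D, ∀ b, t b = t a * g → s b = s a * g → b ∈ E) {x : X →₀ k}
    (hx : x ∈ Finsupp.supported k k D) : A.R g x ∈ Finsupp.supported k k E :=
  supported_induction (P := fun x => A.R g x ∈ Finsupp.supported k k E) (by simp)
    (fun x y hx hy => by rw [map_add]; exact add_mem hx hy)
    (fun c x hx => by rw [map_smul]; exact Submodule.smul_mem _ c hx)
    (fun a ha => Finsupp.supported_mono (fun b hb => h a ha b hb.1 hb.2) (A.R_deg g a)) hx

/-- The adjoint action `x ↦ g · x · g⁻¹` on the span of the arrows with source `1`. -/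
def ad (g : G) : ({a : X // s a = 1} →₀ k) →ₗ[k] ({a : X // s a = 1} →₀ k) :=
  Finsupp.lsubtypeDomain {a : X | s a = 1} ∘ₗ A.L g ∘ₗ A.R g⁻¹ ∘ₗ
    Finsupp.lmapDomain k k Subtype.val

theorem ext_restr {Y : Set X} {x : X →₀ k} (hx : x ∈ Finsupp.supported k k Y) :
    Finsupp.lmapDomain k k (Subtype.val : Y → X) (Finsupp.lsubtypeDomain (R := k) Y x) = x := by
  refine supported_induction (P := fun x : X →₀ k => Finsupp.lmapDomain k k
    (Subtype.val : Y → X) (Finsupp.lsubtypeDomain (R := k) Y x) = x) (by simp)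
    (fun x y hx hy => by rw [map_add, map_add, hx, hy])
    (fun c x hx => by rw [map_smul, map_smul, hx]) (fun a ha => ?_) hx
  ext b
  by_cases hb : b ∈ Y
  · have := Finsupp.mapDomain_apply Subtype.val_injective
      (Finsupp.lsubtypeDomain (R := k) Y (Finsupp.single a (1 : k))) (⟨b, hb⟩ : Y)
    exact this
  · rw [Finsupp.lmapDomain_apply, Finsupp.mapDomain_of_notMem_range _ _ (by simpa using hb)]
    classical
    rw [Finsupp.single_apply, if_neg]
    rintro rfl
    exact hb ha

theorem ext_supported (x : {a : X // s a = 1} →₀ k) :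
    Finsupp.lmapDomain k k Subtype.val x ∈ Finsupp.supported k k {a : X | s a = 1} := by
  refine single_induction (P := fun x : {a : X // s a = 1} →₀ k =>
    Finsupp.lmapDomain k k Subtype.val x ∈ Finsupp.supported k k {a : X | s a = 1}) (by simp)
    (fun x y hx hy => by rw [map_add]; exact add_mem hx hy)
    (fun c x hx => by rw [map_smul]; exact Submodule.smul_mem _ c hx) (fun a => ?_) x
  rw [Finsupp.lmapDomain_apply, Finsupp.mapDomain_single]
  exact Finsupp.single_mem_supported k _ a.2

theorem ext_injective : Function.Injective
    (Finsupp.lmapDomain k k (Subtype.val : {a : X // s a = 1} → X)) :=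
  Finsupp.mapDomain_injective Subtype.val_injective

theorem ext_ad (g : G) (x : {a : X // s a = 1} →₀ k) :
    Finsupp.lmapDomain k k Subtype.val (A.ad g x) =
      A.L g (A.R g⁻¹ (Finsupp.lmapDomain k k Subtype.val x)) := by
  refine ext_restr (Y := {a : X | s a = 1}) ?_
  refine A.L_supported (D := {a : X | s a = g⁻¹}) (fun a ha b _ hb => ?_)
    (A.R_supported (D := {a : X | s a = 1}) (fun a ha b _ hb => ?_) (ext_supported x))
  · rw [Set.mem_ofPred_eq] at ha ⊢
    rw [hb, ha, mul_inv_cancel]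
  · rw [Set.mem_ofPred_eq] at ha ⊢
    rw [hb, ha, one_mul]

theorem ad_one (x : {a : X // s a = 1} →₀ k) : A.ad 1 x = x := by
  apply ext_injective
  rw [ext_ad, inv_one, A.R_one, A.L_one]

theorem ad_mul (g h : G) (x : {a : X // s a = 1} →₀ k) : A.ad (g * h) x = A.ad g (A.ad h x) := by
  apply ext_injective
  rw [ext_ad, ext_ad, ext_ad, mul_inv_rev, A.R_mul, A.L_mul, A.comm h]

theorem ad_deg (g : G) (a : {a : X // s a = 1}) : A.ad g (Finsupp.single a 1) ∈
    Finsupp.supported k k {b : {a : X // s a = 1} | t b = g * t a * g⁻¹} := by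
  have h : Finsupp.lmapDomain k k Subtype.val (A.ad g (Finsupp.single a 1)) ∈
      Finsupp.supported k k {b : X | t b = g * t a * g⁻¹} := by
    rw [ext_ad, Finsupp.lmapDomain_apply, Finsupp.mapDomain_single]
    exact A.L_supported (fun b hb c hc _ => by
      rw [Set.mem_ofPred_eq] at hb ⊢
      rw [hc, hb.1, mul_assoc]) (A.R_deg g⁻¹ a)
  rw [Finsupp.mem_supported] at h ⊢
  intro b hb
  refine h (Finset.mem_coe.2 (Finsupp.mem_support_iff.2 ?_))
  rw [Finsupp.lmapDomain_apply, Finsupp.mapDomain_apply Subtype.val_injective]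
  exact Finsupp.mem_support_iff.1 hb

theorem coact_ad (g : G) (m : {a : X // s a = 1} →₀ k) :
    arrowCoactL k (fun a => t a.1) (gl A.ad (gr k g) m) =
      TensorProduct.map (LinearMap.mulLeft k (gr k g) ∘ₗ LinearMap.mulRight k (gr k g⁻¹))
        (gl A.ad (gr k g)) (arrowCoactL k (fun a => t a.1) m) := by
  refine single_induction (P := fun m => arrowCoactL k (fun a => t a.1) (gl A.ad (gr k g) m) =
    TensorProduct.map (LinearMap.mulLeft k (gr k g) ∘ₗ LinearMap.mulRight k (gr k g⁻¹))
      (gl A.ad (gr k g)) (arrowCoactL k (fun a => t a.1) m)) (by simp)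
    (fun x y hx hy => by simp only [map_add, hx, hy])
    (fun c x hx => by simp only [map_smul, hx]) (fun a => ?_) m
  rw [gl_gr, arrowCoactL_of_supported _ (fun b hb => hb) (A.ad_deg g a), arrowCoactL_single,
    TensorProduct.map_tmul]
  simp [mul_assoc]

/-- The Yetter-Drinfeld module on the span of the arrows with source `1`, with the adjoint
action and the arrow coaction. -/
def ydModule : YDModule k G ({a : X // s a = 1} →₀ k) where
  act := gl A.ad
  coact := arrowCoactL k fun a => t a.1
  act_one m := by rw [← gr_one, gl_gr, A.ad_one]
  act_mul := gl_mul A.ad_mul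
  coact_counit := arrowCoactL_counit fun a : {a : X // s a = 1} => t a.1
  coact_coassoc := arrowCoactL_coassoc fun a : {a : X // s a = 1} => t a.1
  coact_act := A.coact_ad

end ArrowActions

end GroupAlgebra

section RSR
universe u v w

/-- A ramification system with irreducible representations `RSR(G, r, ρ, u)`: a choice `u C ∈ C`
for each conjugacy class `C`, an index set `I C` and, for each `i ∈ I C`, an irreducible right
representation `ρ C i` of the centralizer `Z` of `u C`, on row vectors of length `d C i`. The
ramification is `r_C = ∑ i, d C i`. A right representation of `Z` is a representation of the
opposite group. -/
structure RSR (k : Type u) (G : Type v) [Field k] [Group G] where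
  u : ConjClasses G → G
  u_mem : ∀ C, ConjClasses.mk (u C) = C
  I : ConjClasses G → Type w
  d : ∀ C, I C → ℕ
  ρ : ∀ C (i : I C),
    Representation k (Subgroup.centralizer {u C} : Subgroup G)ᵐᵒᵖ (Fin (d C i) → k)
  irreducible : ∀ C i, (ρ C i).IsIrreducible

/-- Isomorphism of ramification systems: a group isomorphism `φ` and, for each conjugacy class
`C`, an element `h` with `φ (h⁻¹ u(C) h) = u'(φ(C))` and a bijection of index sets under which
`ρ C i` is isomorphic to the pull-back of `ρ'` along `x ↦ φ (h⁻¹ x h)`. -/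
def RSR.Iso {k : Type*} {G G' : Type*} [Field k] [Group G] [Group G']
    (S : RSR k G) (S' : RSR k G') : Prop :=
  ∃ φ : G ≃* G', ∀ C : ConjClasses G, ∃ h : G,
    φ (h⁻¹ * S.u C * h) = S'.u (ConjClasses.map φ.toMonoidHom C) ∧
    ∃ e : S.I C ≃ S'.I (ConjClasses.map φ.toMonoidHom C), ∀ i : S.I C,
      ∃ f : (Fin (S.d C i) → k) ≃ₗ[k] (Fin (S'.d (ConjClasses.map φ.toMonoidHom C) (e i)) → k),
        ∀ (z : (Subgroup.centralizer {S.u C} : Subgroup G))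
          (z' : (Subgroup.centralizer {S'.u (ConjClasses.map φ.toMonoidHom C)} : Subgroup G')),
          (z' : G') = φ (h⁻¹ * z * h) → ∀ v,
          f (S.ρ C i (MulOpposite.op z) v) =
            S'.ρ (ConjClasses.map φ.toMonoidHom C) (e i) (MulOpposite.op z') (f v)

/-- Representatives `g_θ` of the right cosets `Z g_θ` of the centralizers `Z` of the `u C`, that
of `Z` itself being `1`. A right coset is given by the conjugate `c = g_θ⁻¹ u(C) g_θ`. -/
structure RSR.CosetReps {k : Type u} {G : Type v} [Field k] [Group G] (S : RSR.{u, v, w} k G) where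
  g : G → G
  conj : ∀ c, (g c)⁻¹ * S.u (ConjClasses.mk c) * g c = c
  one : ∀ C, g (S.u C) = 1

namespace RSR
variable {k : Type u} {G : Type v} [Field k] [Group G] (S : RSR.{u, v, w} k G)

theorem nonempty_cosetReps : Nonempty S.CosetReps := by
  classical
  have h : ∀ c, ∃ g : G, g⁻¹ * S.u (ConjClasses.mk c) * g = c ∧
      (S.u (ConjClasses.mk c) = c → g = 1) := by
    intro c
    by_cases hc : S.u (ConjClasses.mk c) = c
    · exact ⟨1, by simp [hc], fun _ => rfl⟩
    · obtain ⟨x, hx⟩ := isConj_iff.1 (ConjClasses.mk_eq_mk_iff_isConj.1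
        (S.u_mem (ConjClasses.mk c)))
      exact ⟨x⁻¹, by rw [inv_inv]; exact hx, fun h => absurd h hc⟩
  choose g hg using h
  exact ⟨⟨g, fun c => (hg c).1, fun C => (hg (S.u C)).2 (by rw [S.u_mem])⟩⟩

/-- Pairs `(x, y)` of vertices with `x⁻¹ y ∈ C`. -/
abbrev Pair (C : ConjClasses G) : Type v := {p : G × G // ConjClasses.mk (p.1⁻¹ * p.2) = C}

/-- The arrows `a_{y,x}^{(i,j)}` from `x` to `y`, where `x⁻¹ y ∈ C`, `i ∈ I C`, `j < d C i`. -/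
abbrev Arrow : Type (max v w) := Σ C : ConjClasses G, Pair C × Σ i : S.I C, Fin (S.d C i)

/-- The source `x` of the arrow `a_{y,x}^{(i,j)}`. -/
def source (a : S.Arrow) : G := a.2.1.1.1

/-- The target `y` of the arrow `a_{y,x}^{(i,j)}`. -/
def target (a : S.Arrow) : G := a.2.1.1.2

/-- Left translation `(x, y) ↦ (h x, h y)`. -/
def pairL (h : G) {C : ConjClasses G} (p : Pair C) : Pair C :=
  ⟨(h * p.1.1, h * p.1.2), by
    refine Eq.trans ?_ p.2
    change ConjClasses.mk ((h * p.1.1)⁻¹ * (h * p.1.2)) = _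
    congr 1
    group⟩

/-- Right translation `(x, y) ↦ (x h, y h)`. -/
def pairR (h : G) {C : ConjClasses G} (p : Pair C) : Pair C :=
  ⟨(p.1.1 * h, p.1.2 * h), by
    refine Eq.trans ?_ p.2
    rw [ConjClasses.mk_eq_mk_iff_isConj, isConj_iff]
    exact ⟨h, by group⟩⟩

variable {S} (T : S.CosetReps)

/-- The element `ζ_θ(h) = g_θ h g_θ'⁻¹` of the centralizer of `u C`, so `g_θ h = ζ_θ(h) g_θ'`;
here `θ` and `θ'` are given by `x⁻¹ y` and by `h⁻¹ (x⁻¹ y) h`. -/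
def zeta {C : ConjClasses G} (p : Pair C) (h : G) :
    (Subgroup.centralizer {S.u C} : Subgroup G) :=
  ⟨T.g (p.1.1⁻¹ * p.1.2) * h * (T.g ((p.1.1 * h)⁻¹ * (p.1.2 * h)))⁻¹, by
    rw [Subgroup.mem_centralizer_singleton_iff]
    have h1 := T.conj (p.1.1⁻¹ * p.1.2)
    have h2 := T.conj ((p.1.1 * h)⁻¹ * (p.1.2 * h))
    rw [p.2] at h1
    rw [show ConjClasses.mk ((p.1.1 * h)⁻¹ * (p.1.2 * h)) = C from (pairR h p).2] at h2
    generalize hc : p.1.1⁻¹ * p.1.2 = c at h1 ⊢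
    have e : (p.1.1 * h)⁻¹ * (p.1.2 * h) = h⁻¹ * c * h := by rw [← hc]; group
    rw [e] at h2 ⊢
    generalize T.g (h⁻¹ * c * h) = b at h2 ⊢
    generalize T.g c = a at h1 ⊢
    rw [← h1] at h2
    have h3 : S.u C = b * (h⁻¹ * (a⁻¹ * S.u C * a) * h) * b⁻¹ := by rw [← h2]; group
    conv_lhs => rw [h3]
    group⟩

/-- The vector `∑ s, v s • a_{y,x}^{(i,s)}`. -/
def vec {C : ConjClasses G} (p : Pair C) (i : S.I C) :
    (Fin (S.d C i) → k) →ₗ[k] (S.Arrow →₀ k) :=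
  Fintype.linearCombination k fun s => Finsupp.single ⟨C, p, i, s⟩ 1

/-- The left action `h · a_{y,x}^{(i,j)} = a_{hy,hx}^{(i,j)}`. -/
def left (h : G) : (S.Arrow →₀ k) →ₗ[k] (S.Arrow →₀ k) :=
  Finsupp.linearCombination k fun a => Finsupp.single ⟨a.1, pairL h a.2.1, a.2.2⟩ 1

/-- The right action `a_{y,x}^{(i,j)} · h = ∑ s, k^{(i,j,s)} a_{yh,xh}^{(i,s)}`, where
`(k^{(i,j,s)})_s` is the image of the `j`-th basis vector under `ζ_θ(h)`. -/
def right (h : G) : (S.Arrow →₀ k) →ₗ[k] (S.Arrow →₀ k) :=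
  Finsupp.linearCombination k fun a => vec (pairR h a.2.1) a.2.2.1
    (S.ρ a.1 a.2.2.1 (MulOpposite.op (zeta T a.2.1 h)) (Pi.single a.2.2.2 1))

theorem vec_single {C : ConjClasses G} (p : Pair C) (i : S.I C) (j : Fin (S.d C i)) :
    vec p i (Pi.single j (1 : k)) = Finsupp.single ⟨C, p, i, j⟩ 1 := by
  simp [vec]

theorem single_eq_vec (a : S.Arrow) :
    (Finsupp.single a 1 : S.Arrow →₀ k) = vec a.2.1 a.2.2.1 (Pi.single a.2.2.2 1) :=
  (vec_single a.2.1 a.2.2.1 a.2.2.2).symm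

theorem lin_ext {N : Type*} [AddCommGroup N] [Module k N] {d : ℕ} {f g : (Fin d → k) →ₗ[k] N}
    (h : ∀ j, f (Pi.single j 1) = g (Pi.single j 1)) (v : Fin d → k) : f v = g v :=
  LinearMap.congr_fun (LinearMap.pi_ext' fun j => LinearMap.ext_ring (h j)) v

theorem left_vec (h : G) {C : ConjClasses G} (p : Pair C) (i : S.I C) (v : Fin (S.d C i) → k) :
    left h (vec p i v) = vec (pairL h p) i v :=
  lin_ext (f := left h ∘ₗ vec p i) (g := vec (pairL h p) i) (fun j => by
    rw [LinearMap.comp_apply, vec_single, vec_single, left]; simp) v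

theorem right_vec (h : G) {C : ConjClasses G} (p : Pair C) (i : S.I C) (v : Fin (S.d C i) → k) :
    right T h (vec p i v) =
      vec (pairR h p) i (S.ρ C i (MulOpposite.op (zeta T p h)) v) :=
  lin_ext (f := right T h ∘ₗ vec p i)
    (g := vec (pairR h p) i ∘ₗ S.ρ C i (MulOpposite.op (zeta T p h))) (fun j => by
    rw [LinearMap.comp_apply, vec_single, right]; simp) v

theorem vec_supported {C : ConjClasses G} (p : Pair C) (i : S.I C) (v : Fin (S.d C i) → k) :
    vec p i v ∈ Finsupp.supported k k {b : S.Arrow | S.target b = p.1.2 ∧ S.source b = p.1.1} := by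
  rw [vec, Fintype.linearCombination_apply]
  exact Submodule.sum_mem _ fun s _ => Submodule.smul_mem _ _
    (Finsupp.single_mem_supported k _ ⟨rfl, rfl⟩)

theorem pairL_one {C : ConjClasses G} (p : Pair C) : pairL 1 p = p := by
  apply Subtype.ext; simp [pairL]

theorem pairR_one {C : ConjClasses G} (p : Pair C) : pairR 1 p = p := by
  apply Subtype.ext; simp [pairR]

theorem pairL_mul (g h : G) {C : ConjClasses G} (p : Pair C) :
    pairL (g * h) p = pairL g (pairL h p) := by
  apply Subtype.ext; simp [pairL, mul_assoc]

theorem pairR_mul (g h : G) {C : ConjClasses G} (p : Pair C) :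
    pairR (g * h) p = pairR h (pairR g p) := by
  apply Subtype.ext; simp [pairR, mul_assoc]

theorem pair_comm (g h : G) {C : ConjClasses G} (p : Pair C) :
    pairL g (pairR h p) = pairR h (pairL g p) := by
  apply Subtype.ext; simp [pairL, pairR, mul_assoc]

theorem zeta_one {C : ConjClasses G} (p : Pair C) : zeta T p 1 = 1 := by
  apply Subtype.ext; simp [zeta]

theorem zeta_mul (g h : G) {C : ConjClasses G} (p : Pair C) :
    zeta T p (g * h) = zeta T p g * zeta T (pairR g p) h := by
  apply Subtype.ext; simp [zeta, pairR, mul_assoc]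

theorem zeta_pairL (g h : G) {C : ConjClasses G} (p : Pair C) :
    zeta T (pairL g p) h = zeta T p h := by
  apply Subtype.ext; simp [zeta, pairL, mul_assoc]

theorem arrow_ext {f g : (S.Arrow →₀ k) →ₗ[k] (S.Arrow →₀ k)}
    (h : ∀ C (p : Pair C) (i : S.I C) v, f (vec p i v) = g (vec p i v)) (m : S.Arrow →₀ k) :
    f m = g m :=
  single_induction (P := fun m => f m = g m) (by simp)
    (fun x y hx hy => by rw [map_add, map_add, hx, hy])
    (fun c x hx => by rw [map_smul, map_smul, hx])
    (fun a => by rw [single_eq_vec]; exact h _ _ _ _) m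

/-- The two actions of `G` on the arrow space. -/
def arrowActions : ArrowActions k S.source S.target where
  L := left
  R := right T
  L_one := arrow_ext (g := LinearMap.id) fun C p i v => by
    rw [left_vec, pairL_one]; rfl
  L_mul g h := arrow_ext (g := left g ∘ₗ left h) fun C p i v => by
    rw [LinearMap.comp_apply, left_vec, left_vec, left_vec, pairL_mul]
  R_one := arrow_ext (g := LinearMap.id) fun C p i v => by
    rw [right_vec, pairR_one, zeta_one, MulOpposite.op_one, map_one]; rfl
  R_mul g h := arrow_ext (g := right T h ∘ₗ right T g) fun C p i v => by
    rw [LinearMap.comp_apply, right_vec, right_vec, right_vec, pairR_mul, zeta_mul,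
      MulOpposite.op_mul, map_mul]
    rfl
  comm g h := arrow_ext (f := left g ∘ₗ right T h) (g := right T h ∘ₗ left g) fun C p i v => by
    rw [LinearMap.comp_apply, LinearMap.comp_apply, left_vec, right_vec, right_vec, left_vec,
      pair_comm, zeta_pairL]
  L_deg g a := by
    rw [single_eq_vec, left_vec]
    exact vec_supported _ _ _
  R_deg g a := by
    rw [single_eq_vec, right_vec]
    exact vec_supported _ _ _

/-- The arrow `kG`-Hopf bimodule `(kQ₁ᶜ, G, r, ρ, u)`. -/
def hopfBimodule : HopfBimodule k (MonoidAlgebra k G) (S.Arrow →₀ k) :=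
  (arrowActions T).hopfBimodule

/-- The Yetter-Drinfeld `kG`-module `(kQ₁¹, ad(G, r, ρ, u))`. -/
def ydModule : YDModule k G ({a : S.Arrow // S.source a = 1} →₀ k) :=
  (arrowActions T).ydModule

end RSR
end RSR

/-- The algebra `(kG)*` of functions on `G`. -/
def FunAlg (k G : Type*) : Type _ := G → k

namespace FunAlg
section
variable {k G : Type*} [Field k]

instance : CommRing (FunAlg k G) := inferInstanceAs (CommRing (G → k))
instance : Algebra k (FunAlg k G) := inferInstanceAs (Algebra k (G → k))

/-- Evaluation at `g`. -/
def ev (g : G) : FunAlg k G →ₐ[k] k := Pi.evalAlgHom k (fun _ : G => k) g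

theorem ext_ev {f f' : FunAlg k G} (h : ∀ g, ev g f = ev g f') : f = f' := funext h

@[simp] theorem ev_apply (g : G) (f : G → k) : ev g (f : FunAlg k G) = f g := rfl

variable {N X : Type*} [AddCommGroup N] [Module k N] [AddCommGroup X] [Module k X]

/-- Evaluation at `g` in the left tensor factor. -/
def evL (g : G) : FunAlg k G ⊗[k] N →ₗ[k] N :=
  (TensorProduct.lid k N).toLinearMap ∘ₗ (ev g).toLinearMap.rTensor N

/-- Evaluation at `g` in the right tensor factor. -/
def evR (g : G) : N ⊗[k] FunAlg k G →ₗ[k] N :=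
  (TensorProduct.rid k N).toLinearMap ∘ₗ (ev g).toLinearMap.lTensor N

@[simp] theorem evL_tmul (g : G) (f : FunAlg k G) (n : N) : evL g (f ⊗ₜ[k] n) = ev g f • n := by
  simp [evL]

@[simp] theorem evR_tmul (g : G) (f : FunAlg k G) (n : N) : evR g (n ⊗ₜ[k] f) = ev g f • n := by
  simp [evR]

theorem evL_assoc (g : G) (t : FunAlg k G ⊗[k] X ⊗[k] N) :
    evL g (TensorProduct.assoc k _ X N t) = (evL g).rTensor N t :=
  LinearMap.congr_fun (f := evL g ∘ₗ (TensorProduct.assoc k (FunAlg k G) X N).toLinearMap)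
    (TensorProduct.ext_threefold fun _ _ _ => by simp [TensorProduct.smul_tmul']) t

theorem evR_assoc (g : G) (t : N ⊗[k] (X ⊗[k] FunAlg k G)) :
    evR g ((TensorProduct.assoc k N X _).symm t) = (evR g).lTensor N t := by
  obtain ⟨t, rfl⟩ := (TensorProduct.assoc k N X _).surjective t
  rw [LinearEquiv.symm_apply_apply]
  exact LinearMap.congr_fun (f := evR g) (g := (evR g).lTensor N ∘ₗ
    (TensorProduct.assoc k N X (FunAlg k G)).toLinearMap)
    (TensorProduct.ext_threefold fun _ _ _ => by simp) t

theorem evL_lTensor (g : G) (F : N →ₗ[k] X) (t : FunAlg k G ⊗[k] N) :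
    evL g (F.lTensor _ t) = F (evL g t) :=
  LinearMap.congr_fun (f := evL g ∘ₗ F.lTensor _) (g := F ∘ₗ evL g)
    (TensorProduct.ext' fun _ _ => by simp) t

theorem evR_rTensor (g : G) (F : N →ₗ[k] X) (t : N ⊗[k] FunAlg k G) :
    evR g (F.rTensor _ t) = F (evR g t) :=
  LinearMap.congr_fun (f := evR g ∘ₗ F.rTensor _) (g := F ∘ₗ evR g)
    (TensorProduct.ext' fun _ _ => by simp) t

theorem evL_map₂ {Y : Type*} [AddCommGroup Y] [Module k Y]
    {μ : FunAlg k G →ₗ[k] FunAlg k G →ₗ[k] FunAlg k G} (hμ : ∀ g a b, ev g (μ a b) = ev g a * ev g b)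
    (F : X →ₗ[k] N →ₗ[k] Y) (g : G) (s : FunAlg k G ⊗[k] X) (t : FunAlg k G ⊗[k] N) :
    evL g (TensorProduct.map₂ μ F s t) = F (evL g s) (evL g t) :=
  tensor_induction₂ (P := fun s t => evL g (TensorProduct.map₂ μ F s t) = F (evL g s) (evL g t))
    (by simp) (by simp) (fun s s' t h h' => by simp only [map_add, LinearMap.add_apply, h, h'])
    (fun s t t' h h' => by simp only [map_add, h, h'])
    (fun a x b n => by simp [hμ, mul_smul, smul_comm (ev g a)]) s t

theorem evR_map₂ {Y : Type*} [AddCommGroup Y] [Module k Y]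
    {μ : FunAlg k G →ₗ[k] FunAlg k G →ₗ[k] FunAlg k G} (hμ : ∀ g a b, ev g (μ a b) = ev g a * ev g b)
    (F : X →ₗ[k] N →ₗ[k] Y) (g : G) (s : X ⊗[k] FunAlg k G) (t : N ⊗[k] FunAlg k G) :
    evR g (TensorProduct.map₂ F μ s t) = F (evR g s) (evR g t) :=
  tensor_induction₂ (P := fun s t => evR g (TensorProduct.map₂ F μ s t) = F (evR g s) (evR g t))
    (by simp) (by simp) (fun s s' t h h' => by simp only [map_add, LinearMap.add_apply, h, h'])
    (fun s t t' h h' => by simp only [map_add, h, h'])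
    (fun x a n b => by simp [hμ, mul_smul, smul_comm (ev g a)]) s t

theorem ev_mul (g : G) (a b : FunAlg k G) :
    ev g (LinearMap.mul k (FunAlg k G) a b) = ev g a * ev g b := map_mul (ev g) a b

theorem ev_mul_flip (g : G) (a b : FunAlg k G) :
    ev g ((LinearMap.mul k (FunAlg k G)).flip a b) = ev g a * ev g b :=
  (map_mul (ev g) b a).trans (mul_comm _ _)
end

variable {k G : Type*} [Field k] [Group G]

/-- Left translation `f ↦ f(g ·)`. -/
def trL (g : G) : FunAlg k G →ₗ[k] FunAlg k G := LinearMap.funLeft k k (g * ·)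

/-- Right translation `f ↦ f(· g)`. -/
def trR (g : G) : FunAlg k G →ₗ[k] FunAlg k G := LinearMap.funLeft k k (· * g)

@[simp] theorem ev_trL (g h : G) (f : FunAlg k G) : ev h (trL g f) = ev (g * h) f := rfl
@[simp] theorem ev_trR (g h : G) (f : FunAlg k G) : ev h (trR g f) = ev (h * g) f := rfl

section
variable {N X : Type*} [AddCommGroup N] [Module k N] [AddCommGroup X] [Module k X]

theorem evL_trL (g h : G) (t : FunAlg k G ⊗[k] N) :
    evL h ((trL g).rTensor N t) = evL (g * h) t :=
  LinearMap.congr_fun (f := evL h ∘ₗ (trL g).rTensor N)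
    (TensorProduct.ext' fun _ _ => by simp) t

theorem evR_trR (g h : G) (t : N ⊗[k] FunAlg k G) :
    evR h ((trR g).lTensor N t) = evR (h * g) t :=
  LinearMap.congr_fun (f := evR h ∘ₗ (trR g).lTensor N)
    (TensorProduct.ext' fun _ _ => by simp) t
end

end FunAlg

namespace FunAlg
section
variable {k G N : Type*} [Field k] [DecidableEq G] [AddCommGroup N] [Module k N]

/-- The function that is `1` at `g` and `0` elsewhere. -/
def p (k : Type*) {G : Type*} [Field k] [DecidableEq G] (g : G) : FunAlg k G :=
  fun x => if x = g then 1 else 0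

@[simp] theorem ev_p (x g : G) : ev x (p k g) = if x = g then 1 else 0 := rfl

variable [Fintype G]

theorem eq_sum_p (f : FunAlg k G) : f = ∑ g, ev g f • p k g := by
  apply ext_ev
  intro x
  simp

theorem eq_sum_evL (t : FunAlg k G ⊗[k] N) : t = ∑ g, p k g ⊗ₜ evL g t := by
  induction t using TensorProduct.induction_on with
  | zero => simp
  | tmul f n =>
    conv_lhs => rw [eq_sum_p f]
    simp [TensorProduct.sum_tmul, TensorProduct.smul_tmul]
  | add x y hx hy =>
    conv_lhs => rw [hx, hy]
    simp [TensorProduct.tmul_add, Finset.sum_add_distrib]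

theorem eq_sum_evR (t : N ⊗[k] FunAlg k G) : t = ∑ g, evR g t ⊗ₜ p k g := by
  induction t using TensorProduct.induction_on with
  | zero => simp
  | tmul n f =>
    conv_lhs => rw [eq_sum_p f]
    simp [TensorProduct.tmul_sum, TensorProduct.smul_tmul]
  | add x y hx hy =>
    conv_lhs => rw [hx, hy]
    simp [TensorProduct.add_tmul, Finset.sum_add_distrib]

theorem ext_evL {s t : FunAlg k G ⊗[k] N} (h : ∀ g, evL g s = evL g t) : s = t := by
  rw [eq_sum_evL s, eq_sum_evL t]
  exact Finset.sum_congr rfl fun g _ => by rw [h]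

theorem ext_evR {s t : N ⊗[k] FunAlg k G} (h : ∀ g, evR g s = evR g t) : s = t := by
  rw [eq_sum_evR s, eq_sum_evR t]
  exact Finset.sum_congr rfl fun g _ => by rw [h]
end

variable {k G : Type*} [Field k] [Group G] [Fintype G] [DecidableEq G]

/-- The comultiplication `f ↦ ∑ f(a b) p_a ⊗ p_b`. -/
def comulLin : FunAlg k G →ₗ[k] FunAlg k G ⊗[k] FunAlg k G :=
  ∑ a, ∑ b, (ev (a * b)).toLinearMap.smulRight (p k a ⊗ₜ p k b)

theorem evL_comul (g : G) (f : FunAlg k G) : evL g (comulLin f) = trL g f := by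
  apply ext_ev
  intro h
  simp [comulLin, LinearMap.sum_apply, map_sum]

theorem evR_comul (g : G) (f : FunAlg k G) : evR g (comulLin f) = trR g f := by
  apply ext_ev
  intro h
  simp [comulLin, LinearMap.sum_apply, map_sum]

/-- The comultiplication as an algebra map. -/
def comulAlg : FunAlg k G →ₐ[k] FunAlg k G ⊗[k] FunAlg k G :=
  AlgHom.ofLinearMap comulLin
    (ext_evL fun g => ext_ev fun h => by
      rw [evL_comul, Algebra.TensorProduct.one_def, evL_tmul]; simp)
    (fun a b => ext_evL fun g => by
      rw [← map₂_mul, evL_map₂ ev_mul, evL_comul, evL_comul, evL_comul]; rfl)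

instance : Bialgebra k (FunAlg k G) :=
  Bialgebra.ofAlgHom comulAlg (ev 1)
    (by
      apply AlgHom.ext
      intro f
      change TensorProduct.assoc k _ _ _ ((comulLin (k := k) (G := G)).rTensor _ (comulLin f)) =
        (comulLin (k := k) (G := G)).lTensor _ (comulLin f)
      refine ext_evL fun g => ext_evL fun h => ?_
      have e : evL g ∘ₗ comulLin (k := k) = trL g := LinearMap.ext (evL_comul g)
      rw [evL_assoc, evL_lTensor, ← LinearMap.rTensor_comp_apply, e, evL_trL, evL_comul, evL_comul,
        evL_comul]
      exact ext_ev fun x => by simp [mul_assoc])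
    (by
      apply AlgHom.ext
      intro f
      apply (TensorProduct.lid k (FunAlg k G)).injective
      refine Eq.trans ?_ ((TensorProduct.lid k (FunAlg k G)).apply_symm_apply f).symm
      refine Eq.trans (b := evL 1 (comulLin f)) rfl ?_
      rw [evL_comul]
      exact ext_ev fun x => by simp)
    (by
      apply AlgHom.ext
      intro f
      apply (TensorProduct.rid k (FunAlg k G)).injective
      refine Eq.trans ?_ ((TensorProduct.rid k (FunAlg k G)).apply_symm_apply f).symm
      refine Eq.trans (b := evR 1 (comulLin f)) rfl ?_
      rw [evR_comul]
      exact ext_ev fun x => by simp)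

theorem comul_def (f : FunAlg k G) : Coalgebra.comul (R := k) f = comulLin f := rfl
theorem counit_def : Coalgebra.counit (R := k) (A := FunAlg k G) = (ev 1).toLinearMap := rfl

end FunAlg

section Dual
variable {k G M : Type*} [Field k] [Group G] [AddCommGroup M] [Module k M]

/-- A function on `G` as a linear form on `kG`. -/
def FunAlg.pair (f : FunAlg k G) : MonoidAlgebra k G →ₗ[k] k := gl fun g => FunAlg.ev g f

@[simp] theorem FunAlg.pair_gr (f : FunAlg k G) (g : G) : f.pair (gr k g) = FunAlg.ev g f :=
  gl_gr _ g

theorem FunAlg.pair_add (p q : FunAlg k G) : (p + q).pair = p.pair + q.pair := by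
  apply LinearMap.ext
  exact gr_induction (by simp) (fun x y hx hy => by rw [map_add, map_add, hx, hy])
    (fun c x hx => by rw [map_smul, map_smul, hx])
    (fun g => by simp only [LinearMap.add_apply, FunAlg.pair_gr, map_add])

theorem FunAlg.pair_smul (c : k) (p : FunAlg k G) : (c • p).pair = c • p.pair := by
  apply LinearMap.ext
  exact gr_induction (by simp) (fun x y hx hy => by rw [map_add, map_add, hx, hy])
    (fun c x hx => by rw [map_smul, map_smul, hx])
    (fun g => by simp only [LinearMap.smul_apply, FunAlg.pair_gr, map_smul])

section
variable {N X : Type*} [AddCommGroup N] [Module k N] [AddCommGroup X] [Module k X]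

theorem lin_ext_L {f f' : MonoidAlgebra k G ⊗[k] N →ₗ[k] X}
    (h : ∀ g n, f (gr k g ⊗ₜ n) = f' (gr k g ⊗ₜ n)) (t : MonoidAlgebra k G ⊗[k] N) :
    f t = f' t := by
  refine LinearMap.congr_fun (TensorProduct.ext' fun a n => ?_) t
  exact gr_induction (P := fun a => f (a ⊗ₜ n) = f' (a ⊗ₜ n)) (by simp)
    (fun x y hx hy => by rw [TensorProduct.add_tmul, map_add, map_add, hx, hy])
    (fun c x hx => by rw [← TensorProduct.smul_tmul', map_smul, map_smul, hx])
    (fun g => h g n) a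

theorem lin_ext_R {f f' : N ⊗[k] MonoidAlgebra k G →ₗ[k] X}
    (h : ∀ g n, f (n ⊗ₜ gr k g) = f' (n ⊗ₜ gr k g)) (t : N ⊗[k] MonoidAlgebra k G) :
    f t = f' t := by
  refine LinearMap.congr_fun (TensorProduct.ext' fun n a => ?_) t
  exact gr_induction (P := fun a => f (n ⊗ₜ a) = f' (n ⊗ₜ a)) (by simp)
    (fun x y hx hy => by rw [TensorProduct.tmul_add, map_add, map_add, hx, hy])
    (fun c x hx => by rw [TensorProduct.tmul_smul, map_smul, map_smul, hx])
    (fun g => h g n) a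

variable [DecidableEq G]

/-- The coefficient of `g` in the left tensor factor. -/
def cfL (g : G) : MonoidAlgebra k G ⊗[k] N →ₗ[k] N :=
  (TensorProduct.lid k N).toLinearMap ∘ₗ (FunAlg.p k g).pair.rTensor N

/-- The coefficient of `g` in the right tensor factor. -/
def cfR (g : G) : N ⊗[k] MonoidAlgebra k G →ₗ[k] N :=
  (TensorProduct.rid k N).toLinearMap ∘ₗ (FunAlg.p k g).pair.lTensor N

@[simp] theorem cfL_tmul (g h : G) (n : N) :
    cfL g (gr k h ⊗ₜ[k] n) = if h = g then n else 0 := by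
  rw [cfL, LinearMap.comp_apply, LinearMap.rTensor_tmul, FunAlg.pair_gr]
  by_cases hh : h = g <;> simp [hh]

@[simp] theorem cfR_tmul (g h : G) (n : N) :
    cfR g (n ⊗ₜ[k] gr k h) = if h = g then n else 0 := by
  rw [cfR, LinearMap.comp_apply, LinearMap.lTensor_tmul, FunAlg.pair_gr]
  by_cases hh : h = g <;> simp [hh]

theorem cfL_lTensor (g : G) (F : N →ₗ[k] X) (t : MonoidAlgebra k G ⊗[k] N) :
    cfL g (F.lTensor _ t) = F (cfL g t) :=
  lin_ext_L (f := cfL g ∘ₗ F.lTensor _) (f' := F ∘ₗ cfL g) (fun h n => by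
    simp only [LinearMap.comp_apply, LinearMap.lTensor_tmul, cfL_tmul, apply_ite F, map_zero]) t

theorem cfR_rTensor (g : G) (F : N →ₗ[k] X) (t : N ⊗[k] MonoidAlgebra k G) :
    cfR g (F.rTensor _ t) = F (cfR g t) :=
  lin_ext_R (f := cfR g ∘ₗ F.rTensor _) (f' := F ∘ₗ cfR g) (fun h n => by
    simp only [LinearMap.comp_apply, LinearMap.rTensor_tmul, cfR_tmul, apply_ite F, map_zero]) t

end

namespace HopfBimodule
variable (B : HopfBimodule k (MonoidAlgebra k G) M)

/-- The action `(p · f)(m) = p(m₍₋₁₎) f(m₍₀₎)` of `(kG)*` on the dual space. -/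
def dualActL : FunAlg k G →ₗ[k] Module.Dual k M →ₗ[k] Module.Dual k M :=
  LinearMap.mk₂ k (fun p f => LinearMap.mul' k k ∘ₗ TensorProduct.map p.pair f ∘ₗ B.coactL)
    (fun p q f => by
      rw [FunAlg.pair_add, TensorProduct.map_add_left, LinearMap.add_comp, LinearMap.comp_add])
    (fun c p f => by
      rw [FunAlg.pair_smul, TensorProduct.map_smul_left, LinearMap.smul_comp, LinearMap.comp_smul])
    (fun p f f' => by
      rw [TensorProduct.map_add_right, LinearMap.add_comp, LinearMap.comp_add])
    (fun c p f => by
      rw [TensorProduct.map_smul_right, LinearMap.smul_comp, LinearMap.comp_smul])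

/-- The action `(f · p)(m) = f(m₍₀₎) p(m₍₁₎)` of `(kG)*` on the dual space. -/
def dualActR : FunAlg k G →ₗ[k] Module.Dual k M →ₗ[k] Module.Dual k M :=
  LinearMap.mk₂ k (fun p f => LinearMap.mul' k k ∘ₗ TensorProduct.map f p.pair ∘ₗ B.coactR)
    (fun p q f => by
      rw [FunAlg.pair_add, TensorProduct.map_add_right, LinearMap.add_comp, LinearMap.comp_add])
    (fun c p f => by
      rw [FunAlg.pair_smul, TensorProduct.map_smul_right, LinearMap.smul_comp, LinearMap.comp_smul])
    (fun p f f' => by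
      rw [TensorProduct.map_add_left, LinearMap.add_comp, LinearMap.comp_add])
    (fun c p f => by
      rw [TensorProduct.map_smul_left, LinearMap.smul_comp, LinearMap.comp_smul])

variable [DecidableEq G]

/-- The projection onto the component of left degree `g`. -/
def PL (g : G) : M →ₗ[k] M := cfL g ∘ₗ B.coactL

/-- The projection onto the component of right degree `g`. -/
def PR (g : G) : M →ₗ[k] M := cfR g ∘ₗ B.coactR

theorem PL_PL (g h : G) (m : M) : B.PL h (B.PL g m) = if g = h then B.PL g m else 0 := by
  have e := congrArg (cfL h) (congrArg (cfL g) (B.coactL_coassoc m))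
  rw [cfL_lTensor] at e
  refine e.symm.trans ?_
  refine lin_ext_L (f := cfL h ∘ₗ cfL g ∘ₗ (TensorProduct.assoc k _ _ M).toLinearMap ∘ₗ
    (Coalgebra.comul (R := k)).rTensor M) (f' := if g = h then cfL g else 0) (fun x n => ?_)
    (B.coactL m) |>.trans ?_
  · simp only [LinearMap.comp_apply, LinearMap.rTensor_tmul, comul_gr, LinearEquiv.coe_coe,
      TensorProduct.assoc_tmul, cfL_tmul]
    by_cases h1 : x = g <;> by_cases h2 : g = h <;> simp_all
  · by_cases h2 : g = h <;> simp [h2, PL]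

theorem PR_PR (g h : G) (m : M) : B.PR h (B.PR g m) = if g = h then B.PR g m else 0 := by
  have e := congrArg (cfR h) (congrArg (cfR g)
    ((LinearEquiv.eq_symm_apply _).2 (B.coactR_coassoc m)))
  rw [cfR_rTensor] at e
  refine e.trans ?_
  refine lin_ext_R (f := cfR h ∘ₗ cfR g ∘ₗ (TensorProduct.assoc k M _ _).symm.toLinearMap ∘ₗ
    (Coalgebra.comul (R := k)).lTensor M) (f' := if g = h then cfR g else 0) (fun x n => ?_)
    (B.coactR m) |>.trans ?_
  · simp only [LinearMap.comp_apply, LinearMap.lTensor_tmul, comul_gr, LinearEquiv.coe_coe,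
      TensorProduct.assoc_symm_tmul, cfR_tmul]
    by_cases h1 : x = g <;> by_cases h2 : g = h <;> simp_all
  · by_cases h2 : g = h <;> simp [h2, PR]

theorem PL_PR (g h : G) (m : M) : B.PL g (B.PR h m) = B.PR h (B.PL g m) := by
  have e := congrArg (cfR h) (congrArg (cfL g) (B.coact_comm m))
  rw [cfL_lTensor] at e
  refine Eq.trans ?_ e
  refine Eq.trans (cfR_rTensor h (B.PL g) (B.coactR m)).symm ?_
  congr 1
  have key : ∀ s : (MonoidAlgebra k G ⊗[k] M) ⊗[k] MonoidAlgebra k G,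
      cfL g (TensorProduct.assoc k _ M _ s) = (cfL g).rTensor _ s := by
    refine lin_ext_R (f := cfL g ∘ₗ (TensorProduct.assoc k (MonoidAlgebra k G) M
      (MonoidAlgebra k G)).toLinearMap)
      (f' := (cfL g).rTensor (MonoidAlgebra k G)) (fun x t => ?_)
    refine lin_ext_L (f := (cfL g ∘ₗ (TensorProduct.assoc k (MonoidAlgebra k G) M
      (MonoidAlgebra k G)).toLinearMap) ∘ₗ (TensorProduct.mk k _ _).flip (gr k x))
      (f' := (cfL g).rTensor (MonoidAlgebra k G) ∘ₗ
      (TensorProduct.mk k _ _).flip (gr k x)) (fun y n => ?_) t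
    by_cases hy : y = g <;> simp [hy]
  rw [key, ← LinearMap.rTensor_comp_apply]
  rfl

theorem PL_actL (g x : G) (m : M) :
    B.PL (g * x) (B.actL (gr k g) m) = B.actL (gr k g) (B.PL x m) := by
  rw [PL, LinearMap.comp_apply, B.coactL_actL, comul_gr]
  refine lin_ext_L (f := cfL (g * x) ∘ₗ TensorProduct.map₂ (LinearMap.mul k _) B.actL
    (gr k g ⊗ₜ gr k g)) (f' := B.actL (gr k g) ∘ₗ cfL x) (fun y n => ?_) (B.coactL m)
  rw [LinearMap.comp_apply, TensorProduct.map₂_apply_tmul, TensorProduct.map_tmul,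
    LinearMap.mul_apply', ← gr_mul, cfL_tmul, LinearMap.comp_apply, cfL_tmul]
  by_cases hy : y = x <;> simp [hy]

theorem PL_actR (g x : G) (m : M) :
    B.PL (x * g) (B.actR (gr k g) m) = B.actR (gr k g) (B.PL x m) := by
  rw [PL, LinearMap.comp_apply, B.coactL_actR, comul_gr]
  refine lin_ext_L (f := cfL (x * g) ∘ₗ TensorProduct.map₂ (LinearMap.mul k _).flip B.actR
    (gr k g ⊗ₜ gr k g)) (f' := B.actR (gr k g) ∘ₗ cfL x) (fun y n => ?_) (B.coactL m)
  rw [LinearMap.comp_apply, TensorProduct.map₂_apply_tmul, TensorProduct.map_tmul, LinearMap.flip_apply,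
    LinearMap.mul_apply', ← gr_mul, cfL_tmul, LinearMap.comp_apply, cfL_tmul]
  by_cases hy : y = x <;> simp [hy]

theorem PR_actL (g x : G) (m : M) :
    B.PR (g * x) (B.actL (gr k g) m) = B.actL (gr k g) (B.PR x m) := by
  rw [PR, LinearMap.comp_apply, B.coactR_actL, comul_gr]
  refine lin_ext_R (f := cfR (g * x) ∘ₗ TensorProduct.map₂ B.actL (LinearMap.mul k _)
    (gr k g ⊗ₜ gr k g)) (f' := B.actL (gr k g) ∘ₗ cfR x) (fun y n => ?_) (B.coactR m)
  rw [LinearMap.comp_apply, TensorProduct.map₂_apply_tmul, TensorProduct.map_tmul,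
    LinearMap.mul_apply', ← gr_mul, cfR_tmul, LinearMap.comp_apply, cfR_tmul]
  by_cases hy : y = x <;> simp [hy]

theorem PR_actR (g x : G) (m : M) :
    B.PR (x * g) (B.actR (gr k g) m) = B.actR (gr k g) (B.PR x m) := by
  rw [PR, LinearMap.comp_apply, B.coactR_actR, comul_gr]
  refine lin_ext_R (f := cfR (x * g) ∘ₗ TensorProduct.map₂ B.actR (LinearMap.mul k _).flip
    (gr k g ⊗ₜ gr k g)) (f' := B.actR (gr k g) ∘ₗ cfR x) (fun y n => ?_) (B.coactR m)
  rw [LinearMap.comp_apply, TensorProduct.map₂_apply_tmul, TensorProduct.map_tmul, LinearMap.flip_apply,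
    LinearMap.mul_apply', ← gr_mul, cfR_tmul, LinearMap.comp_apply, cfR_tmul]
  by_cases hy : y = x <;> simp [hy]

variable [Fintype G]

theorem sum_PL (m : M) : ∑ g, B.PL g m = m := by
  have h := lin_ext_L (f := ∑ g, cfL g) (f' := (TensorProduct.lid k M).toLinearMap ∘ₗ
    (Coalgebra.counit (R := k)).rTensor M) (fun g n => by
      rw [LinearMap.comp_apply, LinearMap.rTensor_tmul, counit_gr]
      simp [LinearMap.sum_apply]) (B.coactL m)
  rw [LinearMap.sum_apply] at h
  exact h.trans (B.coactL_counit m)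

theorem sum_PR (m : M) : ∑ g, B.PR g m = m := by
  have h := lin_ext_R (f := ∑ g, cfR g) (f' := (TensorProduct.rid k M).toLinearMap ∘ₗ
    (Coalgebra.counit (R := k)).lTensor M) (fun g n => by
      rw [LinearMap.comp_apply, LinearMap.lTensor_tmul, counit_gr]
      simp [LinearMap.sum_apply]) (B.coactR m)
  rw [LinearMap.sum_apply] at h
  exact h.trans (B.coactR_counit m)

/-- The coaction `f ↦ ∑ p_g ⊗ f(g · -)` of `(kG)*` on the dual space. -/
def dualCoactL : Module.Dual k M →ₗ[k] FunAlg k G ⊗[k] Module.Dual k M :=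
  ∑ g, TensorProduct.mk k _ _ (FunAlg.p k g) ∘ₗ (B.actL (gr k g)).dualMap

/-- The coaction `f ↦ ∑ f(- · g) ⊗ p_g` of `(kG)*` on the dual space. -/
def dualCoactR : Module.Dual k M →ₗ[k] Module.Dual k M ⊗[k] FunAlg k G :=
  ∑ g, (TensorProduct.mk k _ _).flip (FunAlg.p k g) ∘ₗ (B.actR (gr k g)).dualMap

theorem dualActL_apply (p : FunAlg k G) (f : Module.Dual k M) (m : M) :
    B.dualActL p f m = ∑ g, FunAlg.ev g p * f (B.PL g m) := by
  refine (lin_ext_L (f := LinearMap.mul' k k ∘ₗ TensorProduct.map p.pair f)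
    (f' := ∑ g, FunAlg.ev g p • (f ∘ₗ cfL g)) (fun x n => ?_) (B.coactL m)).trans ?_
  · rw [LinearMap.comp_apply, TensorProduct.map_tmul, FunAlg.pair_gr]
    simp [LinearMap.sum_apply, apply_ite f]
  · simp [LinearMap.sum_apply, PL]

theorem dualActR_apply (p : FunAlg k G) (f : Module.Dual k M) (m : M) :
    B.dualActR p f m = ∑ g, FunAlg.ev g p * f (B.PR g m) := by
  refine (lin_ext_R (f := LinearMap.mul' k k ∘ₗ TensorProduct.map f p.pair)
    (f' := ∑ g, FunAlg.ev g p • (f ∘ₗ cfR g)) (fun x n => ?_) (B.coactR m)).trans ?_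
  · rw [LinearMap.comp_apply, TensorProduct.map_tmul, FunAlg.pair_gr]
    simp [LinearMap.sum_apply, apply_ite f, mul_comm]
  · simp [LinearMap.sum_apply, PR]

theorem evL_dualCoactL (g : G) (f : Module.Dual k M) :
    FunAlg.evL g (B.dualCoactL f) = f ∘ₗ B.actL (gr k g) := by
  simp [dualCoactL, LinearMap.sum_apply, map_sum]
  rfl

theorem evR_dualCoactR (g : G) (f : Module.Dual k M) :
    FunAlg.evR g (B.dualCoactR f) = f ∘ₗ B.actR (gr k g) := by
  simp [dualCoactR, LinearMap.sum_apply, map_sum]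
  rfl

/-- The dual `(kG)*`-Hopf bimodule of a `kG`-Hopf bimodule. -/
def dual : HopfBimodule k (FunAlg k G) (Module.Dual k M) where
  actL := B.dualActL
  actR := B.dualActR
  coactL := B.dualCoactL
  coactR := B.dualCoactR
  actL_one f := by
    ext m
    rw [dualActL_apply]
    simp only [map_one, one_mul]
    rw [← map_sum, sum_PL]
  actL_mul a b f := by
    ext m
    simp only [dualActL_apply, PL_PL, map_mul]
    refine Finset.sum_congr rfl fun g _ => ?_
    simp [apply_ite f, mul_assoc]
  actR_one f := by
    ext m
    rw [dualActR_apply]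
    simp only [map_one, one_mul]
    rw [← map_sum, sum_PR]
  actR_mul a b f := by
    ext m
    simp only [dualActR_apply, PR_PR, map_mul]
    refine Finset.sum_congr rfl fun g _ => ?_
    simp [apply_ite f, mul_left_comm, mul_assoc]
  act_comm a b f := by
    ext m
    simp only [dualActR_apply, dualActL_apply, PL_PR, Finset.mul_sum]
    rw [Finset.sum_comm]
    exact Finset.sum_congr rfl fun g _ => Finset.sum_congr rfl fun h _ => mul_left_comm _ _ _
  coactL_counit f := by
    refine (B.evL_dualCoactL 1 f).trans ?_
    ext m
    exact congrArg f (B.actL_one m)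
  coactL_coassoc f := by
    refine FunAlg.ext_evL fun g => FunAlg.ext_evL fun h => ?_
    have e : FunAlg.evL g ∘ₗ FunAlg.comulLin (k := k) = FunAlg.trL g :=
      LinearMap.ext (FunAlg.evL_comul g)
    rw [FunAlg.evL_assoc, FunAlg.evL_lTensor, ← LinearMap.rTensor_comp_apply]
    change FunAlg.evL h ((FunAlg.evL g ∘ₗ FunAlg.comulLin (k := k)).rTensor _ _) = _
    rw [e, FunAlg.evL_trL, evL_dualCoactL, evL_dualCoactL, evL_dualCoactL]
    ext m
    exact congrArg f (by rw [gr_mul]; exact B.actL_mul _ _ m)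
  coactR_counit f := by
    refine (B.evR_dualCoactR 1 f).trans ?_
    ext m
    exact congrArg f (B.actR_one m)
  coactR_coassoc f := by
    rw [← LinearEquiv.eq_symm_apply]
    refine FunAlg.ext_evR fun g => FunAlg.ext_evR fun h => ?_
    have e : FunAlg.evR g ∘ₗ FunAlg.comulLin (k := k) = FunAlg.trR g :=
      LinearMap.ext (FunAlg.evR_comul g)
    rw [FunAlg.evR_assoc, FunAlg.evR_rTensor, ← LinearMap.lTensor_comp_apply]
    change _ = FunAlg.evR h ((FunAlg.evR g ∘ₗ FunAlg.comulLin (k := k)).lTensor _ _)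
    rw [e, FunAlg.evR_trR, evR_dualCoactR, evR_dualCoactR, evR_dualCoactR]
    ext m
    exact congrArg f (by rw [gr_mul]; exact (B.actR_mul _ _ m).symm)
  coact_comm f := by
    refine FunAlg.ext_evL fun g => FunAlg.ext_evR fun h => ?_
    rw [FunAlg.evL_assoc, FunAlg.evL_lTensor, ← LinearMap.rTensor_comp_apply,
      FunAlg.evR_rTensor, LinearMap.comp_apply, evL_dualCoactL, evR_dualCoactR, evL_dualCoactL,
      evR_dualCoactR]
    ext m
    exact congrArg f (B.act_comm _ _ m).symm
  coactL_actL p f := by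
    refine FunAlg.ext_evL fun g => ?_
    rw [FunAlg.evL_map₂ FunAlg.ev_mul, FunAlg.comul_def, FunAlg.evL_comul, evL_dualCoactL,
      evL_dualCoactL]
    ext m
    rw [LinearMap.comp_apply, dualActL_apply, dualActL_apply]
    refine (Fintype.sum_equiv (Equiv.mulLeft g) _ _ fun x => ?_).symm
    rw [Equiv.coe_mulLeft, PL_actL]; rfl
  coactL_actR p f := by
    refine FunAlg.ext_evL fun g => ?_
    rw [FunAlg.evL_map₂ FunAlg.ev_mul_flip, FunAlg.comul_def, FunAlg.evL_comul, evL_dualCoactL,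
      evL_dualCoactL]
    ext m
    rw [LinearMap.comp_apply, dualActR_apply, dualActR_apply]
    refine (Fintype.sum_equiv (Equiv.mulLeft g) _ _ fun x => ?_).symm
    rw [Equiv.coe_mulLeft, PR_actL]; rfl
  coactR_actL p f := by
    refine FunAlg.ext_evR fun g => ?_
    rw [FunAlg.evR_map₂ FunAlg.ev_mul, FunAlg.comul_def, FunAlg.evR_comul, evR_dualCoactR,
      evR_dualCoactR]
    ext m
    rw [LinearMap.comp_apply, dualActL_apply, dualActL_apply]
    refine (Fintype.sum_equiv (Equiv.mulRight g) _ _ fun x => ?_).symm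
    rw [Equiv.coe_mulRight, PL_actR]; rfl
  coactR_actR p f := by
    refine FunAlg.ext_evR fun g => ?_
    rw [FunAlg.evR_map₂ FunAlg.ev_mul_flip, FunAlg.comul_def, FunAlg.evR_comul, evR_dualCoactR,
      evR_dualCoactR]
    ext m
    rw [LinearMap.comp_apply, dualActR_apply, dualActR_apply]
    refine (Fintype.sum_equiv (Equiv.mulRight g) _ _ fun x => ?_).symm
    rw [Equiv.coe_mulRight, PR_actR]; rfl

end HopfBimodule
end Dual

section Isomorphisms
variable {k : Type*} [Field k]

/-- `(φ, e)` is a pull-push isomorphism of Hopf bimodules for some linear bijection `e`: it is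
`H`-bilinear when `H` acts on the target through `φ`, and it is compatible with the coactions when
the coactions of the source are pushed forward along `φ`. -/
def HopfBimodule.IsoOver {H H' M M' : Type*} [Ring H] [Bialgebra k H] [Ring H'] [Bialgebra k H']
    [AddCommGroup M] [Module k M] [AddCommGroup M'] [Module k M'] (φ : H ≃ₐc[k] H')
    (B : HopfBimodule k H M) (B' : HopfBimodule k H' M') : Prop :=
  ∃ e : M ≃ₗ[k] M',
    (∀ h m, e (B.actL h m) = B'.actL (φ h) (e m)) ∧
    (∀ h m, e (B.actR h m) = B'.actR (φ h) (e m)) ∧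
    (∀ m, B'.coactL (e m) =
      TensorProduct.map φ.toCoalgEquiv.toLinearEquiv.toLinearMap e.toLinearMap (B.coactL m)) ∧
    (∀ m, B'.coactR (e m) =
      TensorProduct.map e.toLinearMap φ.toCoalgEquiv.toLinearEquiv.toLinearMap (B.coactR m))

/-- Isomorphism of Hopf bimodules over the same bialgebra. -/
def HopfBimodule.Iso {H M M' : Type*} [Ring H] [Bialgebra k H]
    [AddCommGroup M] [Module k M] [AddCommGroup M'] [Module k M']
    (B : HopfBimodule k H M) (B' : HopfBimodule k H M') : Prop :=
  HopfBimodule.IsoOver (BialgEquiv.refl k H) B B'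

/-- Pull-push isomorphism of Yetter-Drinfeld modules over the Hopf algebra isomorphism `φ`. -/
def YDModule.IsoOver {G G' V V' : Type*} [Group G] [Group G'] [AddCommGroup V] [Module k V]
    [AddCommGroup V'] [Module k V'] (φ : MonoidAlgebra k G ≃ₐc[k] MonoidAlgebra k G')
    (Y : YDModule k G V) (Y' : YDModule k G' V') : Prop :=
  ∃ e : V ≃ₗ[k] V',
    (∀ h v, e (Y.act h v) = Y'.act (φ h) (e v)) ∧
    (∀ v, Y'.coact (e v) =
      TensorProduct.map φ.toCoalgEquiv.toLinearEquiv.toLinearMap e.toLinearMap (Y.coact v))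

/-- Isomorphism of Yetter-Drinfeld modules over the same group. -/
def YDModule.Iso {G V V' : Type*} [Group G] [AddCommGroup V] [Module k V]
    [AddCommGroup V'] [Module k V'] (Y : YDModule k G V) (Y' : YDModule k G V') : Prop :=
  YDModule.IsoOver (BialgEquiv.refl k _) Y Y'

/-- Isomorphism of graded bialgebras. A bialgebra isomorphism between Hopf algebras commutes with
the antipodes, so this is isomorphism of graded Hopf algebras if both sides are Hopf algebras. -/
def GradedIso {A A' : Type*} [Ring A] [Bialgebra k A] [Ring A'] [Bialgebra k A']
    (𝒜 : ℕ → Submodule k A) (𝒜' : ℕ → Submodule k A') : Prop :=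
  ∃ f : A ≃ₐc[k] A', ∀ n, (𝒜 n).map f.toCoalgEquiv.toLinearEquiv.toLinearMap = 𝒜' n

end Isomorphisms

section Braided
variable {k G : Type*} [Field k] [Group G]

namespace YDModule
variable {V : Type*} [AddCommGroup V] [Module k V] (Y : YDModule k G V)

/-- The braiding `v ⊗ w ↦ v₍₋₁₎ · w ⊗ v₍₀₎`. -/
def braid : V ⊗[k] V →ₗ[k] V ⊗[k] V :=
  (TensorProduct.lift Y.act).rTensor V ∘ₗ
    (TensorProduct.rightComm k (MonoidAlgebra k G) V V).toLinearMap ∘ₗ Y.coact.rTensor V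

/-- The coaction `v ⊗ w ↦ v₍₋₁₎ w₍₋₁₎ ⊗ v₍₀₎ ⊗ w₍₀₎` on the tensor square. -/
def coact₂ : V ⊗[k] V →ₗ[k] MonoidAlgebra k G ⊗[k] (V ⊗[k] V) :=
  (LinearMap.mul' k (MonoidAlgebra k G)).rTensor (V ⊗[k] V) ∘ₗ
    (TensorProduct.tensorTensorTensorComm k (MonoidAlgebra k G) V
      (MonoidAlgebra k G) V).toLinearMap ∘ₗ TensorProduct.map Y.coact Y.coact

end YDModule

/-- The product `(a ⊗ b) (c ⊗ d) = a (b₍₋₁₎ · c) ⊗ b₍₀₎ d` of the braided tensor square of an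
algebra in the Yetter-Drinfeld category. -/
def braidedMul {R : Type*} [Ring R] [Algebra k R] (Y : YDModule k G R) :
    (R ⊗[k] R) ⊗[k] (R ⊗[k] R) →ₗ[k] R ⊗[k] R :=
  TensorProduct.map (LinearMap.mul' k R) (LinearMap.mul' k R) ∘ₗ
    (TensorProduct.assoc k (R ⊗[k] R) R R).toLinearMap ∘ₗ
    (TensorProduct.assoc k R R R).symm.toLinearMap.rTensor R ∘ₗ
    (Y.braid.lTensor R).rTensor R ∘ₗ
    (TensorProduct.assoc k R R R).toLinearMap.rTensor R ∘ₗ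
    (TensorProduct.assoc k (R ⊗[k] R) R R).symm.toLinearMap

/-- Graded braided Hopf algebras in the category of Yetter-Drinfeld `kG`-modules. -/
structure GradedBraidedHopf (k G R : Type*) [Field k] [Group G] [Ring R] [Algebra k R]
    [Coalgebra k R] where
  yd : YDModule k G R
  act_mul : ∀ (g : G) a b, yd.act (gr k g) (a * b) = yd.act (gr k g) a * yd.act (gr k g) b
  act_one : ∀ g : G, yd.act (gr k g) 1 = 1
  coact_mul : ∀ a b, yd.coact (a * b) = yd.coact a * yd.coact b
  coact_one : yd.coact 1 = 1
  comul_act : ∀ (g : G) a, Coalgebra.comul (R := k) (yd.act (gr k g) a) =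
    TensorProduct.map (yd.act (gr k g)) (yd.act (gr k g)) (Coalgebra.comul (R := k) a)
  counit_act : ∀ (g : G) a,
    Coalgebra.counit (R := k) (yd.act (gr k g) a) = Coalgebra.counit (R := k) a
  comul_coact : ∀ a, (Coalgebra.comul (R := k) (A := R)).lTensor (MonoidAlgebra k G) (yd.coact a) =
    yd.coact₂ (Coalgebra.comul (R := k) a)
  counit_coact : ∀ a, (Coalgebra.counit (R := k) (A := R)).lTensor (MonoidAlgebra k G)
    (yd.coact a) = 1 ⊗ₜ Coalgebra.counit (R := k) a
  comul_mul : ∀ a b : R, Coalgebra.comul (R := k) (a * b) =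
    braidedMul yd (Coalgebra.comul (R := k) a ⊗ₜ Coalgebra.comul (R := k) b)
  comul_one : Coalgebra.comul (R := k) (1 : R) = 1
  counit_mul : ∀ a b : R, Coalgebra.counit (R := k) (a * b) =
    Coalgebra.counit (R := k) a * Coalgebra.counit (R := k) b
  counit_one : Coalgebra.counit (R := k) (1 : R) = 1
  exists_antipode : ∃ S : R →ₗ[k] R, ∀ a,
    LinearMap.mul' k R (S.rTensor R (Coalgebra.comul (R := k) a)) =
      algebraMap k R (Coalgebra.counit (R := k) a) ∧
    LinearMap.mul' k R (S.lTensor R (Coalgebra.comul (R := k) a)) =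
      algebraMap k R (Coalgebra.counit (R := k) a)
  grade : ℕ → Submodule k R
  isInternal : DirectSum.IsInternal grade
  one_mem : 1 ∈ grade 0
  mul_mem : ∀ i j, ∀ a ∈ grade i, ∀ b ∈ grade j, a * b ∈ grade (i + j)
  comul_mem : ∀ n, ∀ a ∈ grade n, Coalgebra.comul (R := k) a ∈
    ⨆ p ∈ Finset.HasAntidiagonal.antidiagonal n, tens (grade p.1) (grade p.2)
  counit_eq_zero : ∀ n ≠ 0, ∀ a ∈ grade n, Coalgebra.counit (R := k) a = 0
  act_mem : ∀ n h, ∀ a ∈ grade n, yd.act h a ∈ grade n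
  coact_mem : ∀ n, ∀ a ∈ grade n, yd.coact a ∈ tens ⊤ (grade n)

namespace GradedBraidedHopf

/-- Pull-push isomorphism of graded braided Hopf algebras over the Hopf algebra isomorphism
`φ`. -/
def IsoOver {G' R R' : Type*} [Group G'] [Ring R] [Algebra k R] [Coalgebra k R]
    [Ring R'] [Algebra k R'] [Coalgebra k R'] (φ : MonoidAlgebra k G ≃ₐc[k] MonoidAlgebra k G')
    (A : GradedBraidedHopf k G R) (A' : GradedBraidedHopf k G' R') : Prop :=
  ∃ e : R ≃ₐ[k] R',
    (∀ a, Coalgebra.comul (R := k) (e a) =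
      TensorProduct.map e.toLinearMap e.toLinearMap (Coalgebra.comul (R := k) a)) ∧
    (∀ a, Coalgebra.counit (R := k) (e a) = Coalgebra.counit (R := k) a) ∧
    (∀ n, (A.grade n).map e.toLinearMap = A'.grade n) ∧
    (∀ h a, e (A.yd.act h a) = A'.yd.act (φ h) (e a)) ∧
    (∀ a, A'.yd.coact (e a) =
      TensorProduct.map φ.toCoalgEquiv.toLinearEquiv.toLinearMap e.toLinearMap (A.yd.coact a))

variable {R : Type*} [Ring R] [Algebra k R] [Coalgebra k R] (A : GradedBraidedHopf k G R)

/-- Isomorphism of graded braided Hopf algebras over the same group. -/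
def Iso {R' : Type*} [Ring R'] [Algebra k R'] [Coalgebra k R'] (A' : GradedBraidedHopf k G R') :
    Prop :=
  IsoOver (BialgEquiv.refl k _) A A'

/-- Nichols algebras: `R(0) = k`, the primitive elements are those of degree `1`, and they
generate `R`. -/
def IsNichols : Prop :=
  A.grade 0 = Submodule.span k {1} ∧
  (∀ a : R, Coalgebra.comul (R := k) a = a ⊗ₜ 1 + 1 ⊗ₜ a ↔ a ∈ A.grade 1) ∧
  Algebra.adjoin k (A.grade 1 : Set R) = ⊤

/-- `R` is the Nichols algebra `𝓑(V)`: it is a Nichols algebra with `R(1) ≅ V` as Yetter-Drinfeld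
modules. -/
def IsNicholsOf {V : Type*} [AddCommGroup V] [Module k V] (Y : YDModule k G V) : Prop :=
  A.IsNichols ∧ ∃ e : V ≃ₗ[k] A.grade 1,
    (∀ h v, (e (Y.act h v) : R) = A.yd.act h (e v)) ∧
    (∀ v, A.yd.coact (e v) =
      ((A.grade 1).subtype ∘ₗ e.toLinearMap).lTensor (MonoidAlgebra k G) (Y.coact v))

end GradedBraidedHopf
end Braided

/-- Hopf quivers with vertex set `G` and set of arrows `X`: the number of arrows from `x` to `y`
depends only on the conjugacy class of `x⁻¹ y`. -/
structure HopfQuiver (G X : Type*) [Group G] where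
  s : X → G
  t : X → G
  ramified : ∀ x y x' y' : G, ConjClasses.mk (x⁻¹ * y) = ConjClasses.mk (x'⁻¹ * y') →
    Nonempty ({a : X // s a = x ∧ t a = y} ≃ {a : X // s a = x' ∧ t a = y'})

/-- The coactions of the `kG`-Hopf bimodule on the span of the arrows are those of the arrow
comodule `kQ₁ᶜ`: `δ⁻(a) = t(a) ⊗ a` and `δ⁺(a) = a ⊗ s(a)`. -/
def HopfQuiver.IsArrowComodule {k G X : Type*} [Field k] [Group G] (Q : HopfQuiver G X)
    (B : HopfBimodule k (MonoidAlgebra k G) (X →₀ k)) : Prop :=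
  (∀ a, B.coactL (Finsupp.single a 1) = gr k (Q.t a) ⊗ₜ Finsupp.single a 1) ∧
  (∀ a, B.coactR (Finsupp.single a 1) = Finsupp.single a 1 ⊗ₜ gr k (Q.s a))

/-- The actions of the `(kG)*`-Hopf bimodule on the span of the arrows are those of the arrow
module `kQ₁ᵃ`: `p · a = p(t(a)) a` and `a · p = p(s(a)) a`. -/
def HopfQuiver.IsArrowModule {k G X : Type*} [Field k] [Group G] [Fintype G] [DecidableEq G]
    (Q : HopfQuiver G X) (B : HopfBimodule k (FunAlg k G) (X →₀ k)) : Prop :=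
  (∀ p a, B.actL p (Finsupp.single a 1) = FunAlg.ev (Q.t a) p • Finsupp.single a 1) ∧
  (∀ p a, B.actR p (Finsupp.single a 1) = FunAlg.ev (Q.s a) p • Finsupp.single a 1)

/-- The quiver of the ramification system is finite. -/
def RSR.IsFinite {k G : Type*} [Field k] [Group G] (S : RSR k G) : Prop := ∀ C, Finite (S.I C)


end RSRQuiver

end

open RSRQuiver

universe u v w v' w' x y

open scoped TensorProduct
noncomputable section
set_option linter.unusedSectionVars false
namespace RSRQuiver

section GroupIso
variable {k G G' : Type*} [Field k] [Group G] [Group G']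

/-- The bialgebra isomorphism of group algebras induced by a group isomorphism. -/
def grAlgEquiv (k : Type*) {G G' : Type*} [Field k] [Group G] [Group G'] (f : G ≃* G') :
    MonoidAlgebra k G ≃ₐc[k] MonoidAlgebra k G' :=
  BialgEquiv.ofBialgHom (MonoidAlgebra.mapDomainBialgHom k f.toMonoidHom)
    (MonoidAlgebra.mapDomainBialgHom k f.symm.toMonoidHom)
    (by
      rw [← MonoidAlgebra.mapDomainBialgHom_comp, ← MonoidAlgebra.mapDomainBialgHom_id]
      congr 1; ext; simp)
    (by
      rw [← MonoidAlgebra.mapDomainBialgHom_comp, ← MonoidAlgebra.mapDomainBialgHom_id]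
      congr 1; ext; simp)

@[simp] theorem grAlgEquiv_gr (f : G ≃* G') (g : G) : grAlgEquiv k f (gr k g) = gr k (f g) := by
  refine (MonoidAlgebra.mapDomainBialgHom_single _ _ _).trans ?_
  rfl

/-- The group isomorphism underlying a bialgebra isomorphism of group algebras. -/
def grpEquiv (φ : MonoidAlgebra k G ≃ₐc[k] MonoidAlgebra k G') : G ≃* G' :=
  MonoidHom.toMulEquiv (MonoidAlgebra.mapDomainOfBialgHom (φ : MonoidAlgebra k G →ₐc[k] _))
    (MonoidAlgebra.mapDomainOfBialgHom (φ.symm : MonoidAlgebra k G' →ₐc[k] _))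
    (by rw [← MonoidAlgebra.mapDomainOfBialgHom_comp, BialgEquiv.symm_comp,
      MonoidAlgebra.mapDomainOfBialgHom_id])
    (by rw [← MonoidAlgebra.mapDomainOfBialgHom_comp, BialgEquiv.comp_symm,
      MonoidAlgebra.mapDomainOfBialgHom_id])

theorem apply_gr (φ : MonoidAlgebra k G ≃ₐc[k] MonoidAlgebra k G') (g : G) :
    φ (gr k g) = gr k (grpEquiv φ g) :=
  (MonoidAlgebra.single_mapDomainOfBialgHom
    (φ : MonoidAlgebra k G →ₐc[k] MonoidAlgebra k G') g 1).symm

theorem gr_injective : Function.Injective (gr k : G → MonoidAlgebra k G) :=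
  MonoidAlgebra.single_left_injective one_ne_zero

@[simp] theorem grpEquiv_grAlgEquiv (f : G ≃* G') : grpEquiv (grAlgEquiv k f) = f := by
  ext g
  apply gr_injective (k := k)
  rw [← apply_gr, grAlgEquiv_gr]

@[simp] theorem grpEquiv_refl : grpEquiv (BialgEquiv.refl k (MonoidAlgebra k G)) = MulEquiv.refl G := by
  ext g
  apply gr_injective (k := k)
  rw [← apply_gr]
  rfl

/-- The linear map underlying a bialgebra isomorphism. -/
theorem toLin_gr (φ : MonoidAlgebra k G ≃ₐc[k] MonoidAlgebra k G') (g : G) :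
    φ.toCoalgEquiv.toLinearEquiv.toLinearMap (gr k g) = gr k (grpEquiv φ g) := apply_gr φ g

end GroupIso

section Coeff
variable {k G N : Type*} [Field k] [Group G] [AddCommGroup N] [Module k N] [DecidableEq G]
  [Fintype G]

theorem eq_sum_cfL (t : MonoidAlgebra k G ⊗[k] N) : t = ∑ g, gr k g ⊗ₜ cfL g t := by
  have h := lin_ext_L (f := LinearMap.id (R := k) (M := MonoidAlgebra k G ⊗[k] N))
    (f' := ∑ g, TensorProduct.mk k _ _ (gr k g) ∘ₗ cfL g) (fun g n => by
      simp only [LinearMap.sum_apply, LinearMap.comp_apply, cfL_tmul, LinearMap.id_apply]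
      rw [Finset.sum_eq_single g (fun b _ hb => by rw [if_neg (Ne.symm hb), map_zero]) (by simp)]
      simp) t
  simpa [LinearMap.sum_apply] using h

theorem eq_sum_cfR (t : N ⊗[k] MonoidAlgebra k G) : t = ∑ g, cfR g t ⊗ₜ gr k g := by
  have h := lin_ext_R (f := LinearMap.id (R := k) (M := N ⊗[k] MonoidAlgebra k G))
    (f' := ∑ g, (TensorProduct.mk k _ _).flip (gr k g) ∘ₗ cfR g) (fun g n => by
      simp only [LinearMap.sum_apply, LinearMap.comp_apply, cfR_tmul, LinearMap.id_apply]
      rw [Finset.sum_eq_single g (fun b _ hb => by rw [if_neg (Ne.symm hb), map_zero]) (by simp)]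
      simp) t
  simpa [LinearMap.sum_apply] using h

theorem ext_cfL {s t : MonoidAlgebra k G ⊗[k] N} (h : ∀ g, cfL g s = cfL g t) : s = t := by
  rw [eq_sum_cfL s, eq_sum_cfL t]
  exact Finset.sum_congr rfl fun g _ => by rw [h]

theorem ext_cfR {s t : N ⊗[k] MonoidAlgebra k G} (h : ∀ g, cfR g s = cfR g t) : s = t := by
  rw [eq_sum_cfR s, eq_sum_cfR t]
  exact Finset.sum_congr rfl fun g _ => by rw [h]

@[simp] theorem cfL_sum (x : G) (m : G → N) : cfL x (∑ g, gr k g ⊗ₜ[k] m g) = m x := by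
  simp only [map_sum, cfL_tmul, Finset.sum_ite_eq', Finset.mem_univ, if_true]

end Coeff

section CoeffMap
variable {k G G' N N' : Type*} [Field k] [Group G] [Group G'] [AddCommGroup N] [Module k N]
  [AddCommGroup N'] [Module k N'] [DecidableEq G] [DecidableEq G']

theorem cfL_map (φ : MonoidAlgebra k G ≃ₐc[k] MonoidAlgebra k G') (e : N →ₗ[k] N') (g : G)
    (t : MonoidAlgebra k G ⊗[k] N) :
    cfL (grpEquiv φ g) (TensorProduct.map φ.toCoalgEquiv.toLinearEquiv.toLinearMap e t) =
      e (cfL g t) :=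
  lin_ext_L (f := cfL (grpEquiv φ g) ∘ₗ TensorProduct.map φ.toCoalgEquiv.toLinearEquiv.toLinearMap e)
    (f' := e ∘ₗ cfL g) (fun h n => by
      rw [LinearMap.comp_apply, LinearMap.comp_apply, TensorProduct.map_tmul, toLin_gr, cfL_tmul,
        cfL_tmul, apply_ite e, map_zero]
      simp only [EmbeddingLike.apply_eq_iff_eq]) t

theorem cfR_map (φ : MonoidAlgebra k G ≃ₐc[k] MonoidAlgebra k G') (e : N →ₗ[k] N') (g : G)
    (t : N ⊗[k] MonoidAlgebra k G) :
    cfR (grpEquiv φ g) (TensorProduct.map e φ.toCoalgEquiv.toLinearEquiv.toLinearMap t) =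
      e (cfR g t) :=
  lin_ext_R (f := cfR (grpEquiv φ g) ∘ₗ TensorProduct.map e φ.toCoalgEquiv.toLinearEquiv.toLinearMap)
    (f' := e ∘ₗ cfR g) (fun h n => by
      rw [LinearMap.comp_apply, LinearMap.comp_apply, TensorProduct.map_tmul, toLin_gr, cfR_tmul,
        cfR_tmul, apply_ite e, map_zero]
      simp only [EmbeddingLike.apply_eq_iff_eq]) t

end CoeffMap

namespace YDModule
variable {k G V : Type*} [Field k] [Group G] [AddCommGroup V] [Module k V] [DecidableEq G]

/-- The projection onto the component of degree `g`. -/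
def P (Y : YDModule k G V) (g : G) : V →ₗ[k] V := cfL g ∘ₗ Y.coact

theorem P_P (Y : YDModule k G V) (g h : G) (v : V) :
    Y.P h (Y.P g v) = if g = h then Y.P g v else 0 := by
  have e := congrArg (cfL h) (congrArg (cfL g) (Y.coact_coassoc v))
  rw [cfL_lTensor] at e
  refine e.symm.trans ?_
  refine lin_ext_L (f := cfL h ∘ₗ cfL g ∘ₗ (TensorProduct.assoc k _ _ V).toLinearMap ∘ₗ
    (Coalgebra.comul (R := k)).rTensor V) (f' := if g = h then cfL g else 0) (fun x n => ?_)
    (Y.coact v) |>.trans ?_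
  · simp only [LinearMap.comp_apply, LinearMap.rTensor_tmul, comul_gr, LinearEquiv.coe_coe,
      TensorProduct.assoc_tmul, cfL_tmul, apply_ite (cfL h), map_zero]
    split_ifs <;> simp_all
  · split_ifs <;> rfl

theorem P_self (Y : YDModule k G V) (g : G) (v : V) : Y.P g (Y.P g v) = Y.P g v := by
  rw [P_P, if_pos rfl]

theorem P_act (Y : YDModule k G V) (g x : G) (v : V) :
    Y.P (g * x * g⁻¹) (Y.act (gr k g) v) = Y.act (gr k g) (Y.P x v) := by
  rw [P, LinearMap.comp_apply, Y.coact_act]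
  refine lin_ext_L (f := cfL (g * x * g⁻¹) ∘ₗ TensorProduct.map (LinearMap.mulLeft k (gr k g) ∘ₗ
    LinearMap.mulRight k (gr k g⁻¹)) (Y.act (gr k g))) (f' := Y.act (gr k g) ∘ₗ cfL x)
    (fun y n => ?_) (Y.coact v)
  rw [LinearMap.comp_apply, TensorProduct.map_tmul, LinearMap.comp_apply, LinearMap.mulLeft_apply,
    LinearMap.mulRight_apply, ← gr_mul, ← gr_mul, cfL_tmul, LinearMap.comp_apply, cfL_tmul,
    ← mul_assoc]
  by_cases hy : y = x <;> simp [hy]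

theorem P_act' (Y : YDModule k G V) (g x : G) (v : V) :
    Y.P x (Y.act (gr k g) v) = Y.act (gr k g) (Y.P (g⁻¹ * x * g) v) := by
  rw [← P_act]
  congr 1
  group

theorem act_act (Y : YDModule k G V) (g h : G) (v : V) :
    Y.act (gr k g) (Y.act (gr k h) v) = Y.act (gr k (g * h)) v := by
  rw [gr_mul, Y.act_mul]

@[simp] theorem act_gr_one (Y : YDModule k G V) (v : V) : Y.act (gr k 1) v = v := Y.act_one v

variable [Fintype G]

theorem sum_P (Y : YDModule k G V) (v : V) : ∑ g, Y.P g v = v := by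
  have h := lin_ext_L (f := ∑ g, cfL g) (f' := (TensorProduct.lid k V).toLinearMap ∘ₗ
    (Coalgebra.counit (R := k)).rTensor V) (fun g n => by
      rw [LinearMap.comp_apply, LinearMap.rTensor_tmul, counit_gr]
      simp [LinearMap.sum_apply]) (Y.coact v)
  rw [LinearMap.sum_apply] at h
  exact h.trans (Y.coact_counit v)

theorem coact_eq (Y : YDModule k G V) (v : V) : Y.coact v = ∑ g, gr k g ⊗ₜ Y.P g v :=
  eq_sum_cfL _

/-- A Yetter-Drinfeld module from a representation and a compatible system of projections. -/
def ofProj (a P : G → V →ₗ[k] V) (a_one : ∀ v, a 1 v = v)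
    (a_mul : ∀ g h v, a (g * h) v = a g (a h v))
    (P_P : ∀ g h v, P h (P g v) = if g = h then P g v else 0) (sum_P : ∀ v, ∑ g, P g v = v)
    (P_a : ∀ g x v, P (g * x * g⁻¹) (a g v) = a g (P x v)) : YDModule k G V where
  act := gl a
  coact := ∑ g, TensorProduct.mk k _ _ (gr k g) ∘ₗ P g
  act_one v := by rw [← gr_one, gl_gr, a_one]
  act_mul := gl_mul a_mul
  coact_counit v := by
    simp only [LinearMap.sum_apply, LinearMap.comp_apply, TensorProduct.mk_apply, map_sum,
      LinearMap.rTensor_tmul, counit_gr, TensorProduct.lid_tmul, one_smul, sum_P]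
  coact_coassoc v := by
    refine ext_cfL fun g => ?_
    rw [cfL_lTensor]
    simp only [LinearMap.sum_apply, LinearMap.comp_apply, TensorProduct.mk_apply, map_sum,
      LinearMap.rTensor_tmul, comul_gr, TensorProduct.assoc_tmul, cfL_tmul, Finset.sum_ite_eq',
      Finset.mem_univ, if_true, P_P, apply_ite (TensorProduct.mk k _ _ _), map_zero]
    rw [Finset.sum_eq_single g (fun b _ hb => by rw [if_neg (Ne.symm hb)])
      (by simp), if_pos rfl]
  coact_act g v := by
    simp only [LinearMap.sum_apply, LinearMap.comp_apply, TensorProduct.mk_apply, map_sum, gl_gr,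
      TensorProduct.map_tmul, LinearMap.mulLeft_apply, LinearMap.mulRight_apply]
    rw [← (MulAut.conj g).toEquiv.sum_comp]
    refine Finset.sum_congr rfl fun x _ => ?_
    rw [show (MulAut.conj g).toEquiv x = g * x * g⁻¹ from rfl, P_a, gr_mul, gr_mul, mul_assoc]

@[simp] theorem ofProj_act (a P : G → V →ₗ[k] V) (h1 h2 h3 h4 h5) (g : G) :
    (ofProj a P h1 h2 h3 h4 h5).act (gr k g) = a g := gl_gr a g

@[simp] theorem ofProj_P (a P : G → V →ₗ[k] V) (h1 h2 h3 h4 h5) (g : G) :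
    (ofProj a P h1 h2 h3 h4 h5).P g = P g := by
  apply LinearMap.ext
  intro v
  have : (ofProj a P h1 h2 h3 h4 h5).coact v = ∑ g, gr k g ⊗ₜ P g v := by
    simp [ofProj, LinearMap.sum_apply]
  rw [YDModule.P, LinearMap.comp_apply, this, cfL_sum]

variable {G' V' : Type*} [Group G'] [AddCommGroup V'] [Module k V'] [DecidableEq G'] [Fintype G']

theorem isoOver_iff {φ : MonoidAlgebra k G ≃ₐc[k] MonoidAlgebra k G'} {Y : YDModule k G V}
    {Y' : YDModule k G' V'} : IsoOver φ Y Y' ↔ ∃ e : V ≃ₗ[k] V',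
      (∀ g v, e (Y.act (gr k g) v) = Y'.act (gr k (grpEquiv φ g)) (e v)) ∧
      (∀ g v, e (Y.P g v) = Y'.P (grpEquiv φ g) (e v)) := by
  refine exists_congr fun e => and_congr ⟨fun h g v => ?_, fun h a v => ?_⟩
    ⟨fun h g v => ?_, fun h v => ?_⟩
  · rw [h, apply_gr]
  · refine gr_induction (P := fun a => e (Y.act a v) = Y'.act (φ a) (e v)) (by simp)
      (fun x y hx hy => by simp only [map_add, LinearMap.add_apply, hx, hy])
      (fun c x hx => by simp only [map_smul, LinearMap.smul_apply, hx])
      (fun g => by rw [h, apply_gr]) a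
  · rw [P, LinearMap.comp_apply, P, LinearMap.comp_apply, h, cfL_map]; rfl
  · refine ext_cfL fun g' => ?_
    obtain ⟨g, rfl⟩ := (grpEquiv φ).surjective g'
    rw [cfL_map]
    exact (h g v).symm

theorem isoOver_of {Y : YDModule k G V} {Y' : YDModule k G' V'} (f : G ≃* G') (e : V ≃ₗ[k] V')
    (h : ∀ g v, e (Y.act (gr k g) v) = Y'.act (gr k (f g)) (e v))
    (h' : ∀ g v, e (Y.P g v) = Y'.P (f g) (e v)) : IsoOver (grAlgEquiv k f) Y Y' :=
  isoOver_iff.2 ⟨e, by simpa using h, by simpa using h'⟩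

theorem exists_isoOver_iff {Y : YDModule k G V} {Y' : YDModule k G' V'} :
    (∃ φ, IsoOver φ Y Y') ↔ ∃ (f : G ≃* G') (e : V ≃ₗ[k] V'),
      (∀ g v, e (Y.act (gr k g) v) = Y'.act (gr k (f g)) (e v)) ∧
      (∀ g v, e (Y.P g v) = Y'.P (f g) (e v)) :=
  ⟨fun ⟨φ, h⟩ => ⟨grpEquiv φ, isoOver_iff.1 h⟩, fun ⟨f, e, h, h'⟩ => ⟨_, isoOver_of f e h h'⟩⟩

theorem iso_iff {Y : YDModule k G V} {Y' : YDModule k G V'} : Y.Iso Y' ↔ ∃ e : V ≃ₗ[k] V',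
      (∀ g v, e (Y.act (gr k g) v) = Y'.act (gr k g) (e v)) ∧
      (∀ g v, e (Y.P g v) = Y'.P g (e v)) := by
  rw [Iso, isoOver_iff]
  simp

/-- The restriction of a Yetter-Drinfeld module to a subspace that is stable under the action and
under the projections onto the components. -/
def sub (Y : YDModule k G V) (W : Submodule k V) (ha : ∀ g, ∀ v ∈ W, Y.act (gr k g) v ∈ W)
    (hP : ∀ g, ∀ v ∈ W, Y.P g v ∈ W) : YDModule k G W :=
  ofProj (fun g => (Y.act (gr k g)).restrict (ha g)) (fun g => (Y.P g).restrict (hP g))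
    (fun v => Subtype.ext (Y.act_one v))
    (fun g h v => Subtype.ext (by simp only [LinearMap.coe_restrict_apply, act_act]))
    (fun g h v => Subtype.ext (by
      simp only [LinearMap.coe_restrict_apply, P_P]
      split_ifs <;> rfl))
    (fun v => Subtype.ext (by
      simp only [AddSubmonoidClass.coe_finsetSum, LinearMap.coe_restrict_apply, sum_P]))
    (fun g x v => Subtype.ext (by simp only [LinearMap.coe_restrict_apply, P_act]))

@[simp] theorem sub_act (Y : YDModule k G V) (W : Submodule k V) (ha hP) (g : G) (v : W) :
    ((Y.sub W ha hP).act (gr k g) v : V) = Y.act (gr k g) v := by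
  rw [sub, ofProj_act]; rfl

@[simp] theorem sub_P (Y : YDModule k G V) (W : Submodule k V) (ha hP) (g : G) (v : W) :
    ((Y.sub W ha hP).P g v : V) = Y.P g v := by
  rw [sub, ofProj_P]; rfl

end YDModule

section Block
variable {k I N : Type*} [Field k] [AddCommGroup N] [Module k N] {d : I → ℕ}

/-- The inclusion of a block of row vectors. -/
def blk (k : Type*) {I : Type*} [Field k] {d : I → ℕ} (i : I) :
    (Fin (d i) → k) →ₗ[k] ((Σ i, Fin (d i)) →₀ k) :=
  Fintype.linearCombination k fun s => Finsupp.single ⟨i, s⟩ 1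

/-- The projection onto a block of row vectors. -/
def coblk (k : Type*) {I : Type*} [Field k] {d : I → ℕ} (i : I) :
    ((Σ i, Fin (d i)) →₀ k) →ₗ[k] (Fin (d i) → k) :=
  LinearMap.pi fun s => Finsupp.lapply ⟨i, s⟩

theorem blk_single (i : I) (j : Fin (d i)) :
    blk k i (Pi.single j (1 : k)) = Finsupp.single ⟨i, j⟩ 1 := by
  simp [blk]

theorem blk_apply_self (i : I) (v : Fin (d i) → k) (s : Fin (d i)) : blk k i v ⟨i, s⟩ = v s := by
  classical
  rw [blk, Fintype.linearCombination_apply, Finsupp.finsetSum_apply]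
  simp [Finsupp.single_apply]

theorem blk_apply_ne {i j : I} (h : i ≠ j) (v : Fin (d i) → k) (s : Fin (d j)) :
    blk k i v ⟨j, s⟩ = 0 := by
  classical
  rw [blk, Fintype.linearCombination_apply, Finsupp.finsetSum_apply]
  refine Finset.sum_eq_zero fun t _ => ?_
  rw [Finsupp.smul_apply, Finsupp.single_apply, if_neg (fun e => h (congrArg Sigma.fst e)),
    smul_zero]

@[simp] theorem coblk_blk (i : I) (v : Fin (d i) → k) : coblk k i (blk k i v) = v :=
  funext fun s => blk_apply_self i v s

theorem coblk_blk_ne {i j : I} (h : i ≠ j) (v : Fin (d i) → k) : coblk k j (blk k i v) = 0 :=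
  funext fun s => blk_apply_ne h v s

theorem blk_ext {f g : ((Σ i, Fin (d i)) →₀ k) →ₗ[k] N}
    (h : ∀ i v, f (blk k i v) = g (blk k i v)) (x : (Σ i, Fin (d i)) →₀ k) : f x = g x :=
  single_induction (P := fun x => f x = g x) (by simp)
    (fun x y hx hy => by rw [map_add, map_add, hx, hy])
    (fun c x hx => by rw [map_smul, map_smul, hx])
    (fun a => by
      have := h a.1 (Pi.single a.2 1)
      rwa [blk_single] at this) x

/-- Linear maps out of a sum of blocks. -/
def blkLift (f : ∀ i, (Fin (d i) → k) →ₗ[k] N) : ((Σ i, Fin (d i)) →₀ k) →ₗ[k] N :=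
  Finsupp.linearCombination k fun a => f a.1 (Pi.single a.2 1)

@[simp] theorem blkLift_blk (f : ∀ i, (Fin (d i) → k) →ₗ[k] N) (i : I) (v : Fin (d i) → k) :
    blkLift f (blk k i v) = f i v :=
  RSR.lin_ext (f := blkLift f ∘ₗ blk k i) (g := f i) (fun j => by
    rw [LinearMap.comp_apply, blk_single, blkLift]; simp) v

variable {Γ : Type*} [Group Γ]

/-- The direct sum of representations on row vectors. -/
def blkAct (σ : ∀ i, Representation k Γ (Fin (d i) → k)) (g : Γ) :
    ((Σ i, Fin (d i)) →₀ k) →ₗ[k] ((Σ i, Fin (d i)) →₀ k) :=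
  blkLift fun i => blk k i ∘ₗ σ i g

@[simp] theorem blkAct_blk (σ : ∀ i, Representation k Γ (Fin (d i) → k)) (g : Γ) (i : I)
    (v : Fin (d i) → k) : blkAct σ g (blk k i v) = blk k i (σ i g v) := by
  simp [blkAct]

theorem coblk_blkAct (σ : ∀ i, Representation k Γ (Fin (d i) → k)) (g : Γ) (j : I)
    (x : (Σ i, Fin (d i)) →₀ k) : coblk k j (blkAct σ g x) = σ j g (coblk k j x) :=
  blk_ext (f := coblk k j ∘ₗ blkAct σ g) (g := σ j g ∘ₗ coblk k j) (fun i v => by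
    rw [LinearMap.comp_apply, LinearMap.comp_apply, blkAct_blk]
    by_cases h : i = j
    · subst h; simp
    · rw [coblk_blk_ne h, coblk_blk_ne h, map_zero]) x

end Block

section Decomposition
variable {k Γ : Type*} {N : Type w'} [Field k] [Group Γ] [Finite Γ] [AddCommGroup N] [Module k N]

/-- A representation of a finite group whose order is invertible is a sum of irreducible
representations on row vectors. -/
theorem exists_blk_decomposition (hΓ : (Nat.card Γ : k) ≠ 0) (ρ : Representation k Γ N) :
    ∃ (I : Type w') (d : I → ℕ) (σ : ∀ i, Representation k Γ (Fin (d i) → k))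
      (J : ((Σ i, Fin (d i)) →₀ k) ≃ₗ[k] N), (∀ i, (σ i).IsIrreducible) ∧
      ∀ g x, J (blkAct σ g x) = ρ g (J x) := by
  classical
  have : NeZero (Nat.card Γ : k) := ⟨hΓ⟩
  obtain ⟨s, e, -, hs⟩ := IsSemisimpleModule.exists_linearEquiv_dfinsupp
    (MonoidAlgebra k Γ) ρ.asModule
  have : ∀ m : s, FiniteDimensional k m.1 := fun m => by
    have := hs m
    have : Module.Finite (MonoidAlgebra k Γ) m.1 := inferInstance
    have : Module.Finite k (MonoidAlgebra k Γ) :=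
      Module.Finite.equiv (MonoidAlgebra.coeffLinearEquiv k).symm
    exact Module.Finite.trans (MonoidAlgebra k Γ) m.1
  let b : ∀ m : s, (Fin (Module.finrank k m.1) → k) ≃ₗ[k] m.1 := fun m =>
    (Module.finBasis k m.1).equivFun.symm
  let τ : ∀ m : s, Representation k Γ m.1 := fun m => Representation.ofModule' m.1
  have hτ : ∀ (m : s) g (x : m.1), τ m g x = gr k g • x := fun m g x => rfl
  let σ : ∀ m : s, Representation k Γ (Fin (Module.finrank k m.1) → k) := fun m =>
    { toFun := fun g => (b m).symm.toLinearMap ∘ₗ τ m g ∘ₗ (b m).toLinearMap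
      map_one' := by ext; simp
      map_mul' := fun g h => by
        apply LinearMap.ext; intro v
        simp }
  have hb : ∀ (m : s) g v, b m (σ m g v) = gr k g • b m v := fun m g v =>
    ((b m).apply_symm_apply _).trans (hτ m g _)
  have hsmul : ∀ (m : s) (a : MonoidAlgebra k Γ) (x : (σ m).asModule),
      b m ((σ m).asModuleEquiv (a • x)) = a • b m ((σ m).asModuleEquiv x) := fun m a x =>
    gr_induction (P := fun a => b m ((σ m).asModuleEquiv (a • x)) = a • b m ((σ m).asModuleEquiv x))
      (by rw [zero_smul, map_zero, map_zero, zero_smul])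
      (fun y z hy hz => by rw [add_smul, map_add, map_add, hy, hz, add_smul])
      (fun c y hy => by rw [smul_assoc, map_smul, map_smul, hy, smul_assoc])
      (fun g => by rw [Representation.asModuleEquiv_map_smul,
        Representation.asAlgebraHom_single_one, hb]) a
  let q : ((Σ m : s, Fin (Module.finrank k m.1)) →₀ k) ≃ₗ[k] Π₀ m : s, m.1 :=
    LinearEquiv.ofLinearMap (blkLift fun m => DFinsupp.lsingle m ∘ₗ (b m).toLinearMap)
      (DFinsupp.lsum k fun m => blk k m ∘ₗ (b m).symm.toLinearMap)
      (DFinsupp.lhom_ext' fun m => by apply LinearMap.ext; intro x; simp)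
      (LinearMap.ext <| blk_ext fun m v => by simp)
  let e' : ρ.asModule ≃ₗ[k] Π₀ m : s, m.1 := e.restrictScalars k
  refine ⟨s, fun m => Module.finrank k m.1, σ, (q.trans e'.symm).trans ρ.asModuleEquiv,
    fun m => ?_, fun g => blk_ext (f := ((q.trans e'.symm).trans ρ.asModuleEquiv).toLinearMap ∘ₗ
      blkAct σ g) (g := ρ g ∘ₗ ((q.trans e'.symm).trans ρ.asModuleEquiv).toLinearMap) fun m v => ?_⟩
  · rw [Representation.irreducible_iff_isSimpleModule_asModule]
    have := hs m
    exact IsSimpleModule.congr (R := MonoidAlgebra k Γ) (N := m.1)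
      { (σ m).asModuleEquiv.toAddEquiv.trans (b m).toAddEquiv with
        map_smul' := hsmul m }
  · have h1 : ∀ v, q (blk k m v) = DFinsupp.single m (b m v) := fun v => by
      simp [q]
    simp only [LinearMap.comp_apply, blkAct_blk, LinearEquiv.coe_coe, LinearEquiv.trans_apply, h1,
      hb]
    have h2 : DFinsupp.single m (gr k g • b m v) = gr k g • (DFinsupp.single m (b m v) :
      Π₀ m : s, m.1) := by
      ext1 m'
      rw [DFinsupp.smul_apply]
      by_cases hm : m = m'
      · subst hm; simp only [DFinsupp.single_eq_same]
      · rw [DFinsupp.single_eq_of_ne (Ne.symm hm), DFinsupp.single_eq_of_ne (Ne.symm hm), smul_zero]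
    rw [h2]
    have h3 : e'.symm (gr k g • (DFinsupp.single m (b m v) : Π₀ m : s, m.1)) =
      gr k g • e'.symm (DFinsupp.single m (b m v)) := map_smul e.symm _ _
    rw [h3, Representation.asModuleEquiv_map_smul, Representation.asAlgebraHom_single_one]

end Decomposition

section KrullSchmidt
universe u₁ u₂ u₃
variable {k : Type u₃} {I : Type u₁} {J : Type u₂} {Γ : Type*} [Field k] [Group Γ] {d : I → ℕ}
  {d' : J → ℕ}

theorem nonempty_embedding_of_prod_fin {A : Type u₁} {B : Type u₂} {n : ℕ} (hn : n ≠ 0)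
    (f : A × Fin n ↪ B × Fin n) : Nonempty (A ↪ B) := by
  rw [← Cardinal.lift_mk_le']
  have h := Cardinal.lift_mk_le'.2 ⟨f⟩
  simp only [Cardinal.mk_prod, Cardinal.lift_mul, Cardinal.mk_fin, Cardinal.lift_natCast,
    Cardinal.lift_lift] at h
  have hn' : (n : Cardinal.{max u₁ u₂}) ≠ 0 := by exact_mod_cast hn
  generalize Cardinal.lift.{u₂} (Cardinal.mk A) = a at *
  generalize Cardinal.lift.{u₁} (Cardinal.mk B) = b at *
  by_cases hb : b < Cardinal.aleph0
  · have ha : a < Cardinal.aleph0 := by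
      refine lt_of_le_of_lt ((Cardinal.le_mul_right hn').trans h) ?_
      exact Cardinal.mul_lt_aleph0 hb Cardinal.natCast_lt_aleph0
    lift a to ℕ using ha
    lift b to ℕ using hb
    norm_cast at h ⊢
    exact Nat.le_of_mul_le_mul_right h (Nat.pos_of_ne_zero hn)
  · push Not at hb
    refine (Cardinal.le_mul_right hn').trans (h.trans ?_)
    exact (Cardinal.mul_le_max_of_aleph0_le_left hb).trans (max_le le_rfl
      (Cardinal.natCast_lt_aleph0.le.trans hb))

theorem nonempty_embedding_of_blk (σ : ∀ i, Representation k Γ (Fin (d i) → k))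
    (τ : ∀ j, Representation k Γ (Fin (d' j) → k)) (hσ : ∀ i, (σ i).IsIrreducible)
    (hτ : ∀ j, (τ j).IsIrreducible) {n : ℕ} (U : Representation k Γ (Fin n → k)) (hn : n ≠ 0)
    (E : ((Σ i, Fin (d i)) →₀ k) ≃ₗ[k] ((Σ j, Fin (d' j)) →₀ k))
    (hE : ∀ g x, E (blkAct σ g x) = blkAct τ g (E x)) :
    Nonempty ({i // Nonempty ((σ i).Equiv U)} ↪ {j // Nonempty ((τ j).Equiv U)}) := by
  let X : Set (Σ i, Fin (d i)) := {a | Nonempty ((σ a.1).Equiv U)}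
  let Y : Set (Σ j, Fin (d' j)) := {a | Nonempty ((τ a.1).Equiv U)}
  let F : (X →₀ k) →ₗ[k] (Y →₀ k) := Finsupp.lsubtypeDomain Y ∘ₗ E.toLinearMap ∘ₗ
    Finsupp.lmapDomain k k Subtype.val
  have key : ∀ (x : X →₀ k) (j) (hj : ¬ Nonempty ((τ j).Equiv U)),
      coblk k j (E (Finsupp.lmapDomain k k Subtype.val x)) = 0 := by
    intro x j hj
    refine single_induction (P := fun x : X →₀ k =>
      coblk k j (E (Finsupp.lmapDomain k k Subtype.val x)) = 0) (by simp)
      (fun x y hx hy => by simp only [map_add, hx, hy, add_zero])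
      (fun c x hx => by simp only [map_smul, hx, smul_zero]) (fun a => ?_) x
    obtain ⟨⟨i, s⟩, ⟨q⟩⟩ := a
    rw [Finsupp.lmapDomain_apply, Finsupp.mapDomain_single]
    change coblk k j (E (Finsupp.single ⟨i, s⟩ 1)) = 0
    rw [← blk_single]
    let f : Representation.IntertwiningMap (σ i) (τ j) :=
      ⟨coblk k j ∘ₗ E.toLinearMap ∘ₗ blk k i, fun g => by
        apply LinearMap.ext; intro v
        change coblk k j (E (blk k i (σ i g v))) = τ j g (coblk k j (E (blk k i v)))
        rw [← coblk_blkAct, ← hE, blkAct_blk]⟩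
    have := hσ i
    have := hτ j
    rcases Representation.IsIrreducible.bijective_or_eq_zero f with h | h
    · exact absurd ⟨(f.ofBijective h).symm.trans q⟩ hj
    · exact congrArg (fun f : Representation.IntertwiningMap (σ i) (τ j) => f (Pi.single s 1)) h
  have hF : Function.Injective F := by
    rw [← LinearMap.ker_eq_bot, LinearMap.ker_eq_bot']
    intro x hx
    have h0 : E (Finsupp.lmapDomain k k Subtype.val x) = 0 := by
      ext ⟨j, s⟩
      by_cases hj : Nonempty ((τ j).Equiv U)
      · exact DFunLike.congr_fun hx (⟨⟨j, s⟩, hj⟩ : Y)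
      · exact congrFun (key x j hj) s
    rw [LinearEquiv.map_eq_zero_iff] at h0
    exact Finsupp.mapDomain_injective Subtype.val_injective (by simpa using h0)
  have hXY := LinearMap.lift_rank_le_of_injective F hF
  rw [rank_finsupp_self, rank_finsupp_self] at hXY
  have dim : ∀ {m : ℕ} (ρ : Representation k Γ (Fin m → k)), Nonempty (ρ.Equiv U) → m = n := by
    rintro m ρ ⟨q⟩
    have := q.toLinearEquiv.finrank_eq
    simpa using this
  have eX : X ≃ {i // Nonempty ((σ i).Equiv U)} × Fin n :=
    { toFun := fun a => (⟨a.1.1, a.2⟩, Fin.cast (dim _ a.2) a.1.2)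
      invFun := fun a => ⟨⟨a.1.1, Fin.cast (dim _ a.1.2).symm a.2⟩, a.1.2⟩
      left_inv := fun a => rfl
      right_inv := fun a => rfl }
  have eY : Y ≃ {j // Nonempty ((τ j).Equiv U)} × Fin n :=
    { toFun := fun a => (⟨a.1.1, a.2⟩, Fin.cast (dim _ a.2) a.1.2)
      invFun := fun a => ⟨⟨a.1.1, Fin.cast (dim _ a.1.2).symm a.2⟩, a.1.2⟩
      left_inv := fun a => rfl
      right_inv := fun a => rfl }
  simp only [Cardinal.lift_lift] at hXY
  obtain ⟨f⟩ := Cardinal.lift_mk_le.{u₃}.1 hXY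
  exact nonempty_embedding_of_prod_fin hn (f.congr eX eY)

theorem irreducible_dim_ne_zero {n : ℕ} (U : Representation k Γ (Fin n → k))
    (hU : U.IsIrreducible) : n ≠ 0 := by
  rintro rfl
  have := hU.toNontrivial
  obtain ⟨a, b, hab⟩ := exists_pair_ne (Subrepresentation U)
  exact hab (Subrepresentation.toSubmodule_injective (Subsingleton.elim _ _))

/-- The irreducible summands of a representation are unique up to order and isomorphism. -/
theorem exists_equiv_of_blk (σ : ∀ i, Representation k Γ (Fin (d i) → k))
    (τ : ∀ j, Representation k Γ (Fin (d' j) → k)) (hσ : ∀ i, (σ i).IsIrreducible)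
    (hτ : ∀ j, (τ j).IsIrreducible)
    (E : ((Σ i, Fin (d i)) →₀ k) ≃ₗ[k] ((Σ j, Fin (d' j)) →₀ k))
    (hE : ∀ g x, E (blkAct σ g x) = blkAct τ g (E x)) :
    ∃ e : I ≃ J, ∀ i, Nonempty ((σ i).Equiv (τ (e i))) := by
  have hE' : ∀ g x, E.symm (blkAct τ g x) = blkAct σ g (E.symm x) := fun g x => by
    rw [LinearEquiv.symm_apply_eq, hE, LinearEquiv.apply_symm_apply]
  have main : ∀ {n : ℕ} (U : Representation k Γ (Fin n → k)), U.IsIrreducible →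
      Nonempty ({i // Nonempty ((σ i).Equiv U)} ≃ {j // Nonempty ((τ j).Equiv U)}) := by
    intro n U hU
    have hn := irreducible_dim_ne_zero U hU
    obtain ⟨f⟩ := nonempty_embedding_of_blk σ τ hσ hτ U hn E hE
    obtain ⟨g⟩ := nonempty_embedding_of_blk τ σ hτ hσ U hn E.symm hE'
    exact Function.Embedding.antisymm f g
  let D : I ⊕ J → ℕ := Sum.elim d d'
  let κ : ∀ x : I ⊕ J, Representation k Γ (Fin (D x) → k) := fun x => match x with
    | Sum.inl i => σ i
    | Sum.inr j => τ j
  have hκ : ∀ x, (κ x).IsIrreducible := fun x => match x with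
    | Sum.inl i => hσ i
    | Sum.inr j => hτ j
  let s : Setoid (I ⊕ J) :=
    { r := fun x y => Nonempty ((κ x).Equiv (κ y))
      iseqv := ⟨fun x => ⟨Representation.Equiv.refl _⟩, fun ⟨q⟩ => ⟨q.symm⟩,
        fun ⟨q⟩ ⟨r⟩ => ⟨q.trans r⟩⟩ }
  let p : I → Quotient s := fun i => Quotient.mk s (Sum.inl i)
  let q : J → Quotient s := fun j => Quotient.mk s (Sum.inr j)
  have hpq : ∀ c : Quotient s, Nonempty ({i // p i = c} ≃ {j // q j = c}) := by
    intro c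
    induction c using Quotient.inductionOn with
    | h x =>
      obtain ⟨f⟩ := main (κ x) (hκ x)
      exact ⟨((Equiv.subtypeEquivRight fun i => Quotient.eq (r := s)).trans f).trans
        (Equiv.subtypeEquivRight fun j => (Quotient.eq (r := s)).symm)⟩
  let f := fun c => (hpq c).some
  let e : I ≃ J := ((Equiv.sigmaFiberEquiv p).symm.trans (Equiv.sigmaCongrRight f)).trans
    (Equiv.sigmaFiberEquiv q)
  have he : ∀ i, q (e i) = p i := fun i => (f (p i) ⟨i, rfl⟩).2
  exact ⟨e, fun i => Quotient.exact (he i).symm⟩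

end KrullSchmidt

section Glue
variable {k G G' V V' : Type*} [Field k] [AddCommGroup V] [Module k V] [AddCommGroup V']
  [Module k V'] [Fintype G] [Fintype G'] [DecidableEq G] [DecidableEq G']

/-- Isomorphisms between the components of two graded spaces add up to an isomorphism. -/
theorem exists_glue {P : G → V →ₗ[k] V} {P' : G' → V' →ₗ[k] V'}
    (hP : ∀ g h v, P h (P g v) = if g = h then P g v else 0) (sP : ∀ v, ∑ g, P g v = v)
    (hP' : ∀ g h v, P' h (P' g v) = if g = h then P' g v else 0) (sP' : ∀ v, ∑ g, P' g v = v)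
    (f : G ≃ G') (F : G → V →ₗ[k] V') (F' : G → V' →ₗ[k] V)
    (h1 : ∀ g v, F' g (F g v) = P g v) (h2 : ∀ g v, F g (F' g v) = P' (f g) v)
    (h3 : ∀ g v, P' (f g) (F g v) = F g v) (h4 : ∀ g v, P g (F' g v) = F' g v) :
    ∃ e : V ≃ₗ[k] V', (∀ v, e v = ∑ g, F g v) ∧ (∀ g v, P' (f g) (e v) = F g v) ∧
      ∀ g v, e (P g v) = F g v := by
  have FP : ∀ g v, F g (P g v) = F g v := fun g v => by rw [← h1, h2, h3]
  have FP' : ∀ g v, F' g (P' (f g) v) = F' g v := fun g v => by rw [← h2, h1, h4]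
  have o1 : ∀ g h v, F' h (F g v) = if g = h then P g v else 0 := fun g h v => by
    rw [← FP', ← h3 g, hP']
    by_cases hh : g = h
    · subst hh; rw [if_pos rfl, if_pos rfl, h3, h1]
    · rw [if_neg hh, if_neg (fun e => hh (f.injective e)), map_zero]
  have o2 : ∀ g h v, F h (F' g v) = if g = h then P' (f g) v else 0 := fun g h v => by
    rw [← FP, ← h4 g, hP]
    by_cases hh : g = h
    · subst hh; rw [if_pos rfl, if_pos rfl, h4, h2]
    · rw [if_neg hh, if_neg hh, map_zero]
  let e : V ≃ₗ[k] V' := LinearEquiv.ofLinearMap (∑ g, F g) (∑ g, F' g)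
    (LinearMap.ext fun v => by
      simp only [LinearMap.comp_apply, LinearMap.sum_apply, map_sum, o2, LinearMap.id_apply]
      simp only [Finset.sum_ite_eq, Finset.mem_univ, if_true]
      rw [f.sum_comp (fun g => P' g v), sP'])
    (LinearMap.ext fun v => by
      simp only [LinearMap.comp_apply, LinearMap.sum_apply, map_sum, o1, LinearMap.id_apply]
      simp only [Finset.sum_ite_eq, Finset.mem_univ, if_true, sP])
  have he : ∀ v, e v = ∑ g, F g v := fun v => LinearMap.sum_apply _ _ _
  refine ⟨e, he, fun g v => ?_, fun g v => ?_⟩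
  · rw [he, map_sum, Finset.sum_eq_single g, h3]
    · intro b _ hb
      rw [← h3 b, hP', if_neg (fun e => hb (f.injective e))]
    · simp
  · rw [he, Finset.sum_eq_single g, FP]
    · intro b _ hb
      rw [← FP b, hP, if_neg (Ne.symm hb), map_zero]
    · simp

end Glue

section YDGlue
variable {k G G' V V' : Type*} [Field k] [Group G] [Group G'] [AddCommGroup V] [Module k V]
  [AddCommGroup V'] [Module k V'] [Fintype G] [Fintype G'] [DecidableEq G] [DecidableEq G']

/-- Equivariant isomorphisms between the components at representatives of the conjugacy classes
extend to an isomorphism of Yetter-Drinfeld modules. -/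
theorem YDModule.exists_iso_of_components (Y : YDModule k G V) (Y' : YDModule k G' V')
    (f : G ≃* G') (u : ConjClasses G → G) (hu : ∀ C, ConjClasses.mk (u C) = C)
    (E : ConjClasses G → V →ₗ[k] V') (E' : ConjClasses G → V' →ₗ[k] V)
    (h1 : ∀ C v, E' C (E C v) = Y.P (u C) v) (h2 : ∀ C v, E C (E' C v) = Y'.P (f (u C)) v)
    (h3 : ∀ C v, Y'.P (f (u C)) (E C v) = E C v) (h4 : ∀ C v, Y.P (u C) (E' C v) = E' C v)
    (h5 : ∀ C z, z * u C = u C * z → ∀ v,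
      E C (Y.act (gr k z) v) = Y'.act (gr k (f z)) (E C v)) :
    ∃ e : V ≃ₗ[k] V', (∀ g v, e (Y.act (gr k g) v) = Y'.act (gr k (f g)) (e v)) ∧
      (∀ g v, e (Y.P g v) = Y'.P (f g) (e v)) := by
  have hx : ∀ g : G, ∃ x : G, x * u (ConjClasses.mk g) * x⁻¹ = g := fun g =>
    isConj_iff.1 (ConjClasses.mk_eq_mk_iff_isConj.1 (hu (ConjClasses.mk g)))
  choose x hx using hx
  have hx' : ∀ g, (x g)⁻¹ * g * x g = u (ConjClasses.mk g) := fun g => by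
    rw [mul_assoc, inv_mul_eq_iff_eq_mul]
    exact (mul_inv_eq_iff_eq_mul.1 (hx g)).symm
  let F : G → V →ₗ[k] V' := fun g =>
    Y'.act (gr k (f (x g))) ∘ₗ E (ConjClasses.mk g) ∘ₗ Y.act (gr k (x g)⁻¹)
  let F' : G → V' →ₗ[k] V := fun g =>
    Y.act (gr k (x g)) ∘ₗ E' (ConjClasses.mk g) ∘ₗ Y'.act (gr k (f (x g)⁻¹))
  obtain ⟨e, he, hl, hr⟩ := exists_glue (P := Y.P) (P' := Y'.P) Y.P_P Y.sum_P Y'.P_P Y'.sum_P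
    f.toEquiv F F' (fun g v => by
      simp only [F, F', LinearMap.comp_apply]
      rw [Y'.act_act, ← map_mul, inv_mul_cancel, map_one, Y'.act_gr_one, h1, Y.P_act', Y.act_act,
        mul_inv_cancel, Y.act_gr_one, inv_inv, hx])
    (fun g v => by
      simp only [F, F', LinearMap.comp_apply]
      rw [Y.act_act, inv_mul_cancel, Y.act_gr_one, h2, Y'.P_act', Y'.act_act, ← map_mul,
        mul_inv_cancel, map_one, Y'.act_gr_one, ← map_inv, inv_inv, ← map_mul, ← map_mul, hx]
      rfl)
    (fun g v => by
      simp only [F, LinearMap.comp_apply]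
      rw [Y'.P_act', show f.toEquiv g = f g from rfl, ← map_inv, ← map_mul, ← map_mul, hx', h3])
    (fun g v => by
      simp only [F', LinearMap.comp_apply]
      rw [Y.P_act', hx', h4])
  refine ⟨e, fun y v => ?_, fun g v => (hr g v).trans (hl g v).symm⟩
  rw [he, he, map_sum, ← (MulAut.conj y).toEquiv.sum_comp]
  refine Finset.sum_congr rfl fun g _ => ?_
  rw [show (MulAut.conj y).toEquiv g = y * g * y⁻¹ from rfl]
  have hC : ConjClasses.mk (y * g * y⁻¹) = ConjClasses.mk g :=
    (ConjClasses.mk_eq_mk_iff_isConj.2 (isConj_iff.2 ⟨y, rfl⟩)).symm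
  simp only [F, LinearMap.comp_apply, hC]
  have hz : (x (y * g * y⁻¹))⁻¹ * y * x g * u (ConjClasses.mk g) =
      u (ConjClasses.mk g) * ((x (y * g * y⁻¹))⁻¹ * y * x g) := by
    have e1 := hx' (y * g * y⁻¹)
    rw [hC] at e1
    conv_lhs => rw [← hx' g]
    conv_rhs => rw [← e1]
    group
  have e2 := h5 _ _ hz (Y.act (gr k (x g)⁻¹) v)
  rw [Y.act_act] at e2
  rw [Y.act_act, show (x (y * g * y⁻¹))⁻¹ * y = (x (y * g * y⁻¹))⁻¹ * y * x g * (x g)⁻¹ by group, e2,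
    Y'.act_act, Y'.act_act, ← map_mul, ← map_mul]
  congr 4
  group

end YDGlue

section Comp
variable {k Γ Γ' V : Type*} [Field k] [Group Γ] [Group Γ'] [AddCommGroup V] [Module k V]

theorem isIrreducible_comp (ρ : Representation k Γ' V) (hρ : ρ.IsIrreducible) (φ : Γ →* Γ')
    (hφ : Function.Surjective φ) : Representation.IsIrreducible (ρ.comp φ : Representation k Γ V) := by
  let up : Subrepresentation (ρ.comp φ : Representation k Γ V) → Subrepresentation ρ := fun W =>
    ⟨W.toSubmodule, fun g v hv => by
      obtain ⟨g, rfl⟩ := hφ g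
      exact W.apply_mem_toSubmodule g hv⟩
  have bot : (⊥ : Subrepresentation (ρ.comp φ : Representation k Γ V)).toSubmodule = ⊥ := rfl
  have top : (⊤ : Subrepresentation (ρ.comp φ : Representation k Γ V)).toSubmodule = ⊤ := rfl
  refine { exists_pair_ne := ⟨⊥, ⊤, fun h => ?_⟩, eq_bot_or_eq_top := fun W => ?_ }
  · have h1 := congrArg Subrepresentation.toSubmodule h
    rw [bot, top] at h1
    have h' : (⊥ : Subrepresentation ρ) = ⊤ := Subrepresentation.toSubmodule_injective h1
    have := hρ.toNontrivial
    exact bot_ne_top h'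
  · rcases hρ.eq_bot_or_eq_top (up W) with h | h
    · have h1 : W.toSubmodule = ⊥ := congrArg (Subrepresentation.toSubmodule (ρ := ρ)) h
      exact Or.inl (Subrepresentation.toSubmodule_injective h1)
    · have h1 : W.toSubmodule = ⊤ := congrArg (Subrepresentation.toSubmodule (ρ := ρ)) h
      exact Or.inr (Subrepresentation.toSubmodule_injective h1)

end Comp

namespace RSR
variable {k : Type u} {G : Type v} [Field k] [Group G] {S : RSR.{u, v, w} k G}

/-- The pair `(1, u(C))`. -/
def basePair (S : RSR.{u, v, w} k G) (C : ConjClasses G) : Pair C :=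
  ⟨(1, S.u C), by rw [inv_one, one_mul, S.u_mem]⟩

/-- The arrow from `1` to `u(C)` with the given index. -/
def baseArrow (C : ConjClasses G) (a : Σ i : S.I C, Fin (S.d C i)) :
    {a : S.Arrow // S.source a = 1} := ⟨⟨C, basePair S C, a⟩, rfl⟩

theorem baseArrow_injective (C : ConjClasses G) :
    Function.Injective (baseArrow (S := S) C) := fun a b h => by
  have h1 := congrArg Subtype.val h
  simp only [baseArrow, Sigma.mk.injEq, heq_eq_eq, Prod.mk.injEq, true_and] at h1
  exact h1

/-- The inclusion of the component of degree `u(C)` of `(kQ₁¹, ad S)`. -/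
def emb (S : RSR.{u, v, w} k G) (C : ConjClasses G) :
    ((Σ i : S.I C, Fin (S.d C i)) →₀ k) →ₗ[k] ({a : S.Arrow // S.source a = 1} →₀ k) :=
  Finsupp.lmapDomain k k (baseArrow C)

/-- The projection onto the component of degree `u(C)` of `(kQ₁¹, ad S)`. -/
def ret (S : RSR.{u, v, w} k G) (C : ConjClasses G) :
    ({a : S.Arrow // S.source a = 1} →₀ k) →ₗ[k] ((Σ i : S.I C, Fin (S.d C i)) →₀ k) :=
  Finsupp.lcomapDomain (baseArrow C) (baseArrow_injective C)

@[simp] theorem ret_emb (C : ConjClasses G) (x) : ret S C (emb S C x) = x :=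
  Finsupp.comapDomain_mapDomain _ (baseArrow_injective C) x

theorem val_emb_blk (C : ConjClasses G) (i : S.I C) (v : Fin (S.d C i) → k) :
    Finsupp.lmapDomain k k Subtype.val (emb S C (blk k i v)) = vec (basePair S C) i v :=
  lin_ext (f := Finsupp.lmapDomain k k Subtype.val ∘ₗ emb S C ∘ₗ blk k i)
    (g := vec (basePair S C) i) (fun j => by
      rw [LinearMap.comp_apply, LinearMap.comp_apply, blk_single, emb, Finsupp.lmapDomain_apply,
        Finsupp.lmapDomain_apply, Finsupp.mapDomain_single, Finsupp.mapDomain_single, vec_single]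
      rfl) v

variable (T : S.CosetReps)

theorem act_emb (C : ConjClasses G) (z : (Subgroup.centralizer {S.u C} : Subgroup G)) (x) :
    (ydModule T).act (gr k (z : G)) (emb S C x) =
      emb S C (blkAct (S.ρ C) (MulOpposite.op z⁻¹) x) := by
  refine blk_ext (f := (ydModule T).act (gr k (z : G)) ∘ₗ emb S C)
    (g := emb S C ∘ₗ blkAct (S.ρ C) (MulOpposite.op z⁻¹)) (fun i v => ?_) x
  have hz : (z : G) * S.u C = S.u C * z :=
    Subgroup.mem_centralizer_singleton_iff.1 z.2
  apply ArrowActions.ext_injective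
  rw [LinearMap.comp_apply, LinearMap.comp_apply, blkAct_blk, val_emb_blk]
  refine ((congrArg (fun F => Finsupp.lmapDomain k k Subtype.val (F (emb S C (blk k i v))))
    (gl_gr (k := k) (arrowActions T).ad (z : G))).trans ((arrowActions T).ext_ad z _)).trans ?_
  rw [val_emb_blk]
  change left (z : G) (right T (z : G)⁻¹ (vec (basePair S C) i v)) = _
  have e : pairL (z : G) (pairR (z : G)⁻¹ (basePair S C)) = basePair S C := by
    apply Subtype.ext
    simp [pairL, pairR, basePair, ← mul_assoc, hz]
  have e' : zeta T (basePair S C) (z : G)⁻¹ = z⁻¹ := by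
    apply Subtype.ext
    simp [zeta, basePair, ← mul_assoc, hz, T.one]
  rw [right_vec, left_vec, e, e']

variable [DecidableEq G]

theorem ydModule_P_single (g : G) (a : {a : S.Arrow // S.source a = 1}) :
    (ydModule T).P g (Finsupp.single a 1) =
      if S.target a.1 = g then Finsupp.single a 1 else 0 := by
  rw [YDModule.P, LinearMap.comp_apply]
  refine (congrArg (cfL g) (arrowCoactL_single (k := k)
    (fun a : {a : S.Arrow // S.source a = 1} => S.target a.1) a)).trans ?_
  rw [cfL_tmul]

theorem P_emb (C : ConjClasses G) (x) : (ydModule T).P (S.u C) (emb S C x) = emb S C x :=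
  single_induction (P := fun x => (ydModule T).P (S.u C) (emb S C x) = emb S C x) (by simp)
    (fun x y hx hy => by simp only [map_add, hx, hy])
    (fun c x hx => by simp only [map_smul, hx]) (fun a => by
      rw [emb, Finsupp.lmapDomain_apply, Finsupp.mapDomain_single, ydModule_P_single, if_pos]
      rfl) x

theorem emb_ret (C : ConjClasses G) (x) : emb S C (ret S C x) = (ydModule T).P (S.u C) x := by
  refine single_induction (P := fun x => emb S C (ret S C x) = (ydModule T).P (S.u C) x) (by simp)
    (fun x y hx hy => by simp only [map_add, hx, hy])
    (fun c x hx => by simp only [map_smul, hx]) (fun a => ?_) x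
  rw [ydModule_P_single]
  split_ifs with h
  · obtain ⟨⟨C', ⟨⟨p, q⟩, hp⟩, i⟩, ha⟩ := a
    obtain rfl : p = 1 := ha
    obtain rfl : q = S.u C := h
    obtain rfl : C = C' := by simpa [S.u_mem] using hp
    have : (Finsupp.single (⟨⟨C, ⟨(1, S.u C), hp⟩, i⟩, rfl⟩ : {a : S.Arrow // S.source a = 1})
        (1 : k)) = emb S C (Finsupp.single i 1) := by
      rw [emb, Finsupp.lmapDomain_apply, Finsupp.mapDomain_single]
      rfl
    rw [this, ret_emb]
  · have : ret S C (Finsupp.single a 1) = 0 := by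
      ext i
      refine Finsupp.single_eq_of_ne ?_
      rintro rfl
      exact h rfl
    rw [this, map_zero]

end RSR

section BlkEquiv
variable {k I J : Type*} [Field k] {d : I → ℕ} {d' : J → ℕ}

theorem exists_blkEquiv (e : I ≃ J) (f : ∀ i, (Fin (d i) → k) ≃ₗ[k] (Fin (d' (e i)) → k)) :
    ∃ Φ : ((Σ i, Fin (d i)) →₀ k) ≃ₗ[k] ((Σ j, Fin (d' j)) →₀ k),
      ∀ i v, Φ (blk k i v) = blk k (e i) (f i v) := by
  let Φ : ((Σ i, Fin (d i)) →₀ k) →ₗ[k] ((Σ j, Fin (d' j)) →₀ k) :=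
    blkLift fun i => blk k (e i) ∘ₗ (f i).toLinearMap
  have hΦ : ∀ i v, Φ (blk k i v) = blk k (e i) (f i v) := fun i v => blkLift_blk _ i v
  have hg : ∀ j, ∃ g : (Fin (d' j) → k) →ₗ[k] ((Σ i, Fin (d i)) →₀ k),
      ∀ v, Φ (g v) = blk k j v := fun j => by
    obtain ⟨i, rfl⟩ := e.surjective j
    exact ⟨blk k i ∘ₗ (f i).symm.toLinearMap, fun v => by
      rw [LinearMap.comp_apply, hΦ]; simp⟩
  choose g hg using hg
  have hc : ∀ i x, coblk k (e i) (Φ x) = f i (coblk k i x) := fun i x =>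
    blk_ext (f := coblk k (e i) ∘ₗ Φ) (g := (f i).toLinearMap ∘ₗ coblk k i) (fun j v => by
      rw [LinearMap.comp_apply, LinearMap.comp_apply, hΦ]
      by_cases h : j = i
      · subst h; simp
      · rw [coblk_blk_ne h, coblk_blk_ne (fun h' => h (e.injective h')), map_zero]) x
  refine ⟨LinearEquiv.ofBijective Φ ⟨?_, fun y => ⟨blkLift g y, ?_⟩⟩, hΦ⟩
  · refine (injective_iff_map_eq_zero Φ).2 fun x hx => ?_
    ext ⟨i, s⟩
    have := hc i x
    rw [hx, map_zero, eq_comm, LinearEquiv.map_eq_zero_iff] at this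
    exact congrFun this s
  · exact blk_ext (f := Φ ∘ₗ blkLift g) (g := LinearMap.id) (fun j v => by
      rw [LinearMap.comp_apply, blkLift_blk, hg]; rfl) y

end BlkEquiv

section CentralizerConj
variable {G G' : Type*} [Group G] [Group G'] (f : G ≃* G') (h : G) {a : G} {a' : G'}

/-- The map `x ↦ f (h⁻¹ x h)` between centralizers. -/
def centralizerConj (ha : f (h⁻¹ * a * h) = a') :
    (Subgroup.centralizer {a} : Subgroup G) →* (Subgroup.centralizer {a'} : Subgroup G') where
  toFun z := ⟨f (h⁻¹ * z * h), by
    have hz := Subgroup.mem_centralizer_singleton_iff.1 z.2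
    rw [Subgroup.mem_centralizer_singleton_iff, ← ha, ← map_mul, ← map_mul]
    congr 1
    calc h⁻¹ * z * h * (h⁻¹ * a * h) = h⁻¹ * (z * a) * h := by group
      _ = h⁻¹ * (a * z) * h := by rw [hz]
      _ = _ := by group⟩
  map_one' := Subtype.ext (by simp)
  map_mul' x y := Subtype.ext (by simp [← map_mul, mul_assoc])

@[simp] theorem coe_centralizerConj (ha : f (h⁻¹ * a * h) = a') (z) :
    (centralizerConj f h ha z : G') = f (h⁻¹ * z * h) := rfl

theorem centralizerConj_surjective (ha : f (h⁻¹ * a * h) = a') :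
    Function.Surjective (centralizerConj f h ha) := fun z => by
  refine ⟨⟨h * f.symm z * h⁻¹, ?_⟩, Subtype.ext ?_⟩
  · have hz := Subgroup.mem_centralizer_singleton_iff.1 z.2
    have hz' := congrArg f.symm hz
    have ha' : f.symm a' = h⁻¹ * a * h := by rw [← ha, f.symm_apply_apply]
    rw [map_mul, map_mul, ha'] at hz'
    rw [Subgroup.mem_centralizer_singleton_iff]
    calc h * f.symm z * h⁻¹ * a = h * (f.symm z * (h⁻¹ * a * h)) * h⁻¹ := by group
      _ = h * (h⁻¹ * a * h * f.symm z) * h⁻¹ := by rw [hz']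
      _ = _ := by group
  · rw [coe_centralizerConj]
    simp [mul_assoc]

end CentralizerConj

section ComponentRep
variable {k G V : Type*} [Field k] [Group G] [AddCommGroup V] [Module k V] [DecidableEq G]

theorem YDModule.mem_range_P (Y : YDModule k G V) (a : G) (v : V) :
    v ∈ LinearMap.range (Y.P a) ↔ Y.P a v = v :=
  ⟨fun ⟨w, hw⟩ => by rw [← hw, Y.P_self], fun h => ⟨v, h⟩⟩

theorem YDModule.P_act_centralizer (Y : YDModule k G V) (a : G)
    (z : (Subgroup.centralizer {a} : Subgroup G)) (v : V) :
    Y.P a (Y.act (gr k (z : G)) v) = Y.act (gr k (z : G)) (Y.P a v) := by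
  rw [← YDModule.P_act, mul_inv_eq_iff_eq_mul.2 (Subgroup.mem_centralizer_singleton_iff.1 z.2)]

/-- The right representation of the centralizer of `a` on the component of degree `a`. -/
def YDModule.compRep (Y : YDModule k G V) (a : G) :
    Representation k (Subgroup.centralizer {a} : Subgroup G)ᵐᵒᵖ (LinearMap.range (Y.P a)) where
  toFun z := (Y.act (gr k ((z.unop⁻¹ : (Subgroup.centralizer {a} : Subgroup G)) : G))).restrict
    (fun v hv => by rw [mem_range_P] at hv ⊢; rw [P_act_centralizer, hv])
  map_one' := LinearMap.ext fun v => Subtype.ext (by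
    simp only [LinearMap.coe_restrict_apply, MulOpposite.unop_one, inv_one]
    exact Y.act_one _)
  map_mul' x y := LinearMap.ext fun v => Subtype.ext (by
    simp only [LinearMap.coe_restrict_apply, MulOpposite.unop_mul, mul_inv_rev]
    exact (Y.act_act _ _ _).symm)

theorem YDModule.compRep_apply (Y : YDModule k G V) (a : G) (z) (v : LinearMap.range (Y.P a)) :
    (Y.compRep a z v : V) =
      Y.act (gr k ((z.unop⁻¹ : (Subgroup.centralizer {a} : Subgroup G)) : G)) v := rfl

end ComponentRep

namespace RSR
variable {k : Type u} {G : Type v} {G' : Type v'} [Field k] [Group G] [Group G'] [Fintype G]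
  [Fintype G'] [DecidableEq G] [DecidableEq G'] {S : RSR.{u, v, w} k G}
  {S' : RSR.{u, v', w'} k G'} (T : S.CosetReps) (T' : S'.CosetReps)

theorem exists_isoOver_of_iso (hS : S.Iso S') :
    ∃ φ, YDModule.IsoOver φ (ydModule T) (ydModule T') := by
  rw [YDModule.exists_isoOver_iff]
  obtain ⟨f, hf⟩ := hS
  choose h hh e F hF using hf
  choose Φ hΦ using fun C => exists_blkEquiv (e C) (F C)
  have hΦ' : ∀ C (z : (Subgroup.centralizer {S.u C} : Subgroup G)) x,
      Φ C (blkAct (S.ρ C) (MulOpposite.op z) x) = blkAct (S'.ρ _)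
        (MulOpposite.op (centralizerConj f (h C) (hh C) z)) (Φ C x) := fun C z x =>
    blk_ext (f := (Φ C).toLinearMap ∘ₗ blkAct (S.ρ C) (MulOpposite.op z))
      (g := blkAct (S'.ρ _) (MulOpposite.op (centralizerConj f (h C) (hh C) z)) ∘ₗ
        (Φ C).toLinearMap) (fun i v => by
        simp only [LinearMap.comp_apply, LinearEquiv.coe_coe, blkAct_blk, hΦ]
        rw [hF C i z (centralizerConj f (h C) (hh C) z) rfl]) x
  have hu : ∀ C, f (S.u C) = f (h C) * S'.u (ConjClasses.map f.toMonoidHom C) * (f (h C))⁻¹ :=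
    fun C => by rw [← hh]; simp [mul_assoc]
  have P1 : ∀ C x, (ydModule T').P (f (S.u C)) ((ydModule T').act (gr k (f (h C))) (emb S' _ x)) =
      (ydModule T').act (gr k (f (h C))) (emb S' _ x) := fun C x => by
    rw [hu, YDModule.P_act, P_emb]
  refine ⟨f, (ydModule T).exists_iso_of_components (ydModule T') f S.u S.u_mem
    (fun C => (ydModule T').act (gr k (f (h C))) ∘ₗ emb S' _ ∘ₗ (Φ C).toLinearMap ∘ₗ ret S C)
    (fun C => emb S C ∘ₗ (Φ C).symm.toLinearMap ∘ₗ ret S' _ ∘ₗ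
      (ydModule T').act (gr k (f (h C))⁻¹)) ?_ ?_ ?_ ?_ ?_⟩
  · intro C v
    simp only [LinearMap.comp_apply, LinearEquiv.coe_coe]
    rw [YDModule.act_act, inv_mul_cancel, YDModule.act_gr_one, ret_emb,
      LinearEquiv.symm_apply_apply, emb_ret T]
  · intro C v
    simp only [LinearMap.comp_apply, LinearEquiv.coe_coe]
    rw [ret_emb, LinearEquiv.apply_symm_apply, emb_ret T', YDModule.P_act', YDModule.act_act,
      mul_inv_cancel, YDModule.act_gr_one, inv_inv, ← hu]
  · intro C v
    exact P1 C _
  · intro C v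
    exact P_emb T C _
  · intro C z hz v
    simp only [LinearMap.comp_apply, LinearEquiv.coe_coe]
    let z' : (Subgroup.centralizer {S.u C} : Subgroup G) :=
      ⟨z, Subgroup.mem_centralizer_singleton_iff.2 hz⟩
    have e1 : ret S C ((ydModule T).act (gr k z) v) =
        blkAct (S.ρ C) (MulOpposite.op z'⁻¹) (ret S C v) := by
      rw [← ret_emb (S := S) C (blkAct _ _ _), ← act_emb T C z', emb_ret T]
      have : (ydModule T).act (gr k (z' : G)) ((ydModule T).P (S.u C) v) =
          (ydModule T).P (S.u C) ((ydModule T).act (gr k (z' : G)) v) := by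
        rw [← YDModule.P_act, show (z' : G) * S.u C * (z' : G)⁻¹ = S.u C by
          rw [mul_inv_eq_iff_eq_mul]; exact hz]
      rw [this, ← emb_ret T, ret_emb]
    rw [e1, hΦ', map_inv, ← act_emb T', YDModule.act_act, YDModule.act_act,
      coe_centralizerConj, ← map_mul, ← map_mul]
    congr 4
    simp only [z']
    group

theorem iso_of_exists_isoOver (hS : ∃ φ, YDModule.IsoOver φ (ydModule T) (ydModule T')) :
    S.Iso S' := by
  rw [YDModule.exists_isoOver_iff] at hS
  obtain ⟨f, e, ha, hP⟩ := hS
  refine ⟨f, fun C => ?_⟩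
  obtain ⟨c, hc⟩ := isConj_iff.1 (ConjClasses.mk_eq_mk_iff_isConj.1 (show
    ConjClasses.mk (f (S.u C)) = ConjClasses.mk (S'.u (ConjClasses.map f.toMonoidHom C)) by
    rw [S'.u_mem]; conv_rhs => rw [← S.u_mem C]
    rfl))
  obtain ⟨h, rfl⟩ : ∃ h : G, f h⁻¹ = c := ⟨(f.symm c)⁻¹, by simp⟩
  have hh : f (h⁻¹ * S.u C * h) = S'.u (ConjClasses.map f.toMonoidHom C) := by
    rw [← hc]; simp
  have hu : f (S.u C) = f h * S'.u (ConjClasses.map f.toMonoidHom C) * (f h)⁻¹ := by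
    rw [← hh]; simp [mul_assoc]
  refine ⟨h, hh, ?_⟩
  set C' := ConjClasses.map f.toMonoidHom C
  have w : ∀ x, emb S' C' (ret S' C' ((ydModule T').act (gr k (f h)⁻¹) (e (emb S C x)))) =
      (ydModule T').act (gr k (f h)⁻¹) (e (emb S C x)) := fun x => by
    rw [emb_ret T', YDModule.P_act', inv_inv, ← hu, ← hP, P_emb]
  have w' : ∀ y, emb S C (ret S C (e.symm ((ydModule T').act (gr k (f h)) (emb S' C' y)))) =
      e.symm ((ydModule T').act (gr k (f h)) (emb S' C' y)) := fun y => by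
    rw [emb_ret T, LinearEquiv.eq_symm_apply, hP, LinearEquiv.apply_symm_apply, hu,
      YDModule.P_act, P_emb]
  let E : ((Σ i, Fin (S.d C i)) →₀ k) ≃ₗ[k] ((Σ j, Fin (S'.d C' j)) →₀ k) :=
    LinearEquiv.ofLinearMap
      (ret S' C' ∘ₗ (ydModule T').act (gr k (f h)⁻¹) ∘ₗ e.toLinearMap ∘ₗ emb S C)
      (ret S C ∘ₗ e.symm.toLinearMap ∘ₗ (ydModule T').act (gr k (f h)) ∘ₗ emb S' C')
      (LinearMap.ext fun y => by
        simp only [LinearMap.comp_apply, LinearEquiv.coe_coe, w', LinearEquiv.apply_symm_apply,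
          YDModule.act_act, inv_mul_cancel, YDModule.act_gr_one, ret_emb, LinearMap.id_apply])
      (LinearMap.ext fun x => by
        simp only [LinearMap.comp_apply, LinearEquiv.coe_coe, w, LinearEquiv.symm_apply_apply,
          YDModule.act_act, mul_inv_cancel, YDModule.act_gr_one, ret_emb, LinearMap.id_apply])
  have hE : ∀ x, E x = ret S' C' ((ydModule T').act (gr k (f h)⁻¹) (e (emb S C x))) :=
    fun _ => rfl
  obtain ⟨b, hb⟩ := exists_equiv_of_blk (S.ρ C)
    (fun j => (S'.ρ C' j).comp (MonoidHom.op (centralizerConj f h hh))) (S.irreducible C)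
    (fun j => isIrreducible_comp _ (S'.irreducible C' j) _ fun g => by
      obtain ⟨z, hz⟩ := centralizerConj_surjective f h hh g.unop
      exact ⟨MulOpposite.op z, MulOpposite.unop_injective hz⟩) E (fun g x => by
      obtain ⟨z, rfl⟩ := MulOpposite.op_surjective g
      have e1 := act_emb T C z⁻¹ x
      rw [inv_inv] at e1
      rw [hE, ← e1, ha, YDModule.act_act]
      have e2 : (f h)⁻¹ * f ((z⁻¹ : (Subgroup.centralizer {S.u C} : Subgroup G)) : G) =
          ((centralizerConj f h hh z)⁻¹ : (Subgroup.centralizer {S'.u C'} : Subgroup G')) *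
            (f h)⁻¹ := by
        simp [mul_assoc]
      rw [e2, ← YDModule.act_act, ← w, act_emb, ret_emb, inv_inv]
      rfl)
  refine ⟨b, fun i => ?_⟩
  obtain ⟨F⟩ := hb i
  refine ⟨F.toLinearEquiv, fun z z' hz v => ?_⟩
  obtain rfl : z' = centralizerConj f h hh z := Subtype.ext hz
  exact F.toIntertwiningMap.isIntertwining _ _ (MulOpposite.op z) v

theorem iso_iff_yd : S.Iso S' ↔ ∃ φ, YDModule.IsoOver φ (ydModule T) (ydModule T') :=
  ⟨exists_isoOver_of_iso T T', iso_of_exists_isoOver T T'⟩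

theorem iso_ydModule_of_blk {N : Type*} [AddCommGroup N] [Module k N] (Y : YDModule k G N)
    (J : ∀ C, ((Σ i, Fin (S.d C i)) →₀ k) ≃ₗ[k] LinearMap.range (Y.P (S.u C)))
    (hJ : ∀ C g x, J C (blkAct (S.ρ C) g x) = Y.compRep (S.u C) g (J C x)) :
    Y.Iso (ydModule T) := by
  rw [YDModule.iso_iff]
  refine Y.exists_iso_of_components (ydModule T) (MulEquiv.refl G) S.u S.u_mem
    (fun C => emb S C ∘ₗ (J C).symm.toLinearMap ∘ₗ (Y.P (S.u C)).rangeRestrict)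
    (fun C => (LinearMap.range (Y.P (S.u C))).subtype ∘ₗ (J C).toLinearMap ∘ₗ ret S C)
    ?_ ?_ ?_ ?_ ?_
  · intro C v
    simp only [LinearMap.comp_apply, LinearEquiv.coe_coe]
    rw [ret_emb, LinearEquiv.apply_symm_apply]
    rfl
  · intro C v
    simp only [LinearMap.comp_apply, LinearEquiv.coe_coe]
    have : (Y.P (S.u C)).rangeRestrict
        ((LinearMap.range (Y.P (S.u C))).subtype (J C (ret S C v))) = J C (ret S C v) :=
      Subtype.ext ((Y.mem_range_P _ _).1 (J C (ret S C v)).2)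
    rw [this, LinearEquiv.symm_apply_apply]
    exact emb_ret T C v
  · exact fun C v => P_emb T C _
  · exact fun C v => (Y.mem_range_P _ _).1 (Subtype.property _)
  · intro C z hz v
    obtain ⟨z, rfl⟩ : ∃ z' : (Subgroup.centralizer {S.u C} : Subgroup G), (z' : G) = z :=
      ⟨⟨z, Subgroup.mem_centralizer_singleton_iff.2 hz⟩, rfl⟩
    simp only [LinearMap.comp_apply, LinearEquiv.coe_coe, MulEquiv.refl_apply]
    rw [act_emb]
    congr 1
    rw [LinearEquiv.symm_apply_eq, hJ, LinearEquiv.apply_symm_apply]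
    refine Subtype.ext ((Y.P_act_centralizer _ z v).trans ?_)
    rw [YDModule.compRep_apply, MulOpposite.unop_op, inv_inv]
    rfl

/-- Every Yetter-Drinfeld module is isomorphic to one given by a ramification system. -/
theorem exists_iso_ydModule (hG : (Fintype.card G : k) ≠ 0) {N : Type w} [AddCommGroup N]
    [Module k N] (Y : YDModule k G N) :
    ∃ S : RSR.{u, v, w} k G, ∀ T : S.CosetReps, Y.Iso (ydModule T) := by
  let u : ConjClasses G → G := fun C => C.exists_rep.choose
  have hu : ∀ C, ConjClasses.mk (u C) = C := fun C => C.exists_rep.choose_spec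
  have hcard : ∀ C, (Nat.card (Subgroup.centralizer {u C} : Subgroup G)ᵐᵒᵖ : k) ≠ 0 :=
    fun C h0 => by
      rw [Nat.card_congr MulOpposite.opEquiv.symm] at h0
      obtain ⟨c, hc⟩ := Subgroup.card_subgroup_dvd_card (Subgroup.centralizer {u C} : Subgroup G)
      apply hG
      rw [← Nat.card_eq_fintype_card, hc, Nat.cast_mul, h0, zero_mul]
  have fin : ∀ C, Finite (Subgroup.centralizer {u C} : Subgroup G)ᵐᵒᵖ := fun C =>
    Finite.of_equiv _ MulOpposite.opEquiv
  choose I d σ J hσ hJ using fun C => exists_blk_decomposition (hcard C) (Y.compRep (u C))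
  exact ⟨⟨u, hu, I, d, σ, hσ⟩, fun T => iso_ydModule_of_blk T Y J hJ⟩

end RSR

section Along
variable {k G G' G'' V V' V'' : Type*} [Field k] [Group G] [Group G'] [Group G'']
  [AddCommGroup V] [Module k V] [AddCommGroup V'] [Module k V'] [AddCommGroup V''] [Module k V'']
  [DecidableEq G] [DecidableEq G'] [DecidableEq G'']

/-- Isomorphism of Yetter-Drinfeld modules along a group isomorphism. -/
def YDModule.IsoAlong (f : G ≃* G') (Y : YDModule k G V) (Y' : YDModule k G' V') : Prop :=
  ∃ e : V ≃ₗ[k] V', (∀ g v, e (Y.act (gr k g) v) = Y'.act (gr k (f g)) (e v)) ∧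
    (∀ g v, e (Y.P g v) = Y'.P (f g) (e v))

theorem YDModule.IsoAlong.symm {f : G ≃* G'} {Y : YDModule k G V} {Y' : YDModule k G' V'}
    (h : IsoAlong f Y Y') : IsoAlong f.symm Y' Y := by
  obtain ⟨e, h1, h2⟩ := h
  exact ⟨e.symm, fun g v => by rw [LinearEquiv.symm_apply_eq, h1]; simp,
    fun g v => by rw [LinearEquiv.symm_apply_eq, h2]; simp⟩

theorem YDModule.IsoAlong.trans {f : G ≃* G'} {f' : G' ≃* G''} {Y : YDModule k G V}
    {Y' : YDModule k G' V'} {Y'' : YDModule k G'' V''} (h : IsoAlong f Y Y')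
    (h' : IsoAlong f' Y' Y'') : IsoAlong (f.trans f') Y Y'' := by
  obtain ⟨e, h1, h2⟩ := h
  obtain ⟨e', h1', h2'⟩ := h'
  exact ⟨e.trans e', fun g v => by simp [h1, h1'], fun g v => by simp [h2, h2']⟩

theorem YDModule.isoOver_iff_isoAlong [Fintype G] [Fintype G']
    {φ : MonoidAlgebra k G ≃ₐc[k] MonoidAlgebra k G'} {Y : YDModule k G V}
    {Y' : YDModule k G' V'} : IsoOver φ Y Y' ↔ IsoAlong (grpEquiv φ) Y Y' := isoOver_iff

theorem YDModule.iso_iff_isoAlong [Fintype G] {Y : YDModule k G V}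
    {Y' : YDModule k G V'} : Y.Iso Y' ↔ IsoAlong (MulEquiv.refl G) Y Y' := iso_iff

end Along

namespace HopfBimodule
variable {k G G' M M' : Type*} [Field k] [Group G] [Group G'] [AddCommGroup M] [Module k M]
  [AddCommGroup M'] [Module k M'] [DecidableEq G] [DecidableEq G']

theorem actL_actL (B : HopfBimodule k (MonoidAlgebra k G) M) (g h : G) (m : M) :
    B.actL (gr k g) (B.actL (gr k h) m) = B.actL (gr k (g * h)) m := by rw [gr_mul, B.actL_mul]

theorem actR_actR (B : HopfBimodule k (MonoidAlgebra k G) M) (g h : G) (m : M) :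
    B.actR (gr k g) (B.actR (gr k h) m) = B.actR (gr k (h * g)) m := by rw [gr_mul, B.actR_mul]

@[simp] theorem actL_gr_one (B : HopfBimodule k (MonoidAlgebra k G) M) (m : M) :
    B.actL (gr k 1) m = m := B.actL_one m

@[simp] theorem actR_gr_one (B : HopfBimodule k (MonoidAlgebra k G) M) (m : M) :
    B.actR (gr k 1) m = m := B.actR_one m

variable [Fintype G] [Fintype G']

/-- Isomorphism of Hopf bimodules over group algebras along a group isomorphism. -/
def IsoAlong (f : G ≃* G') (B : HopfBimodule k (MonoidAlgebra k G) M)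
    (B' : HopfBimodule k (MonoidAlgebra k G') M') : Prop :=
  ∃ e : M ≃ₗ[k] M', (∀ g m, e (B.actL (gr k g) m) = B'.actL (gr k (f g)) (e m)) ∧
    (∀ g m, e (B.actR (gr k g) m) = B'.actR (gr k (f g)) (e m)) ∧
    (∀ g m, e (B.PL g m) = B'.PL (f g) (e m)) ∧ (∀ g m, e (B.PR g m) = B'.PR (f g) (e m))

theorem isoOver_iff_isoAlong {φ : MonoidAlgebra k G ≃ₐc[k] MonoidAlgebra k G'}
    {B : HopfBimodule k (MonoidAlgebra k G) M} {B' : HopfBimodule k (MonoidAlgebra k G') M'} :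
    IsoOver φ B B' ↔ IsoAlong (grpEquiv φ) B B' := by
  refine exists_congr fun e => and_congr ⟨fun h g m => ?_, fun h => ?_⟩ (and_congr
    ⟨fun h g m => ?_, fun h => ?_⟩ (and_congr ⟨fun h g m => ?_, fun h m => ?_⟩
      ⟨fun h g m => ?_, fun h m => ?_⟩))
  · rw [h, apply_gr]
  · refine fun a m => gr_induction (P := fun a => e (B.actL a m) = B'.actL (φ a) (e m)) (by simp)
      (fun x y hx hy => by simp only [map_add, LinearMap.add_apply, hx, hy])
      (fun c x hx => by simp only [map_smul, LinearMap.smul_apply, hx])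
      (fun g => by rw [h, apply_gr]) a
  · rw [h, apply_gr]
  · refine fun a m => gr_induction (P := fun a => e (B.actR a m) = B'.actR (φ a) (e m)) (by simp)
      (fun x y hx hy => by simp only [map_add, LinearMap.add_apply, hx, hy])
      (fun c x hx => by simp only [map_smul, LinearMap.smul_apply, hx])
      (fun g => by rw [h, apply_gr]) a
  · conv_rhs => rw [PL, LinearMap.comp_apply, h, cfL_map]
    rfl
  · refine ext_cfL fun g => ?_
    obtain ⟨g, rfl⟩ := (grpEquiv φ).surjective g
    rw [cfL_map]
    exact (h g m).symm
  · conv_rhs => rw [PR, LinearMap.comp_apply, h, cfR_map]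
    rfl
  · refine ext_cfR fun g => ?_
    obtain ⟨g, rfl⟩ := (grpEquiv φ).surjective g
    rw [cfR_map]
    exact (h g m).symm

theorem iso_iff_isoAlong {B : HopfBimodule k (MonoidAlgebra k G) M}
    {B' : HopfBimodule k (MonoidAlgebra k G) M'} :
    B.Iso B' ↔ IsoAlong (MulEquiv.refl G) B B' := by
  rw [Iso, isoOver_iff_isoAlong, grpEquiv_refl]

theorem exists_isoOver_iff {B : HopfBimodule k (MonoidAlgebra k G) M}
    {B' : HopfBimodule k (MonoidAlgebra k G') M'} :
    (∃ φ, IsoOver φ B B') ↔ ∃ f, IsoAlong f B B' :=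
  ⟨fun ⟨φ, h⟩ => ⟨_, isoOver_iff_isoAlong.1 h⟩, fun ⟨f, h⟩ => ⟨grAlgEquiv k f, by
    rw [isoOver_iff_isoAlong, grpEquiv_grAlgEquiv]; exact h⟩⟩

section
variable (B : HopfBimodule k (MonoidAlgebra k G) M)

/-- A Hopf bimodule with the adjoint action and the left coaction. -/
def ad : YDModule k G M :=
  YDModule.ofProj (fun g => B.actL (gr k g) ∘ₗ B.actR (gr k g⁻¹)) B.PL
    (fun v => by simp only [LinearMap.comp_apply, inv_one, actL_gr_one, actR_gr_one])
    (fun g h v => by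
      simp only [LinearMap.comp_apply]
      rw [← B.act_comm, actR_actR, actL_actL, mul_inv_rev]) B.PL_PL B.sum_PL
    (fun g x v => by
      simp only [LinearMap.comp_apply]
      rw [mul_assoc, PL_actL, PL_actR])

@[simp] theorem ad_act (g : G) (m : M) :
    B.ad.act (gr k g) m = B.actL (gr k g) (B.actR (gr k g⁻¹) m) := by
  rw [ad, YDModule.ofProj_act]; rfl

@[simp] theorem ad_P (g : G) (m : M) : B.ad.P g m = B.PL g m := by
  rw [ad, YDModule.ofProj_P]

/-- The right coinvariants. -/
def coinv : Submodule k M := LinearMap.range (B.PR 1)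

theorem mem_coinv {m : M} : m ∈ B.coinv ↔ B.PR 1 m = m :=
  ⟨fun ⟨w, hw⟩ => by rw [← hw, B.PR_PR, if_pos rfl], fun h => ⟨m, h⟩⟩

/-- The projection onto the right coinvariants. -/
def toCoinv : M →ₗ[k] B.coinv := (B.PR 1).codRestrict B.coinv fun m => ⟨m, rfl⟩

@[simp] theorem coe_toCoinv (m : M) : (B.toCoinv m : M) = B.PR 1 m := rfl

@[simp] theorem toCoinv_coe (m : B.coinv) : B.toCoinv m = m := Subtype.ext (B.mem_coinv.1 m.2)

theorem PR_ad (g : G) (m : M) : B.PR 1 (B.ad.act (gr k g) m) = B.ad.act (gr k g) (B.PR 1 m) := by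
  rw [ad_act, ad_act, ← PR_actR, ← PR_actL]
  simp

/-- The Yetter-Drinfeld module of right coinvariants. -/
def yd : YDModule k G B.coinv :=
  B.ad.sub B.coinv (fun g m hm => by rw [mem_coinv] at hm ⊢; rw [PR_ad, hm])
    (fun g m hm => by rw [mem_coinv] at hm ⊢; rw [ad_P, ← PL_PR, hm])

@[simp] theorem yd_act (g : G) (m : B.coinv) :
    (B.yd.act (gr k g) m : M) = B.actL (gr k g) (B.actR (gr k g⁻¹) m) := by
  rw [yd, YDModule.sub_act, ad_act]

@[simp] theorem yd_P (g : G) (m : B.coinv) : (B.yd.P g m : M) = B.PL g m := by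
  rw [yd, YDModule.sub_P, ad_P]

end

theorem IsoAlong.yd {f : G ≃* G'} {B : HopfBimodule k (MonoidAlgebra k G) M}
    {B' : HopfBimodule k (MonoidAlgebra k G') M'} (h : IsoAlong f B B') :
    YDModule.IsoAlong f B.yd B'.yd := by
  obtain ⟨e, h1, h2, h3, h4⟩ := h
  refine ⟨e.ofSubmodules B.coinv B'.coinv ?_, fun g v => Subtype.ext ?_, fun g v => Subtype.ext ?_⟩
  · ext m
    rw [Submodule.mem_map_equiv, mem_coinv, mem_coinv, LinearEquiv.eq_symm_apply, h4, map_one,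
      LinearEquiv.apply_symm_apply]
  · simp only [LinearEquiv.ofSubmodules_apply, yd_act, h1, h2, map_inv]
  · simp only [LinearEquiv.ofSubmodules_apply, yd_P, h3]

theorem IsoAlong.of_yd {f : G ≃* G'} {B : HopfBimodule k (MonoidAlgebra k G) M}
    {B' : HopfBimodule k (MonoidAlgebra k G') M'} (h : YDModule.IsoAlong f B.yd B'.yd) :
    IsoAlong f B B' := by
  obtain ⟨e₀, h1, h2⟩ := h
  let E : M →ₗ[k] M' := B'.coinv.subtype ∘ₗ e₀.toLinearMap ∘ₗ B.toCoinv
  let E' : M' →ₗ[k] M := B.coinv.subtype ∘ₗ e₀.symm.toLinearMap ∘ₗ B'.toCoinv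
  have E'E : ∀ m, E' (E m) = B.PR 1 m := fun m => by
    simp only [E, E', LinearMap.comp_apply, Submodule.subtype_apply, toCoinv_coe, LinearEquiv.coe_coe,
      LinearEquiv.symm_apply_apply, coe_toCoinv]
  have EE' : ∀ m, E (E' m) = B'.PR 1 m := fun m => by
    simp only [E, E', LinearMap.comp_apply, Submodule.subtype_apply, toCoinv_coe, LinearEquiv.coe_coe,
      LinearEquiv.apply_symm_apply, coe_toCoinv]
  have PE : ∀ m, B'.PR 1 (E m) = E m := fun m => B'.mem_coinv.1 (Subtype.property _)
  have PE' : ∀ m, B.PR 1 (E' m) = E' m := fun m => B.mem_coinv.1 (Subtype.property _)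
  have Ead : ∀ g m, E (B.actL (gr k g) (B.actR (gr k g⁻¹) m)) =
      B'.actL (gr k (f g)) (B'.actR (gr k (f g⁻¹)) (E m)) := fun g m => by
    have e1 : B.toCoinv (B.actL (gr k g) (B.actR (gr k g⁻¹) m)) =
        B.yd.act (gr k g) (B.toCoinv m) := Subtype.ext (by
      rw [yd_act, coe_toCoinv, coe_toCoinv, ← ad_act, ← ad_act, PR_ad])
    simp only [E, LinearMap.comp_apply, e1, LinearEquiv.coe_coe, h1, Submodule.subtype_apply,
      yd_act, map_inv]
  have EP : ∀ g m, E (B.PL g m) = B'.PL (f g) (E m) := fun g m => by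
    have e1 : B.toCoinv (B.PL g m) = B.yd.P g (B.toCoinv m) :=
      Subtype.ext (by
        rw [yd_P, coe_toCoinv, coe_toCoinv, PL_PR])
    simp only [E, LinearMap.comp_apply, e1, LinearEquiv.coe_coe, h2, Submodule.subtype_apply, yd_P]
  clear_value E E'
  have hPR : ∀ g m, B.PR 1 (B.actL (gr k g⁻¹) m) = B.actL (gr k g⁻¹) (B.PR g m) := fun g m => by
    rw [← PR_actL, inv_mul_cancel]
  have hPR' : ∀ g m, B'.PR 1 (B'.actL (gr k g⁻¹) m) = B'.actL (gr k g⁻¹) (B'.PR g m) :=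
    fun g m => by rw [← PR_actL, inv_mul_cancel]
  let F : G → M →ₗ[k] M' := fun g => B'.actL (gr k (f g)) ∘ₗ E ∘ₗ B.actL (gr k g⁻¹)
  let F' : G → M' →ₗ[k] M := fun g => B.actL (gr k g) ∘ₗ E' ∘ₗ B'.actL (gr k (f g)⁻¹)
  have hF : ∀ g m, F g m = B'.actL (gr k (f g)) (E (B.actL (gr k g⁻¹) m)) := fun _ _ => rfl
  have hF' : ∀ g m, F' g m = B.actL (gr k g) (E' (B'.actL (gr k (f g)⁻¹) m)) := fun _ _ => rfl
  obtain ⟨e, he, hl, hr⟩ := exists_glue (P := B.PR) (P' := B'.PR) B.PR_PR B.sum_PR B'.PR_PR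
    B'.sum_PR f.toEquiv F F' (fun g v => by
      rw [hF, hF', actL_actL, inv_mul_cancel, actL_gr_one, E'E, hPR, actL_actL, mul_inv_cancel,
        actL_gr_one])
    (fun g v => by
      rw [hF, hF', actL_actL, inv_mul_cancel, actL_gr_one, EE', hPR', actL_actL, mul_inv_cancel,
        actL_gr_one]
      rfl)
    (fun g v => by
      rw [hF, show f.toEquiv g = f g * 1 from (mul_one _).symm, PR_actL, PE])
    (fun g v => by
      rw [hF']
      conv_lhs => rw [show B.PR g = B.PR (g * 1) by rw [mul_one]]
      rw [PR_actL, PE'])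
  refine ⟨e, fun h v => ?_, fun h v => ?_, fun h v => ?_,
    fun g v => (hr g v).trans (hl g v).symm⟩
  · rw [he, he, map_sum, ← Equiv.sum_comp (Equiv.mulLeft h)]
    refine Finset.sum_congr rfl fun g _ => ?_
    rw [hF, hF, Equiv.coe_mulLeft, actL_actL, actL_actL, ← map_mul]
    congr 5
    group
  · rw [he, he, map_sum, ← Equiv.sum_comp (Equiv.mulRight h)]
    refine Finset.sum_congr rfl fun g _ => ?_
    rw [hF, hF, Equiv.coe_mulRight, mul_inv_rev, ← actL_actL, B.act_comm]
    have := Ead h⁻¹ (B.actL (gr k g⁻¹) v)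
    rw [inv_inv] at this
    rw [this, actL_actL, ← map_mul, mul_assoc, mul_inv_cancel, mul_one, B'.act_comm]
  · rw [he, he, map_sum]
    refine Finset.sum_congr rfl fun g _ => ?_
    rw [hF, hF, ← PL_actL, EP, ← PL_actL, ← map_mul, ← mul_assoc, mul_inv_cancel, one_mul]

theorem isoAlong_iff_yd {f : G ≃* G'} {B : HopfBimodule k (MonoidAlgebra k G) M}
    {B' : HopfBimodule k (MonoidAlgebra k G') M'} :
    IsoAlong f B B' ↔ YDModule.IsoAlong f B.yd B'.yd := ⟨IsoAlong.yd, IsoAlong.of_yd⟩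

end HopfBimodule

namespace ArrowActions
variable {k G X : Type*} [Field k] [Group G] [DecidableEq G] [Fintype G] {s t : X → G}
  (A : ArrowActions k s t)

theorem PL_single (g : G) (a : X) : A.hopfBimodule.PL g (Finsupp.single a 1) =
    if t a = g then Finsupp.single a 1 else 0 := by
  rw [HopfBimodule.PL, LinearMap.comp_apply]
  refine (congrArg (cfL g) (arrowCoactL_single (k := k) t a)).trans ?_
  rw [cfL_tmul]

theorem PR_single (g : G) (a : X) : A.hopfBimodule.PR g (Finsupp.single a 1) =
    if s a = g then Finsupp.single a 1 else 0 := by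
  rw [HopfBimodule.PR, LinearMap.comp_apply]
  refine (congrArg (cfR g) (arrowCoactR_single (k := k) s a)).trans ?_
  rw [cfR_tmul]

theorem ydModule_P_single (g : G) (a : {a // s a = 1}) :
    A.ydModule.P g (Finsupp.single a 1) = if t a.1 = g then Finsupp.single a 1 else 0 := by
  rw [YDModule.P, LinearMap.comp_apply]
  refine (congrArg (cfL g) (arrowCoactL_single (k := k)
    (fun a : {a // s a = 1} => t a.1) a)).trans ?_
  rw [cfL_tmul]

theorem coinv_eq : A.hopfBimodule.coinv = Finsupp.supported k k {a : X | s a = 1} := by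
  apply le_antisymm
  · rintro _ ⟨x, rfl⟩
    refine single_induction (P := fun x => A.hopfBimodule.PR 1 x ∈ _) (by simp)
      (fun x y hx hy => by rw [map_add]; exact add_mem hx hy)
      (fun c x hx => by rw [map_smul]; exact Submodule.smul_mem _ c hx) (fun a => ?_) x
    rw [PR_single]
    split_ifs with h
    · exact Finsupp.single_mem_supported k _ h
    · exact zero_mem _
  · intro x hx
    refine supported_induction (P := fun x => x ∈ A.hopfBimodule.coinv) (zero_mem _)
      (fun x y hx hy => add_mem hx hy)
      (fun c x hx => Submodule.smul_mem _ c hx) (fun a ha => ?_) hx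
    rw [HopfBimodule.mem_coinv, PR_single, if_pos (show s a = 1 from ha)]

theorem ydModule_isoAlong : YDModule.IsoAlong (MulEquiv.refl G) A.ydModule A.hopfBimodule.yd := by
  let F : ({a : X // s a = 1} →₀ k) →ₗ[k] A.hopfBimodule.coinv :=
    LinearMap.codRestrict _ (Finsupp.lmapDomain k k Subtype.val) (fun x => by
      rw [coinv_eq]; exact ext_supported x)
  refine ⟨LinearEquiv.ofBijective F ⟨fun x y h => ext_injective (congrArg Subtype.val h),
    fun y => ⟨Finsupp.lsubtypeDomain (R := k) {a : X | s a = 1} y, Subtype.ext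
      (ext_restr (Y := {a : X | s a = 1}) (by rw [← A.coinv_eq]; exact y.2))⟩⟩,
    fun g v => Subtype.ext ?_, fun g v => Subtype.ext ?_⟩
  · rw [HopfBimodule.yd_act]
    refine (congrArg (fun F => Finsupp.lmapDomain k k Subtype.val (F v))
      (gl_gr (k := k) A.ad g)).trans ((A.ext_ad g v).trans ?_)
    have e1 : A.hopfBimodule.actL (gr k g) = A.L g := gl_gr A.L g
    have e2 : A.hopfBimodule.actR (gr k g⁻¹) = A.R g⁻¹ := gl_gr A.R g⁻¹
    rw [MulEquiv.refl_apply, e1, e2]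
    rfl
  · rw [HopfBimodule.yd_P]
    refine single_induction (P := fun v => Finsupp.lmapDomain k k Subtype.val (A.ydModule.P g v) =
      A.hopfBimodule.PL g (Finsupp.lmapDomain k k Subtype.val v)) (by simp)
      (fun x y hx hy => by simp only [map_add, hx, hy])
      (fun c x hx => by simp only [map_smul, hx]) (fun a => ?_) v
    rw [ydModule_P_single, Finsupp.lmapDomain_apply, Finsupp.lmapDomain_apply,
      Finsupp.mapDomain_single, PL_single]
    split_ifs
    · rw [Finsupp.mapDomain_single]
    · rw [Finsupp.mapDomain_zero]

end ArrowActions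

namespace RSR
variable {k : Type u} {G : Type v} {G' : Type v'} [Field k] [Group G] [Group G'] [Fintype G]
  [Fintype G'] [DecidableEq G] [DecidableEq G'] {S : RSR.{u, v, w} k G}
  {S' : RSR.{u, v', w'} k G'} (T : S.CosetReps) (T' : S'.CosetReps)

theorem ydModule_isoAlong :
    YDModule.IsoAlong (MulEquiv.refl G) (ydModule T) (hopfBimodule T).yd :=
  (arrowActions T).ydModule_isoAlong

theorem iso_iff_hopfBimodule :
    S.Iso S' ↔ ∃ φ, HopfBimodule.IsoOver φ (hopfBimodule T) (hopfBimodule T') := by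
  rw [iso_iff_yd T T', HopfBimodule.exists_isoOver_iff, YDModule.exists_isoOver_iff]
  refine exists_congr fun f => ?_
  rw [HopfBimodule.isoAlong_iff_yd]
  exact ⟨fun h => ((ydModule_isoAlong T).symm.trans h).trans (ydModule_isoAlong T'),
    fun h => ((ydModule_isoAlong T).trans h).trans (ydModule_isoAlong T').symm⟩

theorem exists_iso_hopfBimodule (hG : (Fintype.card G : k) ≠ 0) {M : Type w} [AddCommGroup M]
    [Module k M] (B : HopfBimodule k (MonoidAlgebra k G) M) :
    ∃ S : RSR.{u, v, w} k G, ∀ T : S.CosetReps, B.Iso (hopfBimodule T) := by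
  obtain ⟨S, hS⟩ := exists_iso_ydModule hG B.yd
  refine ⟨S, fun T => ?_⟩
  rw [HopfBimodule.iso_iff_isoAlong, HopfBimodule.isoAlong_iff_yd]
  exact (YDModule.iso_iff_isoAlong.1 (hS T)).trans (ydModule_isoAlong T)

end RSR

section BialgEquivOf
variable {k A A' : Type*} [Field k] [Ring A] [Bialgebra k A] [Ring A'] [Bialgebra k A']

/-- A bialgebra isomorphism from a linear one. -/
def bialgEquivOf (e : A ≃ₗ[k] A') (h1 : e 1 = 1) (hm : ∀ a b, e (a * b) = e a * e b)
    (hε : ∀ a, Coalgebra.counit (R := k) (e a) = Coalgebra.counit (R := k) a)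
    (hΔ : ∀ a, Coalgebra.comul (R := k) (e a) =
      TensorProduct.map e.toLinearMap e.toLinearMap (Coalgebra.comul (R := k) a)) : A ≃ₐc[k] A' :=
  BialgEquiv.ofAlgEquiv (AlgEquiv.ofLinearEquiv e h1 hm) (AlgHom.ext hε)
    (AlgHom.ext fun a => (hΔ a).symm)

theorem comul_bialgEquiv (F : A ≃ₐc[k] A') (a : A) : Coalgebra.comul (R := k) (F a) =
    TensorProduct.map F.toCoalgEquiv.toLinearEquiv.toLinearMap
      F.toCoalgEquiv.toLinearEquiv.toLinearMap (Coalgebra.comul (R := k) a) :=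
  (CoalgHomClass.map_comp_comul_apply F a).symm

theorem counit_bialgEquiv (F : A ≃ₐc[k] A') (a : A) :
    Coalgebra.counit (R := k) (F a) = Coalgebra.counit (R := k) a :=
  CoalgHomClass.counit_comp_apply F a

end BialgEquivOf

section TensorMaps
variable {k A B C A' B' C' D : Type*} [CommRing k] [AddCommGroup A] [Module k A]
  [AddCommGroup B] [Module k B] [AddCommGroup C] [Module k C] [AddCommGroup A'] [Module k A']
  [AddCommGroup B'] [Module k B'] [AddCommGroup C'] [Module k C'] [AddCommGroup D] [Module k D]

theorem map_map_apply (f : A →ₗ[k] B) (g : B →ₗ[k] C) (f' : A' →ₗ[k] B') (g' : B' →ₗ[k] C')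
    (t : A ⊗[k] A') : TensorProduct.map g g' (TensorProduct.map f f' t) =
      TensorProduct.map (g ∘ₗ f) (g' ∘ₗ f') t := by
  rw [TensorProduct.map_comp]; rfl

theorem map_eq_of_comp {f : A →ₗ[k] B} {f₁ : A →ₗ[k] B} {f' : A' →ₗ[k] B'} {f₁' : A' →ₗ[k] B'}
    (h : ∀ a, f a = f₁ a) (h' : ∀ a, f' a = f₁' a) (t : A ⊗[k] A') :
    TensorProduct.map f f' t = TensorProduct.map f₁ f₁' t := by
  rw [LinearMap.ext h, LinearMap.ext h']

end TensorMaps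

section Realization
variable {k H M A : Type*} [Field k] [Ring H] [Bialgebra k H] [AddCommGroup M] [Module k M]
  [Ring A] [Bialgebra k A]

/-- `H` and `M` are the components of degree `0` and `1` of a graded bialgebra `A`, with the
structure of `A` inducing that of the bialgebra `H` and of the Hopf bimodule `M`. -/
structure Realization (B : HopfBimodule k H M) (𝒜 : ℕ → Submodule k A) where
  iH : H →ₐ[k] A
  iM : M →ₗ[k] A
  q : A →ₗ[k] H
  comul_iH : ∀ h, Coalgebra.comul (R := k) (iH h) =
    TensorProduct.map iH.toLinearMap iH.toLinearMap (Coalgebra.comul (R := k) h)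
  counit_iH : ∀ h, Coalgebra.counit (R := k) (iH h) = Coalgebra.counit (R := k) h
  iM_actL : ∀ h m, iM (B.actL h m) = iH h * iM m
  iM_actR : ∀ h m, iM (B.actR h m) = iM m * iH h
  comul_iM : ∀ m, Coalgebra.comul (R := k) (iM m) =
    TensorProduct.map iH.toLinearMap iM (B.coactL m) +
      TensorProduct.map iM iH.toLinearMap (B.coactR m)
  q_iH : ∀ h, q (iH h) = h
  q_iM : ∀ m, q (iM m) = 0
  iM_injective : Function.Injective iM
  grade_zero : 𝒜 0 = LinearMap.range iH.toLinearMap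
  grade_one : 𝒜 1 = LinearMap.range iM

namespace Realization
variable {H' M' A' : Type*} [Ring H'] [Bialgebra k H'] [AddCommGroup M'] [Module k M']
  [Ring A'] [Bialgebra k A'] {B : HopfBimodule k H M} {B' : HopfBimodule k H' M'}
  {𝒜 : ℕ → Submodule k A} {𝒜' : ℕ → Submodule k A'}

theorem iH_injective (R : Realization B 𝒜) : Function.Injective R.iH :=
  Function.LeftInverse.injective R.q_iH

theorem exists_iH (R : Realization B 𝒜) (R' : Realization B' 𝒜') (F : A ≃ₐc[k] A')
    (hF : (𝒜 0).map F.toCoalgEquiv.toLinearEquiv.toLinearMap = 𝒜' 0) (h : H) :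
    R'.iH (R'.q (F (R.iH h))) = F (R.iH h) := by
  have : F (R.iH h) ∈ 𝒜' 0 := by
    rw [← hF, R.grade_zero]
    exact ⟨_, ⟨h, rfl⟩, rfl⟩
  rw [R'.grade_zero] at this
  obtain ⟨h', hh⟩ := this
  rw [← hh]
  exact congrArg R'.iH (R'.q_iH h')

theorem symm_map {F : A ≃ₐc[k] A'} {W : Submodule k A} {W' : Submodule k A'}
    (h : W.map F.toCoalgEquiv.toLinearEquiv.toLinearMap = W') :
    W'.map F.symm.toCoalgEquiv.toLinearEquiv.toLinearMap = W := by
  subst h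
  ext x
  constructor
  · rintro ⟨_, ⟨y, hy, rfl⟩, rfl⟩
    have : F.symm (F y) ∈ W := by rwa [BialgEquiv.symm_apply_apply]
    exact this
  · exact fun hx => ⟨F x, ⟨x, hx, rfl⟩, BialgEquiv.symm_apply_apply F x⟩

/-- An isomorphism of graded bialgebras restricts to the components of degree `0` and `1`. -/
theorem isoOver_of_gradedIso (R : Realization B 𝒜) (R' : Realization B' 𝒜')
    (h : GradedIso 𝒜 𝒜') : ∃ φ, HopfBimodule.IsoOver φ B B' := by
  obtain ⟨F, hF⟩ := h
  have e1 := exists_iH R R' F (hF 0)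
  have e1' := exists_iH R' R F.symm (symm_map (hF 0))
  let φ₀ : H ≃ₗ[k] H' := LinearEquiv.ofLinearMap
    (R'.q ∘ₗ F.toCoalgEquiv.toLinearEquiv.toLinearMap ∘ₗ R.iH.toLinearMap)
    (R.q ∘ₗ F.symm.toCoalgEquiv.toLinearEquiv.toLinearMap ∘ₗ R'.iH.toLinearMap)
    (LinearMap.ext fun h => by
      change R'.q (F (R.iH (R.q (F.symm (R'.iH h))))) = h
      rw [e1', BialgEquiv.apply_symm_apply, R'.q_iH])
    (LinearMap.ext fun h => by
      change R.q (F.symm (R'.iH (R'.q (F (R.iH h))))) = h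
      rw [e1, BialgEquiv.symm_apply_apply, R.q_iH])
  have hφ₀ : ∀ h, R'.iH (φ₀ h) = F (R.iH h) := e1
  have hφ₁ : ∀ h, φ₀ h = R'.q (F (R.iH h)) := fun _ => rfl
  clear_value φ₀
  let φ : H ≃ₐc[k] H' := bialgEquivOf φ₀
    (R'.iH_injective (by rw [hφ₀, map_one, map_one, map_one]))
    (fun a b => R'.iH_injective (by rw [hφ₀, map_mul, map_mul, map_mul, hφ₀, hφ₀]))
    (fun a => by rw [← R'.counit_iH, hφ₀, counit_bialgEquiv, R.counit_iH])
    (fun a => by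
      have e := congrArg (TensorProduct.map R'.q R'.q) (congrArg (Coalgebra.comul (R := k)) (hφ₀ a))
      rw [R'.comul_iH, comul_bialgEquiv, R.comul_iH, map_map_apply, map_map_apply,
        map_map_apply] at e
      rw [map_eq_of_comp (f₁ := LinearMap.id) (f₁' := LinearMap.id) R'.q_iH R'.q_iH,
        TensorProduct.map_id] at e
      refine e.trans (map_eq_of_comp (fun a => ?_) (fun a => ?_) _)
      · exact (hφ₁ a).symm
      · exact (hφ₁ a).symm)
  have hφ : ∀ h, R'.iH (φ h) = F (R.iH h) := hφ₀
  have hφ' : ∀ h, φ h = R'.q (F (R.iH h)) := hφ₁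
  clear_value φ
  have m1 : ∀ m, F (R.iM m) ∈ LinearMap.range R'.iM := fun m => by
    rw [← R'.grade_one, ← hF, R.grade_one]; exact ⟨_, ⟨m, rfl⟩, rfl⟩
  have m2 : ∀ m, F.symm (R'.iM m) ∈ LinearMap.range R.iM := fun m => by
    rw [← R.grade_one, ← symm_map (hF 1), R'.grade_one]; exact ⟨_, ⟨m, rfl⟩, rfl⟩
  choose f hf using m1
  choose f' hf' using m2
  let e : M ≃ₗ[k] M' :=
    { toFun := f
      invFun := f'
      map_add' := fun x y => R'.iM_injective (by rw [hf, map_add, map_add, map_add, hf, hf])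
      map_smul' := fun c x => R'.iM_injective (by
        rw [hf, map_smul, map_smul, map_smul, hf, RingHom.id_apply])
      left_inv := fun x => R.iM_injective (by rw [hf', hf, BialgEquiv.symm_apply_apply])
      right_inv := fun x => R'.iM_injective (by rw [hf, hf', BialgEquiv.apply_symm_apply]) }
  have he : ∀ m, R'.iM (e m) = F (R.iM m) := hf
  clear_value e
  have key : ∀ m, TensorProduct.map R'.iH.toLinearMap R'.iM (B'.coactL (e m)) +
      TensorProduct.map R'.iM R'.iH.toLinearMap (B'.coactR (e m)) =
      TensorProduct.map R'.iH.toLinearMap R'.iM (TensorProduct.map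
        φ.toCoalgEquiv.toLinearEquiv.toLinearMap e.toLinearMap (B.coactL m)) +
      TensorProduct.map R'.iM R'.iH.toLinearMap (TensorProduct.map
        e.toLinearMap φ.toCoalgEquiv.toLinearEquiv.toLinearMap (B.coactR m)) := fun m => by
    rw [← R'.comul_iM, he, comul_bialgEquiv, R.comul_iM, map_add, map_map_apply, map_map_apply,
      map_map_apply, map_map_apply]
    congr 1
    · exact map_eq_of_comp (fun a => (hφ a).symm) (fun a => (he a).symm) _
    · exact map_eq_of_comp (fun a => (he a).symm) (fun a => (hφ a).symm) _
  have q1 : R'.q ∘ₗ R'.iH.toLinearMap = LinearMap.id := LinearMap.ext R'.q_iH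
  have q2 : R'.q ∘ₗ R'.iM = 0 := LinearMap.ext R'.q_iM
  refine ⟨φ, e, fun h m => R'.iM_injective ?_, fun h m => R'.iM_injective ?_, fun m => ?_,
    fun m => ?_⟩
  · rw [he, R.iM_actL, map_mul, R'.iM_actL, he, hφ]
  · rw [he, R.iM_actR, map_mul, R'.iM_actR, he, hφ]
  · apply Module.Flat.lTensor_preserves_injective_linearMap (M := H') R'.iM R'.iM_injective
    have := congrArg (R'.q.rTensor A') (key m)
    simp only [map_add, TensorAlg.rTensor_map', q1, q2, TensorProduct.map_zero_left,
      LinearMap.zero_apply, add_zero] at this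
    exact this
  · apply Module.Flat.rTensor_preserves_injective_linearMap (M := H') R'.iM R'.iM_injective
    have := congrArg (R'.q.lTensor A') (key m)
    simp only [map_add, TensorAlg.lTensor_map', q1, q2, TensorProduct.map_zero_right,
      LinearMap.zero_apply, zero_add] at this
    exact this

theorem map_injective_of_injective {V W : Type*} [AddCommGroup V] [Module k V] [AddCommGroup W]
    [Module k W] {ι : V →ₗ[k] W} (h : Function.Injective ι) :
    Function.Injective (TensorProduct.map ι ι) := by
  rw [← LinearMap.rTensor_comp_lTensor, LinearMap.coe_comp]
  exact (Module.Flat.rTensor_preserves_injective_linearMap ι h).comp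
    (Module.Flat.lTensor_preserves_injective_linearMap ι h)

/-- The restriction to a sub-bialgebra containing the components of degree `0` and `1`. -/
def restrict {A₀ : Type*} [Ring A₀] [Bialgebra k A₀] (R : Realization B 𝒜) (ι : A₀ →ₐ[k] A)
    (hι : Function.Injective ι)
    (hΔ : ∀ a, TensorProduct.map ι.toLinearMap ι.toLinearMap (Coalgebra.comul (R := k) a) =
      Coalgebra.comul (R := k) (ι a))
    (hε : ∀ a, Coalgebra.counit (R := k) (ι a) = Coalgebra.counit (R := k) a)
    (h0 : 𝒜 0 ≤ LinearMap.range ι.toLinearMap) (h1 : 𝒜 1 ≤ LinearMap.range ι.toLinearMap) :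
    Realization B fun n => (𝒜 n).comap ι.toLinearMap :=
  have m0 : ∀ h, R.iH h ∈ ι.range := fun h => h0 (by rw [R.grade_zero]; exact ⟨h, rfl⟩)
  have m1 : ∀ m, R.iM m ∈ LinearMap.range ι.toLinearMap :=
    fun m => h1 (by rw [R.grade_one]; exact ⟨m, rfl⟩)
  let iH : H →ₐ[k] A₀ := (AlgEquiv.ofInjective ι hι).symm.toAlgHom.comp
    (R.iH.codRestrict ι.range m0)
  let iM : M →ₗ[k] A₀ := (LinearEquiv.ofInjective ι.toLinearMap hι).symm.toLinearMap ∘ₗ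
    R.iM.codRestrict _ m1
  have hH : ∀ h, ι (iH h) = R.iH h := fun h =>
    congrArg Subtype.val ((AlgEquiv.ofInjective ι hι).apply_symm_apply
      (R.iH.codRestrict ι.range m0 h))
  have hM : ∀ m, ι (iM m) = R.iM m := fun m =>
    congrArg Subtype.val ((LinearEquiv.ofInjective ι.toLinearMap hι).apply_symm_apply
      (R.iM.codRestrict _ m1 m))
  { iH := iH
    iM := iM
    q := R.q ∘ₗ ι.toLinearMap
    comul_iH := fun h => map_injective_of_injective (ι := ι.toLinearMap) hι (by
      rw [hΔ, hH, R.comul_iH, map_map_apply]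
      exact map_eq_of_comp (fun a => (hH a).symm) (fun a => (hH a).symm) _)
    counit_iH := fun h => by rw [← hε, hH, R.counit_iH]
    iM_actL := fun h m => hι (by rw [hM, map_mul, hM, hH, R.iM_actL])
    iM_actR := fun h m => hι (by rw [hM, map_mul, hM, hH, R.iM_actR])
    comul_iM := fun m => map_injective_of_injective (ι := ι.toLinearMap) hι (by
      rw [hΔ, hM, R.comul_iM, map_add, map_map_apply, map_map_apply]
      exact congrArg₂ (· + ·) (map_eq_of_comp (fun a => (hH a).symm) (fun a => (hM a).symm) _)
        (map_eq_of_comp (fun a => (hM a).symm) (fun a => (hH a).symm) _))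
    q_iH := fun h => (congrArg R.q (hH h)).trans (R.q_iH h)
    q_iM := fun m => (congrArg R.q (hM m)).trans (R.q_iM m)
    iM_injective := fun x y h => R.iM_injective (by rw [← hM, h, hM])
    grade_zero := by
      ext x
      rw [Submodule.mem_comap, R.grade_zero]
      exact ⟨fun ⟨h, hh⟩ => ⟨h, hι ((hH h).trans hh)⟩, fun ⟨h, hh⟩ => ⟨h, by
        rw [← hh]; exact (hH h).symm⟩⟩
    grade_one := by
      ext x
      rw [Submodule.mem_comap, R.grade_one]
      exact ⟨fun ⟨h, hh⟩ => ⟨h, hι ((hM h).trans hh)⟩, fun ⟨h, hh⟩ => ⟨h, by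
        rw [← hh]; exact (hM h).symm⟩⟩ }

end Realization
end Realization

namespace Amb
variable {k H M : Type*} [Field k] [Ring H] [Bialgebra k H] [AddCommGroup M] [Module k M]
  (B : HopfBimodule k H M)

/-- The inclusion of `H` as an algebra map. -/
def incAlg : H →ₐ[k] Amb B := AlgHom.ofLinearMap (inc B) rfl fun a b => by
  rw [mul_def]
  apply eq_of
  · rw [pr0_mul]; simp
  · rw [tail_mul]; simp

/-- The inclusion of `M` as the component of degree `1`. -/
def incM : M →ₗ[k] Amb B := join B ∘ₗ (inc B).lTensor M ∘ₗ B.coactR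

variable {B}

@[simp] theorem pr0_incM (m : M) : pr0 B (incM B m) = 0 := pr0_join _

@[simp] theorem tail_incM (m : M) : tail B (incM B m) = (inc B).lTensor M (B.coactR m) :=
  tail_join _

theorem lco_incM (m : M) : lco B (incM B m) = (incM B).lTensor H (B.coactL m) := by
  rw [incM, LinearMap.comp_apply, lco_join, LinearMap.comp_apply, lr_comm, nat3, B.coact_comm,
    LinearMap.lTensor_comp_apply, LinearMap.lTensor_comp_apply]

theorem comul_incM (m : M) : comul B (incM B m) =
    TensorProduct.map (inc B) (incM B) (B.coactL m) +
      TensorProduct.map (incM B) (inc B) (B.coactR m) := by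
  rw [comul_eq, lco_incM, tail_incM]
  congr 1
  · rw [← LinearMap.comp_apply, LinearMap.rTensor_comp_lTensor]
  · have e : comul B ∘ₗ inc B = TensorProduct.map (inc B) (inc B) ∘ₗ Coalgebra.comul :=
      LinearMap.ext comul_inc
    rw [← LinearMap.lTensor_comp_apply, e, LinearMap.lTensor_comp_apply, ← B.coactR_coassoc]
    have e2 : ∀ t : M ⊗[k] H ⊗[k] H, (TensorProduct.assoc k M (Amb B) (Amb B)).symm
        ((TensorProduct.map (inc B) (inc B)).lTensor M (TensorProduct.assoc k M H H t)) =
        TensorProduct.map ((inc B).lTensor M) (inc B) t := fun t => by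
      rw [LinearEquiv.symm_apply_eq]
      exact (TensorAlg.assoc_map_map LinearMap.id (inc B) (inc B) t).symm
    rw [e2, TensorAlg.rTensor_map', ← TensorAlg.map_rTensor']
    rfl

theorem incM_actL (h : H) (m : M) : incM B (B.actL h m) = inc B h * incM B m := by
  rw [mul_def]
  apply eq_of
  · rw [pr0_mul]; simp
  · rw [tail_mul, tail_incM, tail_inc, lco_inc, tail_incM, B.coactR_actL]
    simp only [map_zero, LinearMap.zero_apply, add_zero]
    exact map_map₂ (γ := LinearMap.id) (α := LinearMap.id) (β := LinearMap.id)
      (fun _ _ => rfl) (fun a _ b _ => map_mul (incAlg B) a b)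
      (mem_tens_top _) (mem_tens_top _)

theorem incM_actR (h : H) (m : M) : incM B (B.actR h m) = incM B m * inc B h := by
  rw [mul_def]
  apply eq_of
  · rw [pr0_mul]; simp
  · rw [tail_mul, tail_incM, tail_inc, lco_inc, tail_incM, B.coactR_actR, ← map₂_flip]
    simp only [map_zero, zero_add]
    exact map_map₂ (γ := LinearMap.id) (α := LinearMap.id) (β := LinearMap.id)
      (fun _ _ => rfl) (fun a _ b _ => map_mul (incAlg B) a b)
      (mem_tens_top _) (mem_tens_top _)

theorem incM_injective : Function.Injective (incM B) := by
  have e : pr0 B ∘ₗ inc B = LinearMap.id := LinearMap.ext pr0_inc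
  refine Function.LeftInverse.injective (g := fun x => TensorProduct.rid k M
    ((Coalgebra.counit (R := k)).lTensor M ((pr0 B).lTensor M (tail B x)))) fun m => ?_
  simp only [tail_incM]
  rw [← LinearMap.lTensor_comp_apply M (pr0 B), e, LinearMap.lTensor_id, LinearMap.id_apply,
    B.coactR_counit]

theorem inc_injective : Function.Injective (inc B) := Function.LeftInverse.injective pr0_inc

theorem cotEq_inc (w : M ⊗[k] H) : cotEq B ((inc B).lTensor M w) =
    ((inc B).lTensor H).lTensor M (TensorProduct.assoc k M H H (B.coactR.rTensor H w) -
      (Coalgebra.comul (R := k)).lTensor M w) := by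
  have e : lco B ∘ₗ inc B = (inc B).lTensor H ∘ₗ Coalgebra.comul := LinearMap.ext lco_inc
  rw [cotEq, LinearMap.sub_apply, LinearMap.comp_apply, LinearEquiv.coe_coe,
    lr_comm, nat3, map_sub, ← LinearMap.lTensor_comp_apply M (lco B), e,
    LinearMap.lTensor_comp_apply]

theorem cot_one : cot B 1 = LinearMap.range (incM B) := by
  apply le_antisymm
  · rintro _ ⟨z, ⟨hz, hz'⟩, rfl⟩
    obtain ⟨w, rfl⟩ : ∃ w, (inc B).lTensor M w = z := by
      refine tens_induction (P := fun z => ∃ w, (inc B).lTensor M w = z) ⟨0, map_zero _⟩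
        (fun x y ⟨a, ha⟩ ⟨b, hb⟩ => ⟨a + b, by rw [map_add, ha, hb]⟩)
        (fun m _ x hx => ?_) hz
      obtain ⟨h, rfl⟩ := hx
      exact ⟨m ⊗ₜ h, LinearMap.lTensor_tmul _ _ _ _⟩
    rw [SetLike.mem_coe, LinearMap.mem_ker, cotEq_inc] at hz'
    have hinj := Module.Flat.lTensor_preserves_injective_linearMap (M := M) _
      (Module.Flat.lTensor_preserves_injective_linearMap (M := H) _ (inc_injective (B := B)))
    have hz'' := sub_eq_zero.1 ((injective_iff_map_eq_zero _).1 hinj _ hz')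
    refine ⟨TensorProduct.rid k M ((Coalgebra.counit (R := k)).lTensor M w), ?_⟩
    rw [incM, LinearMap.comp_apply, LinearMap.comp_apply]
    congr 2
    have e1 : ∀ t : M ⊗[k] H, B.coactR (TensorProduct.rid k M
        ((Coalgebra.counit (R := k)).lTensor M t)) = (TensorProduct.rid k H).toLinearMap.lTensor M
        (((Coalgebra.counit (R := k)).lTensor H).lTensor M
          (TensorProduct.assoc k M H H (B.coactR.rTensor H t))) := fun t => by
      induction t using TensorProduct.induction_on with
      | zero => simp
      | tmul m h =>
        simp only [LinearMap.lTensor_tmul, LinearMap.rTensor_tmul, TensorProduct.rid_tmul, map_smul]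
        generalize B.coactR m = s
        induction s using TensorProduct.induction_on with
        | zero => simp
        | tmul a b => simp
        | add x y hx hy => simp only [smul_add, map_add, TensorProduct.add_tmul, hx, hy]
      | add x y hx hy => simp only [map_add, hx, hy]
    have e2 : (TensorProduct.rid k H).toLinearMap ∘ₗ (Coalgebra.counit (R := k)).lTensor H ∘ₗ
        Coalgebra.comul = LinearMap.id := LinearMap.ext fun h => by simp
    rw [e1, hz'', ← LinearMap.lTensor_comp_apply, ← LinearMap.lTensor_comp_apply, LinearMap.comp_assoc, e2,
      LinearMap.lTensor_id, LinearMap.id_apply]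
  · rintro _ ⟨m, rfl⟩
    refine ⟨(inc B).lTensor M (B.coactR m), ⟨?_, ?_⟩, rfl⟩
    · exact map_mem_tens (S' := ⊤) LinearMap.id (inc B) (fun _ _ => trivial)
        (fun h _ => show inc B h ∈ cot B 0 from ⟨h, rfl⟩) (mem_tens_top _)
    · rw [SetLike.mem_coe, LinearMap.mem_ker, cotEq_inc, B.coactR_coassoc, sub_self, map_zero]

/-- `H` and `M` as components of `⨁ₙ M^{⊗n} ⊗ H`. -/
def realization : Realization B (cot B) where
  iH := incAlg B
  iM := incM B
  q := pr0 B
  comul_iH := comul_inc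
  counit_iH h := congrArg (Coalgebra.counit (R := k)) (pr0_inc (B := B) h)
  iM_actL := incM_actL
  iM_actR := incM_actR
  comul_iM := comul_incM
  q_iH := pr0_inc
  q_iM := pr0_incM
  iM_injective := incM_injective
  grade_zero := rfl
  grade_one := cot_one

end Amb

section Realizations
variable {k H M : Type*} [Field k] [Ring H] [Bialgebra k H] [AddCommGroup M] [Module k M]
  (B : HopfBimodule k H M)

/-- The inclusion of the cotensor algebra. -/
def CotensorAlg.val : CotensorAlg B →ₐ[k] Amb B := (Amb.cotensor B).val

/-- The inclusion of the algebra of type one. -/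
def TypeOneAlg.val : TypeOneAlg B →ₐ[k] Amb B := (typeOne B).val

theorem CotensorAlg.val_injective : Function.Injective (CotensorAlg.val B) :=
  Subtype.val_injective

theorem CotensorAlg.comul_val (a : CotensorAlg B) :
    TensorProduct.map (CotensorAlg.val B).toLinearMap (CotensorAlg.val B).toLinearMap
      (Coalgebra.comul (R := k) a) = Coalgebra.comul (R := k) (CotensorAlg.val B a) :=
  incl₂_subComul (Subalgebra.toSubmodule (Amb.cotensor B)) (Amb.cotensor_isSubcoalgebra B) a

theorem CotensorAlg.counit_val (a : CotensorAlg B) :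
    Coalgebra.counit (R := k) (CotensorAlg.val B a) = Coalgebra.counit (R := k) a := rfl

theorem TypeOneAlg.val_injective : Function.Injective (TypeOneAlg.val B) :=
  Subtype.val_injective

theorem TypeOneAlg.comul_val (a : TypeOneAlg B) :
    TensorProduct.map (TypeOneAlg.val B).toLinearMap (TypeOneAlg.val B).toLinearMap
      (Coalgebra.comul (R := k) a) = Coalgebra.comul (R := k) (TypeOneAlg.val B a) :=
  incl₂_subComul (Subalgebra.toSubmodule (typeOne B)) (typeOne_isSubcoalgebra B) a

theorem TypeOneAlg.counit_val (a : TypeOneAlg B) :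
    Coalgebra.counit (R := k) (TypeOneAlg.val B a) = Coalgebra.counit (R := k) a := rfl

def CotensorAlg.realization : Realization B (CotensorAlg.grade B) :=
  Amb.realization.restrict (CotensorAlg.val B) (CotensorAlg.val_injective B)
    (CotensorAlg.comul_val B) (CotensorAlg.counit_val B)
    (fun x hx => ⟨⟨x, Submodule.mem_iSup_of_mem 0 hx⟩, rfl⟩)
    (fun x hx => ⟨⟨x, Submodule.mem_iSup_of_mem 1 hx⟩, rfl⟩)

def TypeOneAlg.realization : Realization B (TypeOneAlg.grade B) :=
  Amb.realization.restrict (TypeOneAlg.val B) (TypeOneAlg.val_injective B)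
    (TypeOneAlg.comul_val B) (TypeOneAlg.counit_val B)
    (fun x hx => ⟨⟨x, Algebra.subset_adjoin (Or.inl hx)⟩, rfl⟩)
    (fun x hx => ⟨⟨x, Algebra.subset_adjoin (Or.inr hx)⟩, rfl⟩)

def TensorAlg.realization : Realization B (TensorAlg.grade B) where
  iH := ιH B
  iM := ιM B
  q := (lift B (AlgHom.id k H) 0 (by simp) (by simp)).toLinearMap
  comul_iH := comul_ιH
  counit_iH h := lift_ιH h
  iM_actL := ιM_actL
  iM_actR := ιM_actR
  comul_iM := comul_ιM
  q_iH h := lift_ιH h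
  q_iM m := lift_ιM m
  iM_injective := by
    have h : ∀ m, lift B (Amb.incAlg B) (Amb.incM B) Amb.incM_actL Amb.incM_actR (ιM B m) =
      Amb.incM B m := fun m => lift_ιM m
    intro x y hxy
    apply Amb.incM_injective (B := B)
    rw [← h, hxy, h]
  grade_zero := by rw [grade, pow_zero, mul_one]
  grade_one := by
    rw [grade, pow_one]
    apply le_antisymm
    · rw [Submodule.mul_le]
      rintro _ ⟨h, rfl⟩ _ ⟨m, rfl⟩
      exact ⟨B.actL h m, ιM_actL h m⟩
    · rintro _ ⟨m, rfl⟩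
      have := Submodule.mul_mem_mul (show (1 : TensorAlg B) ∈ LinearMap.range (ιH B).toLinearMap
        from ⟨1, map_one (ιH B)⟩) (show ιM B m ∈ LinearMap.range (ιM B) from ⟨m, rfl⟩)
      rwa [one_mul] at this

end Realizations

/-- The conditions on a linear bijection `e` in the definition of `HopfBimodule.IsoOver`. -/
structure HopfBimodule.IsIsoOver {k H H' M M' : Type*} [Field k] [Ring H] [Bialgebra k H] [Ring H']
    [Bialgebra k H'] [AddCommGroup M] [Module k M] [AddCommGroup M'] [Module k M']
    (φ : H ≃ₐc[k] H') (B : HopfBimodule k H M) (B' : HopfBimodule k H' M') (e : M ≃ₗ[k] M') :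
    Prop where
  actL : ∀ h m, e (B.actL h m) = B'.actL (φ h) (e m)
  actR : ∀ h m, e (B.actR h m) = B'.actR (φ h) (e m)
  coactL : ∀ m, B'.coactL (e m) =
      TensorProduct.map φ.toCoalgEquiv.toLinearEquiv.toLinearMap e.toLinearMap (B.coactL m)
  coactR : ∀ m, B'.coactR (e m) =
      TensorProduct.map e.toLinearMap φ.toCoalgEquiv.toLinearEquiv.toLinearMap (B.coactR m)

section Functoriality
variable {k H H' M M' : Type*} [Field k] [Ring H] [Bialgebra k H] [Ring H']
    [Bialgebra k H'] [AddCommGroup M] [Module k M] [AddCommGroup M'] [Module k M']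
    {φ : H ≃ₐc[k] H'} {B : HopfBimodule k H M} {B' : HopfBimodule k H' M'} {e : M ≃ₗ[k] M'}

theorem map_symm_apply {V W V' W' : Type*} [AddCommGroup V] [Module k V] [AddCommGroup W]
    [Module k W] [AddCommGroup V'] [Module k V'] [AddCommGroup W'] [Module k W']
    {f : V →ₗ[k] W} {f' : W →ₗ[k] V} (h : ∀ v, f' (f v) = v) {g : V' →ₗ[k] W'} {g' : W' →ₗ[k] V'}
    (h' : ∀ v, g' (g v) = v) (t : V ⊗[k] V') :
    TensorProduct.map f' g' (TensorProduct.map f g t) = t := by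
  rw [map_map_apply, map_eq_of_comp (f₁ := LinearMap.id) (f₁' := LinearMap.id) h h',
    TensorProduct.map_id, LinearMap.id_apply]

theorem HopfBimodule.IsIsoOver.symm (h : IsIsoOver φ B B' e) : IsIsoOver φ.symm B' B e.symm where
  actL a m := by
    rw [LinearEquiv.symm_apply_eq, h.actL, BialgEquiv.apply_symm_apply,
      LinearEquiv.apply_symm_apply]
  actR a m := by
    rw [LinearEquiv.symm_apply_eq, h.actR, BialgEquiv.apply_symm_apply,
      LinearEquiv.apply_symm_apply]
  coactL m := by
    obtain ⟨m, rfl⟩ := e.surjective m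
    rw [h.coactL, LinearEquiv.symm_apply_apply]
    exact (map_symm_apply (fun x => BialgEquiv.symm_apply_apply φ x)
      (fun x => e.symm_apply_apply x) _).symm
  coactR m := by
    obtain ⟨m, rfl⟩ := e.surjective m
    rw [h.coactR, LinearEquiv.symm_apply_apply]
    exact (map_symm_apply (fun x => e.symm_apply_apply x)
      (fun x => BialgEquiv.symm_apply_apply φ x) _).symm

namespace TensorAlg

/-- The algebra map between tensor algebras induced by an isomorphism of Hopf bimodules. -/
def mapHom (h : HopfBimodule.IsIsoOver φ B B' e) : TensorAlg B →ₐ[k] TensorAlg B' :=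
  lift B ((ιH B').comp (φ : H ≃ₐ[k] H').toAlgHom) (ιM B' ∘ₗ e.toLinearMap)
    (fun a m => (congrArg (ιM B') (h.actL a m)).trans (ιM_actL _ _))
    (fun a m => (congrArg (ιM B') (h.actR a m)).trans (ιM_actR _ _))

@[simp] theorem mapHom_ιH (h : HopfBimodule.IsIsoOver φ B B' e) (a : H) :
    mapHom h (ιH B a) = ιH B' (φ a) := lift_ιH a

@[simp] theorem mapHom_ιM (h : HopfBimodule.IsIsoOver φ B B' e) (m : M) :
    mapHom h (ιM B m) = ιM B' (e m) := lift_ιM m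

theorem mapHom_symm (h : HopfBimodule.IsIsoOver φ B B' e) :
    (mapHom h.symm).comp (mapHom h) = AlgHom.id k _ :=
  hom_ext (fun a => by
    rw [AlgHom.comp_apply, mapHom_ιH, mapHom_ιH, BialgEquiv.symm_apply_apply]; rfl)
    (fun m => by
    rw [AlgHom.comp_apply, mapHom_ιM, mapHom_ιM, LinearEquiv.symm_apply_apply]; rfl)

theorem mapHom_symm' (h : HopfBimodule.IsIsoOver φ B B' e) :
    (mapHom h).comp (mapHom h.symm) = AlgHom.id k _ :=
  hom_ext (fun a => by
    rw [AlgHom.comp_apply, mapHom_ιH, mapHom_ιH, BialgEquiv.apply_symm_apply]; rfl)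
    (fun m => by
    rw [AlgHom.comp_apply, mapHom_ιM, mapHom_ιM, LinearEquiv.apply_symm_apply]; rfl)

theorem comul_mapHom (h : HopfBimodule.IsIsoOver φ B B' e) :
    (Algebra.TensorProduct.map (mapHom h) (mapHom h)).comp (comul B) =
      (comul B').comp (mapHom h) := by
  refine hom_ext (fun a => ?_) (fun m => ?_)
  · rw [AlgHom.comp_apply, AlgHom.comp_apply, comul_ιH, mapHom_ιH, comul_ιH]
    refine (map_map_apply _ (mapHom h).toLinearMap _ (mapHom h).toLinearMap _).trans ?_
    rw [comul_bialgEquiv, map_map_apply]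
    exact map_eq_of_comp (fun a => mapHom_ιH h a) (fun a => mapHom_ιH h a) _
  · rw [AlgHom.comp_apply, AlgHom.comp_apply, comul_ιM, mapHom_ιM, comul_ιM, h.coactL, h.coactR,
      map_map_apply, map_map_apply, map_add]
    refine congrArg₂ (· + ·)
      ((map_map_apply _ (mapHom h).toLinearMap _ (mapHom h).toLinearMap _).trans ?_)
      ((map_map_apply _ (mapHom h).toLinearMap _ (mapHom h).toLinearMap _).trans ?_)
    · exact map_eq_of_comp (fun a => mapHom_ιH h a) (fun a => mapHom_ιM h a) _
    · exact map_eq_of_comp (fun a => mapHom_ιM h a) (fun a => mapHom_ιH h a) _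

theorem counit_mapHom (h : HopfBimodule.IsIsoOver φ B B' e) :
    (counit B').comp (mapHom h) = counit B := by
  refine hom_ext (fun a => ?_) (fun m => ?_)
  · rw [AlgHom.comp_apply, mapHom_ιH]
    have e1 : counit B (ιH B a) = Coalgebra.counit (R := k) a := lift_ιH a
    have e2 : counit B' (ιH B' (φ a)) = Coalgebra.counit (R := k) (φ a) := lift_ιH _
    rw [e1, e2, counit_bialgEquiv]
  · rw [AlgHom.comp_apply, mapHom_ιM]
    have e1 : counit B (ιM B m) = 0 := lift_ιM m
    have e2 : counit B' (ιM B' (e m)) = 0 := lift_ιM _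
    rw [e1, e2]

theorem gradedIso_of_isoOver (h : HopfBimodule.IsoOver φ B B') : GradedIso (grade B) (grade B') := by
  obtain ⟨e, h1, h2, h3, h4⟩ := h
  have h : HopfBimodule.IsIsoOver φ B B' e := ⟨h1, h2, h3, h4⟩
  refine ⟨BialgEquiv.ofAlgEquiv (AlgEquiv.ofAlgHom (mapHom h) (mapHom h.symm) (mapHom_symm' h)
    (mapHom_symm h)) (counit_mapHom h) (comul_mapHom h), fun n => ?_⟩
  have e1 : (LinearMap.range (ιH B).toLinearMap).map (mapHom h).toLinearMap =
      LinearMap.range (ιH B').toLinearMap := by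
    apply le_antisymm
    · rintro _ ⟨_, ⟨a, rfl⟩, rfl⟩
      exact ⟨φ a, (mapHom_ιH h a).symm⟩
    · rintro _ ⟨a, rfl⟩
      exact ⟨_, ⟨φ.symm a, rfl⟩, (mapHom_ιH h _).trans (by
        rw [BialgEquiv.apply_symm_apply]; rfl)⟩
  have e2 : (LinearMap.range (ιM B)).map (mapHom h).toLinearMap = LinearMap.range (ιM B') := by
    apply le_antisymm
    · rintro _ ⟨_, ⟨a, rfl⟩, rfl⟩
      exact ⟨e a, (mapHom_ιM h a).symm⟩
    · rintro _ ⟨a, rfl⟩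
      exact ⟨_, ⟨e.symm a, rfl⟩, (mapHom_ιM h _).trans (by rw [LinearEquiv.apply_symm_apply])⟩
  change (grade B n).map (mapHom h).toLinearMap = _
  rw [grade, grade, Submodule.map_mul, Submodule.map_pow, e1, e2]

end TensorAlg

namespace Amb

/-- The linear map induced by linear maps `H → H'` and `M → M'`. -/
def mapLin (B : HopfBimodule k H M) (B' : HopfBimodule k H' M') (f : H →ₗ[k] H')
    (g : M →ₗ[k] M') : Amb B →ₗ[k] Amb B' :=
  fold B (inc B' ∘ₗ f) (cons B' ∘ₗ g)

@[simp] theorem mapLin_inc (f : H →ₗ[k] H') (g : M →ₗ[k] M') (h : H) :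
    mapLin B B' f g (inc B h) = inc B' (f h) := fold_inc _ _ h

@[simp] theorem mapLin_cons (f : H →ₗ[k] H') (g : M →ₗ[k] M') (m : M) (x : Amb B) :
    mapLin B B' f g (cons B m x) = cons B' (g m) (mapLin B B' f g x) := fold_cons _ _ m x

theorem mapLin_join (f : H →ₗ[k] H') (g : M →ₗ[k] M') (z : M ⊗[k] Amb B) :
    mapLin B B' f g (join B z) = join B' (TensorProduct.map g (mapLin B B' f g) z) := by
  induction z using TensorProduct.induction_on with
  | zero => simp
  | tmul m x => simp
  | add x y hx hy => simp only [map_add, hx, hy]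

theorem pr0_mapLin (f : H →ₗ[k] H') (g : M →ₗ[k] M') (x : Amb B) :
    pr0 B' (mapLin B B' f g x) = f (pr0 B x) :=
  hom_ext (f := pr0 B' ∘ₗ mapLin B B' f g) (g := f ∘ₗ pr0 B) (fun h => by simp)
    (fun m x _ => by simp) x

theorem tail_mapLin (f : H →ₗ[k] H') (g : M →ₗ[k] M') (x : Amb B) :
    tail B' (mapLin B B' f g x) = TensorProduct.map g (mapLin B B' f g) (tail B x) :=
  hom_ext (f := tail B' ∘ₗ mapLin B B' f g) (g := TensorProduct.map g (mapLin B B' f g) ∘ₗ tail B)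
    (fun h => by simp) (fun m x _ => by simp) x

theorem mapLin_comp {f : H →ₗ[k] H'} {g : M →ₗ[k] M'} {f' : H' →ₗ[k] H} {g' : M' →ₗ[k] M}
    (hf : ∀ h, f' (f h) = h) (hg : ∀ m, g' (g m) = m) (x : Amb B) :
    mapLin B' B f' g' (mapLin B B' f g x) = x :=
  hom_ext (f := mapLin B' B f' g' ∘ₗ mapLin B B' f g) (g := LinearMap.id) (fun h => by simp [hf])
    (fun m x hx => by
      simp only [LinearMap.comp_apply, LinearMap.id_apply] at hx
      simp [hg, hx]) x

variable (φ e B B') in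
/-- The linear bijection induced by an isomorphism of Hopf bimodules. -/
def mapEquiv : Amb B ≃ₗ[k] Amb B' :=
  LinearEquiv.ofLinearMap (mapLin B B' φ.toCoalgEquiv.toLinearEquiv.toLinearMap e.toLinearMap)
    (mapLin B' B φ.symm.toCoalgEquiv.toLinearEquiv.toLinearMap e.symm.toLinearMap)
    (LinearMap.ext (mapLin_comp (BialgEquiv.apply_symm_apply φ) e.apply_symm_apply))
    (LinearMap.ext (mapLin_comp (BialgEquiv.symm_apply_apply φ) e.symm_apply_apply))

theorem mapEquiv_inc (a : H) : mapEquiv φ B B' e (inc B a) = inc B' (φ a) := mapLin_inc _ _ _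

theorem mapEquiv_join (z : M ⊗[k] Amb B) : mapEquiv φ B B' e (join B z) =
    join B' (TensorProduct.map e.toLinearMap (mapEquiv φ B B' e).toLinearMap z) :=
  mapLin_join _ _ _

theorem pr0_mapEquiv (x : Amb B) : pr0 B' (mapEquiv φ B B' e x) = φ (pr0 B x) :=
  pr0_mapLin _ _ _

theorem tail_mapEquiv (x : Amb B) : tail B' (mapEquiv φ B B' e x) =
    TensorProduct.map e.toLinearMap (mapEquiv φ B B' e).toLinearMap (tail B x) :=
  tail_mapLin _ _ _

theorem lco_mapEquiv (h : HopfBimodule.IsIsoOver φ B B' e) (x : Amb B) :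
    lco B' (mapEquiv φ B B' e x) =
    TensorProduct.map φ.toCoalgEquiv.toLinearEquiv.toLinearMap (mapEquiv φ B B' e).toLinearMap
      (lco B x) := by
  apply eq_of_lTensor
  · rw [pr0_lco, pr0_mapEquiv, comul_bialgEquiv, TensorAlg.lTensor_map', ← pr0_lco,
      ← TensorAlg.map_lTensor']
    exact map_eq_of_comp (fun _ => rfl) (fun x => (pr0_mapEquiv x).symm) _
  · have e1 : tail B' ∘ₗ (mapEquiv φ B B' e).toLinearMap =
      TensorProduct.map e.toLinearMap (mapEquiv φ B B' e).toLinearMap ∘ₗ tail B :=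
      LinearMap.ext tail_mapEquiv
    have e2 : B'.coactL ∘ₗ e.toLinearMap = TensorProduct.map
      φ.toCoalgEquiv.toLinearEquiv.toLinearMap e.toLinearMap ∘ₗ B.coactL := LinearMap.ext h.coactL
    rw [tail_lco, tail_mapEquiv, TensorAlg.rTensor_map', e2, TensorAlg.map_rTensor',
      TensorAlg.assoc_map_map, ← tail_lco, TensorAlg.lTensor_map', e1, TensorAlg.map_lTensor']

theorem comul_mapEquiv (h : HopfBimodule.IsIsoOver φ B B' e) (x : Amb B) :
    comul B' (mapEquiv φ B B' e x) =
    TensorProduct.map (mapEquiv φ B B' e).toLinearMap (mapEquiv φ B B' e).toLinearMap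
      (comul B x) := by
  have e1 : tail B' ∘ₗ (mapEquiv φ B B' e).toLinearMap =
    TensorProduct.map e.toLinearMap (mapEquiv φ B B' e).toLinearMap ∘ₗ tail B :=
    LinearMap.ext tail_mapEquiv
  have a0 : ∀ x : Amb B, (pr0 B').rTensor (Amb B') (comul B' (mapEquiv φ B B' e x)) =
      (pr0 B').rTensor (Amb B') (TensorProduct.map (mapEquiv φ B B' e).toLinearMap
        (mapEquiv φ B B' e).toLinearMap (comul B x)) := fun x => by
    rw [pr0_comul, lco_mapEquiv h, TensorAlg.rTensor_map', ← pr0_comul, ← TensorAlg.map_rTensor']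
    exact map_eq_of_comp (fun x => (pr0_mapEquiv x).symm) (fun _ => rfl) _
  have assoc_symm : ∀ t : M ⊗[k] (Amb B ⊗[k] Amb B), (TensorProduct.assoc k M' (Amb B') (Amb B')).symm
      (TensorProduct.map e.toLinearMap (TensorProduct.map (mapEquiv φ B B' e).toLinearMap
        (mapEquiv φ B B' e).toLinearMap) t) = TensorProduct.map (TensorProduct.map e.toLinearMap
        (mapEquiv φ B B' e).toLinearMap) (mapEquiv φ B B' e).toLinearMap
        ((TensorProduct.assoc k M (Amb B) (Amb B)).symm t) := fun t => by
    rw [LinearEquiv.symm_apply_eq, TensorAlg.assoc_map_map, LinearEquiv.apply_symm_apply]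
  induction x using induct with
  | hadd x y hx hy => simp only [map_add, hx, hy]
  | hinc a => exact eq_of_rTensor (a0 _) (by
      rw [tail_comul, mapEquiv_inc, tail_inc, TensorAlg.rTensor_map', e1, TensorAlg.map_rTensor',
        tail_comul, tail_inc]
      simp only [map_zero])
  | hcons m x ih =>
    refine eq_of_rTensor (a0 _) ?_
    rw [tail_comul, tail_mapEquiv, TensorAlg.rTensor_map', e1, TensorAlg.map_rTensor', tail_comul,
      tail_cons, TensorProduct.map_tmul, LinearMap.lTensor_tmul, LinearMap.lTensor_tmul,
      ← assoc_symm, TensorProduct.map_tmul]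
    congr 2

theorem mapEquiv_mul_aux (h : HopfBimodule.IsIsoOver φ B B' e) : ∀ (n i j : ℕ), i + j ≤ n → ∀ a ∈ fil B i, ∀ b ∈ fil B j,
    mapEquiv φ B B' e (mul B a b) = mul B' (mapEquiv φ B B' e a) (mapEquiv φ B B' e b) := by
  intro n
  induction n with
  | zero =>
    intro i j hn a ha b hb
    obtain rfl : i = 0 := by omega
    have : a = 0 := ha
    simp [this]
  | succ n ih =>
    intro i j hn a ha b hb
    rcases i with _ | i
    · have : a = 0 := ha
      simp [this]
    rcases j with _ | j
    · have : b = 0 := hb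
      simp [this]
    apply eq_of
    · rw [pr0_mapEquiv, pr0_mul, pr0_mul, map_mul, pr0_mapEquiv, pr0_mapEquiv]
    · rw [tail_mapEquiv, tail_mul, tail_mul, map_add, lco_mapEquiv h, lco_mapEquiv h,
        tail_mapEquiv, tail_mapEquiv]
      congr 1
      · exact map_map₂ (fun a m => h.actL a m)
          (fun x hx y hy => ih (i + 1) j (by omega) x hx y hy) (lco_fil ha) hb
      · exact map_map₂ (fun m a => h.actR a m)
          (fun x hx y hy => ih i (j + 1) (by omega) x hx y hy) ha (lco_fil hb)

theorem mapEquiv_mul (h : HopfBimodule.IsIsoOver φ B B' e) (a b : Amb B) :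
    mapEquiv φ B B' e (a * b) =
    mapEquiv φ B B' e a * mapEquiv φ B B' e b := by
  obtain ⟨i, hi⟩ := exists_fil a
  obtain ⟨j, hj⟩ := exists_fil b
  exact mapEquiv_mul_aux h (i + j) i j le_rfl a hi b hj

/-- The bialgebra isomorphism induced by an isomorphism of Hopf bimodules. -/
def mapBialg (h : HopfBimodule.IsIsoOver φ B B' e) : Amb B ≃ₐc[k] Amb B' :=
  bialgEquivOf (mapEquiv φ B B' e) (by rw [one_def, mapEquiv_inc, map_one]; rfl) (mapEquiv_mul h)
    (fun a => by
      change Coalgebra.counit (R := k) (pr0 B' (mapEquiv φ B B' e a)) =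
        Coalgebra.counit (R := k) (pr0 B a)
      rw [pr0_mapEquiv, counit_bialgEquiv]) (comul_mapEquiv h)

theorem mapEquiv_cot (h : HopfBimodule.IsIsoOver φ B B' e) : ∀ n, ∀ x ∈ cot B n, mapEquiv φ B B' e x ∈ cot B' n := by
  have e1 : lco B' ∘ₗ (mapEquiv φ B B' e).toLinearMap = TensorProduct.map
      φ.toCoalgEquiv.toLinearEquiv.toLinearMap (mapEquiv φ B B' e).toLinearMap ∘ₗ lco B :=
    LinearMap.ext (lco_mapEquiv h)
  have e2 : B'.coactR ∘ₗ e.toLinearMap = TensorProduct.map e.toLinearMap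
      φ.toCoalgEquiv.toLinearEquiv.toLinearMap ∘ₗ B.coactR := LinearMap.ext h.coactR
  intro n
  induction n with
  | zero =>
    rintro _ ⟨a, rfl⟩
    exact ⟨φ a, (mapEquiv_inc a).symm⟩
  | succ n ih =>
    rintro _ ⟨z, ⟨hz, hz'⟩, rfl⟩
    rw [mapEquiv_join]
    refine ⟨_, ⟨map_mem_tens (S' := ⊤) _ _ (fun _ _ => trivial) ih hz, ?_⟩, rfl⟩
    rw [SetLike.mem_coe, LinearMap.mem_ker, cotEq_eq_zero] at hz' ⊢
    rw [TensorAlg.rTensor_map', e2, TensorAlg.map_rTensor', TensorAlg.assoc_map_map, hz',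
      TensorAlg.lTensor_map', e1, TensorAlg.map_lTensor']

theorem map_cot (h : HopfBimodule.IsIsoOver φ B B' e) (n : ℕ) :
    (cot B n).map (mapEquiv φ B B' e).toLinearMap = cot B' n := by
  apply le_antisymm
  · rintro _ ⟨x, hx, rfl⟩
    exact mapEquiv_cot h n x hx
  · intro x hx
    exact ⟨_, mapEquiv_cot h.symm n x hx, (mapEquiv φ B B' e).apply_symm_apply x⟩

end Amb

section Restrict
variable {A A' A₀ A₀' : Type*} [Ring A] [Bialgebra k A] [Ring A'] [Bialgebra k A'] [Ring A₀]
  [Bialgebra k A₀] [Ring A₀'] [Bialgebra k A₀']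

/-- An isomorphism of bialgebras restricts to corresponding sub-bialgebras. -/
theorem gradedIso_restrict {𝒜 : ℕ → Submodule k A} {𝒜' : ℕ → Submodule k A'} (F : A ≃ₐc[k] A')
    (hF : ∀ n, (𝒜 n).map F.toCoalgEquiv.toLinearEquiv.toLinearMap = 𝒜' n)
    (ι : A₀ →ₐ[k] A) (hι : Function.Injective ι)
    (hΔ : ∀ a, TensorProduct.map ι.toLinearMap ι.toLinearMap (Coalgebra.comul (R := k) a) =
      Coalgebra.comul (R := k) (ι a))
    (hε : ∀ a, Coalgebra.counit (R := k) (ι a) = Coalgebra.counit (R := k) a)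
    (ι' : A₀' →ₐ[k] A') (hι' : Function.Injective ι')
    (hΔ' : ∀ a, TensorProduct.map ι'.toLinearMap ι'.toLinearMap (Coalgebra.comul (R := k) a) =
      Coalgebra.comul (R := k) (ι' a))
    (hε' : ∀ a, Coalgebra.counit (R := k) (ι' a) = Coalgebra.counit (R := k) a)
    (h : ∀ a, ∃ b, ι' b = F (ι a)) (h' : ∀ b, ∃ a, ι a = F.symm (ι' b)) :
    GradedIso (fun n => (𝒜 n).comap ι.toLinearMap) (fun n => (𝒜' n).comap ι'.toLinearMap) := by
  choose f hf using h
  choose f' hf' using h'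
  let E : A₀ ≃ₗ[k] A₀' :=
    { toFun := f
      invFun := f'
      map_add' := fun x y => hι' (by rw [hf, map_add, map_add, map_add, hf, hf])
      map_smul' := fun c x => hι' (by
        rw [hf, map_smul, map_smul, map_smul, hf, RingHom.id_apply])
      left_inv := fun x => hι (by rw [hf', hf, BialgEquiv.symm_apply_apply])
      right_inv := fun x => hι' (by rw [hf, hf', BialgEquiv.apply_symm_apply]) }
  have hE : ∀ a, ι' (E a) = F (ι a) := hf
  clear_value E
  refine ⟨bialgEquivOf E (hι' (by rw [hE, map_one, map_one, map_one]))
    (fun a b => hι' (by rw [hE, map_mul, map_mul, map_mul, hE, hE]))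
    (fun a => by rw [← hε', hE, counit_bialgEquiv, hε])
    (fun a => Realization.map_injective_of_injective (ι := ι'.toLinearMap) hι' (by
      rw [hΔ', hE, comul_bialgEquiv, ← hΔ, map_map_apply, map_map_apply]
      exact map_eq_of_comp (fun a => (hE a).symm) (fun a => (hE a).symm) _)), fun n => ?_⟩
  change ((𝒜 n).comap ι.toLinearMap).map E.toLinearMap = (𝒜' n).comap ι'.toLinearMap
  ext x
  obtain ⟨x, rfl⟩ := E.surjective x
  rw [Submodule.mem_comap, ← hF]
  constructor
  · rintro ⟨y, hy, hxy⟩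
    obtain rfl := E.injective hxy
    exact ⟨_, hy, (hE y).symm⟩
  · rintro ⟨y, hy, hxy⟩
    refine ⟨x, ?_, rfl⟩
    have : y = ι x := F.injective (hxy.trans (hE x))
    rw [this] at hy
    exact hy

end Restrict

theorem Amb.mapEquiv_cotensor (h : HopfBimodule.IsIsoOver φ B B' e) {a : Amb B}
    (ha : a ∈ Amb.cotensor B) : Amb.mapEquiv φ B B' e a ∈ Amb.cotensor B' :=
  Submodule.iSup_induction (Amb.cot B)
    (motive := fun a => Amb.mapEquiv φ B B' e a ∈ ⨆ n, Amb.cot B' n) ha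
    (fun n a ha => Submodule.mem_iSup_of_mem n (Amb.mapEquiv_cot h n a ha))
    (by rw [map_zero]; exact zero_mem _)
    (fun x y hx hy => by rw [map_add]; exact add_mem hx hy)

theorem Amb.mapEquiv_typeOne (h : HopfBimodule.IsIsoOver φ B B' e) {a : Amb B}
    (ha : a ∈ typeOne B) : Amb.mapEquiv φ B B' e a ∈ typeOne B' := by
  have hle : typeOne B ≤ (typeOne B').comap ((Amb.mapBialg h : Amb B ≃ₐ[k] Amb B').toAlgHom) := by
    refine Algebra.adjoin_le ?_
    rintro x (hx | hx)
    · exact Algebra.subset_adjoin (Or.inl (Amb.mapEquiv_cot h 0 x hx))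
    · exact Algebra.subset_adjoin (Or.inr (Amb.mapEquiv_cot h 1 x hx))
  exact hle ha

theorem CotensorAlg.exists_val (h : HopfBimodule.IsIsoOver φ B B' e) (a : CotensorAlg B) :
    ∃ b, CotensorAlg.val B' b = Amb.mapEquiv φ B B' e (CotensorAlg.val B a) :=
  ⟨⟨_, Amb.mapEquiv_cotensor h a.2⟩, rfl⟩

theorem TypeOneAlg.exists_val (h : HopfBimodule.IsIsoOver φ B B' e) (a : TypeOneAlg B) :
    ∃ b, TypeOneAlg.val B' b = Amb.mapEquiv φ B B' e (TypeOneAlg.val B a) :=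
  ⟨⟨_, Amb.mapEquiv_typeOne h a.2⟩, rfl⟩

theorem Amb.mapBialg_apply (h : HopfBimodule.IsIsoOver φ B B' e) (a : Amb B) :
    Amb.mapBialg h a = Amb.mapEquiv φ B B' e a := rfl

theorem Amb.mapBialg_symm_apply (h : HopfBimodule.IsIsoOver φ B B' e) (a : Amb B') :
    (Amb.mapBialg h).symm a = Amb.mapEquiv φ.symm B' B e.symm a := rfl

theorem CotensorAlg.gradedIso_of_isoOver (h : HopfBimodule.IsoOver φ B B') :
    GradedIso (grade B) (grade B') := by
  obtain ⟨e, h1, h2, h3, h4⟩ := h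
  have h : HopfBimodule.IsIsoOver φ B B' e := ⟨h1, h2, h3, h4⟩
  exact gradedIso_restrict (Amb.mapBialg h) (Amb.map_cot h) (val B) (val_injective B)
    (comul_val B) (counit_val B) (val B') (val_injective B') (comul_val B') (counit_val B')
    (fun a => by rw [Amb.mapBialg_apply]; exact exists_val h a)
    (fun a => by rw [Amb.mapBialg_symm_apply]; exact exists_val h.symm a)

theorem TypeOneAlg.gradedIso_of_isoOver (h : HopfBimodule.IsoOver φ B B') :
    GradedIso (grade B) (grade B') := by
  obtain ⟨e, h1, h2, h3, h4⟩ := h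
  have h : HopfBimodule.IsIsoOver φ B B' e := ⟨h1, h2, h3, h4⟩
  exact gradedIso_restrict (Amb.mapBialg h) (Amb.map_cot h) (val B) (val_injective B)
    (comul_val B) (counit_val B) (val B') (val_injective B') (comul_val B') (counit_val B')
    (fun a => by rw [Amb.mapBialg_apply]; exact exists_val h a)
    (fun a => by rw [Amb.mapBialg_symm_apply]; exact exists_val h.symm a)

theorem CotensorAlg.gradedIso_iff : GradedIso (CotensorAlg.grade B) (CotensorAlg.grade B') ↔
    ∃ φ, HopfBimodule.IsoOver φ B B' :=
  ⟨(CotensorAlg.realization B).isoOver_of_gradedIso (CotensorAlg.realization B'),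
    fun ⟨_, h⟩ => CotensorAlg.gradedIso_of_isoOver h⟩

theorem TypeOneAlg.gradedIso_iff : GradedIso (TypeOneAlg.grade B) (TypeOneAlg.grade B') ↔
    ∃ φ, HopfBimodule.IsoOver φ B B' :=
  ⟨(TypeOneAlg.realization B).isoOver_of_gradedIso (TypeOneAlg.realization B'),
    fun ⟨_, h⟩ => TypeOneAlg.gradedIso_of_isoOver h⟩

theorem TensorAlg.gradedIso_iff : GradedIso (TensorAlg.grade B) (TensorAlg.grade B') ↔
    ∃ φ, HopfBimodule.IsoOver φ B B' :=
  ⟨(TensorAlg.realization B).isoOver_of_gradedIso (TensorAlg.realization B'),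
    fun ⟨_, h⟩ => TensorAlg.gradedIso_of_isoOver h⟩

end Functoriality

namespace FunAlg
variable {k G G' : Type*} [Field k] [Group G] [Fintype G] [DecidableEq G] [Group G'] [Fintype G']
  [DecidableEq G']

theorem ev_injective : Function.Injective (ev : G → FunAlg k G →ₐ[k] k) := fun g h e => by
  have := DFunLike.congr_fun e (p k g)
  rw [ev_p, ev_p, if_pos rfl] at this
  by_contra hne
  rw [if_neg (Ne.symm hne)] at this
  exact one_ne_zero this

theorem exists_ev (χ : FunAlg k G →ₐ[k] k) : ∃ g, χ = ev g := by
  have h1 : ∑ g, χ (p k g) = 1 := by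
    rw [← map_sum, ← map_one χ]
    congr 1
    refine ext_ev fun g => ?_
    rw [map_sum, map_one]
    simp
  obtain ⟨g, hg⟩ : ∃ g, χ (p k g) ≠ 0 := by
    by_contra! h
    simp [h] at h1
  refine ⟨g, AlgHom.ext fun q => ?_⟩
  have e : p k g * q = ev g q • p k g := ext_ev fun x => by
    rw [map_mul, map_smul, ev_p]
    by_cases hx : x = g
    · subst hx; simp
    · simp [hx]
  have := congrArg χ e
  rw [map_mul, map_smul, smul_eq_mul, mul_comm] at this
  exact mul_right_cancel₀ hg this

theorem ev_ev_comul (g h : G) (f : FunAlg k G) :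
    ev h (evL g (Coalgebra.comul (R := k) f)) = ev (g * h) f := by
  rw [comul_def, evL_comul, ev_trL]

theorem ext_ev_ev {s t : FunAlg k G ⊗[k] FunAlg k G} (h : ∀ g h, ev h (evL g s) = ev h (evL g t)) :
    s = t := ext_evL fun g => ext_ev fun x => h g x

theorem evL_map {N N' : Type*} [AddCommGroup N] [Module k N] [AddCommGroup N'] [Module k N']
    {F : FunAlg k G →ₗ[k] FunAlg k G'} {g' : G'} {g : G} (hF : ∀ q, ev g' (F q) = ev g q)
    (e : N →ₗ[k] N') (t : FunAlg k G ⊗[k] N) : evL g' (TensorProduct.map F e t) = e (evL g t) := by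
  induction t using TensorProduct.induction_on with
  | zero => simp
  | tmul a b => simp [hF]
  | add x y hx hy => simp only [map_add, hx, hy]

theorem evR_map {N N' : Type*} [AddCommGroup N] [Module k N] [AddCommGroup N'] [Module k N']
    {F : FunAlg k G →ₗ[k] FunAlg k G'} {g' : G'} {g : G} (hF : ∀ q, ev g' (F q) = ev g q)
    (e : N →ₗ[k] N') (t : N ⊗[k] FunAlg k G) : evR g' (TensorProduct.map e F t) = e (evR g t) := by
  induction t using TensorProduct.induction_on with
  | zero => simp
  | tmul a b => simp [hF]
  | add x y hx hy => simp only [map_add, hx, hy]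

/-- A bialgebra isomorphism between function algebras comes from a group isomorphism. -/
theorem exists_mulEquiv (ψ : FunAlg k G ≃ₐc[k] FunAlg k G') :
    ∃ f : G ≃* G', ∀ g q, ev (f g) (ψ q) = ev g q := by
  have h1 : ∀ g : G, ∃ g' : G', ∀ q, ev g' q = ev g (ψ.symm q) := fun g => by
    obtain ⟨g', hg⟩ := exists_ev ((ev g).comp (ψ.symm : FunAlg k G' ≃ₐ[k] FunAlg k G).toAlgHom)
    exact ⟨g', fun q => (DFunLike.congr_fun hg q).symm⟩
  have h2 : ∀ g' : G', ∃ g : G, ∀ q, ev g q = ev g' (ψ q) := fun g' => by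
    obtain ⟨g, hg⟩ := exists_ev ((ev g').comp (ψ : FunAlg k G ≃ₐ[k] FunAlg k G').toAlgHom)
    exact ⟨g, fun q => (DFunLike.congr_fun hg q).symm⟩
  choose f hf using h1
  choose f' hf' using h2
  have hψ : ∀ g q, ev (f g) (ψ q) = ev g q := fun g q => by
    rw [hf, BialgEquiv.symm_apply_apply]
  refine ⟨MulEquiv.mk ⟨f, f', fun g => ?_, fun g => ?_⟩ fun g h => ?_, hψ⟩
  · exact ev_injective (k := k) (AlgHom.ext fun q => by rw [hf', hψ])
  · exact ev_injective (k := k) (AlgHom.ext fun q => by rw [hf, hf', BialgEquiv.apply_symm_apply])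
  · refine ev_injective (k := k) (AlgHom.ext fun q => ?_)
    obtain ⟨q, rfl⟩ : ∃ q', ψ q' = q := ⟨ψ.symm q, BialgEquiv.apply_symm_apply ψ q⟩
    rw [hψ, ← ev_ev_comul, ← ev_ev_comul, comul_bialgEquiv, evL_map (g := g) (fun q => hψ g q)]
    exact (hψ h _).symm

/-- The bialgebra isomorphism of function algebras given by a group isomorphism. -/
def congr (k : Type*) [Field k] (f : G ≃* G') : FunAlg k G ≃ₐc[k] FunAlg k G' :=
  bialgEquivOf (LinearEquiv.funCongrLeft k k f.symm.toEquiv) rfl (fun _ _ => rfl)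
    (fun q => congrArg q f.symm.map_one) (fun q => ext_ev_ev fun g h => by
      rw [evL_map (g := f.symm g) (fun _ => rfl), ev_ev_comul]
      refine Eq.trans ?_ (ev_ev_comul (f.symm g) (f.symm h) q).symm
      exact congrArg q (f.symm.map_mul g h))

theorem ev_congr (f : G ≃* G') (g : G) (q : FunAlg k G) : ev (f g) (congr k f q) = ev g q :=
  congrArg q (f.symm_apply_apply g)

end FunAlg

namespace HopfBimodule
variable {k G G' G'' N N' N'' : Type*} [Field k] [Group G] [Fintype G] [DecidableEq G] [Group G']
  [Fintype G'] [DecidableEq G'] [Group G''] [Fintype G''] [DecidableEq G'']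
  [AddCommGroup N] [Module k N] [AddCommGroup N'] [Module k N'] [AddCommGroup N''] [Module k N'']

/-- Isomorphism of Hopf bimodules over function algebras along a group isomorphism. -/
def FunIsoAlong (f : G ≃* G') (D : HopfBimodule k (FunAlg k G) N)
    (D' : HopfBimodule k (FunAlg k G') N') : Prop :=
  ∃ e : N ≃ₗ[k] N', (∀ g m, e (D.actL (FunAlg.p k g) m) = D'.actL (FunAlg.p k (f g)) (e m)) ∧
    (∀ g m, e (D.actR (FunAlg.p k g) m) = D'.actR (FunAlg.p k (f g)) (e m)) ∧
    (∀ g m, e (FunAlg.evL g (D.coactL m)) = FunAlg.evL (f g) (D'.coactL (e m))) ∧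
    (∀ g m, e (FunAlg.evR g (D.coactR m)) = FunAlg.evR (f g) (D'.coactR (e m)))

theorem FunIsoAlong.trans {f : G ≃* G'} {f' : G' ≃* G''} {D : HopfBimodule k (FunAlg k G) N}
    {D' : HopfBimodule k (FunAlg k G') N'} {D'' : HopfBimodule k (FunAlg k G'') N''}
    (h : FunIsoAlong f D D') (h' : FunIsoAlong f' D' D'') : FunIsoAlong (f.trans f') D D'' := by
  obtain ⟨e, h1, h2, h3, h4⟩ := h
  obtain ⟨e', h1', h2', h3', h4'⟩ := h'
  exact ⟨e.trans e', fun g v => by simp [h1, h1'], fun g v => by simp [h2, h2'],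
    fun g v => by simp [h3, h3'], fun g v => by simp [h4, h4']⟩

theorem isoOver_iff_funIsoAlong {ψ : FunAlg k G ≃ₐc[k] FunAlg k G'} {f : G ≃* G'}
    (hf : ∀ g q, FunAlg.ev (f g) (ψ q) = FunAlg.ev g q) {D : HopfBimodule k (FunAlg k G) N}
    {D' : HopfBimodule k (FunAlg k G') N'} : IsoOver ψ D D' ↔ FunIsoAlong f D D' := by
  have hp : ∀ g, ψ (FunAlg.p k g) = FunAlg.p k (f g) := fun g => FunAlg.ext_ev fun x => by
    obtain ⟨x, rfl⟩ := f.surjective x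
    rw [hf, FunAlg.ev_p, FunAlg.ev_p]
    simp
  refine exists_congr fun e => and_congr ⟨fun h g m => ?_, fun h q m => ?_⟩ (and_congr
    ⟨fun h g m => ?_, fun h q m => ?_⟩ (and_congr ⟨fun h g m => ?_, fun h m => ?_⟩
      ⟨fun h g m => ?_, fun h m => ?_⟩))
  · rw [h, hp]
  · rw [FunAlg.eq_sum_p q]
    simp only [map_sum, map_smul, LinearMap.sum_apply, LinearMap.smul_apply, h, hp]
  · rw [h, hp]
  · rw [FunAlg.eq_sum_p q]
    simp only [map_sum, map_smul, LinearMap.sum_apply, LinearMap.smul_apply, h, hp]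
  · rw [h, FunAlg.evL_map (g := g) (fun q => hf g q)]; rfl
  · refine FunAlg.ext_evL fun g => ?_
    obtain ⟨g, rfl⟩ := f.surjective g
    rw [FunAlg.evL_map (g := g) (fun q => hf g q)]
    exact (h g m).symm
  · rw [h, FunAlg.evR_map (g := g) (fun q => hf g q)]; rfl
  · refine FunAlg.ext_evR fun g => ?_
    obtain ⟨g, rfl⟩ := f.surjective g
    rw [FunAlg.evR_map (g := g) (fun q => hf g q)]
    exact (h g m).symm

theorem exists_isoOver_iff_funIsoAlong {D : HopfBimodule k (FunAlg k G) N}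
    {D' : HopfBimodule k (FunAlg k G') N'} :
    (∃ ψ, IsoOver ψ D D') ↔ ∃ f, FunIsoAlong f D D' :=
  ⟨fun ⟨ψ, h⟩ => by
    obtain ⟨f, hf⟩ := FunAlg.exists_mulEquiv ψ
    exact ⟨f, (isoOver_iff_funIsoAlong hf).1 h⟩,
  fun ⟨f, h⟩ => ⟨FunAlg.congr k f, (isoOver_iff_funIsoAlong (FunAlg.ev_congr f)).2 h⟩⟩

section Dual
variable {M M' : Type*} [AddCommGroup M] [Module k M] [AddCommGroup M'] [Module k M']
  (B : HopfBimodule k (MonoidAlgebra k G) M) (B' : HopfBimodule k (MonoidAlgebra k G') M')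

theorem dual_actL_p (g : G) (ξ : Module.Dual k M) :
    B.dual.actL (FunAlg.p k g) ξ = ξ ∘ₗ B.PL g :=
  LinearMap.ext fun m => (B.dualActL_apply _ ξ m).trans (by simp)

theorem dual_actR_p (g : G) (ξ : Module.Dual k M) :
    B.dual.actR (FunAlg.p k g) ξ = ξ ∘ₗ B.PR g :=
  LinearMap.ext fun m => (B.dualActR_apply _ ξ m).trans (by simp)

theorem evL_dual_coactL (g : G) (ξ : Module.Dual k M) :
    FunAlg.evL g (B.dual.coactL ξ) = ξ ∘ₗ B.actL (gr k g) := B.evL_dualCoactL g ξ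

theorem evR_dual_coactR (g : G) (ξ : Module.Dual k M) :
    FunAlg.evR g (B.dual.coactR ξ) = ξ ∘ₗ B.actR (gr k g) := B.evR_dualCoactR g ξ

variable {B B'}

theorem IsoAlong.dual {f : G ≃* G'} (h : IsoAlong f B B') : FunIsoAlong f B.dual B'.dual := by
  obtain ⟨e, h1, h2, h3, h4⟩ := h
  refine ⟨e.symm.dualMap, fun g ξ => LinearMap.ext fun m => ?_,
    fun g ξ => LinearMap.ext fun m => ?_, fun g ξ => LinearMap.ext fun m => ?_,
    fun g ξ => LinearMap.ext fun m => ?_⟩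
  · obtain ⟨m, rfl⟩ := e.surjective m
    rw [dual_actL_p, dual_actL_p]
    simp [← h3]
  · obtain ⟨m, rfl⟩ := e.surjective m
    rw [dual_actR_p, dual_actR_p]
    simp [← h4]
  · obtain ⟨m, rfl⟩ := e.surjective m
    rw [evL_dual_coactL, evL_dual_coactL]
    simp [← h1]
  · obtain ⟨m, rfl⟩ := e.surjective m
    rw [evR_dual_coactR, evR_dual_coactR]
    simp [← h2]

theorem IsoAlong.of_dual [Module.Finite k M] [Module.Finite k M'] {f : G ≃* G'}
    (h : FunIsoAlong f B.dual B'.dual) : IsoAlong f B B' := by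
  obtain ⟨e, h1, h2, h3, h4⟩ := h
  let E : M' ≃ₗ[k] M := (Module.evalEquiv k M').trans
    (e.dualMap.trans (Module.evalEquiv k M).symm)
  have hE : ∀ m ξ, ξ (E m) = e ξ m := fun m ξ =>
    Module.apply_evalEquiv_symm_apply k M ξ (e.dualMap (Module.evalEquiv k M' m))
  have ext : ∀ x y : M, (∀ ξ : Module.Dual k M, ξ x = ξ y) → x = y := fun x y h =>
    (Module.evalEquiv k M).injective (LinearMap.ext h)
  refine ⟨E.symm, fun g m => ?_, fun g m => ?_, fun g m => ?_, fun g m => ?_⟩ <;>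
    obtain ⟨m, rfl⟩ := E.surjective m <;>
    rw [LinearEquiv.symm_apply_eq, LinearEquiv.symm_apply_apply] <;>
    refine ext _ _ fun ξ => ?_ <;> rw [hE]
  · have := LinearMap.congr_fun (h3 g ξ) m
    rw [evL_dual_coactL, evL_dual_coactL, ← hE] at this
    exact this
  · have := LinearMap.congr_fun (h4 g ξ) m
    rw [evR_dual_coactR, evR_dual_coactR, ← hE] at this
    exact this
  · have := LinearMap.congr_fun (h1 g ξ) m
    rw [dual_actL_p, dual_actL_p, ← hE] at this
    exact this
  · have := LinearMap.congr_fun (h2 g ξ) m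
    rw [dual_actR_p, dual_actR_p, ← hE] at this
    exact this

theorem exists_isoOver_dual_iff [Module.Finite k M] [Module.Finite k M'] :
    (∃ ψ, IsoOver ψ B.dual B'.dual) ↔ ∃ φ, IsoOver φ B B' := by
  rw [exists_isoOver_iff_funIsoAlong, exists_isoOver_iff]
  exact exists_congr fun f => ⟨IsoAlong.of_dual, IsoAlong.dual⟩

end Dual
end HopfBimodule

namespace HopfBimodule
variable {k G N : Type*} [Field k] [Group G] [Fintype G] [DecidableEq G]
  [AddCommGroup N] [Module k N] (D : HopfBimodule k (FunAlg k G) N)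

/-- The operator by which `g` acts on a left `(kG)*`-comodule. -/
def coL (g : G) : N →ₗ[k] N := FunAlg.evL g ∘ₗ D.coactL

/-- The operator by which `g` acts on a right `(kG)*`-comodule. -/
def coR (g : G) : N →ₗ[k] N := FunAlg.evR g ∘ₗ D.coactR

theorem coL_one (m : N) : D.coL 1 m = m := D.coactL_counit m

theorem coR_one (m : N) : D.coR 1 m = m := D.coactR_counit m

theorem coL_coL (g h : G) (m : N) : D.coL h (D.coL g m) = D.coL (g * h) m := by
  have := congrArg (fun t => FunAlg.evL h (FunAlg.evL g t)) (D.coactL_coassoc m)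
  have e : FunAlg.evL g ∘ₗ (Coalgebra.comul (R := k) (A := FunAlg k G)) = FunAlg.trL g :=
    LinearMap.ext (FunAlg.evL_comul g)
  rw [FunAlg.evL_assoc, FunAlg.evL_lTensor, ← LinearMap.rTensor_comp_apply, e,
    FunAlg.evL_trL] at this
  exact this.symm

theorem coR_coR (g h : G) (m : N) : D.coR g (D.coR h m) = D.coR (g * h) m := by
  have := congrArg (fun t => FunAlg.evR g (FunAlg.evR h t))
    (((TensorProduct.assoc k N _ _).eq_symm_apply).2 (D.coactR_coassoc m))
  have e : FunAlg.evR h ∘ₗ (Coalgebra.comul (R := k) (A := FunAlg k G)) = FunAlg.trR h :=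
    LinearMap.ext (FunAlg.evR_comul h)
  rw [FunAlg.evR_assoc, FunAlg.evR_rTensor, ← LinearMap.lTensor_comp_apply, e,
    FunAlg.evR_trR] at this
  exact this

theorem coL_coR (g h : G) (m : N) : D.coL g (D.coR h m) = D.coR h (D.coL g m) := by
  have := congrArg (fun t => FunAlg.evR h (FunAlg.evL g t)) (D.coact_comm m)
  rw [FunAlg.evL_assoc, FunAlg.evL_lTensor, ← LinearMap.rTensor_comp_apply,
    FunAlg.evR_rTensor] at this
  exact this

theorem coL_actL (g : G) (p : FunAlg k G) (m : N) :
    D.coL g (D.actL p m) = D.actL (FunAlg.trL g p) (D.coL g m) := by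
  rw [coL, LinearMap.comp_apply, D.coactL_actL, FunAlg.evL_map₂ FunAlg.ev_mul, FunAlg.comul_def,
    FunAlg.evL_comul]
  rfl

theorem coL_actR (g : G) (p : FunAlg k G) (m : N) :
    D.coL g (D.actR p m) = D.actR (FunAlg.trL g p) (D.coL g m) := by
  rw [coL, LinearMap.comp_apply, D.coactL_actR, FunAlg.evL_map₂ FunAlg.ev_mul_flip,
    FunAlg.comul_def, FunAlg.evL_comul]
  rfl

theorem coR_actL (g : G) (p : FunAlg k G) (m : N) :
    D.coR g (D.actL p m) = D.actL (FunAlg.trR g p) (D.coR g m) := by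
  rw [coR, LinearMap.comp_apply, D.coactR_actL, FunAlg.evR_map₂ FunAlg.ev_mul, FunAlg.comul_def,
    FunAlg.evR_comul]
  rfl

theorem coR_actR (g : G) (p : FunAlg k G) (m : N) :
    D.coR g (D.actR p m) = D.actR (FunAlg.trR g p) (D.coR g m) := by
  rw [coR, LinearMap.comp_apply, D.coactR_actR, FunAlg.evR_map₂ FunAlg.ev_mul_flip,
    FunAlg.comul_def, FunAlg.evR_comul]
  rfl

end HopfBimodule

section Transpose
variable {k X : Type*} [Field k] [Finite X]

open Classical in
/-- The linear isomorphism with the dual space given by the standard basis. -/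
def finsuppDual (k X : Type*) [Field k] [Finite X] : (X →₀ k) ≃ₗ[k] Module.Dual k (X →₀ k) :=
  (Finsupp.basisSingleOne (R := k) (ι := X)).toDualEquiv

theorem finsuppDual_apply_single (x : X →₀ k) (a : X) :
    finsuppDual k X x (Finsupp.single a 1) = x a := by
  classical
  have := (Finsupp.basisSingleOne (R := k) (ι := X)).toDual_apply_left x a
  simpa [finsuppDual, Module.Basis.toDualEquiv_apply] using this

theorem finsuppDual_single (x : X →₀ k) (a : X) :
    finsuppDual k X (Finsupp.single a 1) x = x a := by
  classical
  have := (Finsupp.basisSingleOne (R := k) (ι := X)).toDual_apply_right a x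
  simpa [finsuppDual, Module.Basis.toDualEquiv_apply] using this

theorem finsuppDual_comm (x y : X →₀ k) : finsuppDual k X x y = finsuppDual k X y x :=
  LinearMap.congr_fun (f := finsuppDual k X x) (g := (finsuppDual k X).toLinearMap.flip x)
    (Finsupp.lhom_ext' fun a => LinearMap.ext_ring (by
      simp [finsuppDual_apply_single, finsuppDual_single])) y

/-- The transpose of an endomorphism with respect to the standard basis. -/
def finsuppTr (F : (X →₀ k) →ₗ[k] (X →₀ k)) : (X →₀ k) →ₗ[k] (X →₀ k) :=
  (finsuppDual k X).symm.toLinearMap ∘ₗ F.dualMap ∘ₗ (finsuppDual k X).toLinearMap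

theorem finsuppDual_tr (F : (X →₀ k) →ₗ[k] (X →₀ k)) (x y : X →₀ k) :
    finsuppDual k X (finsuppTr F x) y = finsuppDual k X x (F y) := by
  simp [finsuppTr]

theorem finsuppDual_ext {x x' : X →₀ k}
    (h : ∀ y, finsuppDual k X x y = finsuppDual k X x' y) : x = x' :=
  (finsuppDual k X).injective (LinearMap.ext h)

theorem finsuppTr_single_apply (F : (X →₀ k) →ₗ[k] (X →₀ k)) (a b : X) :
    finsuppTr F (Finsupp.single a 1) b = F (Finsupp.single b 1) a := by
  rw [← finsuppDual_apply_single, finsuppDual_tr, finsuppDual_single]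

end Transpose

namespace HopfQuiver
variable {k G X : Type*} [Field k] [Group G] [Fintype G] [DecidableEq G] [Finite X]
  {Q : HopfQuiver G X} {D : HopfBimodule k (FunAlg k G) (X →₀ k)}

theorem IsArrowModule.actL_apply (hD : Q.IsArrowModule D) (q : FunAlg k G) (n : X →₀ k) (a : X) :
    D.actL q n a = FunAlg.ev (Q.t a) q * n a := by
  have e : Finsupp.lapply a ∘ₗ D.actL q =
      FunAlg.ev (Q.t a) q • (Finsupp.lapply a : (X →₀ k) →ₗ[k] k) :=
    Finsupp.lhom_ext' fun b => LinearMap.ext_ring (by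
      by_cases h : b = a
      · subst h; simp [hD.1]
      · simp [hD.1, Finsupp.single_eq_of_ne (Ne.symm h)])
  exact LinearMap.congr_fun e n

theorem IsArrowModule.actR_apply (hD : Q.IsArrowModule D) (q : FunAlg k G) (n : X →₀ k) (a : X) :
    D.actR q n a = FunAlg.ev (Q.s a) q * n a := by
  have e : Finsupp.lapply a ∘ₗ D.actR q =
      FunAlg.ev (Q.s a) q • (Finsupp.lapply a : (X →₀ k) →ₗ[k] k) :=
    Finsupp.lhom_ext' fun b => LinearMap.ext_ring (by
      by_cases h : b = a
      · subst h; simp [hD.2]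
      · simp [hD.2, Finsupp.single_eq_of_ne (Ne.symm h)])
  exact LinearMap.congr_fun e n

theorem eq_of_ev_mul {x y : G} {c : k} (hc : c ≠ 0)
    (h : ∀ q : FunAlg k G, FunAlg.ev x q * c = FunAlg.ev y q * c) : x = y := by
  by_contra hne
  have := h (FunAlg.p k x)
  rw [FunAlg.ev_p, FunAlg.ev_p, if_pos rfl, if_neg (Ne.symm hne)] at this
  simp [hc] at this

/-- The actions of `G` on the span of the arrows transposed to the coactions of an arrow module. -/
def predual (hD : Q.IsArrowModule D) : ArrowActions k Q.s Q.t where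
  L g := finsuppTr (D.coL g)
  R g := finsuppTr (D.coR g)
  L_one m := finsuppDual_ext fun y => by rw [finsuppDual_tr, D.coL_one]
  L_mul g h m := finsuppDual_ext fun y => by
    rw [finsuppDual_tr, finsuppDual_tr, finsuppDual_tr, D.coL_coL]
  R_one m := finsuppDual_ext fun y => by rw [finsuppDual_tr, D.coR_one]
  R_mul g h m := finsuppDual_ext fun y => by
    rw [finsuppDual_tr, finsuppDual_tr, finsuppDual_tr, D.coR_coR]
  comm g h m := finsuppDual_ext fun y => by
    rw [finsuppDual_tr, finsuppDual_tr, finsuppDual_tr, finsuppDual_tr, D.coL_coR]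
  L_deg g a := by
    rw [Finsupp.mem_supported]
    intro b hb
    have hb : D.coL g (Finsupp.single b 1) a ≠ 0 := by
      rw [← finsuppTr_single_apply]
      exact Finsupp.mem_support_iff.1 hb
    refine ⟨eq_of_ev_mul hb fun q => ?_, eq_of_ev_mul hb fun q => ?_⟩
    · have := DFunLike.congr_fun (D.coL_actL g q (Finsupp.single b 1)) a
      rw [hD.1, map_smul, hD.actL_apply] at this
      exact this
    · have := DFunLike.congr_fun (D.coL_actR g q (Finsupp.single b 1)) a
      rw [hD.2, map_smul, hD.actR_apply] at this
      exact this
  R_deg g a := by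
    rw [Finsupp.mem_supported]
    intro b hb
    have hb : D.coR g (Finsupp.single b 1) a ≠ 0 := by
      rw [← finsuppTr_single_apply]
      exact Finsupp.mem_support_iff.1 hb
    refine ⟨eq_of_ev_mul hb fun q => ?_, eq_of_ev_mul hb fun q => ?_⟩
    · have := DFunLike.congr_fun (D.coR_actL g q (Finsupp.single b 1)) a
      rw [hD.1, map_smul, hD.actL_apply] at this
      exact this
    · have := DFunLike.congr_fun (D.coR_actR g q (Finsupp.single b 1)) a
      rw [hD.2, map_smul, hD.actR_apply] at this
      exact this

theorem funIsoAlong_predual (hD : Q.IsArrowModule D) :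
    HopfBimodule.FunIsoAlong (MulEquiv.refl G) D (predual hD).hopfBimodule.dual := by
  refine ⟨finsuppDual k X, fun g m => ?_, fun g m => ?_, fun g m => ?_, fun g m => ?_⟩
  · rw [HopfBimodule.dual_actL_p]
    refine Finsupp.lhom_ext' fun a => LinearMap.ext_ring ?_
    simp only [LinearMap.comp_apply, Finsupp.lsingle_apply, MulEquiv.refl_apply]
    rw [finsuppDual_apply_single, hD.actL_apply, ArrowActions.PL_single, FunAlg.ev_p]
    split_ifs <;> simp [finsuppDual_apply_single]
  · rw [HopfBimodule.dual_actR_p]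
    refine Finsupp.lhom_ext' fun a => LinearMap.ext_ring ?_
    simp only [LinearMap.comp_apply, Finsupp.lsingle_apply, MulEquiv.refl_apply]
    rw [finsuppDual_apply_single, hD.actR_apply, ArrowActions.PR_single, FunAlg.ev_p]
    split_ifs <;> simp [finsuppDual_apply_single]
  · rw [HopfBimodule.evL_dual_coactL]
    refine LinearMap.ext fun x => ?_
    have e : (predual hD).hopfBimodule.actL (gr k g) = finsuppTr (D.coL g) := gl_gr _ g
    rw [LinearMap.comp_apply, MulEquiv.refl_apply, e, finsuppDual_comm m, finsuppDual_tr,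
      finsuppDual_comm]
    rfl
  · rw [HopfBimodule.evR_dual_coactR]
    refine LinearMap.ext fun x => ?_
    have e : (predual hD).hopfBimodule.actR (gr k g) = finsuppTr (D.coR g) := gl_gr _ g
    rw [LinearMap.comp_apply, MulEquiv.refl_apply, e, finsuppDual_comm m, finsuppDual_tr,
      finsuppDual_comm]
    rfl

end HopfQuiver

namespace RSR
variable {k : Type u} {G : Type v} [Field k] [Group G] [Finite G] {S : RSR.{u, v, w} k G}

theorem IsFinite.finite_arrow (hS : S.IsFinite) : Finite S.Arrow := by
  have : ∀ C, Finite (S.I C) := hS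
  have : Finite (ConjClasses G) := Finite.of_surjective _ ConjClasses.mk_surjective
  infer_instance

theorem isFinite_of_finite_arrow [Finite S.Arrow] : S.IsFinite := fun C => by
  refine Finite.of_injective (β := S.Arrow) (fun i => ⟨C, basePair S C, i,
    ⟨0, Nat.pos_of_ne_zero (irreducible_dim_ne_zero (S.ρ C i) (S.irreducible C i))⟩⟩) ?_
  intro i j h
  simp only [Sigma.mk.injEq, heq_eq_eq, Prod.mk.injEq, true_and] at h
  exact h.1

theorem isFinite_of_equiv {M : Type*} [AddCommGroup M] [Module k M] [Module.Finite k M]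
    (e : M ≃ₗ[k] (S.Arrow →₀ k)) : S.IsFinite := by
  have := Module.Finite.equiv e
  have : Finite S.Arrow := Module.Finite.finite_basis (Finsupp.basisSingleOne (R := k))
  exact isFinite_of_finite_arrow

end RSR

section GradedProjection
variable {k A : Type*} [Field k] [AddCommGroup A] [Module k A] {𝒜 : ℕ → Submodule k A}
  (h𝒜 : DirectSum.IsInternal 𝒜)

/-- The external direct sum of the components. -/
def gradeEquiv : DirectSum ℕ (fun i => 𝒜 i) ≃ₗ[k] A :=
  LinearEquiv.ofBijective (DirectSum.coeLinearMap 𝒜) (id h𝒜)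

theorem gradeEquiv_lof (n : ℕ) (a : 𝒜 n) :
    gradeEquiv h𝒜 (DirectSum.lof k ℕ (fun i => 𝒜 i) n a) = a := DirectSum.coeLinearMap_lof 𝒜 n a

/-- The projection onto the component of degree `n`. -/
def gradeProj (n : ℕ) : A →ₗ[k] A :=
  (𝒜 n).subtype ∘ₗ DirectSum.component k ℕ (fun i => 𝒜 i) n ∘ₗ
    (gradeEquiv h𝒜).symm.toLinearMap

theorem gradeProj_mem (n : ℕ) (a : A) : gradeProj h𝒜 n a ∈ 𝒜 n := Submodule.coe_mem _

theorem gradeProj_of_mem {m : ℕ} {a : A} (ha : a ∈ 𝒜 m) (n : ℕ) :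
    gradeProj h𝒜 n a = if m = n then a else 0 := by
  have e : (gradeEquiv h𝒜).symm a =
      DirectSum.lof k ℕ (fun i => 𝒜 i) m ⟨a, ha⟩ := by
    rw [LinearEquiv.symm_apply_eq]
    exact (gradeEquiv_lof h𝒜 m ⟨a, ha⟩).symm
  rw [gradeProj, LinearMap.comp_apply, LinearMap.comp_apply, LinearEquiv.coe_coe, e]
  by_cases h : m = n
  · subst h; simp
  · rw [if_neg h]
    simp [DirectSum.component.of, h]

theorem gradeProj_self {n : ℕ} {a : A} (ha : a ∈ 𝒜 n) : gradeProj h𝒜 n a = a := by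
  rw [gradeProj_of_mem h𝒜 ha, if_pos rfl]

theorem gradeProj_ne {m n : ℕ} {a : A} (ha : a ∈ 𝒜 m) (h : m ≠ n) : gradeProj h𝒜 n a = 0 := by
  rw [gradeProj_of_mem h𝒜 ha, if_neg h]

theorem eq_of_gradeProj {a b : A} (h : ∀ n, gradeProj h𝒜 n a = gradeProj h𝒜 n b) : a = b :=
  (gradeEquiv h𝒜).symm.injective
    (DirectSum.ext fun n => Subtype.ext (h n))

theorem IsInternal_induction (h𝒜 : DirectSum.IsInternal 𝒜) {p : A → Prop}
    (hom : ∀ n, ∀ a ∈ 𝒜 n, p a) (hadd : ∀ a b, p a → p b → p (a + b)) (a : A) : p a :=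
  Submodule.iSup_induction 𝒜 (motive := p)
    (by rw [h𝒜.submodule_iSup_eq_top]; exact Submodule.mem_top) hom (hom 0 0 (zero_mem _)) hadd

theorem mem_antidiagonal_tens_induction {n : ℕ} {p : A ⊗[k] A → Prop} (h0 : p 0)
    (hadd : ∀ a b, p a → p b → p (a + b))
    (ht : ∀ i j, i + j = n → ∀ a ∈ 𝒜 i, ∀ b ∈ 𝒜 j, p (a ⊗ₜ b)) {z : A ⊗[k] A}
    (hz : z ∈ ⨆ q ∈ Finset.HasAntidiagonal.antidiagonal n, tens (𝒜 q.1) (𝒜 q.2)) : p z :=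
  Submodule.iSup_induction _ (motive := p) hz (fun q _ hx =>
    Submodule.iSup_induction _ (motive := p) hx (fun hq _ hy =>
      tens_induction (P := p) h0 hadd (ht q.1 q.2 (Finset.HasAntidiagonal.mem_antidiagonal.1 hq)) hy) h0 hadd)
    h0 hadd

theorem sum_antidiagonal_gradeProj {n : ℕ} {z : A ⊗[k] A}
    (hz : z ∈ ⨆ q ∈ Finset.HasAntidiagonal.antidiagonal n, tens (𝒜 q.1) (𝒜 q.2)) :
    ∑ q ∈ Finset.HasAntidiagonal.antidiagonal n,
      TensorProduct.map (gradeProj h𝒜 q.1) (gradeProj h𝒜 q.2) z = z := by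
  refine mem_antidiagonal_tens_induction (p := fun z => ∑ q ∈ Finset.HasAntidiagonal.antidiagonal n,
    TensorProduct.map (gradeProj h𝒜 q.1) (gradeProj h𝒜 q.2) z = z) (by simp)
    (fun a b ha hb => by simp only [map_add, Finset.sum_add_distrib, ha, hb])
    (fun i j hij a ha b hb => ?_) hz
  rw [Finset.sum_eq_single (i, j)]
  · rw [TensorProduct.map_tmul, gradeProj_self h𝒜 ha, gradeProj_self h𝒜 hb]
  · rintro ⟨p, q⟩ _ hne
    rw [TensorProduct.map_tmul]
    by_cases hp : i = p
    · have hq : j ≠ q := fun hq => hne (by rw [hp, hq])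
      rw [gradeProj_ne h𝒜 hb hq, TensorProduct.tmul_zero]
    · rw [gradeProj_ne h𝒜 ha hp, TensorProduct.zero_tmul]
  · intro h
    exact absurd (Finset.HasAntidiagonal.mem_antidiagonal.2 hij) h

theorem lTensor_gradeProj {n p q : ℕ} (hpq : p + q = n) {z : A ⊗[k] A}
    (hz : z ∈ ⨆ q ∈ Finset.HasAntidiagonal.antidiagonal n, tens (𝒜 q.1) (𝒜 q.2)) :
    (gradeProj h𝒜 q).lTensor A z = TensorProduct.map (gradeProj h𝒜 p) (gradeProj h𝒜 q) z := by
  refine mem_antidiagonal_tens_induction (p := fun z => (gradeProj h𝒜 q).lTensor A z =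
    TensorProduct.map (gradeProj h𝒜 p) (gradeProj h𝒜 q) z) (by simp)
    (fun a b ha hb => by simp only [map_add, ha, hb]) (fun i j hij a ha b hb => ?_) hz
  rw [TensorProduct.map_tmul, LinearMap.lTensor_tmul]
  by_cases hq : j = q
  · rw [gradeProj_of_mem h𝒜 ha, if_pos (by omega)]
  · rw [gradeProj_ne h𝒜 hb hq, TensorProduct.tmul_zero, TensorProduct.tmul_zero]

end GradedProjection

namespace YDModule
variable {k G V : Type*} [Field k] [Group G] [AddCommGroup V] [Module k V] [DecidableEq G]
  [Fintype G]

theorem braid_tmul (Y : YDModule k G V) (v w : V) :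
    Y.braid (v ⊗ₜ w) = ∑ g, Y.act (gr k g) w ⊗ₜ Y.P g v := by
  simp only [braid, LinearMap.comp_apply, LinearMap.rTensor_tmul, Y.coact_eq v,
    TensorProduct.sum_tmul, map_sum, LinearEquiv.coe_coe, TensorProduct.rightComm_tmul,
    TensorProduct.lift.tmul]

theorem coact₂_tmul (Y : YDModule k G V) (v w : V) :
    Y.coact₂ (v ⊗ₜ w) = ∑ g, ∑ h, gr k (g * h) ⊗ₜ (Y.P g v ⊗ₜ Y.P h w) := by
  simp only [coact₂, LinearMap.comp_apply, TensorProduct.map_tmul, Y.coact_eq,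
    TensorProduct.sum_tmul, TensorProduct.tmul_sum, map_sum, LinearEquiv.coe_coe,
    TensorProduct.tensorTensorTensorComm_tmul, LinearMap.rTensor_tmul, LinearMap.mul'_apply,
    gr_mul]
  exact Finset.sum_comm

end YDModule

theorem braidedMul_tmul {k G R : Type*} [Field k] [Group G] [DecidableEq G] [Fintype G] [Ring R]
    [Algebra k R] (Y : YDModule k G R) (a b c d : R) :
    braidedMul Y ((a ⊗ₜ b) ⊗ₜ (c ⊗ₜ d)) = ∑ g, (a * Y.act (gr k g) c) ⊗ₜ (Y.P g b * d) := by
  simp only [braidedMul, LinearMap.comp_apply, LinearEquiv.coe_coe, TensorProduct.assoc_symm_tmul,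
    LinearMap.rTensor_tmul, TensorProduct.assoc_tmul, LinearMap.lTensor_tmul, Y.braid_tmul,
    TensorProduct.tmul_sum, TensorProduct.sum_tmul, map_sum, TensorProduct.map_tmul,
    LinearMap.mul'_apply]

namespace GradedBraidedHopf
variable {k G R : Type*} [Field k] [Group G] [Fintype G] [DecidableEq G] [Ring R] [Algebra k R]
  [Coalgebra k R] (A : GradedBraidedHopf k G R)

/-- The component `(pr₁ ⊗ id) Δ` of the comultiplication. -/
def dLeft : R →ₗ[k] R ⊗[k] R := (gradeProj A.isInternal 1).rTensor R ∘ₗ Coalgebra.comul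

theorem P_mem (n : ℕ) (g : G) {a : R} (ha : a ∈ A.grade n) : A.yd.P g a ∈ A.grade n :=
  tens_induction (P := fun t => cfL g t ∈ A.grade n) (by simp)
    (fun x y hx hy => by rw [map_add]; exact add_mem hx hy)
    (fun v _ w hw => gr_induction (P := fun v => cfL g (v ⊗ₜ[k] w) ∈ A.grade n) (by simp)
      (fun x y hx hy => by rw [TensorProduct.add_tmul, map_add]; exact add_mem hx hy)
      (fun c x hx => by
        rw [← TensorProduct.smul_tmul', map_smul]; exact Submodule.smul_mem _ c hx)
      (fun h => by rw [cfL_tmul]; split_ifs <;> simp [hw]) v) (A.coact_mem n a ha)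

theorem gradeProj_act (n : ℕ) (g : G) (a : R) :
    gradeProj A.isInternal n (A.yd.act (gr k g) a) =
      A.yd.act (gr k g) (gradeProj A.isInternal n a) := by
  refine IsInternal_induction A.isInternal (p := fun a =>
    gradeProj A.isInternal n (A.yd.act (gr k g) a) =
      A.yd.act (gr k g) (gradeProj A.isInternal n a)) (fun m a ha => ?_)
    (fun a b ha hb => by simp only [map_add, ha, hb]) a
  rw [gradeProj_of_mem _ ha, gradeProj_of_mem _ (A.act_mem m _ a ha), apply_ite (A.yd.act _),
    map_zero]

theorem P_one (g : G) : A.yd.P g 1 = if 1 = g then 1 else 0 := by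
  rw [YDModule.P, LinearMap.comp_apply, A.coact_one, Algebra.TensorProduct.one_def, ← gr_one,
    cfL_tmul]

theorem lTensor_gradeProj_dLeft (n : ℕ) (a : R) : (gradeProj A.isInternal n).lTensor R (A.dLeft a) =
    A.dLeft (gradeProj A.isInternal (n + 1) a) := by
  refine IsInternal_induction A.isInternal (p := fun a => (gradeProj A.isInternal n).lTensor R
    (A.dLeft a) = A.dLeft (gradeProj A.isInternal (n + 1) a)) (fun m a ha => ?_)
    (fun a b ha hb => by simp only [map_add, ha, hb]) a
  rw [gradeProj_of_mem _ ha, apply_ite A.dLeft, map_zero]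
  change (gradeProj A.isInternal n).lTensor R ((gradeProj A.isInternal 1).rTensor R
    (Coalgebra.comul (R := k) a)) = if m = n + 1 then (gradeProj A.isInternal 1).rTensor R
    (Coalgebra.comul (R := k) a) else 0
  refine mem_antidiagonal_tens_induction (p := fun z =>
    (gradeProj A.isInternal n).lTensor R ((gradeProj A.isInternal 1).rTensor R z) =
    if m = n + 1 then (gradeProj A.isInternal 1).rTensor R z else 0) (by simp)
    (fun a b ha hb => by
      simp only [map_add, ha, hb]
      split_ifs <;> simp) (fun i j hij a ha b hb => ?_) (A.comul_mem m a ha)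
  rw [LinearMap.rTensor_tmul, LinearMap.lTensor_tmul, gradeProj_of_mem _ ha,
    gradeProj_of_mem _ hb]
  by_cases hi : i = 1
  · rw [if_pos hi]
    by_cases hj : j = n
    · rw [if_pos hj, if_pos (by omega)]
    · rw [if_neg hj, if_neg (by omega), TensorProduct.tmul_zero]
  · rw [if_neg hi, TensorProduct.zero_tmul, TensorProduct.zero_tmul, ite_self]

variable {A}

theorem IsNichols.gradeProj_zero (hA : A.IsNichols) :
    gradeProj A.isInternal 0 = Algebra.linearMap k R ∘ₗ Coalgebra.counit := by
  refine LinearMap.ext fun a => IsInternal_induction A.isInternal (p := fun a =>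
    gradeProj A.isInternal 0 a = (Algebra.linearMap k R ∘ₗ Coalgebra.counit) a) (fun n a ha => ?_)
    (fun a b ha hb => by simp only [map_add, ha, hb]) a
  rw [gradeProj_of_mem _ ha, LinearMap.comp_apply]
  by_cases hn : n = 0
  · subst hn
    rw [hA.1] at ha
    obtain ⟨c, rfl⟩ := Submodule.mem_span_singleton.1 ha
    rw [if_pos rfl, map_smul, A.counit_one, smul_eq_mul, mul_one, Algebra.linearMap_apply,
      Algebra.algebraMap_eq_smul_one]
  · rw [if_neg hn, A.counit_eq_zero n hn a ha, map_zero]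

theorem IsNichols.gradeProj_mul (hA : A.IsNichols) {v : R} (hv : v ∈ A.grade 1) (a : R) :
    gradeProj A.isInternal 1 (v * a) = Coalgebra.counit (R := k) a • v := by
  refine IsInternal_induction A.isInternal (p := fun a =>
    gradeProj A.isInternal 1 (v * a) = Coalgebra.counit (R := k) a • v) (fun n a ha => ?_)
    (fun a b ha hb => by simp only [map_add, mul_add, add_smul, ha, hb]) a
  rw [gradeProj_of_mem _ (A.mul_mem 1 n v hv a ha)]
  by_cases hn : n = 0
  · subst hn
    rw [hA.1] at ha
    obtain ⟨c, rfl⟩ := Submodule.mem_span_singleton.1 ha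
    simp [A.counit_one]
  · rw [if_neg (by omega), A.counit_eq_zero n hn a ha, zero_smul]

theorem rTensor_dLeft_comul (a : R) (ha : A.dLeft a = 0) :
    A.dLeft.rTensor R (Coalgebra.comul (R := k) a) = 0 := by
  apply (TensorProduct.assoc k R R R).injective
  rw [dLeft, LinearMap.rTensor_comp_apply, nat1, Coalgebra.coassoc_apply, lr_comm]
  change (Coalgebra.comul (R := k)).lTensor R (A.dLeft a) = _
  rw [ha, map_zero, map_zero]

theorem map_counit_comul {W : Type*} [AddCommGroup W] [Module k W] (f : R →ₗ[k] W) (a : R) :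
    TensorProduct.map f (Algebra.linearMap k R ∘ₗ Coalgebra.counit) (Coalgebra.comul (R := k) a) =
      f a ⊗ₜ 1 := by
  have := congrArg (TensorProduct.map f (Algebra.linearMap k R))
    (Coalgebra.lTensor_counit_comul (R := k) a)
  rw [TensorProduct.map_tmul, ← LinearMap.comp_apply, LinearMap.map_comp_lTensor] at this
  simpa using this

theorem map_counit_comul' {W : Type*} [AddCommGroup W] [Module k W] (f : R →ₗ[k] W) (a : R) :
    TensorProduct.map (Algebra.linearMap k R ∘ₗ Coalgebra.counit) f (Coalgebra.comul (R := k) a) =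
      1 ⊗ₜ f a := by
  have := congrArg (TensorProduct.map (Algebra.linearMap k R) f)
    (Coalgebra.rTensor_counit_comul (R := k) a)
  rw [TensorProduct.map_tmul, ← LinearMap.comp_apply, LinearMap.map_comp_rTensor] at this
  simpa using this

theorem tmul_one_injective (A : GradedBraidedHopf k G R) {a : R} (h : a ⊗ₜ[k] (1 : R) = 0) : a = 0 := by
  have := congrArg (TensorProduct.rid k R ∘ (Coalgebra.counit (R := k) (A := R)).lTensor R) h
  simpa [A.counit_one] using this

theorem IsNichols.eq_zero_of_dLeft (hA : A.IsNichols) (n : ℕ) (hn : n ≠ 0) {a : R}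
    (ha : a ∈ A.grade n) (h : A.dLeft a = 0) : a = 0 := by
  induction n using Nat.strong_induction_on generalizing a with
  | _ n ih =>
    have hz := A.comul_mem n a ha
    have key : ∀ p q, p + q = n → p ≠ 0 → q ≠ 0 → TensorProduct.map (gradeProj A.isInternal p)
        (gradeProj A.isInternal q) (Coalgebra.comul (R := k) a) = 0 := by
      intro p q hpq hp hq
      have hmem : TensorProduct.map (gradeProj A.isInternal p) (gradeProj A.isInternal q)
          (Coalgebra.comul (R := k) a) ∈ tens (A.grade p) (A.grade q) :=
        map_mem_tens _ _ (fun _ _ => gradeProj_mem _ _ _) (fun _ _ => gradeProj_mem _ _ _)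
          (mem_tens_top _)
      have h0 := tens_ker_right A.dLeft hmem (by
        rw [← lTensor_gradeProj A.isInternal hpq hz, lr_comm, rTensor_dLeft_comul a h, map_zero])
      refine tens_induction (P := fun t => t = 0) rfl (fun x y hx hy => by rw [hx, hy, add_zero])
        (fun v hv w _ => ?_) h0
      rw [ih p (by omega) hp hv.1 hv.2, TensorProduct.zero_tmul]
    have e := sum_antidiagonal_gradeProj A.isInternal hz
    rw [Finset.sum_eq_add (n, 0) (0, n) (by simp [hn]) (fun q hq hne => by
        rw [Finset.HasAntidiagonal.mem_antidiagonal] at hq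
        refine key _ _ hq (fun h => hne.2 ?_) (fun h => hne.1 ?_)
        · exact Prod.ext h (by rw [← hq, h, zero_add])
        · exact Prod.ext (by rw [← hq, h, add_zero]) h) (by simp) (by simp)] at e
    rw [hA.gradeProj_zero, map_counit_comul, map_counit_comul', gradeProj_self _ ha] at e
    have h1 : a ∈ A.grade 1 := (hA.2.1 a).1 e.symm
    refine tmul_one_injective A (Eq.trans ?_ h)
    rw [dLeft, LinearMap.comp_apply, ← e, map_add, LinearMap.rTensor_tmul, LinearMap.rTensor_tmul,
      gradeProj_self _ h1, gradeProj_ne _ A.one_mem (by simp), TensorProduct.zero_tmul, add_zero]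

/-- In a Nichols algebra, `(pr₁ ⊗ id) Δ` vanishes only on the scalars. -/
theorem IsNichols.eq_counit_of_dLeft (hA : A.IsNichols) {a : R} (h : A.dLeft a = 0) :
    a = algebraMap k R (Coalgebra.counit (R := k) a) := by
  have e := LinearMap.congr_fun hA.gradeProj_zero a
  refine Eq.trans ?_ e
  refine eq_of_gradeProj A.isInternal fun n => ?_
  rw [gradeProj_of_mem _ (gradeProj_mem A.isInternal 0 a)]
  rcases n with _ | n
  · rw [if_pos rfl]
  · rw [if_neg (by simp)]
    refine hA.eq_zero_of_dLeft (n + 1) (by simp) (gradeProj_mem _ _ _) ?_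
    rw [← lTensor_gradeProj_dLeft, h, map_zero]

end GradedBraidedHopf

theorem TensorAlgebra_left_induction {k V : Type*} [Field k] [AddCommGroup V] [Module k V]
    {p : TensorAlgebra k V → Prop} (h1 : p 1) (hadd : ∀ s t, p s → p t → p (s + t))
    (hsmul : ∀ (c : k) t, p t → p (c • t)) (hι : ∀ v t, p t → p (TensorAlgebra.ι k v * t))
    (t : TensorAlgebra k V) : p t := by
  have : ∀ s, p s → p (t * s) := by
    induction t using TensorAlgebra.induction with
    | algebraMap c => intro s hs; rw [← Algebra.smul_def]; exact hsmul c s hs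
    | ι v => exact hι v
    | mul a b ha hb => intro s hs; rw [mul_assoc]; exact ha _ (hb _ hs)
    | add a b ha hb => intro s hs; rw [add_mul]; exact hadd _ _ (ha s hs) (hb s hs)
  rw [← mul_one t]
  exact this 1 h1

namespace YDModule
variable {k G V : Type*} [Field k] [Group G] [Fintype G] [DecidableEq G] [AddCommGroup V]
  [Module k V] (Y : YDModule k G V)

/-- The operator `w ⊗ t ↦ v₍₋₁₎ · w ⊗ v₍₀₎ t` on `V ⊗ T(V)`. -/
def braidedMulLeft : V →ₗ[k] V ⊗[k] TensorAlgebra k V →ₗ[k] V ⊗[k] TensorAlgebra k V :=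
  ∑ g, TensorProduct.mapBilinear (.id k) V (TensorAlgebra k V) V (TensorAlgebra k V) (Y.act (gr k g)) ∘ₗ
    LinearMap.mul k (TensorAlgebra k V) ∘ₗ TensorAlgebra.ι k ∘ₗ Y.P g

theorem braidedMulLeft_apply (v : V) (s : V ⊗[k] TensorAlgebra k V) : Y.braidedMulLeft v s =
    ∑ g, TensorProduct.map (Y.act (gr k g))
      (LinearMap.mulLeft k (TensorAlgebra.ι k (Y.P g v))) s := by
  simp only [braidedMulLeft, LinearMap.sum_apply]
  rfl

/-- One step of the recursion for `skewDeriv`. -/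
def skewStep : V →ₗ[k] Module.End k (TensorAlgebra k V × V ⊗[k] TensorAlgebra k V) :=
  LinearMap.mk₂ k (fun v p => (TensorAlgebra.ι k v * p.1, v ⊗ₜ p.1 + Y.braidedMulLeft v p.2))
    (fun v w p => Prod.ext (by simp [add_mul]) (by
      simp only [map_add, LinearMap.add_apply, TensorProduct.add_tmul, Prod.snd_add]; abel))
    (fun c v p => Prod.ext (by simp) (by
      simp only [map_smul, LinearMap.smul_apply, Prod.smul_snd, smul_add,
        TensorProduct.smul_tmul']))
    (fun v p q => Prod.ext (by simp [mul_add]) (by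
      simp only [map_add, TensorProduct.tmul_add, Prod.snd_add, Prod.fst_add]; abel))
    (fun c v p => Prod.ext (by simp) (by
      simp only [map_smul, Prod.smul_snd, Prod.smul_fst, smul_add, TensorProduct.tmul_smul]))

/-- The component `T(V) → V ⊗ T(V)` of the braided comultiplication of the tensor algebra. -/
def skewDeriv : TensorAlgebra k V →ₗ[k] V ⊗[k] TensorAlgebra k V :=
  LinearMap.snd k _ _ ∘ₗ LinearMap.applyₗ (1, 0) ∘ₗ (TensorAlgebra.lift k Y.skewStep).toLinearMap

theorem skewDeriv_one : Y.skewDeriv 1 = 0 := by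
  simp [skewDeriv]

theorem fst_lift_skewStep (t : TensorAlgebra k V) :
    (TensorAlgebra.lift k Y.skewStep t (1, 0)).1 = t :=
  TensorAlgebra_left_induction (p := fun t => (TensorAlgebra.lift k Y.skewStep t (1, 0)).1 = t)
    (by simp) (fun s t hs ht => by simp only [map_add, LinearMap.add_apply, Prod.fst_add, hs, ht])
    (fun c t ht => by simp only [map_smul, LinearMap.smul_apply, Prod.smul_fst, ht])
    (fun v t ht => by
      rw [map_mul, TensorAlgebra.lift_ι_apply, Module.End.mul_apply]
      exact congrArg (TensorAlgebra.ι k v * ·) ht) t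

theorem skewDeriv_ι_mul (v : V) (t : TensorAlgebra k V) :
    Y.skewDeriv (TensorAlgebra.ι k v * t) = v ⊗ₜ t + Y.braidedMulLeft v (Y.skewDeriv t) := by
  refine Eq.trans (b := (TensorAlgebra.lift k Y.skewStep (TensorAlgebra.ι k v * t) (1, 0)).2) rfl ?_
  rw [map_mul, TensorAlgebra.lift_ι_apply, Module.End.mul_apply]
  exact congrArg (fun s => v ⊗ₜ[k] s + Y.braidedMulLeft v (Y.skewDeriv t))
    (Y.fst_lift_skewStep t)

/-- Elements of the tensor algebra of degree at most `1`. -/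
def tensorFil (k V : Type*) [Field k] [AddCommGroup V] [Module k V] :
    Submodule k (TensorAlgebra k V) :=
  1 ⊔ LinearMap.range (TensorAlgebra.ι k (M := V))

theorem one_le_tensorFil : (1 : Submodule k (TensorAlgebra k V)) ≤ tensorFil k V := le_sup_left

theorem ι_mem_tensorFil (v : V) : TensorAlgebra.ι k v ∈ tensorFil k V :=
  le_sup_right (a := (1 : Submodule k (TensorAlgebra k V))) (LinearMap.mem_range_self _ v)

theorem tensorFil_pow_mono {m n : ℕ} (h : m ≤ n) : tensorFil k V ^ m ≤ tensorFil k V ^ n :=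
  pow_le_pow_right₀ one_le_tensorFil h

theorem exists_mem_tensorFil_pow (t : TensorAlgebra k V) : ∃ n, t ∈ tensorFil k V ^ n :=
  TensorAlgebra_left_induction (p := fun t => ∃ n, t ∈ tensorFil k V ^ n)
    ⟨0, by rw [pow_zero]; exact Submodule.one_le.1 le_rfl⟩
    (fun _ _ ⟨m, hs⟩ ⟨n, ht⟩ => ⟨max m n, add_mem (tensorFil_pow_mono (le_max_left m n) hs)
      (tensorFil_pow_mono (le_max_right m n) ht)⟩)
    (fun c _ ⟨n, ht⟩ => ⟨n, Submodule.smul_mem _ c ht⟩)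
    (fun v t ⟨n, ht⟩ => ⟨n + 1, by
      rw [pow_succ']; exact Submodule.mul_mem_mul (ι_mem_tensorFil v) ht⟩) t

theorem tensorFil_pow_succ_induction {n : ℕ} {p : TensorAlgebra k V → Prop}
    (hadd : ∀ s t, p s → p t → p (s + t)) (h : ∀ t ∈ tensorFil k V ^ n, p t)
    (hι : ∀ v, ∀ t ∈ tensorFil k V ^ n, p (TensorAlgebra.ι k v * t)) {t : TensorAlgebra k V}
    (ht : t ∈ tensorFil k V ^ (n + 1)) : p t := by
  rw [pow_succ'] at ht
  refine Submodule.mul_induction_on ht (fun w hw s hs => ?_) hadd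
  obtain ⟨a, ha, b, ⟨v, rfl⟩, rfl⟩ := Submodule.mem_sup.1 hw
  obtain ⟨c, rfl⟩ := Submodule.mem_one.1 ha
  rw [add_mul, ← Algebra.smul_def]
  exact hadd _ _ (h _ (Submodule.smul_mem _ c hs)) (hι v s hs)

theorem skewDeriv_mem (n : ℕ) {t : TensorAlgebra k V} (ht : t ∈ tensorFil k V ^ (n + 1)) :
    Y.skewDeriv t ∈ tens ⊤ (tensorFil k V ^ n) := by
  induction n generalizing t with
  | zero =>
    have h0 : ∀ t ∈ tensorFil k V ^ 0, Y.skewDeriv t = 0 := fun t ht => by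
      rw [pow_zero] at ht
      obtain ⟨c, rfl⟩ := Submodule.mem_one.1 ht
      rw [Algebra.algebraMap_eq_smul_one, map_smul, skewDeriv_one, smul_zero]
    refine tensorFil_pow_succ_induction
      (p := fun t => Y.skewDeriv t ∈ tens ⊤ (tensorFil k V ^ 0))
      (fun s t hs ht => by rw [map_add]; exact add_mem hs ht)
      (fun t ht => by rw [h0 t ht]; exact zero_mem _) (fun v t ht => ?_) ht
    rw [skewDeriv_ι_mul, h0 t ht, map_zero, add_zero]
    exact tmul_mem_tens trivial ht
  | succ n ih =>
    refine tensorFil_pow_succ_induction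
      (p := fun t => Y.skewDeriv t ∈ tens ⊤ (tensorFil k V ^ (n + 1)))
      (fun s t hs ht => by rw [map_add]; exact add_mem hs ht)
      (fun t ht => tens_mono le_rfl (tensorFil_pow_mono n.le_succ) (ih ht)) (fun v t ht => ?_) ht
    rw [skewDeriv_ι_mul, braidedMulLeft_apply]
    refine add_mem (tmul_mem_tens trivial ht) (Submodule.sum_mem _ fun g _ =>
      map_mem_tens _ _ (fun _ _ => Submodule.mem_top) (fun s hs => ?_) (ih ht))
    rw [LinearMap.mulLeft_apply, pow_succ']
    exact Submodule.mul_mem_mul (ι_mem_tensorFil _) hs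

end YDModule

namespace GradedBraidedHopf
variable {k G G' R V : Type*} [Field k] [Group G] [Fintype G] [DecidableEq G] [Group G']
  [Fintype G'] [DecidableEq G'] [Ring R] [Algebra k R] [Coalgebra k R] [AddCommGroup V]
  [Module k V] {Y : YDModule k G V} {A : GradedBraidedHopf k G' R} {f : G ≃* G'} {j : V →ₗ[k] R}

theorem counit_lift (hj : ∀ v, j v ∈ A.grade 1) (t : TensorAlgebra k V) :
    Coalgebra.counit (R := k) (TensorAlgebra.lift k j t) = TensorAlgebra.algebraMapInv t :=
  TensorAlgebra_left_induction (p := fun t => Coalgebra.counit (R := k)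
    (TensorAlgebra.lift k j t) = TensorAlgebra.algebraMapInv t) (by simp [A.counit_one])
    (fun s t hs ht => by simp only [map_add, hs, ht])
    (fun c t ht => by simp only [map_smul, ht])
    (fun v t _ => by
      rw [map_mul, TensorAlgebra.lift_ι_apply, A.counit_mul, A.counit_eq_zero 1 one_ne_zero _ (hj v),
        zero_mul, map_mul]
      simp [TensorAlgebra.algebraMapInv]) t

theorem comul_mul_of_mem_grade_one (hA : A.IsNichols) {v : R} (hv : v ∈ A.grade 1) (a : R) :
    Coalgebra.comul (R := k) (v * a) =
      (LinearMap.mulLeft k v).rTensor R (Coalgebra.comul (R := k) a) +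
        ∑ g, TensorProduct.map (A.yd.act (gr k g)) (LinearMap.mulLeft k (A.yd.P g v))
          (Coalgebra.comul (R := k) a) := by
  rw [A.comul_mul, (hA.2.1 v).2 hv]
  generalize Coalgebra.comul (R := k) a = z
  induction z using TensorProduct.induction_on with
  | zero => simp
  | add x y hx hy =>
    simp only [TensorProduct.tmul_add, map_add, hx, hy, Finset.sum_add_distrib]
    abel
  | tmul c d =>
    rw [TensorProduct.add_tmul, map_add, braidedMul_tmul, braidedMul_tmul]
    congr 1
    · simp only [P_one, ite_mul, one_mul, zero_mul, apply_ite (TensorProduct.tmul k _),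
        TensorProduct.tmul_zero, Finset.sum_ite_eq, Finset.mem_univ, if_true]
      rw [YDModule.act_gr_one]; rfl
    · simp only [one_mul]; rfl

theorem IsNichols.dLeft_mul (hA : A.IsNichols) {v : R} (hv : v ∈ A.grade 1) (a : R) :
    A.dLeft (v * a) = v ⊗ₜ a + ∑ g, TensorProduct.map (A.yd.act (gr k g))
      (LinearMap.mulLeft k (A.yd.P g v)) (A.dLeft a) := by
  rw [dLeft, LinearMap.comp_apply, comul_mul_of_mem_grade_one hA hv, map_add, map_sum]
  congr 1
  · have e := congrArg (TensorProduct.lid k R) (Coalgebra.rTensor_counit_comul (R := k) a)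
    rw [TensorProduct.lid_tmul, one_smul] at e
    conv_rhs => rw [← e]
    generalize Coalgebra.comul (R := k) a = z
    induction z using TensorProduct.induction_on with
    | zero => simp
    | add x y hx hy => simp only [map_add, TensorProduct.tmul_add, hx, hy]
    | tmul c d => simp [hA.gradeProj_mul hv, TensorProduct.smul_tmul]
  · refine Finset.sum_congr rfl fun g _ => ?_
    rw [LinearMap.comp_apply]
    generalize Coalgebra.comul (R := k) a = z
    induction z using TensorProduct.induction_on with
    | zero => simp
    | add x y hx hy => simp only [map_add, hx, hy]
    | tmul c d => simp [gradeProj_act]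

theorem IsNichols.dLeft_lift (hA : A.IsNichols) (hj : ∀ v, j v ∈ A.grade 1)
    (hact : ∀ g v, j (Y.act (gr k g) v) = A.yd.act (gr k (f g)) (j v))
    (hP : ∀ g v, j (Y.P g v) = A.yd.P (f g) (j v)) (t : TensorAlgebra k V) :
    A.dLeft (TensorAlgebra.lift k j t) =
      TensorProduct.map j (TensorAlgebra.lift k j).toLinearMap (Y.skewDeriv t) := by
  refine TensorAlgebra_left_induction (p := fun t => A.dLeft (TensorAlgebra.lift k j t) =
      TensorProduct.map j (TensorAlgebra.lift k j).toLinearMap (Y.skewDeriv t)) ?_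
    (fun s t hs ht => by simp only [map_add, hs, ht]) (fun c t ht => by simp only [map_smul, ht])
    (fun v t ht => ?_) t
  · rw [Y.skewDeriv_one, map_zero, map_one, dLeft, LinearMap.comp_apply, A.comul_one,
      Algebra.TensorProduct.one_def, LinearMap.rTensor_tmul, gradeProj_ne _ A.one_mem (by simp),
      TensorProduct.zero_tmul]
  · rw [map_mul, TensorAlgebra.lift_ι_apply, hA.dLeft_mul (hj v), Y.skewDeriv_ι_mul, map_add, ht,
      Y.braidedMulLeft_apply, map_sum]
    congr 1
    rw [← Equiv.sum_comp f.toEquiv]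
    refine Finset.sum_congr rfl fun g _ => ?_
    generalize Y.skewDeriv t = z
    induction z using TensorProduct.induction_on with
    | zero => simp
    | add x y hx hy => simp only [map_add, hx, hy]
    | tmul c d => simp [hact, hP]

variable {G'' R' : Type*} [Group G''] [Fintype G''] [DecidableEq G''] [Ring R'] [Algebra k R']
  [Coalgebra k R'] {A' : GradedBraidedHopf k G'' R'} {f' : G ≃* G''} {j' : V →ₗ[k] R'}

theorem IsNichols.lift_eq_zero (hA : A.IsNichols) (hj : ∀ v, j v ∈ A.grade 1)
    (hact : ∀ g v, j (Y.act (gr k g) v) = A.yd.act (gr k (f g)) (j v))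
    (hP : ∀ g v, j (Y.P g v) = A.yd.P (f g) (j v)) (hinj : Function.Injective j)
    (hA' : A'.IsNichols) (hj' : ∀ v, j' v ∈ A'.grade 1)
    (hact' : ∀ g v, j' (Y.act (gr k g) v) = A'.yd.act (gr k (f' g)) (j' v))
    (hP' : ∀ g v, j' (Y.P g v) = A'.yd.P (f' g) (j' v))
    (t : TensorAlgebra k V) (ht : TensorAlgebra.lift k j t = 0) :
    TensorAlgebra.lift k j' t = 0 := by
  have hε : ∀ t, TensorAlgebra.lift k j t = 0 → TensorAlgebra.algebraMapInv t = 0 := fun t ht => by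
    rw [← counit_lift hj, ht, map_zero]
  obtain ⟨n, hn⟩ := YDModule.exists_mem_tensorFil_pow t
  induction n generalizing t with
  | zero =>
    rw [pow_zero] at hn
    obtain ⟨c, rfl⟩ := Submodule.mem_one.1 hn
    have := hε _ ht
    rw [TensorAlgebra.algebraMap_leftInverse] at this
    rw [this, map_zero, map_zero]
  | succ n ih =>
    have h0 : TensorProduct.map j (TensorAlgebra.lift k j).toLinearMap (Y.skewDeriv t) = 0 := by
      rw [← hA.dLeft_lift hj hact hP, ht, map_zero]
    have h1 : (TensorAlgebra.lift k j).toLinearMap.lTensor V (Y.skewDeriv t) = 0 := by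
      apply Module.Flat.rTensor_preserves_injective_linearMap (M := R) j hinj
      rw [map_zero, ← h0, ← LinearMap.comp_apply, LinearMap.rTensor_comp_lTensor]
    have h2 := tens_ker_left _ (Y.skewDeriv_mem n hn) h1
    have h3 : TensorProduct.map j' (TensorAlgebra.lift k j').toLinearMap (Y.skewDeriv t) = 0 := by
      refine tens_induction (P := fun z =>
        TensorProduct.map j' (TensorAlgebra.lift k j').toLinearMap z = 0) (map_zero _)
        (fun x y hx hy => by rw [map_add, hx, hy, add_zero]) (fun v _ s hs => ?_) h2
      rw [TensorProduct.map_tmul, AlgHom.toLinearMap_apply, ih s hs.2 hs.1,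
        TensorProduct.tmul_zero]
    rw [← hA'.dLeft_lift hj' hact' hP'] at h3
    rw [hA'.eq_counit_of_dLeft h3, counit_lift hj', hε t ht, map_zero]

end GradedBraidedHopf

/-- Two surjective algebra maps with the same kernel have isomorphic targets. -/
theorem exists_algEquiv_of_ker {k T R R' : Type*} [Field k] [Ring T] [Algebra k T] [Ring R]
    [Algebra k R] [Ring R'] [Algebra k R'] (F : T →ₐ[k] R) (F' : T →ₐ[k] R')
    (hF : Function.Surjective F) (hF' : Function.Surjective F') (h : ∀ t, F t = 0 ↔ F' t = 0) :
    ∃ E : R ≃ₐ[k] R', ∀ t, E (F t) = F' t := by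
  have hE : ∀ s t, F s = F t → F' s = F' t := fun s t e => by
    rw [← sub_eq_zero, ← map_sub, h, map_sub, sub_eq_zero] at e; exact e
  have hE' : ∀ s t, F' s = F' t → F s = F t := fun s t e => by
    rw [← sub_eq_zero, ← map_sub, ← h, map_sub, sub_eq_zero] at e; exact e
  choose σ hσ using hF
  have e : ∀ t, F' (σ (F t)) = F' t := fun t => hE _ _ (hσ _)
  let E : R →ₐ[k] R' := AlgHom.ofLinearMap
    ⟨⟨fun r => F' (σ r), fun r s => by
        rw [← map_add]; exact hE _ _ (by rw [map_add, hσ, hσ, hσ])⟩,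
      fun c r => by
        rw [RingHom.id_apply, ← map_smul]; exact hE _ _ (by rw [map_smul, hσ, hσ])⟩
    ((hE _ _ (by rw [hσ, map_one])).trans (map_one F'))
    (fun r s => by
      refine Eq.trans ?_ (map_mul F' (σ r) (σ s))
      exact hE _ _ (by rw [map_mul, hσ, hσ, hσ]))
  refine ⟨AlgEquiv.ofBijective E ⟨fun r s hrs => ?_, fun r => ?_⟩, e⟩
  · have := hE' _ _ hrs
    rwa [hσ, hσ] at this
  · obtain ⟨t, rfl⟩ := hF' r
    exact ⟨F t, e t⟩

theorem map_braidedMul {k G G' R R' : Type*} [Field k] [Group G] [Fintype G] [DecidableEq G]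
    [Group G'] [Fintype G'] [DecidableEq G'] [Ring R] [Algebra k R] [Ring R'] [Algebra k R']
    {Y : YDModule k G R} {Y' : YDModule k G' R'} {f : G ≃* G'} (e : R →ₐ[k] R')
    (h : ∀ g a, e (Y.act (gr k g) a) = Y'.act (gr k (f g)) (e a))
    (h' : ∀ g a, e (Y.P g a) = Y'.P (f g) (e a)) (s t : R ⊗[k] R) :
    TensorProduct.map e.toLinearMap e.toLinearMap (braidedMul Y (s ⊗ₜ t)) =
      braidedMul Y' (TensorProduct.map e.toLinearMap e.toLinearMap s ⊗ₜ
        TensorProduct.map e.toLinearMap e.toLinearMap t) := by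
  refine tensor_induction₂ (P := fun s t => TensorProduct.map e.toLinearMap e.toLinearMap
    (braidedMul Y (s ⊗ₜ t)) = braidedMul Y' (TensorProduct.map e.toLinearMap e.toLinearMap s
      ⊗ₜ TensorProduct.map e.toLinearMap e.toLinearMap t)) (by simp) (by simp)
    (fun s s' t h h' => by simp only [TensorProduct.add_tmul, map_add, h, h'])
    (fun s t t' h h' => by simp only [TensorProduct.tmul_add, map_add, h, h'])
    (fun a b c d => ?_) s t
  rw [TensorProduct.map_tmul, TensorProduct.map_tmul, braidedMul_tmul, braidedMul_tmul, map_sum,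
    ← Equiv.sum_comp f.toEquiv]
  refine Finset.sum_congr rfl fun g _ => ?_
  rw [TensorProduct.map_tmul]
  simp [h, h']

namespace GradedBraidedHopf
variable {k G G' R R' : Type*} [Field k] [Group G] [Fintype G] [DecidableEq G] [Group G']
  [Fintype G'] [DecidableEq G'] [Ring R] [Algebra k R] [Coalgebra k R] [Ring R'] [Algebra k R']
  [Coalgebra k R'] {A : GradedBraidedHopf k G R} {A' : GradedBraidedHopf k G' R'}

variable (A) in
/-- The Yetter-Drinfeld module of elements of degree `1`. -/
def gradeOne : YDModule k G (A.grade 1) :=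
  A.yd.sub (A.grade 1) (fun g => A.act_mem 1 (gr k g)) (fun g _ => A.P_mem 1 g)

theorem isNicholsOf_iff {V : Type*} [AddCommGroup V] [Module k V] {Y : YDModule k G V} :
    A.IsNicholsOf Y ↔ A.IsNichols ∧ YDModule.IsoAlong (MulEquiv.refl G) Y A.gradeOne := by
  refine and_congr_right fun _ => exists_congr fun e => and_congr ⟨fun h g v => Subtype.ext ?_,
    fun h a v => ?_⟩ ⟨fun h g v => Subtype.ext ?_, fun h v => ext_cfL fun g => ?_⟩
  · rw [h]; exact (YDModule.sub_act ..).symm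
  · refine gr_induction (P := fun a => (e (Y.act a v) : R) = A.yd.act a (e v)) (by simp)
      (fun x y hx hy => by simp only [map_add, LinearMap.add_apply, Submodule.coe_add, hx, hy])
      (fun c x hx => by simp only [map_smul, LinearMap.smul_apply, Submodule.coe_smul, hx])
      (fun g => ?_) a
    rw [h]; exact YDModule.sub_act ..
  · refine Eq.trans ?_ (YDModule.sub_P ..).symm
    rw [YDModule.P, YDModule.P, LinearMap.comp_apply, LinearMap.comp_apply, h, cfL_lTensor]; rfl
  · rw [cfL_lTensor]
    have := congrArg Subtype.val (h g v)
    exact ((YDModule.sub_P ..).symm.trans this.symm)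

theorem IsNichols.induction (hA : A.IsNichols) {p : R → Prop} (h0 : ∀ c, p (algebraMap k R c))
    (h1 : ∀ v ∈ A.grade 1, p v) (hadd : ∀ a b, p a → p b → p (a + b))
    (hmul : ∀ a b, p a → p b → p (a * b)) (a : R) : p a :=
  Algebra.adjoin_induction (p := fun a _ => p a) h1 h0 (fun a b _ _ => hadd a b)
    (fun a b _ _ => hmul a b) (show a ∈ Algebra.adjoin k (A.grade 1 : Set R) by
      rw [hA.2.2]; exact Algebra.mem_top)

theorem grade_one_pow_le (n : ℕ) : A.grade 1 ^ n ≤ A.grade n := by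
  induction n with
  | zero => rw [pow_zero, Submodule.one_le]; exact A.one_mem
  | succ n ih =>
    rw [pow_succ, Submodule.mul_le]
    exact fun a ha b hb => A.mul_mem n 1 a (ih ha) b hb

theorem IsNichols.grade_eq_pow (hA : A.IsNichols) (n : ℕ) : A.grade n = A.grade 1 ^ n := by
  refine le_antisymm (fun a ha => ?_) (grade_one_pow_le n)
  have key : ∀ a : R, ∀ n, gradeProj A.isInternal n a ∈ A.grade 1 ^ n := by
    have : ∀ a ∈ ⨆ m, A.grade 1 ^ m, ∀ n, gradeProj A.isInternal n a ∈ A.grade 1 ^ n :=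
      fun a ha => Submodule.iSup_induction _
        (motive := fun a => ∀ n, gradeProj A.isInternal n a ∈ A.grade 1 ^ n) ha
        (fun m a ha n => by
          rw [gradeProj_of_mem _ (grade_one_pow_le m ha)]
          split_ifs with h
          · rw [← h]; exact ha
          · exact zero_mem _)
        (fun n => by rw [map_zero]; exact zero_mem _)
        (fun a b ha hb n => by rw [map_add]; exact add_mem (ha n) (hb n))
    refine fun a => this a ?_
    have hle : ∀ n, A.grade 1 ^ n ≤ ⨆ m, A.grade 1 ^ m := le_iSup (fun n => A.grade 1 ^ n)
    refine hA.induction (p := fun a => a ∈ ⨆ m, A.grade 1 ^ m) (fun c => hle 0 ?_)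
      (fun v hv => hle 1 (by rwa [pow_one])) (fun _ _ => add_mem) (fun a b ha hb => ?_) a
    · rw [pow_zero]; exact Submodule.mem_one.2 ⟨c, rfl⟩
    · have := Submodule.mul_mem_mul ha hb
      rw [Submodule.iSup_mul] at this
      refine Submodule.iSup_induction _ (motive := fun a => a ∈ ⨆ m, A.grade 1 ^ m) this
        (fun m x hx => ?_) (zero_mem _) (fun _ _ => add_mem)
      rw [Submodule.mul_iSup] at hx
      refine Submodule.iSup_induction _ (motive := fun a => a ∈ ⨆ m, A.grade 1 ^ m) hx
        (fun n y hy => ?_) (zero_mem _) (fun _ _ => add_mem)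
      rw [← pow_add] at hy
      exact hle _ hy
  rw [← gradeProj_self A.isInternal ha]
  exact key a n

theorem P_mul (g : G) (a b : R) :
    A.yd.P g (a * b) = ∑ h, A.yd.P h a * A.yd.P (h⁻¹ * g) b := by
  rw [YDModule.P, LinearMap.comp_apply, A.coact_mul, A.yd.coact_eq a, A.yd.coact_eq b,
    Finset.sum_mul_sum]
  simp only [Algebra.TensorProduct.tmul_mul_tmul, ← gr_mul, map_sum, cfL_tmul]
  refine Finset.sum_congr rfl fun h _ => ?_
  rw [Finset.sum_eq_single (h⁻¹ * g)]
  · simp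
  · intro x _ hx
    rw [if_neg]
    rintro rfl
    exact hx (by group)
  · simp

theorem IsNichols.isoOver_of_gradeOne (hA : A.IsNichols) (hA' : A'.IsNichols)
    {φ : MonoidAlgebra k G ≃ₐc[k] MonoidAlgebra k G'}
    (h : YDModule.IsoAlong (grpEquiv φ) A.gradeOne A'.gradeOne) : IsoOver φ A A' := by
  obtain ⟨θ, hθ, hθ'⟩ := h
  let j : A.grade 1 →ₗ[k] R := (A.grade 1).subtype
  let j' : A.grade 1 →ₗ[k] R' := (A'.grade 1).subtype ∘ₗ θ.toLinearMap
  have hact : ∀ g v, j (A.gradeOne.act (gr k g) v) = A.yd.act (gr k (MulEquiv.refl G g)) (j v) :=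
    fun g v => YDModule.sub_act ..
  have hP : ∀ g v, j (A.gradeOne.P g v) = A.yd.P (MulEquiv.refl G g) (j v) :=
    fun g v => YDModule.sub_P ..
  have hact' : ∀ g v, j' (A.gradeOne.act (gr k g) v) = A'.yd.act (gr k (grpEquiv φ g)) (j' v) :=
    fun g v => (congrArg Subtype.val (hθ g v)).trans (YDModule.sub_act ..)
  have hP' : ∀ g v, j' (A.gradeOne.P g v) = A'.yd.P (grpEquiv φ g) (j' v) :=
    fun g v => (congrArg Subtype.val (hθ' g v)).trans (YDModule.sub_P ..)
  have hj : ∀ v, j v ∈ A.grade 1 := fun v => v.2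
  have hj' : ∀ v, j' v ∈ A'.grade 1 := fun v => (θ v).2
  have hs : Function.Surjective (TensorAlgebra.lift k j) := fun a =>
    hA.induction (p := fun a => ∃ t, TensorAlgebra.lift k j t = a)
      (fun c => ⟨algebraMap k _ c, AlgHom.commutes _ c⟩)
      (fun v hv => ⟨TensorAlgebra.ι k ⟨v, hv⟩, TensorAlgebra.lift_ι_apply _ _⟩)
      (fun _ _ ⟨s, hs⟩ ⟨t, ht⟩ => ⟨s + t, by rw [map_add, hs, ht]⟩)
      (fun _ _ ⟨s, hs⟩ ⟨t, ht⟩ => ⟨s * t, by rw [map_mul, hs, ht]⟩) a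
  have hs' : Function.Surjective (TensorAlgebra.lift k j') := fun a =>
    hA'.induction (p := fun a => ∃ t, TensorAlgebra.lift k j' t = a)
      (fun c => ⟨algebraMap k _ c, AlgHom.commutes _ c⟩)
      (fun v hv => ⟨TensorAlgebra.ι k (θ.symm ⟨v, hv⟩), by
        rw [TensorAlgebra.lift_ι_apply]
        exact congrArg Subtype.val (θ.apply_symm_apply _)⟩)
      (fun _ _ ⟨s, hs⟩ ⟨t, ht⟩ => ⟨s + t, by rw [map_add, hs, ht]⟩)
      (fun _ _ ⟨s, hs⟩ ⟨t, ht⟩ => ⟨s * t, by rw [map_mul, hs, ht]⟩) a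
  obtain ⟨E, hE⟩ := exists_algEquiv_of_ker (TensorAlgebra.lift k j) (TensorAlgebra.lift k j') hs hs'
    (fun t => ⟨hA.lift_eq_zero hj hact hP Subtype.val_injective hA' hj' hact' hP' t,
      hA'.lift_eq_zero hj' hact' hP' (Subtype.val_injective.comp θ.injective) hA hj hact hP t⟩)
  have hE1 : ∀ v : A.grade 1, E v = θ v := fun v => by
    have := hE (TensorAlgebra.ι k v)
    rwa [TensorAlgebra.lift_ι_apply, TensorAlgebra.lift_ι_apply] at this
  have hEact : ∀ g a, E (A.yd.act (gr k g) a) = A'.yd.act (gr k (grpEquiv φ g)) (E a) :=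
    fun g a => hA.induction (p := fun a =>
        E (A.yd.act (gr k g) a) = A'.yd.act (gr k (grpEquiv φ g)) (E a))
      (fun c => by
        rw [Algebra.algebraMap_eq_smul_one, map_smul, A.act_one, map_smul, map_one, map_smul,
          A'.act_one])
      (fun v hv => by
        have := hact' g ⟨v, hv⟩
        rw [show j' ⟨v, hv⟩ = E v from (hE1 ⟨v, hv⟩).symm] at this
        rw [← this]
        refine Eq.trans ?_ (hE1 _)
        exact congrArg E (hact g ⟨v, hv⟩).symm)
      (fun a b ha hb => by simp only [map_add, ha, hb])
      (fun a b ha hb => by rw [A.act_mul, map_mul, ha, hb, map_mul, A'.act_mul]) a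
  have hEP : ∀ a g, E (A.yd.P g a) = A'.yd.P (grpEquiv φ g) (E a) :=
    fun a => hA.induction (p := fun a => ∀ g, E (A.yd.P g a) = A'.yd.P (grpEquiv φ g) (E a))
      (fun c g => by
        rw [Algebra.algebraMap_eq_smul_one, map_smul, A.P_one, map_smul, map_smul, map_one,
          map_smul, A'.P_one, ← map_one (grpEquiv φ), apply_ite E, map_one, map_zero]
        simp only [EmbeddingLike.apply_eq_iff_eq])
      (fun v hv g => by
        have := hP' g ⟨v, hv⟩
        rw [show j' ⟨v, hv⟩ = E v from (hE1 ⟨v, hv⟩).symm] at this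
        rw [← this]
        refine Eq.trans ?_ (hE1 _)
        exact congrArg E (hP g ⟨v, hv⟩).symm)
      (fun a b ha hb g => by simp only [map_add, ha, hb])
      (fun a b ha hb g => by
        rw [P_mul, map_mul, P_mul, map_sum, ← Equiv.sum_comp (grpEquiv φ).toEquiv]
        refine Finset.sum_congr rfl fun x _ => ?_
        rw [map_mul, ha, hb]
        simp) a
  obtain ⟨h1, h2⟩ : (∀ h a, E (A.yd.act h a) = A'.yd.act (φ h) (E a)) ∧
      (∀ a, A'.yd.coact (E a) = TensorProduct.map φ.toCoalgEquiv.toLinearEquiv.toLinearMap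
        E.toLinearMap (A.yd.coact a)) := by
    refine ⟨fun h a => ?_, fun a => ext_cfL fun g => ?_⟩
    · refine gr_induction (P := fun h => E (A.yd.act h a) = A'.yd.act (φ h) (E a)) (by simp)
        (fun x y hx hy => by simp only [map_add, LinearMap.add_apply, hx, hy])
        (fun c x hx => by simp only [map_smul, LinearMap.smul_apply, hx])
        (fun g => by rw [hEact, apply_gr]) h
    · obtain ⟨g, rfl⟩ := (grpEquiv φ).surjective g
      rw [cfL_map]
      exact (hEP a g).symm
  refine ⟨E, fun a => ?_, fun a => ?_, fun n => ?_, h1, h2⟩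
  · refine hA.induction (p := fun a => Coalgebra.comul (R := k) (E a) =
      TensorProduct.map E.toLinearMap E.toLinearMap (Coalgebra.comul (R := k) a)) (fun c => ?_)
      (fun v hv => ?_) (fun a b ha hb => by simp only [map_add, ha, hb]) (fun a b ha hb => ?_) a
    · rw [Algebra.algebraMap_eq_smul_one, map_smul, map_one, map_smul, A'.comul_one, map_smul,
        A.comul_one, map_smul, Algebra.TensorProduct.one_def, Algebra.TensorProduct.one_def,
        TensorProduct.map_tmul]
      simp
    · rw [(hA.2.1 v).2 hv, (hA'.2.1 (E v)).2 (by rw [hE1 ⟨v, hv⟩]; exact (θ _).2)]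
      simp
    · rw [map_mul, A'.comul_mul, ha, hb, A.comul_mul]
      exact (map_braidedMul E.toAlgHom hEact (fun g a => hEP a g) _ _).symm
  · rw [← (hs a).choose_spec, hE, counit_lift hj', counit_lift hj]
  · rw [hA.grade_eq_pow, hA'.grade_eq_pow]
    refine (Submodule.map_pow (A.grade 1) (f := E.toAlgHom) n).trans ?_
    congr 1
    refine le_antisymm ?_ fun v hv => ?_
    · rintro _ ⟨v, hv, rfl⟩
      exact (hE1 ⟨v, hv⟩).symm ▸ (θ _).2
    · refine ⟨(θ.symm ⟨v, hv⟩ : A.grade 1), Subtype.coe_prop _, (hE1 _).trans ?_⟩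
      rw [LinearEquiv.apply_symm_apply]

theorem IsoOver.gradeOne {φ : MonoidAlgebra k G ≃ₐc[k] MonoidAlgebra k G'} (h : IsoOver φ A A') :
    YDModule.IsoAlong (grpEquiv φ) A.gradeOne A'.gradeOne := by
  obtain ⟨E, -, -, hE, h1, h2⟩ := h
  have hmem : ∀ v ∈ A.grade 1, E v ∈ A'.grade 1 := fun v hv => by
    rw [← hE 1]; exact ⟨v, hv, rfl⟩
  refine ⟨LinearEquiv.ofBijective (E.toLinearMap.restrict hmem) ⟨fun v w hvw =>
    Subtype.ext (E.injective (congrArg Subtype.val hvw)), fun w => ?_⟩,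
    fun g v => Subtype.ext ?_, fun g v => Subtype.ext ?_⟩
  · obtain ⟨v, hv, hw⟩ := (hE 1).ge w.2
    exact ⟨⟨v, hv⟩, Subtype.ext hw⟩
  · refine (congrArg E (YDModule.sub_act ..)).trans (Eq.trans ?_ (YDModule.sub_act ..).symm)
    rw [h1, apply_gr]; rfl
  · refine (congrArg E (YDModule.sub_P ..)).trans (Eq.trans ?_ (YDModule.sub_P ..).symm)
    have := congrArg (cfL (grpEquiv φ g)) (h2 v)
    rw [cfL_map] at this
    exact this.symm

theorem IsNicholsOf.isoOver_iff {V V' : Type*} [AddCommGroup V] [Module k V] [AddCommGroup V']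
    [Module k V'] {Y : YDModule k G V} {Y' : YDModule k G' V'} (h : A.IsNicholsOf Y)
    (h' : A'.IsNicholsOf Y') {φ : MonoidAlgebra k G ≃ₐc[k] MonoidAlgebra k G'} :
    IsoOver φ A A' ↔ YDModule.IsoOver φ Y Y' := by
  rw [isNicholsOf_iff] at h h'
  rw [YDModule.isoOver_iff_isoAlong]
  exact ⟨fun e => (h.2.trans e.gradeOne).trans h'.2.symm,
    fun e => h.1.isoOver_of_gradeOne h'.1 ((h.2.symm.trans e).trans h'.2)⟩

end GradedBraidedHopf

/-- A bialgebra with a projection onto the group algebra `kG`. -/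
structure GroupProjection (k G C : Type*) [Field k] [Group G] [Ring C] [Bialgebra k C] where
  i : MonoidAlgebra k G →ₐ[k] C
  π : C →ₐ[k] MonoidAlgebra k G
  comul_i : ∀ g : G, Coalgebra.comul (R := k) (i (gr k g)) = i (gr k g) ⊗ₜ i (gr k g)
  comul_π : ∀ x, Coalgebra.comul (R := k) (π x) =
    TensorProduct.map π.toLinearMap π.toLinearMap (Coalgebra.comul (R := k) x)
  counit_π : ∀ x, Coalgebra.counit (R := k) (π x) = Coalgebra.counit (R := k) x
  π_i : ∀ g : G, π (i (gr k g)) = gr k g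

namespace GroupProjection
variable {k G C : Type*} [Field k] [Group G] [Fintype G] [DecidableEq G] [Ring C] [Bialgebra k C]
  (E : GroupProjection k G C)

/-- The image of a group element. -/
def u (g : G) : C := E.i (gr k g)

theorem u_mul (g h : G) : E.u (g * h) = E.u g * E.u h := by rw [u, gr_mul, map_mul]; rfl

@[simp] theorem u_one : E.u 1 = 1 := by rw [u, gr_one, map_one]

@[simp] theorem u_mul_inv (g : G) : E.u g * E.u g⁻¹ = 1 := by rw [← u_mul, mul_inv_cancel, u_one]

@[simp] theorem u_inv_mul (g : G) : E.u g⁻¹ * E.u g = 1 := by rw [← u_mul, inv_mul_cancel, u_one]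

theorem comul_u (g : G) : Coalgebra.comul (R := k) (E.u g) = E.u g ⊗ₜ E.u g := E.comul_i g

@[simp] theorem counit_u (g : G) : Coalgebra.counit (R := k) (E.u g) = 1 := by
  rw [← E.counit_π, u, E.π_i, counit_gr]

/-- The left coaction of `kG`. -/
def coactAlg : C →ₐ[k] MonoidAlgebra k G ⊗[k] C :=
  (Algebra.TensorProduct.map E.π (AlgHom.id k C)).comp (Bialgebra.comulAlgHom k C)

theorem coactAlg_apply (x : C) :
    E.coactAlg x = E.π.toLinearMap.rTensor C (Coalgebra.comul (R := k) x) := rfl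

theorem coactAlg_u (g : G) : E.coactAlg (E.u g) = gr k g ⊗ₜ E.u g := by
  rw [coactAlg_apply, comul_u, LinearMap.rTensor_tmul, AlgHom.toLinearMap_apply]
  exact congrArg (· ⊗ₜ[k] E.u g) (E.π_i g)

/-- The Yetter-Drinfeld module structure given by the adjoint action and the left coaction. -/
def yd : YDModule k G C where
  act := gl fun g => LinearMap.mulLeft k (E.u g) ∘ₗ LinearMap.mulRight k (E.u g⁻¹)
  coact := E.coactAlg.toLinearMap
  act_one v := by rw [← gr_one, gl_gr]; simp
  act_mul := gl_mul fun g h v => by simp [u_mul, mul_assoc]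
  coact_counit x := by
    have e : (Coalgebra.counit (R := k) (A := MonoidAlgebra k G)) ∘ₗ E.π.toLinearMap =
      Coalgebra.counit := LinearMap.ext E.counit_π
    rw [AlgHom.toLinearMap_apply, coactAlg_apply, ← LinearMap.rTensor_comp_apply, e]
    simp
  coact_coassoc x := by
    have e : (Coalgebra.comul (R := k) (A := MonoidAlgebra k G)) ∘ₗ E.π.toLinearMap =
      TensorProduct.map E.π.toLinearMap E.π.toLinearMap ∘ₗ Coalgebra.comul :=
      LinearMap.ext E.comul_π
    rw [AlgHom.toLinearMap_apply, coactAlg_apply, ← LinearMap.rTensor_comp_apply, e,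
      LinearMap.rTensor_comp_apply]
    refine (TensorAlg.assoc_map_map E.π.toLinearMap E.π.toLinearMap LinearMap.id _).trans ?_
    rw [Coalgebra.coassoc_apply]
    have e2 : E.coactAlg.toLinearMap = E.π.toLinearMap.rTensor C ∘ₗ Coalgebra.comul := rfl
    rw [e2, LinearMap.lTensor_comp_apply, ← lr_comm]
    generalize (Coalgebra.comul (R := k) (A := C)).lTensor C _ = w
    rw [← LinearMap.comp_apply, LinearMap.lTensor_comp_rTensor]
    rfl
  coact_act g x := by
    rw [gl_gr, LinearMap.comp_apply, LinearMap.mulLeft_apply, LinearMap.mulRight_apply,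
      AlgHom.toLinearMap_apply, map_mul, map_mul, coactAlg_u, coactAlg_u]
    change _ = TensorProduct.map _ _ (E.coactAlg x)
    generalize E.coactAlg x = z
    induction z using TensorProduct.induction_on with
    | zero => simp
    | add x y hx hy => simp only [mul_add, add_mul, map_add, hx, hy]
    | tmul a b => simp

theorem yd_act (g : G) (x : C) : E.yd.act (gr k g) x = E.u g * x * E.u g⁻¹ := by
  have : E.yd.act (gr k g) = LinearMap.mulLeft k (E.u g) ∘ₗ LinearMap.mulRight k (E.u g⁻¹) :=
    gl_gr _ g
  rw [this]
  simp [mul_assoc]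

theorem yd_coact (x : C) : E.yd.coact x = E.coactAlg x := rfl

theorem P_mul (g : G) (a b : C) : E.yd.P g (a * b) = ∑ h, E.yd.P h a * E.yd.P (h⁻¹ * g) b := by
  rw [YDModule.P, LinearMap.comp_apply, yd_coact, map_mul, ← yd_coact, ← yd_coact,
    E.yd.coact_eq a, E.yd.coact_eq b, Finset.sum_mul_sum]
  simp only [Algebra.TensorProduct.tmul_mul_tmul, ← gr_mul, map_sum, cfL_tmul]
  refine Finset.sum_congr rfl fun h _ => ?_
  rw [Finset.sum_eq_single (h⁻¹ * g)]
  · simp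
  · intro x _ hx
    rw [if_neg]
    rintro rfl
    exact hx (by group)
  · simp

theorem P_u (g h : G) : E.yd.P g (E.u h) = if h = g then E.u h else 0 := by
  rw [YDModule.P, LinearMap.comp_apply, yd_coact, coactAlg_u, cfL_tmul]

theorem P_mul_u (g h : G) (a : C) : E.yd.P (g * h) (a * E.u h) = E.yd.P g a * E.u h := by
  rw [P_mul, Finset.sum_eq_single g]
  · rw [inv_mul_cancel_left, P_u, if_pos rfl]
  · intro x _ hx
    rw [P_u, if_neg, mul_zero]
    intro e
    apply hx
    rw [eq_inv_mul_iff_mul_eq] at e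
    exact mul_right_cancel e
  · simp

theorem counit_P (x : C) : E.π x = ∑ g, Coalgebra.counit (R := k) (E.yd.P g x) • gr k g := by
  have h : TensorProduct.rid k _ ((Coalgebra.counit (R := k) (A := C)).lTensor _ (E.yd.coact x)) =
      E.π x := by
    rw [yd_coact, coactAlg_apply, ← lr_comm, Coalgebra.lTensor_counit_comul]
    simp
  rw [← h, E.yd.coact_eq]
  simp

theorem comul_P (g : G) (x : C) : Coalgebra.comul (R := k) (E.yd.P g x) =
    (E.yd.P g).rTensor C (Coalgebra.comul (R := k) x) := by
  have h := congrArg (cfL g) (congrArg (E.π.toLinearMap.rTensor (C ⊗[k] C))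
    (Coalgebra.coassoc_apply (R := k) x))
  rw [lr_comm, cfL_lTensor] at h
  refine h.symm.trans ?_
  rw [← nat1, ← LinearMap.rTensor_comp_apply]
  change cfL g (TensorProduct.assoc k _ _ _ (E.coactAlg.toLinearMap.rTensor C _)) =
    (cfL g ∘ₗ E.coactAlg.toLinearMap).rTensor C _
  rw [LinearMap.rTensor_comp_apply]
  generalize E.coactAlg.toLinearMap.rTensor C _ = z
  refine LinearMap.congr_fun (f := cfL g ∘ₗ (TensorProduct.assoc k _ _ _).toLinearMap)
    (g := (cfL g).rTensor C) (TensorProduct.ext' fun s c => ?_) z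
  refine lin_ext_L (f := cfL g ∘ₗ (TensorProduct.assoc k _ _ _).toLinearMap ∘ₗ
    (TensorProduct.mk k (MonoidAlgebra k G ⊗[k] C) C).flip c)
    (f' := (TensorProduct.mk k C C).flip c ∘ₗ cfL g) (fun h n => ?_) s
  simp only [LinearMap.comp_apply, LinearMap.flip_apply, TensorProduct.mk_apply,
    LinearEquiv.coe_coe, TensorProduct.assoc_tmul, cfL_tmul]
  split_ifs <;> simp

/-- The map `a ⊗ b ↦ a S(b₍₋₁₎) ⊗ b₍₀₎`. -/
def twist : C ⊗[k] C →ₗ[k] C ⊗[k] C :=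
  ∑ g, TensorProduct.map (LinearMap.mulRight k (E.u g⁻¹)) (E.yd.P g)

theorem twist_tmul (a b : C) : E.twist (a ⊗ₜ b) = ∑ g, (a * E.u g⁻¹) ⊗ₜ E.yd.P g b := by
  simp [twist, LinearMap.sum_apply]

/-- The braided comultiplication `x ↦ x₍₁₎ S(π(x₍₂₎)) ⊗ x₍₃₎`. -/
def bcomul : C →ₗ[k] C ⊗[k] C := E.twist ∘ₗ Coalgebra.comul

theorem bcomul_apply (x : C) : E.bcomul x = E.twist (Coalgebra.comul (R := k) x) := rfl

theorem bcomul_mul_u (a : C) (g : G) :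
    E.bcomul (a * E.u g) = (LinearMap.mulRight k (E.u g)).lTensor C (E.bcomul a) := by
  rw [bcomul_apply, bcomul_apply, Bialgebra.comul_mul, comul_u]
  generalize Coalgebra.comul (R := k) a = z
  induction z using TensorProduct.induction_on with
  | zero => simp
  | add x y hx hy => simp only [add_mul, map_add, hx, hy]
  | tmul b c =>
    rw [Algebra.TensorProduct.tmul_mul_tmul, twist_tmul, twist_tmul, map_sum,
      ← Equiv.sum_comp (Equiv.mulRight g)]
    refine Finset.sum_congr rfl fun h _ => ?_
    rw [Equiv.coe_mulRight, P_mul_u, mul_inv_rev, u_mul, mul_assoc, ← mul_assoc (E.u g), u_mul_inv,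
      one_mul, LinearMap.lTensor_tmul, LinearMap.mulRight_apply]

theorem bcomul_P (g : G) (x : C) : E.bcomul (E.yd.P g x) =
    E.twist ((E.yd.P g).rTensor C (Coalgebra.comul (R := k) x)) := by
  rw [bcomul_apply, comul_P]

theorem bcomul_coassoc (x : C) :
    TensorProduct.assoc k C C C (E.bcomul.rTensor C (E.bcomul x)) =
      E.bcomul.lTensor C (E.bcomul x) := by
  let K : C ⊗[k] (C ⊗[k] C) →ₗ[k] C ⊗[k] (C ⊗[k] C) :=
    ∑ h, TensorProduct.map (LinearMap.mulRight k (E.u h⁻¹)) (E.twist ∘ₗ (E.yd.P h).rTensor C)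
  have hK : ∀ a b c, K (a ⊗ₜ (b ⊗ₜ c)) =
      ∑ h, ∑ g, (a * E.u h⁻¹) ⊗ₜ ((E.yd.P h b * E.u g⁻¹) ⊗ₜ E.yd.P g c) := fun a b c => by
    simp [K, LinearMap.sum_apply, twist_tmul, TensorProduct.tmul_sum]
  have h1 : ∀ z : C ⊗[k] C, E.bcomul.lTensor C (E.twist z) =
      K ((Coalgebra.comul (R := k)).lTensor C z) := fun z => by
    induction z using TensorProduct.induction_on with
    | zero => simp
    | add x y hx hy => simp only [map_add, hx, hy]
    | tmul a b => simp [K, LinearMap.sum_apply, twist_tmul, bcomul_P]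
  have h2 : ∀ z : C ⊗[k] C, TensorProduct.assoc k C C C (E.bcomul.rTensor C (E.twist z)) =
      K (TensorProduct.assoc k C C C ((Coalgebra.comul (R := k)).rTensor C z)) := fun z => by
    induction z using TensorProduct.induction_on with
    | zero => simp
    | add x y hx hy => simp only [map_add, hx, hy]
    | tmul a b =>
      simp only [twist_tmul, map_sum, LinearMap.rTensor_tmul, bcomul_mul_u]
      rw [bcomul_apply]
      generalize Coalgebra.comul (R := k) a = w
      induction w using TensorProduct.induction_on with
      | zero => simp
      | add x y hx hy =>
        simp only [map_add, TensorProduct.add_tmul, Finset.sum_add_distrib, hx, hy]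
      | tmul c d =>
        rw [TensorProduct.assoc_tmul, hK, Finset.sum_comm]
        simp [twist_tmul, TensorProduct.sum_tmul]
  rw [bcomul_apply, h1, h2, Coalgebra.coassoc_apply]

theorem counit_bcomul (x : C) :
    (Coalgebra.counit (R := k)).rTensor C (E.bcomul x) = 1 ⊗ₜ x := by
  rw [← Coalgebra.rTensor_counit_comul, bcomul_apply]
  generalize Coalgebra.comul (R := k) x = z
  induction z using TensorProduct.induction_on with
  | zero => simp
  | add x y hx hy => simp only [map_add, hx, hy]
  | tmul a b =>
    rw [twist_tmul, map_sum]
    simp only [LinearMap.rTensor_tmul, Bialgebra.counit_mul, counit_u, mul_one]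
    rw [← TensorProduct.tmul_sum, E.yd.sum_P]

/-- The subalgebra of right coinvariants. -/
def coinvariants : Subalgebra k C :=
  AlgHom.equalizer ((Algebra.TensorProduct.map (AlgHom.id k C) E.π).comp
    (Bialgebra.comulAlgHom k C)) Algebra.TensorProduct.includeLeft

theorem mem_coinvariants {x : C} : x ∈ E.coinvariants ↔
    E.π.toLinearMap.lTensor C (Coalgebra.comul (R := k) x) = x ⊗ₜ 1 := Iff.rfl

theorem π_of_mem_coinvariants {x : C} (hx : x ∈ E.coinvariants) :
    E.π x = algebraMap k _ (Coalgebra.counit (R := k) x) := by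
  rw [mem_coinvariants] at hx
  have := congrArg (TensorProduct.lid k _ ∘ (Coalgebra.counit (R := k) (A := C)).rTensor _) hx
  simp only [Function.comp_apply] at this
  rw [lr_comm, Coalgebra.rTensor_counit_comul] at this
  simpa [Algebra.algebraMap_eq_smul_one] using this

theorem bcomul_counit {x : C} (hx : x ∈ E.coinvariants) :
    (Coalgebra.counit (R := k)).lTensor C (E.bcomul x) = x ⊗ₜ 1 := by
  rw [mem_coinvariants] at hx
  let N : C ⊗[k] MonoidAlgebra k G →ₗ[k] C :=
    TensorProduct.lift (gl fun g => LinearMap.mulRight k (E.u g⁻¹)).flip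
  have hN : ∀ a g, N (a ⊗ₜ gr k g) = a * E.u g⁻¹ := fun a g => by
    simp only [N, TensorProduct.lift.tmul, LinearMap.flip_apply, gl_gr, LinearMap.mulRight_apply]
  have key : ∀ z : C ⊗[k] C, (Coalgebra.counit (R := k)).lTensor C (E.twist z) =
      N (E.π.toLinearMap.lTensor C z) ⊗ₜ 1 := fun z => by
    induction z using TensorProduct.induction_on with
    | zero => simp
    | add x y hx hy => simp only [map_add, TensorProduct.add_tmul, hx, hy]
    | tmul a b =>
      rw [LinearMap.lTensor_tmul, AlgHom.toLinearMap_apply, E.counit_P, twist_tmul, map_sum,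
        TensorProduct.tmul_sum, map_sum, TensorProduct.sum_tmul]
      refine Finset.sum_congr rfl fun g _ => ?_
      rw [LinearMap.lTensor_tmul, TensorProduct.tmul_smul, map_smul, hN, TensorProduct.smul_tmul,
        smul_eq_mul, mul_one]
  rw [bcomul_apply, key, hx, ← gr_one, hN, inv_one, u_one, mul_one]

theorem twist_mul (s t : C ⊗[k] C) :
    E.twist (s * t) = braidedMul E.yd (E.twist s ⊗ₜ E.twist t) := by
  refine tensor_induction₂ (P := fun s t =>
    E.twist (s * t) = braidedMul E.yd (E.twist s ⊗ₜ E.twist t)) (by simp) (by simp)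
    (fun s s' t h h' => by simp only [add_mul, map_add, TensorProduct.add_tmul, h, h'])
    (fun s t t' h h' => by simp only [mul_add, map_add, TensorProduct.tmul_add, h, h'])
    (fun a b c d => ?_) s t
  rw [Algebra.TensorProduct.tmul_mul_tmul, twist_tmul, twist_tmul, twist_tmul,
    TensorProduct.sum_tmul, map_sum]
  simp only [P_mul, TensorProduct.tmul_sum, map_sum, braidedMul_tmul]
  rw [Finset.sum_comm]
  refine Finset.sum_congr rfl fun h _ => ?_
  rw [← Equiv.sum_comp (Equiv.mulLeft h)]
  refine Finset.sum_congr rfl fun l _ => ?_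
  rw [Finset.sum_eq_single h]
  · rw [E.yd.P_self, yd_act, Equiv.coe_mulLeft, inv_mul_cancel_left]
    congr 1
    simp only [mul_inv_rev, u_mul, mul_assoc]
    rw [← mul_assoc (E.u h⁻¹), u_inv_mul, one_mul]
  · intro x _ hx
    rw [E.yd.P_P, if_neg (Ne.symm hx), zero_mul, TensorProduct.tmul_zero]
  · simp

theorem bcomul_mul (a b : C) :
    E.bcomul (a * b) = braidedMul E.yd (E.bcomul a ⊗ₜ E.bcomul b) := by
  rw [bcomul_apply, Bialgebra.comul_mul, twist_mul]; rfl

theorem bcomul_one : E.bcomul 1 = 1 := by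
  rw [bcomul_apply, Bialgebra.comul_one, Algebra.TensorProduct.one_def, twist_tmul,
    Finset.sum_eq_single 1]
  · rw [← u_one E, P_u, if_pos rfl]; simp
  · intro x _ hx
    rw [← u_one E, P_u, if_neg (Ne.symm hx), TensorProduct.tmul_zero]
  · simp

theorem bcomul_act (g : G) (x : C) : E.bcomul (E.yd.act (gr k g) x) =
    TensorProduct.map (E.yd.act (gr k g)) (E.yd.act (gr k g)) (E.bcomul x) := by
  rw [yd_act, bcomul_apply, bcomul_apply, Bialgebra.comul_mul, Bialgebra.comul_mul, comul_u,
    comul_u]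
  generalize Coalgebra.comul (R := k) x = z
  induction z using TensorProduct.induction_on with
  | zero => simp
  | add x y hx hy => simp only [mul_add, add_mul, map_add, hx, hy]
  | tmul a b =>
    rw [Algebra.TensorProduct.tmul_mul_tmul, Algebra.TensorProduct.tmul_mul_tmul, ← yd_act,
      ← yd_act, twist_tmul, twist_tmul, map_sum, ← Equiv.sum_comp (MulAut.conj g).toEquiv]
    refine Finset.sum_congr rfl fun h _ => ?_
    rw [show (MulAut.conj g).toEquiv h = g * h * g⁻¹ from rfl, E.yd.P_act, TensorProduct.map_tmul]
    congr 1
    rw [yd_act, yd_act]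
    simp only [mul_inv_rev, inv_inv, u_mul, mul_assoc]
    rw [← mul_assoc (E.u g⁻¹) (E.u g), u_inv_mul, one_mul]

theorem counit_act (g : G) (x : C) :
    Coalgebra.counit (R := k) (E.yd.act (gr k g) x) = Coalgebra.counit (R := k) x := by
  rw [yd_act]; simp

theorem bcomul_coact (x : C) : E.bcomul.lTensor (MonoidAlgebra k G) (E.yd.coact x) =
    E.yd.coact₂ (E.bcomul x) := by
  have key : ∀ z : C ⊗[k] C, E.yd.coact₂ (E.twist z) =
      ∑ g, gr k g ⊗ₜ E.twist ((E.yd.P g).rTensor C z) := fun z => by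
    induction z using TensorProduct.induction_on with
    | zero => simp
    | add x y hx hy =>
      simp only [map_add, TensorProduct.tmul_add, Finset.sum_add_distrib, hx, hy]
    | tmul a b =>
      simp only [twist_tmul, map_sum, YDModule.coact₂_tmul, LinearMap.rTensor_tmul,
        TensorProduct.tmul_sum]
      conv_rhs => rw [Finset.sum_comm]
      refine Finset.sum_congr rfl fun g _ => ?_
      refine Fintype.sum_equiv (Equiv.mulRight g) _ _ fun h => ?_
      rw [Finset.sum_eq_single g]
      · have := E.P_mul_u (h * g) g⁻¹ a
        rw [mul_inv_cancel_right] at this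
        rw [E.yd.P_self, Equiv.coe_mulRight, this]
      · intro x _ hx
        rw [E.yd.P_P, if_neg (Ne.symm hx), TensorProduct.tmul_zero, TensorProduct.tmul_zero]
      · simp
  rw [bcomul_apply, key, E.yd.coact_eq, map_sum]
  simp only [LinearMap.lTensor_tmul, bcomul_P]

end GroupProjection

section Connected
variable {k R : Type*} [Field k] [Ring R] [Algebra k R] [Coalgebra k R] {𝒜 : ℕ → Submodule k R}

/-- A linear map that agrees on each component with a prescribed linear map. -/
theorem exists_linearMap_of_grade (h𝒜 : DirectSum.IsInternal 𝒜) (f : ℕ → R →ₗ[k] R) :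
    ∃ S : R →ₗ[k] R, ∀ n, ∀ a ∈ 𝒜 n, S a = f n a := by
  refine ⟨DirectSum.toModule k ℕ R (fun n => f n ∘ₗ (𝒜 n).subtype) ∘ₗ
    (gradeEquiv h𝒜).symm.toLinearMap, fun n a ha => ?_⟩
  have e : (gradeEquiv h𝒜).symm a = DirectSum.lof k ℕ (fun i => 𝒜 i) n ⟨a, ha⟩ := by
    rw [LinearEquiv.symm_apply_eq]
    exact (gradeEquiv_lof h𝒜 n ⟨a, ha⟩).symm
  rw [LinearMap.comp_apply, LinearEquiv.coe_coe, e, DirectSum.toModule_lof]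
  rfl

/-- A connected graded coalgebra with an algebra structure has an antipode. -/
theorem exists_antipode_of_connected (h𝒜 : DirectSum.IsInternal 𝒜)
    (h0 : 𝒜 0 = Submodule.span k {1}) (counit_one : Coalgebra.counit (R := k) (1 : R) = 1)
    (comul_mem : ∀ n, ∀ a ∈ 𝒜 n, Coalgebra.comul (R := k) a ∈
      ⨆ p ∈ Finset.HasAntidiagonal.antidiagonal n, tens (𝒜 p.1) (𝒜 p.2)) :
    ∃ S : R →ₗ[k] R, ∀ a,
      LinearMap.mul' k R (S.rTensor R (Coalgebra.comul (R := k) a)) =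
        algebraMap k R (Coalgebra.counit (R := k) a) ∧
      LinearMap.mul' k R (S.lTensor R (Coalgebra.comul (R := k) a)) =
        algebraMap k R (Coalgebra.counit (R := k) a) := by
  let v : WithConv (R →ₗ[k] R) := WithConv.toConv LinearMap.id
  let u : WithConv (R →ₗ[k] R) := 1 - v
  have hv : 1 - u = v := sub_sub_cancel 1 v
  have hu0 : ∀ a ∈ 𝒜 0, u a = 0 := fun a ha => by
    rw [h0, Submodule.mem_span_singleton] at ha
    obtain ⟨c, rfl⟩ := ha
    change u.ofConv (c • 1) = 0
    rw [map_smul]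
    have : u.ofConv 1 = (1 : WithConv (R →ₗ[k] R)) 1 - 1 := rfl
    rw [this, LinearMap.convOne_apply, counit_one, map_one, sub_self, smul_zero]
  have hu : ∀ n m, m < n → ∀ a ∈ 𝒜 m, (u ^ n) a = 0 := by
    intro n
    induction n with
    | zero => intro m hm; omega
    | succ n ih =>
      intro m hm a ha
      rw [pow_succ, LinearMap.convMul_apply]
      refine mem_antidiagonal_tens_induction (𝒜 := 𝒜) (p := fun z => LinearMap.mul' k R
        (TensorProduct.map (u ^ n).ofConv u.ofConv z) = 0) (by simp)
        (fun a b ha hb => by rw [map_add, map_add, ha, hb, add_zero])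
        (fun i j hij a ha b hb => ?_) (comul_mem m a ha)
      rw [TensorProduct.map_tmul, LinearMap.mul'_apply]
      by_cases hi : i < n
      · rw [ih i hi a ha, zero_mul]
      · obtain rfl : j = 0 := by omega
        rw [hu0 b hb, mul_zero]
  let s : ℕ → WithConv (R →ₗ[k] R) := fun n => ∑ i ∈ Finset.range n, u ^ i
  have hs_apply : ∀ n a, (s n).ofConv a = ∑ i ∈ Finset.range n, (u ^ i).ofConv a := fun n a => by
    have : (s n).ofConv = ∑ i ∈ Finset.range n, (u ^ i).ofConv :=
      map_sum (WithConv.linearEquiv k (R →ₗ[k] R)) _ _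
    rw [this, LinearMap.sum_apply]
  have hs : ∀ m n, m ≤ n → ∀ a ∈ 𝒜 m, (s (n + 1)).ofConv a = (s (m + 1)).ofConv a := by
    intro m n hmn a ha
    rw [hs_apply, hs_apply]
    refine (Finset.sum_subset (Finset.range_mono (by omega)) fun i _ hi => ?_).symm
    exact hu i m (by simpa using hi) a ha
  obtain ⟨S, hS⟩ := exists_linearMap_of_grade h𝒜 fun n => (s (n + 1)).ofConv
  have hS' : ∀ m n, m ≤ n → ∀ a ∈ 𝒜 m, S a = (s (n + 1)).ofConv a := fun m n hmn a ha => by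
    rw [hS m a ha, hs m n hmn a ha]
  have hone : ∀ n, ∀ a ∈ 𝒜 n, (1 - u ^ (n + 1) : WithConv (R →ₗ[k] R)) a =
      algebraMap k R (Coalgebra.counit (R := k) a) := fun n a ha => by
    have : (1 - u ^ (n + 1) : WithConv (R →ₗ[k] R)) a =
      (1 : WithConv (R →ₗ[k] R)) a - (u ^ (n + 1)).ofConv a := rfl
    rw [this, hu (n + 1) n (Nat.lt_succ_self n) a ha, sub_zero, LinearMap.convOne_apply]
  refine ⟨S, IsInternal_induction h𝒜 (fun n a ha => ⟨?_, ?_⟩) fun a b ha hb =>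
    ⟨by simp only [map_add, ha.1, hb.1], by simp only [map_add, ha.2, hb.2]⟩⟩
  · rw [← hone n a ha, ← geom_sum_mul_neg, hv, LinearMap.convMul_apply]
    congr 1
    refine mem_antidiagonal_tens_induction (𝒜 := 𝒜) (p := fun z => S.rTensor R z =
      TensorProduct.map (s (n + 1)).ofConv v.ofConv z) (by simp)
      (fun a b ha hb => by rw [map_add, map_add, ha, hb])
      (fun i j hij a ha b hb => ?_) (comul_mem n a ha)
    rw [TensorProduct.map_tmul, LinearMap.rTensor_tmul, hS' i n (by omega) a ha]
    rfl
  · rw [← hone n a ha, ← mul_neg_geom_sum, hv, LinearMap.convMul_apply]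
    congr 1
    refine mem_antidiagonal_tens_induction (𝒜 := 𝒜) (p := fun z => S.lTensor R z =
      TensorProduct.map v.ofConv (s (n + 1)).ofConv z) (by simp)
      (fun a b ha hb => by rw [map_add, map_add, ha, hb])
      (fun i j hij a ha b hb => ?_) (comul_mem n a ha)
    rw [TensorProduct.map_tmul, LinearMap.lTensor_tmul, hS' j n (by omega) b hb]
    rfl

end Connected

theorem isInternal_of_projections {k A B : Type*} [Field k] [AddCommGroup A] [Module k A]
    [AddCommGroup B] [Module k B] {𝒜 : ℕ → Submodule k A} (ι : A →ₗ[k] B)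
    (hι : Function.Injective ι) (d : ℕ → A →ₗ[k] B)
    (hd : ∀ m n, ∀ x ∈ 𝒜 m, d n x = if m = n then ι x else 0) (hsup : ⨆ n, 𝒜 n = ⊤) :
    DirectSum.IsInternal 𝒜 := by
  rw [DirectSum.isInternal_submodule_iff_iSupIndep_and_iSup_eq_top]
  refine ⟨fun n => ?_, hsup⟩
  rw [Submodule.disjoint_def]
  intro x hx hx'
  have h0 : d n x = 0 := by
    have : (⨆ j, ⨆ (_ : j ≠ n), 𝒜 j) ≤ LinearMap.ker (d n) :=
      iSup₂_le fun j hj y hy => by rw [LinearMap.mem_ker, hd j n y hy, if_neg hj]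
    exact this hx'
  rw [hd n n x hx, if_pos rfl] at h0
  exact hι (h0.trans (map_zero ι).symm)

theorem adjoin_toSubmodule_eq_iSup_pow {k A : Type*} [Field k] [Ring A] [Algebra k A]
    (V : Submodule k A) :
    Subalgebra.toSubmodule (Algebra.adjoin k (V : Set A)) = ⨆ n, V ^ n := by
  have h1 : (1 : A) ∈ ⨆ n, V ^ n :=
    Submodule.mem_iSup_of_mem (p := fun n => V ^ n) 0 (by rw [pow_zero]; exact Submodule.one_le.1 le_rfl)
  have hmul : ∀ x ∈ ⨆ n, V ^ n, ∀ y ∈ ⨆ n, V ^ n, x * y ∈ ⨆ n, V ^ n := fun x hx y hy =>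
    Submodule.iSup_induction _ (motive := fun x => x * y ∈ ⨆ n, V ^ n) hx (fun m x hx =>
      Submodule.iSup_induction _ (motive := fun y => x * y ∈ ⨆ n, V ^ n) hy (fun n y hy =>
        Submodule.mem_iSup_of_mem (p := fun n => V ^ n) (m + n) (by rw [pow_add]; exact Submodule.mul_mem_mul hx hy))
        (by simp) (fun a b ha hb => by rw [mul_add]; exact add_mem ha hb))
      (by simp) (fun a b ha hb => by rw [add_mul]; exact add_mem ha hb)
  apply le_antisymm
  · intro x hx
    refine Algebra.adjoin_induction (p := fun x _ => x ∈ ⨆ n, V ^ n)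
      (fun v hv => Submodule.mem_iSup_of_mem (p := fun n => V ^ n) 1 (by rw [pow_one]; exact hv))
      (fun c => by rw [Algebra.algebraMap_eq_smul_one]; exact Submodule.smul_mem _ c h1)
      (fun a b _ _ => add_mem) (fun a b _ _ ha hb => hmul a ha b hb) hx
  · refine iSup_le fun n => ?_
    induction n with
    | zero => rw [pow_zero, Submodule.one_le]; exact Subalgebra.one_mem _
    | succ n ih =>
      rw [pow_succ, Submodule.mul_le]
      exact fun a ha b hb => Subalgebra.mul_mem _ (ih ha) (Algebra.subset_adjoin hb)

namespace GroupProjection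
variable {k G C : Type*} [Field k] [Group G] [Fintype G] [DecidableEq G] [Ring C] [Bialgebra k C]
  (E : GroupProjection k G C)

theorem act_mul (g : G) (a b : C) :
    E.yd.act (gr k g) (a * b) = E.yd.act (gr k g) a * E.yd.act (gr k g) b := by
  simp only [yd_act, mul_assoc]
  rw [← mul_assoc (E.u g⁻¹) (E.u g), u_inv_mul, one_mul]

theorem act_one (g : G) : E.yd.act (gr k g) 1 = 1 := by rw [yd_act, mul_one, u_mul_inv]

theorem P_one (g : G) : E.yd.P g 1 = if 1 = g then 1 else 0 := by rw [← u_one E, P_u]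

theorem counit_coact {x : C} (hx : x ∈ E.coinvariants) :
    (Coalgebra.counit (R := k) (A := C)).lTensor _ (E.yd.coact x) =
      1 ⊗ₜ Coalgebra.counit (R := k) x := by
  rw [yd_coact, coactAlg_apply, ← lr_comm, Coalgebra.lTensor_counit_comul, LinearMap.rTensor_tmul,
    AlgHom.toLinearMap_apply, E.π_of_mem_coinvariants hx, Algebra.algebraMap_eq_smul_one,
    TensorProduct.smul_tmul, smul_eq_mul, mul_one]

theorem counit_of_primitive {x : C} (hx : E.bcomul x = x ⊗ₜ 1 + 1 ⊗ₜ x) :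
    Coalgebra.counit (R := k) x = 0 := by
  have h := congrArg (Coalgebra.counit (R := k) ∘ TensorProduct.lid k C) (E.counit_bcomul x)
  rw [hx] at h
  simpa using h

theorem comul_of_primitive {x : C} (hx : E.bcomul x = x ⊗ₜ 1 + 1 ⊗ₜ x) :
    Coalgebra.comul (R := k) x = x ⊗ₜ 1 + ∑ g, E.u g ⊗ₜ E.yd.P g x := by
  let K : C ⊗[k] C →ₗ[k] C ⊗[k] C :=
    ∑ g, TensorProduct.map (LinearMap.mulRight k (E.u g)) (E.yd.P g)
  have hK : ∀ a b, K (a ⊗ₜ b) = ∑ g, (a * E.u g) ⊗ₜ E.yd.P g b := fun a b => by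
    simp [K, LinearMap.sum_apply]
  have key : ∀ z : C ⊗[k] C, K (E.twist z) = z := fun z => by
    induction z using TensorProduct.induction_on with
    | zero => simp
    | add x y hx hy => simp only [map_add, hx, hy]
    | tmul a b =>
      have : ∀ g, K ((a * E.u g⁻¹) ⊗ₜ E.yd.P g b) = a ⊗ₜ E.yd.P g b := fun g => by
        rw [hK, Finset.sum_eq_single g]
        · rw [mul_assoc, u_inv_mul, mul_one, E.yd.P_self]
        · intro h _ hh
          rw [E.yd.P_P, if_neg (Ne.symm hh), TensorProduct.tmul_zero]
        · simp
      rw [twist_tmul, map_sum, Finset.sum_congr rfl fun g _ => this g, ← TensorProduct.tmul_sum,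
        E.yd.sum_P]
  rw [← key (Coalgebra.comul (R := k) x), ← bcomul_apply, hx, map_add, hK, hK,
    Finset.sum_eq_single 1]
  · rw [u_one, mul_one, P_one, if_pos rfl]
    simp only [one_mul]
  · intro g _ hg
    rw [P_one, if_neg (Ne.symm hg), TensorProduct.tmul_zero]
  · simp

theorem twist_tmul_one (a : C) : E.twist (a ⊗ₜ 1) = a ⊗ₜ 1 := by
  rw [twist_tmul, Finset.sum_eq_single 1]
  · rw [inv_one, u_one, mul_one, P_one, if_pos rfl]
  · intro g _ hg
    rw [P_one, if_neg (Ne.symm hg), TensorProduct.tmul_zero]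
  · simp

/-- A space of primitive coinvariants such that its powers form a direct sum and the primitive
coinvariants are homogeneous of degree `1`. -/
structure PrimitiveSpace where
  V : Submodule k C
  act_mem : ∀ g, ∀ v ∈ V, E.yd.act (gr k g) v ∈ V
  P_mem : ∀ g, ∀ v ∈ V, E.yd.P g v ∈ V
  mem_coinvariants : ∀ v ∈ V, v ∈ E.coinvariants
  bcomul_eq : ∀ v ∈ V, E.bcomul v = v ⊗ₜ 1 + 1 ⊗ₜ v
  deg : ℕ → C →ₗ[k] C
  deg_pow : ∀ m n, ∀ x ∈ V ^ m, deg n x = if m = n then x else 0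
  deg_one : ∀ x ∈ E.coinvariants, E.bcomul x = x ⊗ₜ 1 + 1 ⊗ₜ x → deg 1 x = x

namespace PrimitiveSpace
variable {E} (D : E.PrimitiveSpace)

theorem pow_act_mem (n : ℕ) (g : G) {x : C} (hx : x ∈ D.V ^ n) : E.yd.act (gr k g) x ∈ D.V ^ n := by
  induction n generalizing x with
  | zero =>
    rw [pow_zero, Submodule.mem_one] at hx
    obtain ⟨c, rfl⟩ := hx
    rw [Algebra.algebraMap_eq_smul_one, map_smul, E.act_one, pow_zero]
    exact Submodule.smul_mem _ _ (Submodule.one_le.1 le_rfl)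
  | succ n ih =>
    rw [pow_succ] at hx ⊢
    refine Submodule.mul_induction_on hx (fun a ha v hv => ?_) fun a b ha hb => by
      rw [map_add]; exact add_mem ha hb
    rw [E.act_mul]
    exact Submodule.mul_mem_mul (ih ha) (D.act_mem g v hv)

theorem pow_P_mem (n : ℕ) (g : G) {x : C} (hx : x ∈ D.V ^ n) : E.yd.P g x ∈ D.V ^ n := by
  induction n generalizing x g with
  | zero =>
    rw [pow_zero, Submodule.mem_one] at hx
    obtain ⟨c, rfl⟩ := hx
    rw [Algebra.algebraMap_eq_smul_one, map_smul, E.P_one, pow_zero]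
    refine Submodule.smul_mem _ _ ?_
    split_ifs
    · exact Submodule.one_le.1 le_rfl
    · exact zero_mem _
  | succ n ih =>
    rw [pow_succ] at hx ⊢
    refine Submodule.mul_induction_on hx (fun a ha v hv => ?_) fun a b ha hb => by
      rw [map_add]; exact add_mem ha hb
    rw [E.P_mul]
    exact sum_mem fun h _ => Submodule.mul_mem_mul (ih h ha) (D.P_mem _ v hv)

theorem counit_pow {n : ℕ} (hn : n ≠ 0) {x : C} (hx : x ∈ D.V ^ n) :
    Coalgebra.counit (R := k) x = 0 := by
  obtain ⟨n, rfl⟩ := Nat.exists_eq_succ_of_ne_zero hn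
  rw [Nat.succ_eq_add_one, pow_succ] at hx
  refine Submodule.mul_induction_on hx (fun a ha v hv => ?_) fun a b ha hb => by
    rw [map_add, ha, hb, add_zero]
  rw [Bialgebra.counit_mul, E.counit_of_primitive (D.bcomul_eq v hv), mul_zero]

theorem bcomul_pow (n : ℕ) {x : C} (hx : x ∈ D.V ^ n) : E.bcomul x ∈
    ⨆ p ∈ Finset.HasAntidiagonal.antidiagonal n, tens (D.V ^ p.1) (D.V ^ p.2) := by
  have mem : ∀ {n i j : ℕ} (_ : i + j = n) {a b : C} (_ : a ∈ D.V ^ i) (_ : b ∈ D.V ^ j),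
      a ⊗ₜ[k] b ∈ ⨆ p ∈ Finset.HasAntidiagonal.antidiagonal n, tens (D.V ^ p.1) (D.V ^ p.2) :=
    fun {n i j} h {a b} ha hb => Submodule.mem_iSup_of_mem (i, j) (Submodule.mem_iSup_of_mem
      (Finset.HasAntidiagonal.mem_antidiagonal.2 h) (tmul_mem_tens ha hb))
  induction n generalizing x with
  | zero =>
    rw [pow_zero, Submodule.mem_one] at hx
    obtain ⟨c, rfl⟩ := hx
    rw [Algebra.algebraMap_eq_smul_one, map_smul, E.bcomul_one, Algebra.TensorProduct.one_def]
    exact Submodule.smul_mem _ _ (mem (i := 0) (j := 0) rfl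
      (by rw [pow_zero]; exact Submodule.one_le.1 le_rfl)
      (by rw [pow_zero]; exact Submodule.one_le.1 le_rfl))
  | succ n ih =>
    rw [pow_succ] at hx
    refine Submodule.mul_induction_on hx (fun a ha v hv => ?_) fun a b ha hb => by
      rw [map_add]; exact add_mem ha hb
    rw [E.bcomul_mul, D.bcomul_eq v hv]
    refine mem_antidiagonal_tens_induction (𝒜 := fun n => D.V ^ n) (p := fun z =>
      braidedMul E.yd (z ⊗ₜ (v ⊗ₜ 1 + 1 ⊗ₜ v)) ∈ ⨆ p ∈ Finset.HasAntidiagonal.antidiagonal (n + 1),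
        tens (D.V ^ p.1) (D.V ^ p.2)) (by simp)
      (fun a b ha hb => by rw [TensorProduct.add_tmul, map_add]; exact add_mem ha hb)
      (fun i j hij a ha b hb => ?_) (ih ha)
    rw [TensorProduct.tmul_add, map_add, braidedMul_tmul, braidedMul_tmul]
    refine add_mem (sum_mem fun g _ => mem (i := i + 1) (j := j) (by omega) ?_ ?_)
      (sum_mem fun g _ => mem (i := i) (j := j + 1) (by omega) ?_ ?_)
    · rw [pow_succ]; exact Submodule.mul_mem_mul ha (D.act_mem g v hv)
    · rw [mul_one]; exact D.pow_P_mem j g hb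
    · rw [E.act_one, mul_one]; exact ha
    · rw [pow_succ]; exact Submodule.mul_mem_mul (D.pow_P_mem j g hb) hv

/-- The subalgebra generated by the space of primitive elements. -/
def alg : Subalgebra k C := Algebra.adjoin k (D.V : Set C)

theorem toSubmodule_alg : Subalgebra.toSubmodule D.alg = ⨆ n, D.V ^ n :=
  adjoin_toSubmodule_eq_iSup_pow D.V

theorem pow_le_alg (n : ℕ) {x : C} (hx : x ∈ D.V ^ n) : x ∈ D.alg := by
  rw [← Subalgebra.mem_toSubmodule, toSubmodule_alg]
  exact Submodule.mem_iSup_of_mem (p := fun n => D.V ^ n) n hx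

theorem alg_induction {p : C → Prop} (hpow : ∀ n, ∀ x ∈ D.V ^ n, p x)
    (hadd : ∀ a b, p a → p b → p (a + b)) {x : C} (hx : x ∈ D.alg) : p x := by
  rw [← Subalgebra.mem_toSubmodule, toSubmodule_alg] at hx
  exact Submodule.iSup_induction _ (motive := p) hx hpow (hpow 0 0 (zero_mem _)) hadd

theorem alg_le_coinvariants {x : C} (hx : x ∈ D.alg) : x ∈ E.coinvariants :=
  (Algebra.adjoin_le D.mem_coinvariants : D.alg ≤ E.coinvariants) hx

theorem act_mem_alg (g : G) {x : C} (hx : x ∈ D.alg) : E.yd.act (gr k g) x ∈ D.alg :=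
  D.alg_induction (p := fun x => E.yd.act (gr k g) x ∈ D.alg)
    (fun n _ hx => D.pow_le_alg n (D.pow_act_mem n g hx))
    (fun a b ha hb => by rw [map_add]; exact add_mem ha hb) hx

theorem P_mem_alg (g : G) {x : C} (hx : x ∈ D.alg) : E.yd.P g x ∈ D.alg :=
  D.alg_induction (p := fun x => E.yd.P g x ∈ D.alg)
    (fun n _ hx => D.pow_le_alg n (D.pow_P_mem n g hx))
    (fun a b ha hb => by rw [map_add]; exact add_mem ha hb) hx

theorem mem_V_of_primitive {x : C} (hx : x ∈ D.alg) (h : E.bcomul x = x ⊗ₜ 1 + 1 ⊗ₜ x) :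
    x ∈ D.V := by
  rw [← D.deg_one x (D.alg_le_coinvariants hx) h]
  refine D.alg_induction (p := fun x => D.deg 1 x ∈ D.V) (fun n x hx => ?_)
    (fun a b ha hb => by rw [map_add]; exact add_mem ha hb) hx
  rw [D.deg_pow n 1 x hx]
  split_ifs with hn
  · rw [hn, pow_one] at hx; exact hx
  · exact zero_mem _

/-- The algebra generated by the space of primitive elements. -/
def Alg : Type _ := D.alg

instance : Ring D.Alg := inferInstanceAs (Ring D.alg)
instance : Algebra k D.Alg := inferInstanceAs (Algebra k D.alg)

/-- The inclusion. -/
def val : D.Alg →ₐ[k] C := D.alg.val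

theorem val_injective : Function.Injective D.val := Subtype.val_injective

theorem val_mem (x : D.Alg) : D.val x ∈ D.alg := x.2

/-- A linear retraction of the inclusion. -/
def retr : C →ₗ[k] D.Alg :=
  (LinearMap.exists_leftInverse_of_injective D.val.toLinearMap
    (LinearMap.ker_eq_bot.2 D.val_injective)).choose

theorem val_retr {x : C} (hx : x ∈ D.alg) : D.val (D.retr x) = x := by
  have h := LinearMap.congr_fun (LinearMap.exists_leftInverse_of_injective D.val.toLinearMap
    (LinearMap.ker_eq_bot.2 D.val_injective)).choose_spec (⟨x, hx⟩ : D.alg)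
  exact congrArg D.val h

/-- The inclusion on tensor squares. -/
def val₂ : D.Alg ⊗[k] D.Alg →ₗ[k] C ⊗[k] C :=
  TensorProduct.map D.val.toLinearMap D.val.toLinearMap

@[simp] theorem val₂_tmul (a b : D.Alg) : D.val₂ (a ⊗ₜ b) = D.val a ⊗ₜ D.val b := rfl

theorem val₂_injective : Function.Injective D.val₂ :=
  TensorProduct.map_injective_of_flat_flat _ _ D.val_injective D.val_injective

theorem lTensor_val_injective (W : Type*) [AddCommGroup W] [Module k W] :
    Function.Injective (D.val.toLinearMap.lTensor W) :=
  Module.Flat.lTensor_preserves_injective_linearMap _ D.val_injective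

theorem rTensor_val_injective (W : Type*) [AddCommGroup W] [Module k W] :
    Function.Injective (D.val.toLinearMap.rTensor W) :=
  Module.Flat.rTensor_preserves_injective_linearMap _ D.val_injective

/-- The comultiplication. -/
def comulAlg : D.Alg →ₗ[k] D.Alg ⊗[k] D.Alg :=
  TensorProduct.map D.retr D.retr ∘ₗ E.bcomul ∘ₗ D.val.toLinearMap

theorem comulAlg_mem {n : ℕ} {x : D.Alg} (hx : D.val x ∈ D.V ^ n) :
    D.comulAlg x ∈ ⨆ p ∈ Finset.HasAntidiagonal.antidiagonal n,
      tens ((D.V ^ p.1).comap D.val.toLinearMap) ((D.V ^ p.2).comap D.val.toLinearMap) := by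
  refine mem_antidiagonal_tens_induction (𝒜 := fun n => D.V ^ n) (p := fun z =>
    TensorProduct.map D.retr D.retr z ∈ ⨆ p ∈ Finset.HasAntidiagonal.antidiagonal n,
      tens ((D.V ^ p.1).comap D.val.toLinearMap) ((D.V ^ p.2).comap D.val.toLinearMap)) (by simp)
    (fun a b ha hb => by rw [map_add]; exact add_mem ha hb)
    (fun i j hij a ha b hb => ?_) (D.bcomul_pow n hx)
  refine Submodule.mem_iSup_of_mem (i, j) (Submodule.mem_iSup_of_mem
    (Finset.HasAntidiagonal.mem_antidiagonal.2 hij) (tmul_mem_tens ?_ ?_))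
  · rw [Submodule.mem_comap, AlgHom.toLinearMap_apply, D.val_retr (D.pow_le_alg i ha)]; exact ha
  · rw [Submodule.mem_comap, AlgHom.toLinearMap_apply, D.val_retr (D.pow_le_alg j hb)]; exact hb

theorem val₂_comulAlg (x : D.Alg) : D.val₂ (D.comulAlg x) = E.bcomul (D.val x) := by
  refine D.alg_induction (p := fun y => D.val₂ (TensorProduct.map D.retr D.retr (E.bcomul y)) =
    E.bcomul y) (fun n y hy => ?_) (fun a b ha hb => by simp only [map_add, ha, hb]) (D.val_mem x)
  refine mem_antidiagonal_tens_induction (𝒜 := fun n => D.V ^ n) (p := fun z =>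
    D.val₂ (TensorProduct.map D.retr D.retr z) = z) (by simp)
    (fun a b ha hb => by simp only [map_add, ha, hb]) (fun i j hij a ha b hb => ?_)
    (D.bcomul_pow n hy)
  rw [TensorProduct.map_tmul, val₂_tmul, D.val_retr (D.pow_le_alg i ha),
    D.val_retr (D.pow_le_alg j hb)]

instance : Coalgebra k D.Alg where
  comul := D.comulAlg
  counit := Coalgebra.counit ∘ₗ D.val.toLinearMap
  coassoc := by
    apply LinearMap.ext
    intro x
    have inj : Function.Injective (TensorProduct.map D.val.toLinearMap D.val₂) :=
      TensorProduct.map_injective_of_flat_flat _ _ D.val_injective D.val₂_injective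
    apply inj
    have e1 : ∀ t : D.Alg ⊗[k] D.Alg, TensorProduct.map D.val.toLinearMap D.val₂
        (D.comulAlg.lTensor _ t) = E.bcomul.lTensor C (D.val₂ t) := fun t => by
      induction t using TensorProduct.induction_on with
      | zero => simp
      | tmul a b => simp [val₂_comulAlg]
      | add x y hx hy => simp only [map_add, hx, hy]
    have e2 : ∀ t : D.Alg ⊗[k] D.Alg, TensorProduct.map D.val.toLinearMap D.val₂
        (TensorProduct.assoc k _ _ _ (D.comulAlg.rTensor _ t)) =
        TensorProduct.assoc k C C C (E.bcomul.rTensor C (D.val₂ t)) := fun t => by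
      rw [val₂, TensorProduct.map_map_assoc]
      congr 1
      induction t using TensorProduct.induction_on with
      | zero => simp
      | tmul a b =>
        rw [LinearMap.rTensor_tmul, TensorProduct.map_tmul, TensorProduct.map_tmul,
          LinearMap.rTensor_tmul]
        exact congrArg (· ⊗ₜ[k] D.val b) (D.val₂_comulAlg a)
      | add x y hx hy => simp only [map_add, hx, hy]
    simp only [LinearMap.comp_apply, LinearEquiv.coe_coe]
    rw [e2, e1, val₂_comulAlg, E.bcomul_coassoc]
  rTensor_counit_comp_comul := by
    apply LinearMap.ext
    intro x
    apply D.lTensor_val_injective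
    simp only [LinearMap.comp_apply, LinearMap.rTensor_comp_apply]
    rw [← lr_comm, ← LinearMap.comp_apply (LinearMap.lTensor C _), LinearMap.lTensor_comp_rTensor]
    refine (congrArg _ (D.val₂_comulAlg x)).trans ?_
    rw [E.counit_bcomul]
    rfl
  lTensor_counit_comp_comul := by
    apply LinearMap.ext
    intro x
    apply D.rTensor_val_injective
    simp only [LinearMap.comp_apply, LinearMap.lTensor_comp_apply]
    rw [lr_comm, ← LinearMap.comp_apply (LinearMap.rTensor C _), LinearMap.rTensor_comp_lTensor]
    refine (congrArg _ (D.val₂_comulAlg x)).trans ?_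
    rw [E.bcomul_counit (D.alg_le_coinvariants (D.val_mem x))]
    rfl

theorem val₂_comul (x : D.Alg) :
    D.val₂ (Coalgebra.comul (R := k) x) = E.bcomul (D.val x) := D.val₂_comulAlg x

theorem counit_def (x : D.Alg) :
    Coalgebra.counit (R := k) x = Coalgebra.counit (R := k) (D.val x) := rfl

/-- The Yetter-Drinfeld module structure. -/
def yd : YDModule k G D.Alg :=
  E.yd.sub (Subalgebra.toSubmodule D.alg) (fun g _ => D.act_mem_alg g) (fun g _ => D.P_mem_alg g)

theorem val_act (g : G) (x : D.Alg) : D.val (D.yd.act (gr k g) x) = E.yd.act (gr k g) (D.val x) :=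
  YDModule.sub_act ..

theorem val_P (g : G) (x : D.Alg) : D.val (D.yd.P g x) = E.yd.P g (D.val x) :=
  YDModule.sub_P ..

theorem lTensor_val_coact (x : D.Alg) :
    D.val.toLinearMap.lTensor _ (D.yd.coact x) = E.yd.coact (D.val x) :=
  ext_cfL fun g => by rw [cfL_lTensor]; exact D.val_P g x

theorem lTensor_val₂_coact₂ (z : D.Alg ⊗[k] D.Alg) :
    D.val₂.lTensor _ (D.yd.coact₂ z) = E.yd.coact₂ (D.val₂ z) := by
  induction z using TensorProduct.induction_on with
  | zero => simp
  | add x y hx hy => simp only [map_add, hx, hy]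
  | tmul a b =>
    simp only [val₂_tmul, YDModule.coact₂_tmul, map_sum, LinearMap.lTensor_tmul, val_P]

/-- The component of degree `n`. -/
def grade (n : ℕ) : Submodule k D.Alg := (D.V ^ n).comap D.val.toLinearMap

theorem mem_grade {n : ℕ} {x : D.Alg} : x ∈ D.grade n ↔ D.val x ∈ D.V ^ n := Iff.rfl

theorem iSup_grade : ⨆ n, D.grade n = ⊤ := by
  refine eq_top_iff.2 fun x _ => ?_
  have h : ∃ y ∈ ⨆ n, D.grade n, D.val y = D.val x := by
    refine D.alg_induction (p := fun z => ∃ y ∈ ⨆ n, D.grade n, D.val y = z) (fun n z hz => ?_)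
      (fun a b => ?_) (D.val_mem x)
    · have e := D.val_retr (D.pow_le_alg n hz)
      exact ⟨D.retr z, Submodule.mem_iSup_of_mem n (by rw [mem_grade, e]; exact hz), e⟩
    · rintro ⟨y, hy, rfl⟩ ⟨z, hz, rfl⟩
      exact ⟨y + z, add_mem hy hz, map_add _ _ _⟩
  obtain ⟨y, hy, e⟩ := h
  rwa [← D.val_injective e]

theorem isInternal : DirectSum.IsInternal D.grade :=
  isInternal_of_projections D.val.toLinearMap D.val_injective
    (fun n => D.deg n ∘ₗ D.val.toLinearMap) (fun m n _ hx => D.deg_pow m n _ hx) D.iSup_grade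

theorem grade_zero : D.grade 0 = Submodule.span k {1} := by
  ext x
  rw [mem_grade, pow_zero, Submodule.mem_one, Submodule.mem_span_singleton]
  refine exists_congr fun c => ⟨fun h => D.val_injective ?_, ?_⟩
  · rw [map_smul, map_one, ← h, Algebra.algebraMap_eq_smul_one]
  · rintro rfl
    rw [map_smul, map_one, Algebra.algebraMap_eq_smul_one]

theorem act_mem_grade (n : ℕ) (h : MonoidAlgebra k G) {a : D.Alg} (ha : a ∈ D.grade n) :
    D.yd.act h a ∈ D.grade n :=
  gr_induction (P := fun h => D.yd.act h a ∈ D.grade n) (by simp)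
    (fun x y hx hy => by rw [map_add, LinearMap.add_apply]; exact add_mem hx hy)
    (fun c x hx => by rw [map_smul, LinearMap.smul_apply]; exact Submodule.smul_mem _ c hx)
    (fun g => by rw [mem_grade, val_act]; exact D.pow_act_mem n g ha) h

/-- The graded braided Hopf algebra generated by a space of primitive elements. -/
def braidedHopf : GradedBraidedHopf k G D.Alg where
  yd := D.yd
  act_mul g a b := D.val_injective (by simp only [val_act, map_mul, E.act_mul])
  act_one g := D.val_injective (by simp only [val_act, map_one, E.act_one])
  coact_mul a b := by
    apply D.lTensor_val_injective
    have h := map_mul (Algebra.TensorProduct.map (AlgHom.id k (MonoidAlgebra k G)) D.val)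
      (D.yd.coact a) (D.yd.coact b)
    refine Eq.trans ?_ h.symm
    refine Eq.trans ?_ (congrArg₂ (· * ·) (D.lTensor_val_coact a) (D.lTensor_val_coact b)).symm
    rw [lTensor_val_coact, map_mul, yd_coact, map_mul]
    rfl
  coact_one := by
    apply D.lTensor_val_injective
    rw [lTensor_val_coact, map_one, yd_coact, map_one]
    exact (map_one (Algebra.TensorProduct.map (AlgHom.id k (MonoidAlgebra k G)) D.val)).symm
  comul_act g a := by
    apply D.val₂_injective
    rw [val₂_comul, val_act, E.bcomul_act, ← val₂_comul]
    generalize Coalgebra.comul (R := k) a = z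
    induction z using TensorProduct.induction_on with
    | zero => simp
    | add x y hx hy => simp only [map_add, hx, hy]
    | tmul a b => simp only [TensorProduct.map_tmul, val₂_tmul, val_act]
  counit_act g a := by rw [counit_def, val_act, E.counit_act, counit_def]
  comul_coact a := by
    apply Module.Flat.lTensor_preserves_injective_linearMap (M := MonoidAlgebra k G) D.val₂
      D.val₂_injective
    have e : D.val₂ ∘ₗ Coalgebra.comul (R := k) (A := D.Alg) = E.bcomul ∘ₗ D.val.toLinearMap :=
      LinearMap.ext D.val₂_comul
    rw [lTensor_val₂_coact₂, val₂_comul, ← E.bcomul_coact, ← LinearMap.lTensor_comp_apply, e,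
      LinearMap.lTensor_comp_apply, lTensor_val_coact]
  counit_coact a := by
    have e : Coalgebra.counit (R := k) (A := D.Alg) = Coalgebra.counit ∘ₗ D.val.toLinearMap := rfl
    rw [e, LinearMap.lTensor_comp_apply, lTensor_val_coact,
      E.counit_coact (D.alg_le_coinvariants (D.val_mem a))]
    rfl
  comul_mul a b := by
    apply D.val₂_injective
    rw [val₂_comul, map_mul, E.bcomul_mul, ← val₂_comul, ← val₂_comul]
    exact (map_braidedMul (f := MulEquiv.refl G) D.val D.val_act D.val_P _ _).symm
  comul_one := by
    apply D.val₂_injective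
    rw [val₂_comul, map_one, E.bcomul_one, Algebra.TensorProduct.one_def,
      Algebra.TensorProduct.one_def, val₂_tmul, map_one]
  counit_mul a b := by rw [counit_def, map_mul, Bialgebra.counit_mul]; rfl
  counit_one := by rw [counit_def, map_one, Bialgebra.counit_one]
  exists_antipode := exists_antipode_of_connected D.isInternal D.grade_zero
    (by rw [counit_def, map_one, Bialgebra.counit_one]) fun _ _ h => D.comulAlg_mem h
  grade := D.grade
  isInternal := D.isInternal
  one_mem := by rw [grade_zero]; exact Submodule.mem_span_singleton_self 1
  mul_mem i j a ha b hb := by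
    rw [mem_grade] at *
    rw [map_mul, pow_add]
    exact Submodule.mul_mem_mul ha hb
  comul_mem n a ha := D.comulAlg_mem ha
  counit_eq_zero n hn a ha := D.counit_pow hn ha
  act_mem n h a ha := D.act_mem_grade n h ha
  coact_mem n a ha := by
    rw [D.yd.coact_eq]
    refine sum_mem fun g _ => tmul_mem_tens Submodule.mem_top ?_
    rw [mem_grade, val_P]
    exact D.pow_P_mem n g ha

theorem mem_grade_one {x : D.Alg} : x ∈ D.grade 1 ↔ D.val x ∈ D.V := by rw [mem_grade, pow_one]

theorem isNichols : D.braidedHopf.IsNichols := by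
  refine ⟨D.grade_zero, fun a => ?_, ?_⟩
  · refine Iff.trans ?_ D.mem_grade_one.symm
    have e : D.val₂ (a ⊗ₜ 1 + 1 ⊗ₜ a) = D.val a ⊗ₜ 1 + 1 ⊗ₜ D.val a := by
      rw [map_add, val₂_tmul, val₂_tmul, map_one]
    rw [← D.val₂_injective.eq_iff, e, val₂_comul]
    exact ⟨D.mem_V_of_primitive (D.val_mem a), D.bcomul_eq _⟩
  · have e : (D.braidedHopf.grade 1 : Set D.Alg) = D.val ⁻¹' D.V := Set.ext fun _ => D.mem_grade_one
    rw [e]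
    exact Algebra.adjoin_adjoin_coe_preimage

theorem isNicholsOf {W : Type*} [AddCommGroup W] [Module k W] {Y : YDModule k G W}
    (j : W →ₗ[k] C) (hj : Function.Injective j) (hV : LinearMap.range j = D.V)
    (hact : ∀ g w, j (Y.act (gr k g) w) = E.yd.act (gr k g) (j w))
    (hP : ∀ g w, j (Y.P g w) = E.yd.P g (j w)) : D.braidedHopf.IsNicholsOf Y := by
  have hmem : ∀ w, j w ∈ D.V := fun w => hV ▸ LinearMap.mem_range_self j w
  have hval : ∀ w, D.val (D.retr (j w)) = j w := fun w =>
    D.val_retr (Algebra.subset_adjoin (hmem w))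
  let e : W →ₗ[k] D.braidedHopf.grade 1 := LinearMap.codRestrict _ (D.retr ∘ₗ j) fun w =>
    D.mem_grade_one.2 (by rw [LinearMap.comp_apply, hval]; exact hmem w)
  have he : ∀ w, D.val (e w) = j w := hval
  refine GradedBraidedHopf.isNicholsOf_iff.2 ⟨D.isNichols, LinearEquiv.ofBijective e
    ⟨fun w w' h => hj ?_, fun x => ?_⟩, fun g w => Subtype.ext (D.val_injective ?_),
    fun g w => Subtype.ext (D.val_injective ?_)⟩
  · rw [← he, ← he, h]
  · have hx := D.mem_grade_one.1 x.2
    rw [← hV] at hx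
    obtain ⟨w, hw⟩ := hx
    exact ⟨w, Subtype.ext (D.val_injective ((he w).trans hw))⟩
  · exact (he _).trans ((hact g w).trans ((congrArg _ (he w).symm).trans
      ((D.val_act g _).symm.trans (congrArg D.val (YDModule.sub_act ..).symm))))
  · exact (he _).trans ((hP g w).trans ((congrArg _ (he w).symm).trans
      ((D.val_P g _).symm.trans (congrArg D.val (YDModule.sub_P ..).symm))))

end PrimitiveSpace
end GroupProjection

namespace Amb
variable {k G M : Type*} [Field k] [Group G] [Fintype G] [DecidableEq G] [AddCommGroup M]
  [Module k M] (B : HopfBimodule k (MonoidAlgebra k G) M)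

/-- The projection of `Amb B` onto the group algebra. -/
def groupProjection : GroupProjection k G (Amb B) where
  i := incAlg B
  π := AlgHom.ofLinearMap (pr0 B) (pr0_inc 1) fun a b => pr0_mul a b
  comul_i g := by
    refine (comul_inc (B := B) (gr k g)).trans ?_
    rw [comul_gr]; rfl
  comul_π x := by
    refine (pr0_lco x).symm.trans ?_
    rw [← pr0_comul, ← LinearMap.comp_apply, LinearMap.lTensor_comp_rTensor]
    rfl
  counit_π x := rfl
  π_i g := pr0_inc _

theorem groupProjection_P (g : G) (x : Amb B) :
    (groupProjection B).yd.P g x = cfL g (lco B x) := by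
  rw [← pr0_comul]; rfl

theorem groupProjection_u (g : G) : (groupProjection B).u g = inc B (gr k g) := rfl

theorem P_incM (g : G) (m : M) : (groupProjection B).yd.P g (incM B m) = incM B (B.PL g m) := by
  rw [groupProjection_P, lco_incM, cfL_lTensor]; rfl

theorem act_incM (g : G) (m : M) : (groupProjection B).yd.act (gr k g) (incM B m) =
    incM B (B.actL (gr k g) (B.actR (gr k g⁻¹) m)) := by
  rw [GroupProjection.yd_act, incM_actL, incM_actR, mul_assoc]; rfl

variable {B} in
theorem coactR_of_mem_coinv {m : M} (hm : m ∈ B.coinv) : B.coactR m = m ⊗ₜ 1 :=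
  ext_cfR fun g => by
    rw [HopfBimodule.mem_coinv] at hm
    change B.PR g m = _
    rw [← hm, B.PR_PR, hm, ← gr_one, cfR_tmul]

theorem comul_incM_of_mem_coinv {m : M} (hm : m ∈ B.coinv) :
    Coalgebra.comul (R := k) (incM B m) =
      ∑ g, (groupProjection B).u g ⊗ₜ incM B (B.PL g m) + incM B m ⊗ₜ 1 := by
  refine (comul_incM m).trans ?_
  rw [coactR_of_mem_coinv hm, eq_sum_cfL (B.coactL m), map_sum]
  rfl

theorem incM_mem_coinvariants {m : M} (hm : m ∈ B.coinv) :
    incM B m ∈ (groupProjection B).coinvariants := by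
  rw [GroupProjection.mem_coinvariants, comul_incM_of_mem_coinv B hm, map_add, map_sum]
  have h : ∀ m, (groupProjection B).π.toLinearMap (incM B m) = 0 := pr0_incM
  simp only [LinearMap.lTensor_tmul, h, TensorProduct.tmul_zero, Finset.sum_const_zero, zero_add]
  rw [AlgHom.toLinearMap_apply, map_one]

theorem bcomul_incM {m : M} (hm : m ∈ B.coinv) :
    (groupProjection B).bcomul (incM B m) = incM B m ⊗ₜ 1 + 1 ⊗ₜ incM B m := by
  rw [GroupProjection.bcomul_apply, comul_incM_of_mem_coinv B hm, map_add,
    GroupProjection.twist_tmul_one, add_comm, map_sum]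
  congr 1
  have h : ∀ g, (groupProjection B).twist ((groupProjection B).u g ⊗ₜ incM B (B.PL g m)) =
      1 ⊗ₜ incM B (B.PL g m) := fun g => by
    rw [GroupProjection.twist_tmul, Finset.sum_eq_single g]
    · rw [GroupProjection.u_mul_inv, P_incM, B.PL_PL, if_pos rfl]
    · intro h _ hh
      rw [P_incM, B.PL_PL, if_neg (Ne.symm hh), map_zero, TensorProduct.tmul_zero]
    · simp
  rw [Finset.sum_congr rfl fun g _ => h g, ← TensorProduct.tmul_sum, ← map_sum, B.sum_PL]

/-- The projection onto `M^{⊗n} ⊗ H`. -/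
def deg : ℕ → (Amb B →ₗ[k] Amb B)
  | 0 => inc B ∘ₗ pr0 B
  | n + 1 => join B ∘ₗ (deg n).lTensor M ∘ₗ tail B

theorem deg_cot (m n : ℕ) (x : Amb B) (hx : x ∈ cot B m) :
    deg B n x = if m = n then x else 0 := by
  induction n generalizing m x with
  | zero =>
    cases m with
    | zero => obtain ⟨h, rfl⟩ := hx; simp [deg]
    | succ m => obtain ⟨z, -, rfl⟩ := hx; simp [deg]
  | succ n ih =>
    cases m with
    | zero => obtain ⟨h, rfl⟩ := hx; simp [deg]
    | succ m =>
      obtain ⟨z, ⟨hz, -⟩, rfl⟩ := hx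
      have h : (deg B n).lTensor M z = if m = n then z else 0 := by
        refine tens_induction (P := fun z => (deg B n).lTensor M z = if m = n then z else 0)
          (by simp) (fun a b ha hb => by rw [map_add, ha, hb]; split_ifs <;> simp)
          (fun v _ x hx => ?_) hz
        rw [LinearMap.lTensor_tmul, ih m x hx]
        split_ifs <;> simp
      rw [deg, LinearMap.comp_apply, LinearMap.comp_apply, tail_join, h]
      simp only [Nat.add_right_cancel_iff]
      split_ifs <;> simp

theorem deg_one_of_primitive {x : Amb B} (hx : x ∈ (groupProjection B).coinvariants)
    (h : (groupProjection B).bcomul x = x ⊗ₜ 1 + 1 ⊗ₜ x) : deg B 1 x = x := by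
  have h0 : pr0 B x = 0 := by
    refine ((groupProjection B).π_of_mem_coinvariants hx).trans ?_
    rw [(groupProjection B).counit_of_primitive h, map_zero]
  have h1 : (comul B).lTensor M (tail B x) =
      TensorProduct.assoc k M (Amb B) (Amb B) (tail B x ⊗ₜ 1) := by
    rw [← LinearEquiv.symm_apply_eq, ← tail_comul]
    refine (congrArg _ ((groupProjection B).comul_of_primitive h)).trans ?_
    rw [map_add, map_sum]
    simp only [LinearMap.rTensor_tmul, groupProjection_u, tail_inc, TensorProduct.zero_tmul,
      Finset.sum_const_zero, add_zero]
  let K : M ⊗[k] (Amb B ⊗[k] Amb B) →ₗ[k] M ⊗[k] Amb B :=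
    ((TensorProduct.lid k (Amb B)).toLinearMap ∘ₗ (counit B).rTensor (Amb B)).lTensor M
  have hK : ∀ w, K ((comul B).lTensor M w) = w := fun w => by
    have e : ((TensorProduct.lid k (Amb B)).toLinearMap ∘ₗ (counit B).rTensor (Amb B)) ∘ₗ comul B =
        LinearMap.id := LinearMap.ext fun y => by simp [counit_left]
    rw [← LinearMap.lTensor_comp_apply, e, LinearMap.lTensor_id, LinearMap.id_apply]
  have hK' : ∀ w, (deg B 0).lTensor M (K (TensorProduct.assoc k M (Amb B) (Amb B) (w ⊗ₜ 1))) =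
      K (TensorProduct.assoc k M (Amb B) (Amb B) (w ⊗ₜ 1)) := fun w => by
    induction w using TensorProduct.induction_on with
    | zero => simp
    | add x y hx hy => simp only [TensorProduct.add_tmul, map_add, hx, hy]
    | tmul m y => simp [K, deg, one_def]
  have h2 : (deg B 0).lTensor M (tail B x) = tail B x := by
    rw [← hK (tail B x), h1, hK']
  rw [deg, LinearMap.comp_apply, LinearMap.comp_apply, h2]
  have := decomp x
  rwa [h0, map_zero, zero_add] at this

/-- The space of coinvariants of degree `1`. -/
def primitiveSpace : (groupProjection B).PrimitiveSpace where
  V := B.coinv.map (incM B)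
  act_mem := by
    rintro g _ ⟨m, hm, rfl⟩
    rw [act_incM]
    exact ⟨_, by rw [← B.yd_act g ⟨m, hm⟩]; exact Subtype.property _, rfl⟩
  P_mem := by
    rintro g _ ⟨m, hm, rfl⟩
    rw [P_incM]
    exact ⟨_, by rw [← B.yd_P g ⟨m, hm⟩]; exact Subtype.property _, rfl⟩
  mem_coinvariants := by
    rintro _ ⟨m, hm, rfl⟩
    exact incM_mem_coinvariants B hm
  bcomul_eq := by
    rintro _ ⟨m, hm, rfl⟩
    exact bcomul_incM B hm
  deg := deg B
  deg_pow m n x hx := by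
    refine deg_cot B m n x ?_
    clear n
    induction m generalizing x with
    | zero =>
      rw [pow_zero, Submodule.mem_one] at hx
      obtain ⟨c, rfl⟩ := hx
      exact ⟨c • 1, by rw [map_smul, ← one_def, Algebra.algebraMap_eq_smul_one]⟩
    | succ m ih =>
      rw [pow_succ] at hx
      refine Submodule.mul_induction_on hx (fun a ha v hv => ?_) fun a b ha hb => add_mem ha hb
      refine mul_cot (m + 1) m 1 rfl a (ih a ha) v ?_
      obtain ⟨w, -, rfl⟩ := hv
      rw [cot_one]
      exact ⟨w, rfl⟩
  deg_one x hx h := deg_one_of_primitive B hx h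

theorem isNicholsOf_yd : (primitiveSpace B).braidedHopf.IsNicholsOf B.yd :=
  (primitiveSpace B).isNicholsOf (incM B ∘ₗ B.coinv.subtype)
    (incM_injective.comp Subtype.val_injective)
    (by rw [LinearMap.range_comp, Submodule.range_subtype]; rfl)
    (fun g w => by
      rw [LinearMap.comp_apply, LinearMap.comp_apply, Submodule.subtype_apply, B.yd_act, act_incM]
      rfl)
    (fun g w => by
      rw [LinearMap.comp_apply, LinearMap.comp_apply, Submodule.subtype_apply, B.yd_P, P_incM]
      rfl)

end Amb

namespace RSR
variable {k : Type u} {G : Type v} [Field k] [Group G] [Fintype G] [DecidableEq G]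

theorem exists_isNicholsOf {S : RSR.{u, v, w} k G} (T : S.CosetReps) :
    ∃ (R : Type (max u v w)) (_ : Ring R) (_ : Algebra k R) (_ : Coalgebra k R)
      (A : GradedBraidedHopf k G R), A.IsNicholsOf (RSR.ydModule T) := by
  refine ⟨(Amb.primitiveSpace (hopfBimodule T)).Alg, inferInstance, inferInstance, inferInstance,
    (Amb.primitiveSpace (hopfBimodule T)).braidedHopf, ?_⟩
  obtain ⟨h, h'⟩ := GradedBraidedHopf.isNicholsOf_iff.1 (Amb.isNicholsOf_yd (hopfBimodule T))
  exact GradedBraidedHopf.isNicholsOf_iff.2 ⟨h, (ydModule_isoAlong T).trans h'⟩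

end RSR

namespace RSR
variable {k : Type u} {G : Type v} [Field k] [Group G] [Fintype G] [DecidableEq G]

theorem exists_iso_of_isNichols (hG : (Fintype.card G : k) ≠ 0) {R : Type w} [Ring R]
    [Algebra k R] [Coalgebra k R] {A : GradedBraidedHopf k G R} (hA : A.IsNichols) :
    ∃ S : RSR.{u, v, w} k G, ∀ (T : S.CosetReps)
      (R' : Type x) [Ring R'] [Algebra k R'] [Coalgebra k R'] (A' : GradedBraidedHopf k G R'),
      A'.IsNicholsOf (RSR.ydModule T) → A.Iso A' := by
  obtain ⟨S, hS⟩ := exists_iso_ydModule hG A.gradeOne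
  refine ⟨S, fun T R' _ _ _ A' hA' => ?_⟩
  have h : A.IsNicholsOf A.gradeOne := GradedBraidedHopf.isNicholsOf_iff.2
    ⟨hA, LinearEquiv.refl k _, fun _ _ => rfl, fun _ _ => rfl⟩
  exact (h.isoOver_iff hA').2 (hS T)

theorem exists_isoOver_dual (hG : (Fintype.card G : k) ≠ 0) {X : Type w} [Finite X]
    {Q : HopfQuiver G X} {D : HopfBimodule k (FunAlg k G) (X →₀ k)} (hD : Q.IsArrowModule D) :
    ∃ S : RSR.{u, v, max u w} k G, S.IsFinite ∧ ∀ T : S.CosetReps,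
      ∃ ψ, HopfBimodule.IsoOver ψ D (hopfBimodule T).dual := by
  obtain ⟨S, hS⟩ := exists_iso_hopfBimodule hG (HopfQuiver.predual hD).hopfBimodule
  have hS' : S.IsFinite := by
    obtain ⟨e, -⟩ := hS S.nonempty_cosetReps.some
    exact isFinite_of_equiv e
  refine ⟨S, hS', fun T => HopfBimodule.exists_isoOver_iff_funIsoAlong.2
    ⟨_, (HopfQuiver.funIsoAlong_predual hD).trans (HopfBimodule.iso_iff_isoAlong.1 (hS T)).dual⟩⟩

end RSR

end RSRQuiver
end

theorem theorem1 (k : Type u) [Field k] (G : Type v) [Group G] [Fintype G]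
    [DecidableEq G] (hG : (Fintype.card G : k) ≠ 0) :
    -- existence for Yetter-Drinfeld modules
    (∀ (N : Type w) [AddCommGroup N] [Module k N] (Y : YDModule k G N),
      ∃ S : RSR.{u, v, w} k G, ∀ T : S.CosetReps, Y.Iso (RSR.ydModule T)) ∧
    -- existence for Hopf bimodules
    (∀ (M : Type w) [AddCommGroup M] [Module k M]
      (B : HopfBimodule k (MonoidAlgebra k G) M),
      ∃ S : RSR.{u, v, w} k G, ∀ T : S.CosetReps,
        B.Iso (RSR.hopfBimodule T)) ∧
    -- the Nichols algebra of each `(kQ₁¹, ad)` exists, and existence for Nichols algebras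
    (∀ (S : RSR.{u, v, w} k G) (T : S.CosetReps),
      ∃ (R : Type (max u v w)) (_ : Ring R) (_ : Algebra k R) (_ : Coalgebra k R)
        (A : GradedBraidedHopf k G R), A.IsNicholsOf (RSR.ydModule T)) ∧
    (∀ (R : Type w) [Ring R] [Algebra k R] [Coalgebra k R]
      (A : GradedBraidedHopf k G R), A.IsNichols →
      ∃ S : RSR.{u, v, w} k G, ∀ (T : S.CosetReps)
        (R' : Type x) [Ring R'] [Algebra k R'] [Coalgebra k R']
        (A' : GradedBraidedHopf k G R'),
        A'.IsNicholsOf (RSR.ydModule T) → A.Iso A') ∧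
    -- existence for pointed Hopf algebras of type one
    (∀ (M : Type w) [AddCommGroup M] [Module k M]
      (B : HopfBimodule k (MonoidAlgebra k G) M),
      ∃ S : RSR.{u, v, w} k G, ∀ T : S.CosetReps,
        GradedIso (TypeOneAlg.grade B)
          (TypeOneAlg.grade (RSR.hopfBimodule T))) ∧
    -- existence for the quiver Hopf algebras with vertex algebra `kG`
    (∀ (X : Type w) (Q : HopfQuiver G X)
      (B : HopfBimodule k (MonoidAlgebra k G) (X →₀ k)), Q.IsArrowComodule B →
      ∃ S : RSR.{u, v, max u w} k G, ∀ T : S.CosetReps,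
        GradedIso (CotensorAlg.grade B)
          (CotensorAlg.grade (RSR.hopfBimodule T)) ∧
        GradedIso (TensorAlg.grade B)
          (TensorAlg.grade (RSR.hopfBimodule T)) ∧
        GradedIso (TypeOneAlg.grade B)
          (TypeOneAlg.grade (RSR.hopfBimodule T))) ∧
    -- existence for the quiver Hopf algebras with vertex algebra `(kG)*`
    (∀ (X : Type w) [Finite X] (Q : HopfQuiver G X)
      (B : HopfBimodule k (FunAlg k G) (X →₀ k)), Q.IsArrowModule B →
      ∃ S : RSR.{u, v, max u w} k G, S.IsFinite ∧ ∀ T : S.CosetReps,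
        GradedIso (TensorAlg.grade B)
          (TensorAlg.grade (RSR.hopfBimodule T).dual) ∧
        GradedIso (CotensorAlg.grade B)
          (CotensorAlg.grade (RSR.hopfBimodule T).dual) ∧
        GradedIso (TypeOneAlg.grade B)
          (TypeOneAlg.grade (RSR.hopfBimodule T).dual)) ∧
    -- uniqueness
    (∀ (G' : Type v') [Group G'] [Fintype G'] [DecidableEq G'], (Fintype.card G' : k) ≠ 0 →
      ∀ (S : RSR.{u, v, w} k G) (S' : RSR.{u, v', w'} k G')
        (T : S.CosetReps) (T' : S'.CosetReps),
      (S.Iso S' ↔ ∃ φ : MonoidAlgebra k G ≃ₐc[k] MonoidAlgebra k G',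
        YDModule.IsoOver φ (RSR.ydModule T) (RSR.ydModule T')) ∧
      (S.Iso S' ↔ ∃ φ : MonoidAlgebra k G ≃ₐc[k] MonoidAlgebra k G',
        HopfBimodule.IsoOver φ (RSR.hopfBimodule T)
          (RSR.hopfBimodule T')) ∧
      (∀ (R : Type x) [Ring R] [Algebra k R] [Coalgebra k R]
        (A : GradedBraidedHopf k G R)
        (R' : Type y) [Ring R'] [Algebra k R'] [Coalgebra k R']
        (A' : GradedBraidedHopf k G' R'),
        A.IsNicholsOf (RSR.ydModule T) → A'.IsNicholsOf (RSR.ydModule T') →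
        (S.Iso S' ↔ ∃ φ : MonoidAlgebra k G ≃ₐc[k] MonoidAlgebra k G',
          GradedBraidedHopf.IsoOver φ A A')) ∧
      (S.Iso S' ↔ GradedIso
        (CotensorAlg.grade (RSR.hopfBimodule T))
        (CotensorAlg.grade (RSR.hopfBimodule T'))) ∧
      (S.Iso S' ↔ GradedIso
        (TensorAlg.grade (RSR.hopfBimodule T))
        (TensorAlg.grade (RSR.hopfBimodule T'))) ∧
      (S.Iso S' ↔ GradedIso
        (TypeOneAlg.grade (RSR.hopfBimodule T))
        (TypeOneAlg.grade (RSR.hopfBimodule T'))) ∧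
      (S.IsFinite → S'.IsFinite →
        (S.Iso S' ↔ GradedIso
          (TensorAlg.grade (RSR.hopfBimodule T).dual)
          (TensorAlg.grade (RSR.hopfBimodule T').dual)) ∧
        (S.Iso S' ↔ GradedIso
          (CotensorAlg.grade (RSR.hopfBimodule T).dual)
          (CotensorAlg.grade (RSR.hopfBimodule T').dual)) ∧
        (S.Iso S' ↔ GradedIso
          (TypeOneAlg.grade (RSR.hopfBimodule T).dual)
          (TypeOneAlg.grade (RSR.hopfBimodule T').dual)))) := by
  refine ⟨fun N _ _ Y => RSR.exists_iso_ydModule hG Y,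
    fun M _ _ B => RSR.exists_iso_hopfBimodule hG B,
    fun S T => RSR.exists_isNicholsOf T,
    fun R _ _ _ A hA => RSR.exists_iso_of_isNichols hG hA, fun M _ _ B => ?_,
    fun X Q B _ => ?_, fun X _ Q B hB => ?_, fun G' _ _ _ _ S S' T T' => ?_⟩
  · obtain ⟨S, hS⟩ := RSR.exists_iso_hopfBimodule hG B
    exact ⟨S, fun T => TypeOneAlg.gradedIso_of_isoOver (hS T)⟩
  · obtain ⟨S, hS⟩ := RSR.exists_iso_hopfBimodule hG B
    exact ⟨S, fun T => ⟨CotensorAlg.gradedIso_of_isoOver (hS T),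
      TensorAlg.gradedIso_of_isoOver (hS T), TypeOneAlg.gradedIso_of_isoOver (hS T)⟩⟩
  · obtain ⟨S, hS, h⟩ := RSR.exists_isoOver_dual hG hB
    refine ⟨S, hS, fun T => ?_⟩
    obtain ⟨ψ, hψ⟩ := h T
    exact ⟨TensorAlg.gradedIso_of_isoOver hψ, CotensorAlg.gradedIso_of_isoOver hψ,
      TypeOneAlg.gradedIso_of_isoOver hψ⟩
  · refine ⟨RSR.iso_iff_yd T T', RSR.iso_iff_hopfBimodule T T',
      fun R _ _ _ A R' _ _ _ A' h h' => ?_, ?_, ?_, ?_, fun hS hS' => ?_⟩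
    · rw [RSR.iso_iff_yd T T']
      exact exists_congr fun φ => (h.isoOver_iff h').symm
    · rw [CotensorAlg.gradedIso_iff, RSR.iso_iff_hopfBimodule T T']
    · rw [TensorAlg.gradedIso_iff, RSR.iso_iff_hopfBimodule T T']
    · rw [TypeOneAlg.gradedIso_iff, RSR.iso_iff_hopfBimodule T T']
    · have := hS.finite_arrow
      have := hS'.finite_arrow
      rw [TensorAlg.gradedIso_iff, CotensorAlg.gradedIso_iff, TypeOneAlg.gradedIso_iff,
        HopfBimodule.exists_isoOver_dual_iff, RSR.iso_iff_hopfBimodule T T']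
      exact ⟨Iff.rfl, Iff.rfl, Iff.rfl⟩
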